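/- Let $T>0$ and $\mathbb T^3=\mathbb R^3/\mathbb Z^3$. Let $(u,b)$ be a weak solution on $(0,T)\times\mathbb T^3$ of the inviscid Hall MHD equations $$u_t+u\cdot\nabla u-b\cdot\nabla b+\nabla\Pi=0,\qquad b_t+u\cdot\nabla b-b\cdot\nabla u+\nabla\times[(\nabla\times b)\times b]=0,\qquad \operatorname{div}u=\operatorname{div}b=0,$$ (that is: $u,b\in L^2_{loc}$, the current $j=\nabla\times b$ and $j\times b$ are in $L^1_{loc}$, and the equations hold in the sense of distributions, the first one tested against divergence-free fields), and let the vector potential $A$ and the pressure $\pi\in L^1_{loc}((0,T)\times\mathbb T^3)$ satisfy, in the sense of distributions, $$\nabla\times A=b,\qquad \operatorname{div}A=0,\qquad A_t-u\times b+(\nabla\times b)\times b+\nabla\pi=0 .$$ Assume $j\in L^\infty(0,T;L^{3/2}(\mathbb T^3))$, $u\in L^3(0,T;L^3(\mathbb T^3))$ and $A\in C((0,T)\times\mathbb T^3)$. Put $\delta b(\ell)=b(t,x+\ell)-b(t,x)$, let $\varphi(x)=C_0e^{-1/(1-|x|^2)}$ for $|x|<1$ and $\varphi(x)=0$ for $|x|\ge1$,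 where $C_0$ is such that $\int_{\mathbb R^3}\varphi=1$, and let $\varphi_\varepsilon(x)=\varepsilon^{-3}\varphi(x/\varepsilon)$. Let $\sigma$ be the surface measure on the unit sphere $\partial B\subset\mathbb R^3$. Define $$D_{mh}(b,\varepsilon)=-\tfrac12\int_{\mathbb R^3}\nabla\varphi_\varepsilon(\ell)\cdot\delta b(\ell)\,|\delta b(\ell)|^2\,d\ell,\qquad S(b,b,b;\lambda)=\frac1\lambda\int_{\partial B}\zeta\cdot\delta b(\lambda\zeta)\,|\delta b(\lambda\zeta)|^2\,\frac{d\sigma(\zeta)}{4\pi}.$$ For all $\varepsilon,\lambda>0$ these integrals converge absolutely for almost every $(t,x)$ and define functions in $L^1_{loc}((0,T)\times\mathbb T^3)$. Moreover: 1. $D_{mh}(b,\varepsilon)$ converges, in the sense of distributions on $(0,T)\times\mathbb T^3$ as $\varepsilon\to0^+$, to a distribution $D_{mh}(b)$. 2. $\operatorname{div}(b\otimes b)$ is a locally integrable vector field, and, in the sense of distributions, $$\partial_t(A\cdot b)+\operatorname{div}\big([\operatorname{div}(b\otimes b)]\times A\big)-\operatorname{div}\big((u\times b)\times A\big)+\operatorname{div}\big((\pi-\tfrac12|b|^2)\,b\big)+\operatorname{div}\big(b|b|^2\big)=D_{mh}(b),$$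 where $A\cdot b$ and all the fields under the outer divergences are locally integrable. 3. The limit $S(b,b,b)=-\lim_{\lambda\to0^+}S(b,b,b;\lambda)$ exists in the sense of distributions, and $$S(b,b,b)=-\tfrac23\,D_{mh}(b)=-\tfrac43\cdot\tfrac12D_{mh}(b).$$ That is, the four-thirds law holds for $\tfrac12D_{mh}(b)$, which is the dissipation term in the balance of $\tfrac12A\cdot b$. -/

import Mathlib

open MeasureTheory Set Filter Topology

noncomputable section

namespace HallMHD

open scoped ContDiff

/-- Euclidean three-space. -/
abbrev E3 : Type := EuclideanSpace ℝ (Fin 3)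

/-- The cross product on Euclidean three-space. -/
def cross (x y : E3) : E3 := WithLp.toLp 2 (crossProduct x.ofLp y.ofLp)

/-! ### Space-time domain

Functions on `(0,T) × 𝕋³`, where `𝕋³ = ℝ³/ℤ³`, are functions of `(t, x) : ℝ × E3` that are
`ℤ³`-periodic in `x`; their values for `t ∉ (0,T)` play no role. Integrals over `𝕋³` are
integrals over the unit cube. -/

/-- The `i`-th standard basis vector of `ℝ³`. -/
def basisVec (i : Fin 3) : E3 := EuclideanSpace.single i 1

/-- `ℤ³`-periodicity in the space variable. -/
def SpacePeriodic {F : Type*} (f : ℝ × E3 → F) : Prop :=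
  ∀ (t : ℝ) (x : E3) (i : Fin 3), f (t, x + basisVec i) = f (t, x)

/-- The unit cube, a fundamental domain of `𝕋³`. -/
def cube : Set E3 := {x | ∀ i, x i ∈ Ico (0 : ℝ) 1}

/-- `(0,T) × 𝕋³`. -/
def slab (T : ℝ) : Set (ℝ × E3) := Ioo 0 T ×ˢ cube

/-- `f ∈ L^p_loc((0,T) × 𝕋³)`: as `𝕋³` is compact, this is `f ∈ L^p([a,c] × 𝕋³)` for every
`[a,c] ⊂ (0,T)`. -/
def MemLpLoc {F : Type*} [NormedAddCommGroup F] (T : ℝ) (p : ENNReal) (f : ℝ × E3 → F) : Prop :=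
  ∀ a c : ℝ, 0 < a → c < T → MemLp f p (volume.restrict (Icc a c ×ˢ cube))

/-- `f ∈ L^p(0,T; L^q(𝕋³))`. -/
def MemLpLq {F : Type*} [NormedAddCommGroup F] (T : ℝ) (p q : ENNReal) (f : ℝ × E3 → F) : Prop :=
  AEStronglyMeasurable f (volume.restrict (slab T)) ∧
    eLpNorm (fun t : ℝ => eLpNorm (fun x : E3 => f (t, x)) q (volume.restrict cube)) p
      (volume.restrict (Ioo 0 T)) < ⊤

/-! ### Test functions and distributions on `(0,T) × 𝕋³` -/

/-- The `F`-valued test functions `C_c^∞((0,T) × 𝕋³; F)`. -/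
def testSpace (T : ℝ) (F : Type*) [NormedAddCommGroup F] [NormedSpace ℝ F] :
    Submodule ℝ (ℝ × E3 → F) where
  carrier := {ψ | ContDiff ℝ ∞ ψ ∧ SpacePeriodic ψ ∧
    ∃ a c : ℝ, 0 < a ∧ c < T ∧ ∀ (t : ℝ) (x : E3), t ∉ Icc a c → ψ (t, x) = 0}
  add_mem' := by
    rintro f g ⟨hf, pf, a, c, ha, hc, sf⟩ ⟨hg, pg, a', c', ha', hc', sg⟩
    refine ⟨hf.add hg, fun t x i => ?_, min a a', max c c', lt_min ha ha', max_lt hc hc',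
      fun t x ht => ?_⟩
    · simp only [Pi.add_apply, pf t x i, pg t x i]
    · have h1 : t ∉ Icc a c := fun h => ht ⟨(min_le_left _ _).trans h.1, h.2.trans (le_max_left _ _)⟩
      have h2 : t ∉ Icc a' c' :=
        fun h => ht ⟨(min_le_right _ _).trans h.1, h.2.trans (le_max_right _ _)⟩
      simp [sf t x h1, sg t x h2]
  zero_mem' := by
    refine ⟨contDiff_const, fun _ _ _ => rfl, 1, T - 1, one_pos, by linarith, fun _ _ _ => rfl⟩
  smul_mem' := by
    rintro k f ⟨hf, pf, a, c, ha, hc, sf⟩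
    refine ⟨contDiff_const.smul hf, fun t x i => ?_, a, c, ha, hc, fun t x ht => ?_⟩
    · simp only [Pi.smul_apply, pf t x i]
    · simp [sf t x ht]

/-- Distributions on `(0,T) × 𝕋³`: linear functionals on the test functions that, on the test
functions supported in any fixed `[a,c] × 𝕋³`, are bounded by finitely many derivatives. -/
structure TorusDistribution (T : ℝ) where
  toLinearMap : testSpace T ℝ →ₗ[ℝ] ℝ
  bounded : ∀ a c : ℝ, 0 < a → c < T → ∃ (N : ℕ) (C : ℝ), ∀ ψ : testSpace T ℝ,
    (∀ (t : ℝ) (x : E3), t ∉ Icc a c → ψ.1 (t, x) = 0) →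
      ∀ M : ℝ, (∀ n ≤ N, ∀ z, ‖iteratedFDeriv ℝ n ψ.1 z‖ ≤ M) → |toLinearMap ψ| ≤ C * M

/-- `f_ε → D` in the sense of distributions as `ε → 0⁺`, for functions `f_ε ∈ L^1_loc`. -/
def TendstoDistribution {T : ℝ} (f : ℝ → ℝ × E3 → ℝ) (D : TorusDistribution T) : Prop :=
  (∀ ε : ℝ, 0 < ε → MemLpLoc T 1 (f ε)) ∧
    ∀ ψ : testSpace T ℝ,
      Tendsto (fun ε : ℝ => ∫ z in slab T, f ε z * ψ.1 z) (𝓝[>] 0) (𝓝 (D.toLinearMap ψ))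

/-! ### Classical differential operators, applied to test functions -/

/-- `∂_t ψ`. -/
def dt {F : Type*} [NormedAddCommGroup F] [NormedSpace ℝ F] (ψ : ℝ × E3 → F) (z : ℝ × E3) : F :=
  fderiv ℝ ψ z (1, 0)

/-- `∂_{x_i} ψ`. -/
def dx {F : Type*} [NormedAddCommGroup F] [NormedSpace ℝ F] (i : Fin 3) (ψ : ℝ × E3 → F)
    (z : ℝ × E3) : F :=
  fderiv ℝ ψ z (0, basisVec i)

/-- The spatial gradient. -/
def grad (ψ : ℝ × E3 → ℝ) (z : ℝ × E3) : E3 := !₂[dx 0 ψ z, dx 1 ψ z, dx 2 ψ z]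

/-- The spatial divergence. -/
def divergence (Ψ : ℝ × E3 → E3) (z : ℝ × E3) : ℝ := ∑ i, dx i Ψ z i

/-- The spatial curl. -/
def curl (Ψ : ℝ × E3 → E3) (z : ℝ × E3) : E3 :=
  !₂[dx 1 Ψ z 2 - dx 2 Ψ z 1, dx 2 Ψ z 0 - dx 0 Ψ z 2, dx 0 Ψ z 1 - dx 1 Ψ z 0]

/-- `(v ⊗ w) : ∇Ψ = ∑_{k,i} v_k w_i ∂_k Ψ_i`, so that `-∫ (v ⊗ w) : ∇Ψ` is the pairing with `Ψ` of
the vector field `div (v ⊗ w)` with components `∑_k ∂_k (v_k w_i)`. -/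
def tensorGrad (v w : E3) (Ψ : ℝ × E3 → E3) (z : ℝ × E3) : ℝ :=
  ∑ k, ∑ i, v k * w i * dx k Ψ z i

/-! ### Weak formulations -/

/-- `div f = 0` in the sense of distributions. -/
def WeakDivFree (T : ℝ) (f : ℝ × E3 → E3) : Prop :=
  ∀ ψ : testSpace T ℝ, ∫ z in slab T, inner ℝ (f z) (grad ψ.1 z) = 0

/-- `∇ × f = g` in the sense of distributions. -/
def WeakCurl (T : ℝ) (f g : ℝ × E3 → E3) : Prop :=
  ∀ Ψ : testSpace T E3,
    ∫ z in slab T, inner ℝ (g z) (Ψ.1 z) = ∫ z in slab T, inner ℝ (f z) (curl Ψ.1 z)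

/-- `div (f ⊗ f) = g` in the sense of distributions. -/
def WeakDivTensor (T : ℝ) (f g : ℝ × E3 → E3) : Prop :=
  ∀ Ψ : testSpace T E3,
    ∫ z in slab T, inner ℝ (g z) (Ψ.1 z) = - ∫ z in slab T, tensorGrad (f z) (f z) Ψ.1 z

/-- `(u,b)`, with current `j = ∇ × b`, is a weak solution on `(0,T) × 𝕋³` of the inviscid
Hall MHD equations
`u_t + u·∇u - b·∇b + ∇Π = 0`, `b_t + u·∇b - b·∇u + ∇×((∇×b)×b) = 0`, `div u = div b = 0`.
The pressure `Π` is eliminated by divergence-free test fields. -/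
structure IsWeakSolution (T : ℝ) (u b j : ℝ × E3 → E3) : Prop where
  periodic_u : SpacePeriodic u
  periodic_b : SpacePeriodic b
  periodic_j : SpacePeriodic j
  u_loc : MemLpLoc T 2 u
  b_loc : MemLpLoc T 2 b
  j_loc : MemLpLoc T 1 j
  hall_loc : MemLpLoc T 1 (fun z => cross (j z) (b z))
  current : WeakCurl T b j
  div_u : WeakDivFree T u
  div_b : WeakDivFree T b
  momentum : ∀ Ψ : testSpace T E3, (∀ z, divergence Ψ.1 z = 0) →
    ∫ z in slab T, (inner ℝ (u z) (dt Ψ.1 z) + tensorGrad (u z) (u z) Ψ.1 z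
      - tensorGrad (b z) (b z) Ψ.1 z) = 0
  induction : ∀ Ψ : testSpace T E3,
    ∫ z in slab T, (inner ℝ (b z) (dt Ψ.1 z) + tensorGrad (u z) (b z) Ψ.1 z
      - tensorGrad (b z) (u z) Ψ.1 z - inner ℝ (cross (j z) (b z)) (curl Ψ.1 z)) = 0

/-- `A` is a magnetic vector potential of `b` with pressure `π` on `(0,T) × 𝕋³`:
`∇ × A = b`, `div A = 0` and `A_t - u × b + j × b + ∇π = 0` in the sense of distributions. -/
structure IsVectorPotential (T : ℝ) (u b j A : ℝ × E3 → E3) (π : ℝ × E3 → ℝ) : Prop where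
  periodic_A : SpacePeriodic A
  periodic_π : SpacePeriodic π
  A_loc : MemLpLoc T 1 A
  π_loc : MemLpLoc T 1 π
  curl_A : WeakCurl T A b
  div_A : WeakDivFree T A
  equation : ∀ Ψ : testSpace T E3,
    ∫ z in slab T, (inner ℝ (A z) (dt Ψ.1 z) + inner ℝ (cross (u z) (b z)) (Ψ.1 z)
      - inner ℝ (cross (j z) (b z)) (Ψ.1 z) + π z * divergence Ψ.1 z) = 0

/-! ### Mollifier, increments, dissipation term, structure function -/

/-- `exp(-1/(1-|x|²))` for `|x| < 1` and `0` for `|x| ≥ 1`. -/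
def bump (x : E3) : ℝ := if ‖x‖ < 1 then Real.exp (-(1 / (1 - ‖x‖ ^ 2))) else 0

/-- The standard mollifier `φ`, normalised to have integral one. -/
def mollifier (x : E3) : ℝ := (∫ y, bump y)⁻¹ * bump x

/-- `φ_ε(x) = ε⁻³ φ(x/ε)`. -/
def scaledMollifier (ε : ℝ) (x : E3) : ℝ := (ε ^ 3)⁻¹ * mollifier (ε⁻¹ • x)

/-- The increment `δb(ℓ) = b(t, x + ℓ) - b(t, x)`. -/
def increment (b : ℝ × E3 → E3) (z : ℝ × E3) (l : E3) : E3 := b (z.1, z.2 + l) - b z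

/-- `∇φ_ε(ℓ) · δb(ℓ) |δb(ℓ)|²`. -/
def dissipationIntegrand (b : ℝ × E3 → E3) (ε : ℝ) (z : ℝ × E3) (l : E3) : ℝ :=
  inner ℝ (gradient (scaledMollifier ε) l) (increment b z l) * ‖increment b z l‖ ^ 2

/-- `D_mh(b,ε) = -½ ∫ ∇φ_ε(ℓ) · δb(ℓ) |δb(ℓ)|² dℓ`, a function of `(t,x)`. -/
def dissipation (b : ℝ × E3 → E3) (ε : ℝ) (z : ℝ × E3) : ℝ :=
  -(1 / 2) * ∫ l, dissipationIntegrand b ε z l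

/-- `ζ · δb(rζ) |δb(rζ)|²` for `ζ` in the unit sphere. -/
def structureIntegrand (b : ℝ × E3 → E3) (r : ℝ) (z : ℝ × E3)
    (ζ : Metric.sphere (0 : E3) 1) : ℝ :=
  inner ℝ (ζ : E3) (increment b z (r • (ζ : E3))) * ‖increment b z (r • (ζ : E3))‖ ^ 2

/-- `S(b,b,b;r) = (1/r) ∫_{∂B} ζ · δb(rζ) |δb(rζ)|² dσ(ζ)/4π`, where `σ` is the surface measure of
the unit sphere; a function of `(t,x)`. -/
def structureFunction (b : ℝ × E3 → E3) (r : ℝ) (z : ℝ × E3) : ℝ :=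
  (1 / r) * ((4 * Real.pi)⁻¹ *
    ∫ ζ, structureIntegrand b r z ζ ∂((volume : Measure E3).toSphere))

/-- The local balance of magnetic helicity
`∂_t (A·b) + div (G × A) - div ((u × b) × A) + div ((π - |b|²/2) b) + div (|b|² b) = D`
in the sense of distributions on `(0,T) × 𝕋³`, all terms being derivatives of locally integrable
functions; it is used for `G = div (b ⊗ b)`. -/
structure HelicityBalance (T : ℝ) (u b A G : ℝ × E3 → E3) (π : ℝ × E3 → ℝ)
    (D : TorusDistribution T) : Prop where
  density_loc : MemLpLoc T 1 (fun z => inner ℝ (A z) (b z))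
  hall_flux_loc : MemLpLoc T 1 (fun z => cross (G z) (A z))
  convective_flux_loc : MemLpLoc T 1 (fun z => cross (cross (u z) (b z)) (A z))
  pressure_flux_loc : MemLpLoc T 1 (fun z => (π z - ‖b z‖ ^ 2 / 2) • b z)
  cubic_flux_loc : MemLpLoc T 1 (fun z => ‖b z‖ ^ 2 • b z)
  balance : ∀ ψ : testSpace T ℝ,
    -(∫ z in slab T, inner ℝ (A z) (b z) * dt ψ.1 z)
      - (∫ z in slab T, inner ℝ (cross (G z) (A z)) (grad ψ.1 z))
      + (∫ z in slab T, inner ℝ (cross (cross (u z) (b z)) (A z)) (grad ψ.1 z))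
      - (∫ z in slab T, inner ℝ ((π z - ‖b z‖ ^ 2 / 2) • b z) (grad ψ.1 z))
      - (∫ z in slab T, inner ℝ (‖b z‖ ^ 2 • b z) (grad ψ.1 z))
      = D.toLinearMap ψ

end HallMHD

end

noncomputable section

open scoped Pointwise
open scoped ContDiff ENNReal

namespace HallMHD

/-! ### Integration of periodic functions -/

/-! Fix a test function `ψ` and consider, as a function of the lag `l`, the field `F_i(l) = ∫ ψ
δb_i(l) |δb(l)|²` (`lagFlux`). The heart of the proof is that `F` is continuous and that its
divergence in `l` is a continuous function `q` (`lagSource`) with `q(0) = 2 ⟨D, ψ⟩`, where `D` is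
the distribution given by the left side of the helicity balance (`Fields.defect`). The balance then
holds by definition of `D`, and both limits are evaluations of `q` at the origin. Integration by
parts against the mollifier gives `-½ ∫ ∇φ_ε · F = ½ ∫ φ_ε q → ½ q(0)`. The divergence theorem on
the ball of radius `r` shows that the averaged flux through the sphere, divided by `r`, tends to
`q(0)/3`. Comparing `½ q(0)` with `-q(0)/3` gives the factor `-2/3`.

Why the divergence is continuous: expanding the cube writes `F` as a sum of correlations `∫ f(t,x)
g(t,x+l)`. With `div b = 0` and `G = div (b ⊗ b)`, the lag derivatives produce correlations of `ψ G`
with `b` and of `ψ b` with `G`. Hölder does not control these, as `G` is only in `L¹` and `b` only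
in `L³`. But the same pairs occur in the evolution of `∫ ψ A(t,x) · b(t,x+l)`, because `A_t = u × b
- G - ∇P` and `b_t = ∇ × (u × b - G)`. Subtracting that identity replaces them by correlations with
`f = u × b ∈ L^{3/2}`, with the bounded `A`, and with the pressure. What survives are Hölder pairs
whose translated factor has a finite exponent, so continuity of translations in `L^p` makes them
continuous in `l` (`continuous_corr`). At `l = 0` the terms with `u × b` disappear by orthogonality
to `b` (`Fields.lagSource_zero`).

These computations are made rigorous by testing in the lag with trigonometric polynomials `e`. Since
`e(y - x)` is a finite sum of products (`Sep`), every correlation becomes a time integral of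
products of spatial moments. The moments of `ψ A` and of `b` have integrable weak time derivatives,
so the product rule for absolutely continuous functions applies (`integral_weak_deriv_mul`,
`Fields.time_identity`, `Fields.integral_pd_lagFlux`). Convolution with a trigonometric
approximation of the identity then passes to smooth compactly supported tests
(`TorusDiv.integral_pd_mul`).

The integrability comes from elliptic estimates on almost every time slice. As `div b = 0`, the
gradient of `b` is a combination of second order Riesz transforms of `j`, hence lies in `L^{3/2}`.
Formally `∫ |b|³ = ∫ A · ∇ × (|b| b) ≤ C ‖A‖_∞ ∫ |b| |∇b|`, and Young's inequality bounds `b` in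
`L³`, uniformly on compact time intervals (`integral_cube_pow_curl_le`, `bdd_field`). Continuity of
`A` enters only through this local bound. Next, `j × b = G - ½ ∇|b|²`, so the equation for `A` has
the total pressure `P = π - |b|²/2`, and `P` minus its spatial mean is in `L^{3/2}` because its
Laplacian is given by `u × b` and `b ⊗ b` (`exists_fields`). Both estimates rest on the `L^{3/2}`
boundedness of second order Riesz transforms, which is proved by a heat flow and a Bellman function
(`riesz_pairing`). -/

/-- `ℤ³`-periodicity of a function of the space variable. -/
def Per {F : Type*} (f : E3 → F) : Prop := ∀ (x : E3) (i : Fin 3), f (x + basisVec i) = f x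

/-- The standard basis of `ℝ³`. -/
abbrev stdBasis : Module.Basis (Fin 3) ℝ E3 := (EuclideanSpace.basisFun (Fin 3) ℝ).toBasis

/-- The lattice `ℤ³`. -/
abbrev latt : AddSubgroup E3 := (Submodule.span ℤ (range stdBasis)).toAddSubgroup

instance : Countable latt := inferInstanceAs (Countable (Submodule.span ℤ (range stdBasis)))

lemma cube_eq : cube = ZSpan.fundamentalDomain stdBasis := by
  ext x
  simp [cube, ZSpan.mem_fundamentalDomain]

lemma cube_fd : IsAddFundamentalDomain latt cube (volume : Measure E3) := by
  rw [cube_eq]; exact ZSpan.isAddFundamentalDomain' stdBasis volume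

lemma cube_fd_vadd (l : E3) : IsAddFundamentalDomain latt (l +ᵥ cube) (volume : Measure E3) :=
  cube_fd.vadd_of_comm l

lemma measurableSet_cube : MeasurableSet cube := by
  rw [cube_eq]; exact ZSpan.fundamentalDomain_measurableSet stdBasis

lemma volume_cube : volume cube = 1 := by
  have : cube = WithLp.ofLp ⁻¹' (Set.pi univ fun _ => Ico (0 : ℝ) 1) := by
    ext x; simp [cube]
  rw [this, (PiLp.volume_preserving_ofLp (Fin 3)).measure_preimage]
  · simp [Real.volume_pi_Ico]
  · exact (MeasurableSet.univ_pi fun _ => measurableSet_Ico).nullMeasurableSet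

instance : IsProbabilityMeasure ((volume : Measure E3).restrict cube) :=
  ⟨by simp [volume_cube]⟩

lemma Per.latt {F : Type*} {f : E3 → F} (hf : Per f) (v : latt) (x : E3) : f (v +ᵥ x) = f x := by
  let H : AddSubgroup E3 :=
    { carrier := {v | ∀ x, f (v + x) = f x}
      add_mem' := fun {a b} ha hb x => by rw [add_assoc, ha, hb]
      zero_mem' := fun x => by simp
      neg_mem' := fun {a} ha x => by rw [← ha, add_neg_cancel_left] }
  have h : Submodule.span ℤ (range stdBasis) ≤ AddSubgroup.toIntSubmodule H := by
    refine Submodule.span_le.2 ?_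
    rintro _ ⟨i, rfl⟩ x
    have := hf x i
    simpa [basisVec, add_comm] using this
  exact h v.2 x

lemma preimage_add_vadd (l : E3) (s : Set E3) : (fun x => x + l) ⁻¹' (l +ᵥ s) = s := by
  ext x
  simp [Set.mem_vadd_set_iff_neg_vadd_mem, add_comm]

lemma map_add_restrict_cube (l : E3) :
    ((volume : Measure E3).restrict cube).map (fun x => x + l) = volume.restrict (l +ᵥ cube) := by
  have := ((measurePreserving_add_right (volume : Measure E3) l).restrict_preimage
    (measurableSet_cube.const_vadd l)).map_eq
  rwa [preimage_add_vadd] at this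

/-- The shifted cube is another fundamental domain of the lattice, and periodic functions have the
same integral over all of them. -/
lemma lintegral_shift {f : E3 → ℝ≥0∞} (hf : Per f) (l : E3) :
    ∫⁻ x in cube, f (x + l) = ∫⁻ x in cube, f x := by
  rw [← (cube_fd_vadd l).setLIntegral_eq cube_fd f hf.latt, ← map_add_restrict_cube,
    (measurableEmbedding_addRight l).lintegral_map]

lemma integral_shift {F : Type*} [NormedAddCommGroup F] [NormedSpace ℝ F] {f : E3 → F}
    (hf : Per f) (l : E3) : ∫ x in cube, f (x + l) = ∫ x in cube, f x := by
  rw [← (cube_fd_vadd l).setIntegral_eq cube_fd hf.latt, ← map_add_restrict_cube,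
    (measurableEmbedding_addRight l).integral_map]

lemma aesm_shift {F : Type*} [NormedAddCommGroup F] {f : E3 → F} (hf : Per f)
    (h : AEStronglyMeasurable f (volume.restrict cube)) (l : E3) :
    AEStronglyMeasurable (fun x => f (x + l)) (volume.restrict cube) := by
  rw [← (cube_fd_vadd l).aestronglyMeasurable_on_iff cube_fd hf.latt, ← map_add_restrict_cube,
    (measurableEmbedding_addRight l).aestronglyMeasurable_map_iff] at h
  exact h

lemma aesm_univ {F : Type*} [NormedAddCommGroup F] {f : E3 → F} (hf : Per f)
    (h : AEStronglyMeasurable f (volume.restrict cube)) : AEStronglyMeasurable f volume := by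
  rw [← cube_fd.sum_restrict, aestronglyMeasurable_sum_measure_iff]
  intro g
  exact (cube_fd.aestronglyMeasurable_on_iff (cube_fd.vadd_of_comm g) hf.latt).1 h

lemma eLpNorm_shift {F : Type*} [NormedAddCommGroup F] {f : E3 → F} (hf : Per f) (l : E3)
    {p : ℝ≥0∞} (hp : p ≠ ⊤) :
    eLpNorm (fun x => f (x + l)) p (volume.restrict cube) = eLpNorm f p (volume.restrict cube) := by
  rcases eq_or_ne p 0 with rfl | h0
  · simp
  rw [eLpNorm_eq_lintegral_rpow_enorm_toReal h0 hp, eLpNorm_eq_lintegral_rpow_enorm_toReal h0 hp,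
    lintegral_shift (f := fun x => ‖f x‖ₑ ^ p.toReal) (fun x i => by simp only [hf x i]) l]

lemma memLp_shift {F : Type*} [NormedAddCommGroup F] {f : E3 → F} (hf : Per f) (l : E3)
    {p : ℝ≥0∞} (hp : p ≠ ⊤) (h : MemLp f p (volume.restrict cube)) :
    MemLp (fun x => f (x + l)) p (volume.restrict cube) :=
  ⟨aesm_shift hf h.1 l, by rw [eLpNorm_shift hf l hp]; exact h.2⟩

lemma integrable_shift {F : Type*} [NormedAddCommGroup F] {f : E3 → F} (hf : Per f) (l : E3)
    (h : IntegrableOn f cube) : IntegrableOn (fun x => f (x + l)) cube :=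
  memLp_one_iff_integrable.1 (memLp_shift hf l ENNReal.one_ne_top (memLp_one_iff_integrable.2 h))

/-! ### Space-time -/

lemma slice_per {F : Type*} {f : ℝ × E3 → F} (hf : SpacePeriodic f) (t : ℝ) :
    Per (fun x => f (t, x)) := fun x i => hf t x i

/-- Lebesgue measure on `S × 𝕋³`. -/
abbrev tcube (S : Set ℝ) : Measure (ℝ × E3) := volume.restrict (S ×ˢ cube)

lemma tcube_eq (S : Set ℝ) :
    tcube S = ((volume : Measure ℝ).restrict S).prod ((volume : Measure E3).restrict cube) :=
  (Measure.prod_restrict S cube).symm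

lemma iUnion_latt_vadd_cube : ⋃ v : latt, ((v : E3) +ᵥ cube) = univ := by
  refine eq_univ_of_forall fun x => ?_
  obtain ⟨v, hv, -⟩ := ZSpan.exist_unique_vadd_mem_fundamentalDomain stdBasis x
  rw [← cube_eq] at hv
  refine mem_iUnion.2 ⟨⟨-(v : E3), neg_mem v.2⟩, ?_⟩
  rw [Set.mem_vadd_set_iff_neg_vadd_mem, neg_neg]
  exact hv

lemma measurePreserving_space_shift (S : Set ℝ) (l : E3) (s : Set E3) (hs : MeasurableSet s) :
    MeasurePreserving (fun z : ℝ × E3 => (z.1, z.2 + l)) (volume.restrict (S ×ˢ s))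
      (volume.restrict (S ×ˢ (l +ᵥ s))) := by
  have e1 : (volume : Measure (ℝ × E3)).restrict (S ×ˢ s)
      = ((volume : Measure ℝ).restrict S).prod ((volume : Measure E3).restrict s) :=
    (Measure.prod_restrict S s).symm
  have e2 : (volume : Measure (ℝ × E3)).restrict (S ×ˢ (l +ᵥ s))
      = ((volume : Measure ℝ).restrict S).prod ((volume : Measure E3).restrict (l +ᵥ s)) :=
    (Measure.prod_restrict S _).symm
  rw [e1, e2]
  refine (MeasurePreserving.id ((volume : Measure ℝ).restrict S)).prod (g := fun x : E3 => x + l) ?_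
  have := (measurePreserving_add_right (volume : Measure E3) l).restrict_preimage
    (hs.const_vadd l)
  rwa [preimage_add_vadd] at this

lemma measurableEmbedding_space_shift (l : E3) :
    MeasurableEmbedding (fun z : ℝ × E3 => (z.1, z.2 + l)) := by
  have := ((Homeomorph.refl ℝ).prodCongr (Homeomorph.addRight l)).measurableEmbedding
  exact this

lemma SpacePeriodic.shift_latt {F : Type*} {f : ℝ × E3 → F} (hf : SpacePeriodic f) (v : latt)
    (z : ℝ × E3) : f (z.1, z.2 + v) = f z := by
  have := (slice_per hf z.1).latt v z.2
  rwa [AddSubgroup.vadd_def, vadd_eq_add, add_comm] at this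

/-- Countably many lattice translates of the cube cover space. Shifts sample functions outside the
cube, so measurability is needed there too. -/
lemma aesm_tuniv {F : Type*} [NormedAddCommGroup F] {f : ℝ × E3 → F} (hf : SpacePeriodic f)
    {S : Set ℝ} (h : AEStronglyMeasurable f (tcube S)) :
    AEStronglyMeasurable f (volume.restrict (S ×ˢ univ)) := by
  rw [← iUnion_latt_vadd_cube, prod_iUnion, aestronglyMeasurable_iUnion_iff]
  intro v
  rw [← (measurePreserving_space_shift S (v : E3) cube measurableSet_cube).map_eq,
    (measurableEmbedding_space_shift (v : E3)).aestronglyMeasurable_map_iff]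
  refine h.congr (Eventually.of_forall fun z => ?_)
  exact (hf.shift_latt v z).symm

lemma aesm_tshift_set {F : Type*} [NormedAddCommGroup F] {f : ℝ × E3 → F} (hf : SpacePeriodic f)
    {S : Set ℝ} (h : AEStronglyMeasurable f (tcube S)) (l : E3) (s : Set E3)
    (hs : MeasurableSet s) :
    AEStronglyMeasurable (fun z : ℝ × E3 => f (z.1, z.2 + l)) (volume.restrict (S ×ˢ s)) := by
  have h1 := (aesm_tuniv hf h).mono_measure
    (Measure.restrict_mono (prod_mono (le_refl S) (subset_univ (l +ᵥ s))) le_rfl)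
  exact h1.comp_measurePreserving (measurePreserving_space_shift S l s hs)

lemma aesm_tshift {F : Type*} [NormedAddCommGroup F] {f : ℝ × E3 → F} (hf : SpacePeriodic f)
    {S : Set ℝ} (h : AEStronglyMeasurable f (tcube S)) (l : E3) :
    AEStronglyMeasurable (fun z : ℝ × E3 => f (z.1, z.2 + l)) (tcube S) :=
  aesm_tshift_set hf h l cube measurableSet_cube

lemma tlintegral_shift {f : ℝ × E3 → ℝ≥0∞} (hf : SpacePeriodic f) {S : Set ℝ}
    (h : AEMeasurable f (tcube S)) (h' : ∀ l, AEMeasurable (fun z : ℝ × E3 => f (z.1, z.2 + l)) (tcube S))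
    (l : E3) : ∫⁻ z, f (z.1, z.2 + l) ∂(tcube S) = ∫⁻ z, f z ∂(tcube S) := by
  have h2 := h' l
  rw [tcube_eq] at *
  rw [lintegral_prod _ h2, lintegral_prod _ h]
  exact lintegral_congr fun t => lintegral_shift (slice_per hf t) l

lemma eLpNorm_tshift {F : Type*} [NormedAddCommGroup F] {f : ℝ × E3 → F} (hf : SpacePeriodic f)
    {S : Set ℝ} (h : AEStronglyMeasurable f (tcube S)) (l : E3)
    {p : ℝ≥0∞} (hp : p ≠ ⊤) :
    eLpNorm (fun z : ℝ × E3 => f (z.1, z.2 + l)) p (tcube S) = eLpNorm f p (tcube S) := by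
  rcases eq_or_ne p 0 with rfl | h0
  · simp
  rw [eLpNorm_eq_lintegral_rpow_enorm_toReal h0 hp, eLpNorm_eq_lintegral_rpow_enorm_toReal h0 hp,
    tlintegral_shift (f := fun x => ‖f x‖ₑ ^ p.toReal) (fun t x i => by simp only [hf t x i])
      (h.enorm.pow_const _) (fun l => (aesm_tshift hf h l).enorm.pow_const _) l]

lemma memLp_tshift {F : Type*} [NormedAddCommGroup F] {f : ℝ × E3 → F} (hf : SpacePeriodic f)
    {S : Set ℝ} (l : E3) {p : ℝ≥0∞} (hp : p ≠ ⊤) (h : MemLp f p (tcube S)) :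
    MemLp (fun z : ℝ × E3 => f (z.1, z.2 + l)) p (tcube S) :=
  ⟨aesm_tshift hf h.1 l, by rw [eLpNorm_tshift hf h.1 l hp]; exact h.2⟩

/-! ### Continuity of translations in `L^p` -/

/-- A bounded union of translates of the unit cube that contains the unit neighbourhood of it. -/
def bigCube : Set E3 :=
  ⋃ v : Fin 3 → Fin 3, ((WithLp.toLp 2 (fun i => ((v i : ℕ) : ℝ) - 1) : E3) +ᵥ cube)

lemma measurableSet_bigCube : MeasurableSet bigCube :=
  MeasurableSet.iUnion fun _ => measurableSet_cube.const_vadd _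

lemma add_mem_bigCube {x l : E3} (hx : x ∈ cube) (hl : ‖l‖ ≤ 1) : x + l ∈ bigCube := by
  have hb : ∀ i, |l i| ≤ 1 := fun i => by
    have := PiLp.norm_apply_le l i
    rw [Real.norm_eq_abs] at this
    linarith
  have key : ∀ i, ∃ v : Fin 3, (x + l) i - (((v : ℕ) : ℝ) - 1) ∈ Ico (0 : ℝ) 1 := by
    intro i
    have h1 := hx i
    have h2 := abs_le.1 (hb i)
    simp only [PiLp.add_apply]
    by_cases c1 : x i + l i < 0
    · refine ⟨0, ?_, ?_⟩ <;> norm_num <;> linarith [h1.1, h1.2]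
    · by_cases c2 : x i + l i < 1
      · refine ⟨1, ?_, ?_⟩ <;> norm_num <;> linarith [h1.1, h1.2]
      · refine ⟨2, ?_, ?_⟩ <;> norm_num <;> linarith [h1.1, h1.2]
  choose v hv using key
  refine mem_iUnion.2 ⟨v, ?_⟩
  rw [Set.mem_vadd_set_iff_neg_vadd_mem]
  intro i
  have := hv i
  simpa [add_comm, sub_eq_add_neg, add_assoc, add_left_comm] using this

lemma memLp_bigCube {F : Type*} [NormedAddCommGroup F] {f : ℝ × E3 → F} (hf : SpacePeriodic f)
    {S : Set ℝ} {p : ℝ≥0∞} (hp : p ≠ ⊤) (h : MemLp f p (tcube S)) :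
    MemLp f p (volume.restrict (S ×ˢ bigCube)) := by
  have h1 : ∀ l : E3, MemLp f p (volume.restrict (S ×ˢ (l +ᵥ cube))) := fun l => by
    rw [← (measurePreserving_space_shift S l cube measurableSet_cube).map_eq,
      (measurableEmbedding_space_shift l).memLp_map_measure_iff]
    exact memLp_tshift hf l hp h
  rw [bigCube, prod_iUnion]
  refine ⟨(aestronglyMeasurable_iUnion_iff).2 fun v => (h1 _).1, ?_⟩
  rcases eq_or_ne p 0 with rfl | h0
  · simp
  refine (eLpNorm_lt_top_iff_lintegral_rpow_enorm_lt_top h0 hp).2 ?_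
  refine (lintegral_iUnion_le _ _).trans_lt ?_
  rw [tsum_fintype, ENNReal.sum_lt_top]
  exact fun v _ => (eLpNorm_lt_top_iff_lintegral_rpow_enorm_lt_top h0 hp).1 (h1 _).2

/-- Translations act continuously on `Lp` for finite `p`, so the norm in question is a continuous
function of the shift that vanishes at `0`. -/
lemma tendsto_eLpNorm_translate {G F : Type*} [NormedAddCommGroup G] [MeasurableSpace G]
    [BorelSpace G] [SecondCountableTopology G] {μ : Measure G} [μ.IsAddLeftInvariant]
    [μ.IsAddRightInvariant] [IsLocallyFiniteMeasure μ] [μ.InnerRegularCompactLTTop]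
    [NormedAddCommGroup F] {p : ℝ≥0∞} [Fact (1 ≤ p)] (hp : p ≠ ⊤) {f : G → F}
    (hf : MemLp f p μ) :
    Tendsto (fun l : G => eLpNorm (fun x => f (l + x) - f x) p μ) (𝓝 0) (𝓝 0) := by
  have : Fact (p ≠ ⊤) := ⟨hp⟩
  set g := hf.toLp f with hg
  have hc : Continuous fun l : G => ‖(DomAddAct.mk l +ᵥ g) - g‖ := by
    have h1 : Continuous fun l : G => (DomAddAct.mk l) +ᵥ g :=
      Continuous.vadd (DomAddAct.continuous_mk) continuous_const
    exact (h1.sub continuous_const).norm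
  have h0 : ‖(DomAddAct.mk (0 : G) +ᵥ g) - g‖ = 0 := by
    rw [DomAddAct.mk_zero, zero_vadd, sub_self, norm_zero]
  have h2 := hc.tendsto 0
  rw [h0] at h2
  have h3 := (ENNReal.continuous_ofReal.tendsto 0).comp h2
  rw [ENNReal.ofReal_zero] at h3
  refine h3.congr fun l => ?_
  simp only [Function.comp]
  rw [Lp.norm_def, ENNReal.ofReal_toReal (Lp.eLpNorm_ne_top _)]
  refine eLpNorm_congr_ae ?_
  have e1 := Lp.coeFn_sub (DomAddAct.mk l +ᵥ g) g
  have e2 := DomAddAct.vadd_Lp_ae_eq (DomAddAct.mk l) g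
  have e3 := hf.coeFn_toLp
  have e4 : ∀ᵐ x ∂μ, g (l + x) = f (l + x) :=
    (measurePreserving_add_left μ l).quasiMeasurePreserving.ae e3
  filter_upwards [e1, e2, e3, e4] with x h1 h2 h3 h4
  rw [h1, Pi.sub_apply, h2, h3]
  simp only [Equiv.symm_apply_apply, vadd_eq_add]
  rw [h4]

instance : (volume : Measure (ℝ × E3)).IsAddHaarMeasure :=
  inferInstanceAs ((volume : Measure ℝ).prod (volume : Measure E3)).IsAddHaarMeasure

/-- Reduction to the whole space: cut `f` off outside `S ×ˢ bigCube`. For shifts of length at most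
one the cut-off is not visible from the unit cube. -/
lemma tendsto_eLpNorm_tshift {F : Type*} [NormedAddCommGroup F] {f : ℝ × E3 → F}
    (hf : SpacePeriodic f) {S : Set ℝ} (hS : MeasurableSet S) {p : ℝ≥0∞} (h1 : 1 ≤ p)
    (hp : p ≠ ⊤) (h : MemLp f p (tcube S)) :
    Tendsto (fun l : E3 => eLpNorm (fun z : ℝ × E3 => f (z.1, z.2 + l) - f z) p (tcube S))
      (𝓝 0) (𝓝 0) := by
  have : Fact (1 ≤ p) := ⟨h1⟩
  have hm : MeasurableSet (S ×ˢ bigCube) := hS.prod measurableSet_bigCube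
  have hF : MemLp ((S ×ˢ bigCube).indicator f) p volume :=
    (memLp_indicator_iff_restrict hm).2 (memLp_bigCube hf hp h)
  have h2 := tendsto_eLpNorm_translate hp hF
  have h3 : Tendsto (fun l : E3 => ((0 : ℝ), l)) (𝓝 0) (𝓝 0) := by
    have : Continuous fun l : E3 => ((0 : ℝ), l) := by fun_prop
    exact this.tendsto 0
  have h4 := h2.comp h3
  refine tendsto_of_tendsto_of_tendsto_of_le_of_le' tendsto_const_nhds h4
    (Eventually.of_forall fun _ => zero_le) ?_
  filter_upwards [Metric.closedBall_mem_nhds (0 : E3) one_pos] with l hl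
  have hl : ‖l‖ ≤ 1 := by simpa using hl
  have e : eLpNorm (fun z : ℝ × E3 => f (z.1, z.2 + l) - f z) p (tcube S)
      = eLpNorm (fun z : ℝ × E3 => (S ×ˢ bigCube).indicator f (((0 : ℝ), l) + z)
          - (S ×ˢ bigCube).indicator f z) p (tcube S) := by
    refine eLpNorm_congr_ae ?_
    filter_upwards [ae_restrict_mem (hS.prod measurableSet_cube)] with z hz
    have m1 : ((0 : ℝ), l) + z ∈ S ×ˢ bigCube :=
      ⟨by simpa using hz.1, by simpa [add_comm] using add_mem_bigCube hz.2 hl⟩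
    have m2 : z ∈ S ×ˢ bigCube :=
      ⟨hz.1, by simpa using add_mem_bigCube (l := 0) hz.2 (by simp)⟩
    rw [indicator_of_mem m1, indicator_of_mem m2]
    congr 2
    ext <;> simp [add_comm]
  rw [e]
  exact eLpNorm_mono_measure _ Measure.restrict_le_self

lemma tendsto_eLpNorm_shift {F : Type*} [NormedAddCommGroup F] {f : E3 → F}
    (hf : Per f) {p : ℝ≥0∞} (h1 : 1 ≤ p)
    (hp : p ≠ ⊤) (h : MemLp f p (volume.restrict cube)) :
    Tendsto (fun l : E3 => eLpNorm (fun x => f (x + l) - f x) p (volume.restrict cube))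
      (𝓝 0) (𝓝 0) := by
  -- A function of `x` is read as a function of `(t, x)` with `t` in an interval of length one,
  -- which preserves norms.
  have hmp : MeasurePreserving (Prod.snd : ℝ × E3 → E3) (tcube (Icc 0 1)) (volume.restrict cube) := by
    rw [tcube_eq]
    have : IsProbabilityMeasure ((volume : Measure ℝ).restrict (Icc 0 1)) := ⟨by simp⟩
    exact measurePreserving_snd
  have hF : MemLp (fun z : ℝ × E3 => f z.2) p (tcube (Icc 0 1)) := h.comp_measurePreserving hmp
  refine (tendsto_eLpNorm_tshift (f := fun z : ℝ × E3 => f z.2) (fun t x i => hf x i)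
    measurableSet_Icc h1 hp hF).congr fun l => ?_
  exact eLpNorm_comp_measurePreserving (g := fun x => f (x + l) - f x)
    ((aesm_shift hf h.1 l).sub h.1) hmp

/-! ### Smooth periodic functions -/

/-- The partial derivative `∂_i f`. -/
def pd (i : Fin 3) (f : E3 → ℝ) (x : E3) : ℝ := fderiv ℝ f x (basisVec i)

/-- Smooth periodic functions of the space variable. -/
structure SP (f : E3 → ℝ) : Prop where
  smooth : ContDiff ℝ ∞ f
  per : Per f

lemma exists_mem_cube_eq {F : Type*} (x : E3) : ∃ y ∈ cube, ∀ f : E3 → F, Per f → f x = f y := by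
  obtain ⟨v, hv, -⟩ := ZSpan.exist_unique_vadd_mem_fundamentalDomain stdBasis x
  rw [← cube_eq] at hv
  exact ⟨_, hv, fun f hf => (hf.latt ⟨v, v.2⟩ x).symm⟩

lemma norm_le_of_mem_cube {x : E3} (hx : x ∈ cube) : ‖x‖ ≤ 2 := by
  rw [EuclideanSpace.norm_eq, Real.sqrt_le_left (by norm_num), Fin.sum_univ_three]
  have h : ∀ i, ‖x i‖ ^ 2 ≤ 1 := fun i => by
    rw [Real.norm_eq_abs, sq_abs]
    nlinarith [(hx i).1, (hx i).2]
  linarith [h 0, h 1, h 2]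

lemma Per.exists_bound {F : Type*} [NormedAddCommGroup F] {f : E3 → F} (hf : Per f)
    (hc : Continuous f) : ∃ C, 0 ≤ C ∧ ∀ x, ‖f x‖ ≤ C := by
  obtain ⟨C, hC⟩ := (isCompact_closedBall (0 : E3) 2).exists_bound_of_continuousOn hc.continuousOn
  have h : ∀ x, ‖f x‖ ≤ C := fun x => by
    obtain ⟨y, hy, h⟩ := exists_mem_cube_eq (F := F) x
    rw [h f hf]
    exact hC y (by simpa using norm_le_of_mem_cube hy)
  exact ⟨C, (norm_nonneg _).trans (h 0), h⟩

lemma Per.integrableOn {F : Type*} [NormedAddCommGroup F] {f : E3 → F} (hf : Per f)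
    (hc : Continuous f) : IntegrableOn f cube := by
  obtain ⟨C, -, hC⟩ := hf.exists_bound hc
  exact Integrable.of_bound hc.aestronglyMeasurable C (Eventually.of_forall hC)

lemma Per.memLp {F : Type*} [NormedAddCommGroup F] {f : E3 → F} (hf : Per f)
    (hc : Continuous f) (p : ℝ≥0∞) : MemLp f p (volume.restrict cube) := by
  obtain ⟨C, -, hC⟩ := hf.exists_bound hc
  exact MemLp.of_bound hc.aestronglyMeasurable C (Eventually.of_forall hC)

lemma Per.comp {F G : Type*} {f : E3 → F} (hf : Per f) (g : F → G) : Per (fun x => g (f x)) :=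
  fun x i => by simp only [hf x i]

lemma Per.shift {F : Type*} {f : E3 → F} (hf : Per f) (l : E3) : Per (fun x => f (x + l)) :=
  fun x i => by simp only [add_right_comm x _ l, hf _ i]

lemma Per.shift_sub {F : Type*} {f : E3 → F} (hf : Per f) (l : E3) : Per (fun x => f (x - l)) := by
  simpa [sub_eq_add_neg] using hf.shift (-l)

lemma Per.neg {F : Type*} {f : E3 → F} (hf : Per f) : Per (fun x => f (-x)) := fun x i => by
  have := hf (-x - basisVec i) i
  rw [sub_add_cancel] at this
  simp only [neg_add, ← sub_eq_add_neg, this]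

lemma Per.sub_shift {F : Type*} {f : E3 → F} (hf : Per f) (l : E3) : Per (fun x => f (l - x)) := by
  have := (hf.shift l).neg
  simpa [sub_eq_add_neg, add_comm] using this

namespace SP

variable {f g : E3 → ℝ}

lemma continuous (hf : SP f) : Continuous f := hf.smooth.continuous

lemma differentiable (hf : SP f) : Differentiable ℝ f := hf.smooth.differentiable (by simp)

lemma const (c : ℝ) : SP (fun _ => c) := ⟨contDiff_const, fun _ _ => rfl⟩

lemma add (hf : SP f) (hg : SP g) : SP (fun x => f x + g x) :=
  ⟨hf.smooth.add hg.smooth, fun x i => by simp only [hf.per x i, hg.per x i]⟩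

lemma sub (hf : SP f) (hg : SP g) : SP (fun x => f x - g x) :=
  ⟨hf.smooth.sub hg.smooth, fun x i => by simp only [hf.per x i, hg.per x i]⟩

lemma mul (hf : SP f) (hg : SP g) : SP (fun x => f x * g x) :=
  ⟨hf.smooth.mul hg.smooth, fun x i => by simp only [hf.per x i, hg.per x i]⟩

lemma const_mul (hf : SP f) (c : ℝ) : SP (fun x => c * f x) := (SP.const c).mul hf

lemma sum {ι : Type*} (s : Finset ι) {f : ι → E3 → ℝ} (hf : ∀ j ∈ s, SP (f j)) :
    SP (fun x => ∑ j ∈ s, f j x) :=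
  ⟨ContDiff.sum fun j hj => (hf j hj).smooth,
    fun x i => Finset.sum_congr rfl fun j hj => (hf j hj).per x i⟩

lemma pd (hf : SP f) (i : Fin 3) : SP (pd i f) := by
  refine ⟨(hf.smooth.fderiv_right (m := ∞) (by simp)).clm_apply contDiff_const, fun x k => ?_⟩
  have h : f = fun y => f (y + basisVec k) := by ext y; rw [hf.per y k]
  rw [HallMHD.pd, HallMHD.pd]
  conv_rhs => rw [h]
  rw [fderiv_comp_add_right]

lemma shift_sub (hf : SP f) (l : E3) : SP (fun y => f (y - l)) :=
  ⟨hf.smooth.comp (contDiff_id.sub contDiff_const), hf.per.shift_sub l⟩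

lemma integrableOn (hf : SP f) : IntegrableOn f cube := hf.per.integrableOn hf.continuous

lemma memLp (hf : SP f) (p : ℝ≥0∞) : MemLp f p (volume.restrict cube) :=
  hf.per.memLp hf.continuous p

lemma exists_bound (hf : SP f) : ∃ C, 0 ≤ C ∧ ∀ x, |f x| ≤ C := hf.per.exists_bound hf.continuous

end SP

lemma pd_eq {f : E3 → ℝ} {f' : E3 →L[ℝ] ℝ} {x : E3} (h : HasFDerivAt f f' x) (i : Fin 3) :
    pd i f x = f' (basisVec i) := by rw [pd, h.fderiv]

lemma pd_const (i : Fin 3) (c : ℝ) : pd i (fun _ => c) = fun _ => 0 := by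
  ext x; simp [pd]

lemma pd_add {f g : E3 → ℝ} (hf : Differentiable ℝ f) (hg : Differentiable ℝ g) (i : Fin 3) :
    pd i (fun x => f x + g x) = fun x => pd i f x + pd i g x := by
  ext x; exact pd_eq ((hf x).hasFDerivAt.add (hg x).hasFDerivAt) i

lemma pd_sub {f g : E3 → ℝ} (hf : Differentiable ℝ f) (hg : Differentiable ℝ g) (i : Fin 3) :
    pd i (fun x => f x - g x) = fun x => pd i f x - pd i g x := by
  ext x; exact pd_eq ((hf x).hasFDerivAt.sub (hg x).hasFDerivAt) i

lemma pd_neg (f : E3 → ℝ) (i : Fin 3) :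
    pd i (fun x => - f x) = fun x => - pd i f x := by
  ext x; simp [pd, fderiv_fun_neg]

lemma pd_mul {f g : E3 → ℝ} (hf : Differentiable ℝ f) (hg : Differentiable ℝ g) (i : Fin 3) :
    pd i (fun x => f x * g x) = fun x => pd i f x * g x + f x * pd i g x := by
  ext x
  rw [pd_eq (f := fun x => f x * g x) ((hf x).hasFDerivAt.mul (hg x).hasFDerivAt) i]
  simp [pd]; ring

lemma pd_const_mul {f : E3 → ℝ} (hf : Differentiable ℝ f) (c : ℝ) (i : Fin 3) :
    pd i (fun x => c * f x) = fun x => c * pd i f x := by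
  ext x
  rw [pd_eq ((hf x).hasFDerivAt.const_mul c) i]
  simp [pd]

lemma pd_sum {ι : Type*} (s : Finset ι) {f : ι → E3 → ℝ} (hf : ∀ j ∈ s, Differentiable ℝ (f j))
    (i : Fin 3) : pd i (fun x => ∑ j ∈ s, f j x) = fun x => ∑ j ∈ s, pd i (f j) x := by
  ext x
  rw [pd_eq (HasFDerivAt.fun_sum fun j hj => (hf j hj x).hasFDerivAt) i]
  simp [pd]

lemma pd_comp {f : E3 → ℝ} {g : ℝ → ℝ} {x : E3} {g' : ℝ} (hg : HasDerivAt g g' (f x))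
    (hf : DifferentiableAt ℝ f x) (i : Fin 3) : pd i (fun x => g (f x)) x = g' * pd i f x := by
  rw [pd_eq (f := fun x => g (f x)) (hg.comp_hasFDerivAt x hf.hasFDerivAt) i]
  simp [pd]

lemma pd_shift_sub (f : E3 → ℝ) (l x : E3) (i : Fin 3) :
    pd i (fun y => f (y - l)) x = pd i f (x - l) := by
  rw [pd, pd, fderiv_comp_sub]

lemma pd_sub_shift {f : E3 → ℝ} (hf : Differentiable ℝ f) (l x : E3) (i : Fin 3) :
    pd i (fun y => f (l - y)) x = - pd i f (l - x) := by
  have := (hf (l - x)).hasFDerivAt.comp x ((hasFDerivAt_id x).const_sub l)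
  rw [pd_eq (f := fun y => f (l - y)) this i]
  simp [pd]

lemma pd_comm {f : E3 → ℝ} (hf : SP f) (i k : Fin 3) : pd i (pd k f) = pd k (pd i f) := by
  ext x
  have h1 : DifferentiableAt ℝ (fderiv ℝ f) x :=
    ((hf.smooth.fderiv_right (m := ∞) (by simp)).differentiable (by simp)) x
  have key : ∀ i k : Fin 3, pd i (pd k f) x
      = fderiv ℝ (fderiv ℝ f) x (basisVec i) (basisVec k) := fun i k => by
    have := h1.hasFDerivAt.clm_apply (hasFDerivAt_const (basisVec k) x)
    rw [pd_eq (f := pd k f) this i]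
    simp
  rw [key, key]
  exact (hf.smooth.contDiffAt.isSymmSndFDerivAt (by simpa using (WithTop.coe_le_coe.2 (le_top : (2 : ℕ∞) ≤ ⊤)))).eq _ _

lemma hasDerivAt_pd {f : E3 → ℝ} (hf : Differentiable ℝ f) (x : E3) (i : Fin 3) (r : ℝ) :
    HasDerivAt (fun r : ℝ => f (x + r • basisVec i)) (pd i f (x + r • basisVec i)) r := by
  have h1 : HasDerivAt (fun r : ℝ => x + r • basisVec i) (basisVec i) r := by
    simpa using ((hasDerivAt_id r).smul_const (basisVec i)).const_add x
  exact (hf _).hasFDerivAt.comp_hasDerivAt r h1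

/-- The integral of a derivative of a periodic function vanishes. -/
lemma integral_pd {f : E3 → ℝ} (hf : SP f) (i : Fin 3) : ∫ x in cube, pd i f x = 0 := by
  obtain ⟨C, -, hC⟩ := (hf.pd i).exists_bound
  have hd := hasDerivAt_integral_of_dominated_loc_of_deriv_le
    (μ := volume.restrict cube) (F := fun (r : ℝ) (x : E3) => f (x + r • basisVec i))
    (F' := fun (r : ℝ) (x : E3) => pd i f (x + r • basisVec i)) (x₀ := 0) (s := univ)
    (bound := fun _ => C) univ_mem
    (Eventually.of_forall fun r => (hf.continuous.comp (by fun_prop)).aestronglyMeasurable)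
    (by simpa using (show Integrable f (volume.restrict cube) from hf.integrableOn))
    ((hf.pd i).continuous.comp (by fun_prop)).aestronglyMeasurable
    (Eventually.of_forall fun x r _ => hC _) (integrable_const C)
    (Eventually.of_forall fun x r _ => hasDerivAt_pd hf.differentiable x i r)
  have h2 := hd.2
  simp only [zero_smul, add_zero] at h2
  -- The integral of `f (x + r e_i)` does not depend on `r`, so its derivative, found by
  -- differentiating under the integral, is zero.
  simp only [integral_shift hf.per] at h2
  exact h2.unique (hasDerivAt_const 0 _)

/-- Integration by parts on the torus. -/
lemma integral_pd_mul {f g : E3 → ℝ} (hf : SP f) (hg : SP g) (i : Fin 3) :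
    ∫ x in cube, pd i f x * g x = - ∫ x in cube, f x * pd i g x := by
  have h := integral_pd (hf.mul hg) i
  rw [pd_mul hf.differentiable hg.differentiable,
    integral_add ((hf.pd i).mul hg).integrableOn (hf.mul (hg.pd i)).integrableOn] at h
  linarith

/-! ### Trigonometric polynomials -/

/-- The linear phase `2π n·x`. -/
def phase (n : Fin 3 → ℤ) (x : E3) : ℝ := 2 * Real.pi * ∑ i, (n i : ℝ) * x i

/-- The plane wave `cos (2π n·x + θ)`. -/
def wave (n : Fin 3 → ℤ) (θ : ℝ) (x : E3) : ℝ := Real.cos (phase n x + θ)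

/-- Real trigonometric polynomials on `𝕋³`. -/
def TP (f : E3 → ℝ) : Prop :=
  f ∈ Submodule.span ℝ (range fun p : (Fin 3 → ℤ) × ℝ => wave p.1 p.2)

lemma phase_add (n : Fin 3 → ℤ) (x y : E3) : phase n (x + y) = phase n x + phase n y := by
  simp only [phase, PiLp.add_apply, mul_add, Finset.sum_add_distrib]

lemma phase_neg (n : Fin 3 → ℤ) (x : E3) : phase n (-x) = - phase n x := by
  simp [phase]

lemma phase_sub (n : Fin 3 → ℤ) (x y : E3) : phase n (x - y) = phase n x - phase n y := by
  rw [sub_eq_add_neg, phase_add, phase_neg, sub_eq_add_neg]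

lemma phase_add_left (n m : Fin 3 → ℤ) (x : E3) : phase (n + m) x = phase n x + phase m x := by
  simp [phase, add_mul, Finset.sum_add_distrib, mul_add]

lemma phase_sub_left (n m : Fin 3 → ℤ) (x : E3) : phase (n - m) x = phase n x - phase m x := by
  simp [phase, sub_mul, Finset.sum_sub_distrib, mul_sub]

lemma phase_zero_left (x : E3) : phase 0 x = 0 := by simp [phase]

lemma phase_basisVec (n : Fin 3 → ℤ) (i : Fin 3) : phase n (basisVec i) = n i * (2 * Real.pi) := by
  simp [phase, basisVec, PiLp.single_apply]
  ring

lemma contDiff_phase (n : Fin 3 → ℤ) : ContDiff ℝ ∞ (phase n) := by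
  unfold phase; fun_prop

lemma pd_phase (n : Fin 3 → ℤ) (i : Fin 3) (x : E3) : pd i (phase n) x = n i * (2 * Real.pi) := by
  have h1 := hasDerivAt_pd ((contDiff_phase n).differentiable (by simp)) x i 0
  rw [zero_smul, add_zero] at h1
  have h2 : HasDerivAt (fun r : ℝ => phase n (x + r • basisVec i)) (n i * (2 * Real.pi)) 0 := by
    have e : (fun r : ℝ => phase n (x + r • basisVec i))
        = fun r => phase n x + r * (n i * (2 * Real.pi)) := by
      ext r
      rw [phase_add, ← phase_basisVec]
      congr 1
      simp only [phase, PiLp.smul_apply, smul_eq_mul, Finset.mul_sum]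
      exact Finset.sum_congr rfl fun j _ => by ring
    rw [e]
    simpa using ((hasDerivAt_id (0 : ℝ)).mul_const (n i * (2 * Real.pi))).const_add (phase n x)
  exact h1.unique h2

lemma wave_sp (n : Fin 3 → ℤ) (θ : ℝ) : SP (wave n θ) := by
  refine ⟨Real.contDiff_cos.comp ((contDiff_phase n).add contDiff_const), fun x i => ?_⟩
  rw [wave, wave, phase_add, phase_basisVec, add_right_comm, Real.cos_add_int_mul_two_pi]

lemma pd_wave (n : Fin 3 → ℤ) (θ : ℝ) (i : Fin 3) :
    pd i (wave n θ) = fun x => (n i * (2 * Real.pi)) * wave n (θ + Real.pi / 2) x := by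
  ext x
  have := pd_comp (g := fun s => Real.cos (s + θ)) (f := phase n) (x := x)
    ((Real.hasDerivAt_cos _).comp_add_const (phase n x) θ)
    ((contDiff_phase n).differentiable (by simp) x) i
  rw [pd_phase] at this
  rw [show wave n θ = fun x => Real.cos (phase n x + θ) from rfl, this, wave, ← add_assoc,
    Real.cos_add_pi_div_two]
  ring

lemma wave_mem (n : Fin 3 → ℤ) (θ : ℝ) : TP (wave n θ) := Submodule.subset_span ⟨(n, θ), rfl⟩

lemma TP.induction {P : (E3 → ℝ) → Prop} (hw : ∀ n θ, P (wave n θ))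
    (hadd : ∀ f g, TP f → TP g → P f → P g → P (fun x => f x + g x))
    (hsmul : ∀ (c : ℝ) f, TP f → P f → P (fun x => c * f x)) {f : E3 → ℝ} (hf : TP f) : P f := by
  refine Submodule.span_induction (p := fun f _ => P f) ?_ ?_ ?_ ?_ hf
  · rintro _ ⟨p, rfl⟩; exact hw _ _
  · have := hsmul 0 _ (wave_mem 0 0) (hw 0 0)
    simp only [zero_mul] at this
    exact this
  · exact fun f g hf hg h1 h2 => hadd f g hf hg h1 h2
  · exact fun c f hf h => hsmul c f hf h

lemma TP.add {f g : E3 → ℝ} (hf : TP f) (hg : TP g) : TP (fun x => f x + g x) :=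
  Submodule.add_mem _ hf hg

lemma TP.const_mul {f : E3 → ℝ} (hf : TP f) (c : ℝ) : TP (fun x => c * f x) :=
  Submodule.smul_mem _ c hf

lemma TP.neg {f : E3 → ℝ} (hf : TP f) : TP (fun x => - f x) := Submodule.neg_mem _ hf

lemma TP.sub {f g : E3 → ℝ} (hf : TP f) (hg : TP g) : TP (fun x => f x - g x) :=
  Submodule.sub_mem _ hf hg

lemma TP.sum {ι : Type*} (s : Finset ι) {f : ι → E3 → ℝ} (hf : ∀ j ∈ s, TP (f j)) :
    TP (fun x => ∑ j ∈ s, f j x) := by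
  have := Submodule.sum_mem _ hf
  unfold TP
  convert this using 1
  ext x; simp

lemma TP.sp {f : E3 → ℝ} (hf : TP f) : SP f :=
  TP.induction wave_sp (fun _ _ _ _ => SP.add) (fun c _ _ h => h.const_mul c) hf

lemma TP.const (c : ℝ) : TP (fun _ => c) := by
  have := TP.const_mul (wave_mem 0 0) c
  simpa [wave, phase_zero_left] using this

lemma TP.pd {f : E3 → ℝ} (hf : TP f) (i : Fin 3) : TP (pd i f) := by
  refine TP.induction (P := fun f => TP (HallMHD.pd i f)) (fun n θ => ?_) (fun f g hf hg h1 h2 => ?_)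
    (fun c f hf h => ?_) hf
  · rw [pd_wave]; exact TP.const_mul (wave_mem _ _) _
  · rw [pd_add hf.sp.differentiable hg.sp.differentiable]; exact h1.add h2
  · rw [pd_const_mul hf.sp.differentiable]; exact h.const_mul c

lemma TP.mul {f g : E3 → ℝ} (hf : TP f) (hg : TP g) : TP (fun x => f x * g x) := by
  refine TP.induction (P := fun f => TP (fun x => f x * g x)) (fun n θ => ?_)
    (fun f f' hf hf' h1 h2 => ?_) (fun c f hf h => ?_) hf
  · refine TP.induction (P := fun g => TP (fun x => wave n θ x * g x)) (fun m η => ?_)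
      (fun f f' hf hf' h1 h2 => ?_) (fun c f hf h => ?_) hg
    · have := ((wave_mem (n + m) (θ + η)).const_mul (1 / 2)).add
        ((wave_mem (n - m) (θ - η)).const_mul (1 / 2))
      convert this using 2 with x
      simp only [wave, phase_add_left, phase_sub_left]
      rw [show phase n x + phase m x + (θ + η) = (phase n x + θ) + (phase m x + η) by ring,
        show phase n x - phase m x + (θ - η) = (phase n x + θ) - (phase m x + η) by ring,
        Real.cos_add (phase n x + θ) (phase m x + η), Real.cos_sub]
      ring
    · simpa only [mul_add] using h1.add h2
    · simpa only [mul_left_comm] using h.const_mul c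
  · simpa only [add_mul] using h1.add h2
  · simpa only [mul_assoc] using h.const_mul c

lemma TP.pow {f : E3 → ℝ} (hf : TP f) (N : ℕ) : TP (fun x => f x ^ N) := by
  induction N with
  | zero => simpa using TP.const 1
  | succ N ih => simpa only [pow_succ] using ih.mul hf

lemma TP.shift_sub {f : E3 → ℝ} (hf : TP f) (l : E3) : TP (fun x => f (x - l)) := by
  refine TP.induction (P := fun f => TP (fun x => f (x - l))) (fun n θ => ?_)
    (fun f f' hf hf' h1 h2 => h1.add h2) (fun c f hf h => h.const_mul c) hf
  convert wave_mem n (θ - phase n l) using 2 with x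
  simp only [wave, phase_sub]; ring_nf

/-- Separation of variables. It makes convolutions with trigonometric polynomials trigonometric
polynomials, and later turns correlations into products of moments. -/
lemma wave_sub (n : Fin 3 → ℤ) (θ : ℝ) (x y : E3) :
    wave n θ (y - x) = wave n (-θ) x * wave n 0 y
      + wave n (-θ - Real.pi / 2) x * wave n (-(Real.pi / 2)) y := by
  simp only [wave, phase_sub, add_zero]
  rw [show phase n y - phase n x + θ = phase n y - (phase n x + -θ) by ring, Real.cos_sub,
    show phase n x + (-θ - Real.pi / 2) = (phase n x + -θ) - Real.pi / 2 by ring,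
    Real.cos_sub_pi_div_two, ← sub_eq_add_neg (phase n y), Real.cos_sub_pi_div_two]
  ring

lemma wave_add_pi (n : Fin 3 → ℤ) (θ : ℝ) (x : E3) : wave n (θ + Real.pi) x = - wave n θ x := by
  rw [wave, ← add_assoc, Real.cos_add_pi, wave]

/-! ### Convolution with trigonometric polynomials -/

/-- The correlation `x ↦ ∫ e(y - x) f(y) dy` over the torus. -/
def kerOp (e f : E3 → ℝ) (x : E3) : ℝ := ∫ y in cube, e (y - x) * f y

lemma integrable_sp_mul {e f : E3 → ℝ} (he : SP e) (hf : IntegrableOn f cube) :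
    IntegrableOn (fun y => e y * f y) cube := by
  obtain ⟨C, -, hC⟩ := he.exists_bound
  exact hf.bdd_mul he.continuous.aestronglyMeasurable (Eventually.of_forall hC)

lemma kerOp_wave {f : E3 → ℝ} (hf : IntegrableOn f cube) (n : Fin 3 → ℤ) (θ : ℝ) (x : E3) :
    kerOp (wave n θ) f x = (∫ y in cube, wave n 0 y * f y) * wave n (-θ) x
      + (∫ y in cube, wave n (-(Real.pi / 2)) y * f y) * wave n (-θ - Real.pi / 2) x := by
  simp only [kerOp, wave_sub]
  have : ∀ y, (wave n (-θ) x * wave n 0 y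
      + wave n (-θ - Real.pi / 2) x * wave n (-(Real.pi / 2)) y) * f y
      = wave n (-θ) x * (wave n 0 y * f y)
      + wave n (-θ - Real.pi / 2) x * (wave n (-(Real.pi / 2)) y * f y) := fun y => by ring
  simp only [this]
  rw [integral_add ((integrable_sp_mul (wave_sp _ _) hf).const_mul _)
    ((integrable_sp_mul (wave_sp _ _) hf).const_mul _), integral_const_mul, integral_const_mul]
  ring

lemma kerOp_add_left {e e' f : E3 → ℝ} (he : SP e) (he' : SP e') (hf : IntegrableOn f cube) :
    kerOp (fun x => e x + e' x) f = fun x => kerOp e f x + kerOp e' f x := by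
  ext x
  simp only [kerOp, add_mul]
  exact integral_add (integrable_sp_mul (he.shift_sub x) hf) (integrable_sp_mul (he'.shift_sub x) hf)

lemma kerOp_const_mul_left (e f : E3 → ℝ) (c : ℝ) :
    kerOp (fun x => c * e x) f = fun x => c * kerOp e f x := by
  ext x
  simp only [kerOp, mul_assoc, integral_const_mul]

/-- Everything is linear in `e`, and for a plane wave the convolution is explicit. The sign comes
from differentiating `e (y - x)` in `x`. -/
lemma kerOp_spec {e f : E3 → ℝ} (he : TP e) (hf : IntegrableOn f cube) :
    TP (kerOp e f) ∧ ∀ i, pd i (kerOp e f) = fun x => - kerOp (pd i e) f x := by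
  refine TP.induction
    (P := fun e => TP (kerOp e f) ∧ ∀ i, pd i (kerOp e f) = fun x => - kerOp (pd i e) f x)
    (fun n θ => ?_) (fun e e' he he' h1 h2 => ?_) (fun c e he h => ?_) he
  · have e1 : kerOp (wave n θ) f = fun x => (∫ y in cube, wave n 0 y * f y) * wave n (-θ) x
      + (∫ y in cube, wave n (-(Real.pi / 2)) y * f y) * wave n (-θ - Real.pi / 2) x :=
      funext fun x => kerOp_wave hf n θ x
    refine ⟨?_, fun i => ?_⟩
    · rw [e1]; exact ((wave_mem _ _).const_mul _).add ((wave_mem _ _).const_mul _)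
    · rw [e1, pd_add ((wave_sp _ _).const_mul _).differentiable
        ((wave_sp _ _).const_mul _).differentiable, pd_const_mul (wave_sp _ _).differentiable,
        pd_const_mul (wave_sp _ _).differentiable, pd_wave, pd_wave, pd_wave, kerOp_const_mul_left]
      ext x
      beta_reduce
      rw [kerOp_wave hf]
      have a1 : wave n (-θ + Real.pi / 2) x = - wave n (-(θ + Real.pi / 2)) x := by
        rw [← wave_add_pi]; congr 1; ring
      have a2 : wave n (-θ - Real.pi / 2 + Real.pi / 2) x
          = - wave n (-(θ + Real.pi / 2) - Real.pi / 2) x := by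
        rw [← wave_add_pi]; congr 1; ring
      rw [a1, a2]; ring
  · rw [kerOp_add_left he.sp he'.sp hf]
    refine ⟨h1.1.add h2.1, fun i => ?_⟩
    rw [pd_add h1.1.sp.differentiable h2.1.sp.differentiable, h1.2, h2.2,
      pd_add he.sp.differentiable he'.sp.differentiable, kerOp_add_left (he.sp.pd i) (he'.sp.pd i) hf]
    ext x; ring
  · rw [kerOp_const_mul_left]
    refine ⟨h.1.const_mul c, fun i => ?_⟩
    rw [pd_const_mul h.1.sp.differentiable, h.2, pd_const_mul he.sp.differentiable,
      kerOp_const_mul_left]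
    ext x; ring

lemma kerOp_mem {e f : E3 → ℝ} (he : TP e) (hf : IntegrableOn f cube) : TP (kerOp e f) :=
  (kerOp_spec he hf).1

lemma pd_kerOp {e f : E3 → ℝ} (he : TP e) (hf : IntegrableOn f cube) (i : Fin 3) :
    pd i (kerOp e f) = fun x => - kerOp (pd i e) f x := (kerOp_spec he hf).2 i

/-- Weak derivatives (tested against trigonometric polynomials) commute with the convolution. -/
lemma kerOp_pd_eq_neg {e f g : E3 → ℝ} (he : TP e) {i : Fin 3}
    (h : ∀ θ, TP θ → ∫ x in cube, f x * pd i θ x = - ∫ x in cube, g x * θ x) (x : E3) :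
    kerOp (pd i e) f x = - kerOp e g x := by
  have := h _ (he.shift_sub x)
  simp only [kerOp]
  simp only [pd_shift_sub] at this
  simpa only [mul_comm] using this

lemma pd_kerOp_of_weak {e f g : E3 → ℝ} (he : TP e) (hf : IntegrableOn f cube) {i : Fin 3}
    (h : ∀ θ, TP θ → ∫ x in cube, f x * pd i θ x = - ∫ x in cube, g x * θ x) :
    pd i (kerOp e f) = kerOp e g := by
  rw [pd_kerOp he hf]
  ext x
  rw [kerOp_pd_eq_neg he h, neg_neg]

lemma kerOp_eq_shift {e f : E3 → ℝ} (he : Per e) (hf : Per f) (x : E3) :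
    kerOp e f x = ∫ l in cube, e l * f (x + l) := by
  have h : Per fun y => e (y - x) * f y := fun y i => by
    simp only [hf y i, he.shift_sub x y i]
  rw [kerOp, ← integral_shift h x]
  simp only [add_sub_cancel_right]
  simp only [add_comm]

/-! ### A trigonometric approximation of the identity -/

/-- `(1 + cos (2π x_i)) / 2`. -/
def peakFactor (i : Fin 3) (x : E3) : ℝ := 1 / 2 * (1 + wave (Pi.single i 1) 0 x)

/-- `∏_i (1 + cos (2π x_i)) / 2`, which has its maximum `1` at the lattice points only. -/
def peakBase (x : E3) : ℝ := peakFactor 0 x * peakFactor 1 x * peakFactor 2 x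

/-- The normalised powers of `peakBase`. -/
def peakKer (N : ℕ) (x : E3) : ℝ := (∫ y in cube, peakBase y ^ N)⁻¹ * peakBase x ^ N

lemma peakFactor_eq (i : Fin 3) (x : E3) :
    peakFactor i x = 1 / 2 * (1 + Real.cos (2 * Real.pi * x i)) := by
  rw [peakFactor, wave, phase]
  congr 3
  rw [Finset.sum_eq_single i]
  · simp
  · intro j _ hj; simp [Pi.single_eq_of_ne hj]
  · simp

lemma tp_peakFactor (i : Fin 3) : TP (peakFactor i) :=
  TP.const_mul (TP.add (TP.const 1) (wave_mem _ _)) _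

lemma tp_peakBase : TP peakBase := TP.mul (TP.mul (tp_peakFactor 0) (tp_peakFactor 1)) (tp_peakFactor 2)

lemma tp_peakKer (N : ℕ) : TP (peakKer N) := TP.const_mul (TP.pow tp_peakBase N) _

lemma peakFactor_mem (i : Fin 3) (x : E3) : peakFactor i x ∈ Icc (0 : ℝ) 1 := by
  rw [peakFactor_eq]
  constructor <;> linarith [Real.neg_one_le_cos (2 * Real.pi * x i), Real.cos_le_one (2 * Real.pi * x i)]

lemma peakBase_nonneg (x : E3) : 0 ≤ peakBase x :=
  mul_nonneg (mul_nonneg (peakFactor_mem 0 x).1 (peakFactor_mem 1 x).1) (peakFactor_mem 2 x).1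

/-- On `[-1/2, 1/2]³` the origin is the only maximum point. Uniqueness is what makes the normalised
powers concentrate there. -/
lemma peakBase_lt_one {x : E3} (hx : ∀ i, |x i| ≤ 1 / 2) (h : x ≠ 0) : peakBase x < 1 := by
  have h0 : ∃ i, x i ≠ 0 := by
    by_contra! h'
    exact h (by ext i; simpa using h' i)
  obtain ⟨i, hi⟩ := h0
  have h1 : peakFactor i x < 1 := by
    refine lt_of_le_of_ne (peakFactor_mem i x).2 fun he => hi ?_
    rw [peakFactor_eq] at he
    have h2 := abs_le.1 (hx i)
    have hc : Real.cos (2 * Real.pi * x i) = 1 := by linarith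
    rw [Real.cos_eq_one_iff_of_lt_of_lt] at hc
    · have := Real.pi_pos
      rcases mul_eq_zero.1 hc with h3 | h3
      · linarith
      · exact h3
    · nlinarith [Real.pi_pos]
    · nlinarith [Real.pi_pos]
  have a := peakFactor_mem 0 x
  have b := peakFactor_mem 1 x
  have c := peakFactor_mem 2 x
  have hab : peakFactor 0 x * peakFactor 1 x ≤ 1 := mul_le_one₀ a.2 b.1 b.2
  have hab0 : 0 ≤ peakFactor 0 x * peakFactor 1 x := mul_nonneg a.1 b.1
  rw [peakBase]
  fin_cases i
  · simp only [Fin.zero_eta] at h1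
    nlinarith [mul_le_of_le_one_right a.1 b.2, mul_le_of_le_one_right hab0 c.2]
  · simp only [Fin.mk_one] at h1
    nlinarith [mul_le_of_le_one_left b.1 a.2, mul_le_of_le_one_right hab0 c.2]
  · simp only [Fin.reduceFinMk] at h1
    nlinarith [mul_le_of_le_one_left c.1 hab]

lemma peakBase_zero : peakBase 0 = 1 := by
  simp [peakBase, peakFactor_eq]; norm_num

/-- The closed unit cube. -/
def closedCube : Set E3 := WithLp.ofLp ⁻¹' (Set.pi univ fun _ => Icc (0 : ℝ) 1)

/-- The centre of the cube. -/
def centre : E3 := WithLp.toLp 2 fun _ => 1 / 2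

lemma isCompact_closedCube : IsCompact closedCube :=
  (PiLp.homeomorph 2 fun _ : Fin 3 => ℝ).isCompact_preimage.2 (isCompact_univ_pi fun _ => isCompact_Icc)

lemma closedCube_ae_eq : (closedCube : Set E3) =ᵐ[volume] cube := by
  refine (ae_eq_of_subset_of_measure_ge (fun x hx => ?_) ?_ measurableSet_cube.nullMeasurableSet
    ?_).symm
  · exact fun i _ => ⟨(hx i).1, (hx i).2.le⟩
  · rw [volume_cube, closedCube, (PiLp.volume_preserving_ofLp (Fin 3)).measure_preimage]
    · simp [Real.volume_Icc_pi, Set.pi_univ_Icc]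
    · exact (MeasurableSet.univ_pi fun _ => measurableSet_Icc).nullMeasurableSet
  · exact isCompact_closedCube.measure_lt_top.ne

lemma mem_interior_closedCube : centre ∈ interior closedCube := by
  have : IsOpen (WithLp.ofLp ⁻¹' (Set.pi univ fun _ => Ioo (0 : ℝ) 1) : Set E3) :=
    (isOpen_set_pi finite_univ fun _ _ => isOpen_Ioo).preimage (PiLp.continuous_ofLp 2 _)
  refine mem_interior.2 ⟨WithLp.ofLp ⁻¹' (Set.pi univ fun _ => Ioo (0 : ℝ) 1),
    preimage_mono (pi_mono fun _ _ => Ioo_subset_Icc_self), this, fun i _ => ?_⟩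
  simp [centre]; norm_num

/-- Powers of a function with a unique maximum concentrate at the maximum point. The picture is
translated by `centre` because the origin is a corner of the cube, while the peak must lie in the
closure of the interior of a compact set that contains a full neighbourhood. -/
lemma tendsto_integral_peakKer {W : E3 → ℝ} (hW : Per W) (hi : IntegrableOn W cube)
    (hc : ContinuousAt W 0) :
    Tendsto (fun N => ∫ l in cube, peakKer N l * W l) atTop (𝓝 (W 0)) := by
  have hcont : Continuous fun x => peakBase (x - centre) :=
    tp_peakBase.sp.continuous.comp (continuous_id.sub continuous_const)
  have habs : ∀ x ∈ closedCube, ∀ i, |(x - centre) i| ≤ 1 / 2 := fun x hx i => by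
    have := hx i (mem_univ i)
    simp only [PiLp.sub_apply, centre]
    rw [abs_le]; constructor <;> linarith [this.1, this.2]
  have key := tendsto_setIntegral_pow_smul_of_unique_maximum_of_isCompact_of_integrableOn
    (μ := (volume : Measure E3)) (g := fun x => W (x - centre)) (x₀ := centre)
    isCompact_closedCube (c := fun x => peakBase (x - centre)) hcont.continuousOn
    (fun y hy hne => by
      rw [sub_self, peakBase_zero]
      exact peakBase_lt_one (habs y hy) (sub_ne_zero.2 hne))
    (fun x _ => peakBase_nonneg _) (by rw [sub_self, peakBase_zero]; exact one_pos)
    (subset_closure mem_interior_closedCube)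
    (by
      have := integrable_shift hW (-centre) hi
      rw [← integrableOn_congr_set_ae closedCube_ae_eq] at this
      simpa [sub_eq_add_neg] using this)
    (by
      have h1 : ContinuousAt (fun x => W (x - centre)) centre := by
        refine ContinuousAt.comp (f := fun x => x - centre) (g := W) ?_ (by fun_prop)
        simpa using hc
      exact h1.continuousWithinAt)
  simp only [setIntegral_congr_set closedCube_ae_eq, sub_self] at key
  refine key.congr fun N => ?_
  have e1 : ∫ x in cube, peakBase (x - centre) ^ N = ∫ x in cube, peakBase x ^ N := by
    have := integral_shift (f := fun x => peakBase x ^ N) (tp_peakBase.sp.per.comp (· ^ N)) (-centre)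
    simpa [sub_eq_add_neg] using this
  have e2 : ∫ x in cube, peakBase (x - centre) ^ N • W (x - centre)
      = ∫ x in cube, peakBase x ^ N * W x := by
    have := integral_shift (f := fun x => peakBase x ^ N * W x)
      (fun x i => by simp only [tp_peakBase.sp.per x i, hW x i]) (-centre)
    simpa [sub_eq_add_neg] using this
  rw [e1, e2, smul_eq_mul, ← integral_const_mul]
  simp only [peakKer, mul_assoc]

lemma integral_peakBase_pos (N : ℕ) : 0 < ∫ y in cube, peakBase y ^ N := by
  have hc : Continuous fun x => peakBase x ^ N := tp_peakBase.sp.continuous.pow N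
  have hn : ∀ x, 0 ≤ peakBase x ^ N := fun x => pow_nonneg (peakBase_nonneg x) N
  rw [← setIntegral_congr_set closedCube_ae_eq]
  have hu : IsOpen {x : E3 | 0 < peakBase (x - 0)} := isOpen_lt continuous_const
    (tp_peakBase.sp.continuous.comp (continuous_id.sub continuous_const))
  have h0 : (0 : E3) ∈ closure (interior closedCube) := by
    have hcvx : Convex ℝ closedCube := by
      intro x hx y hy a b ha hb hab i _
      have h1 := hx i (mem_univ i)
      have h2 := hy i (mem_univ i)
      simp only [PiLp.add_apply, PiLp.smul_apply, smul_eq_mul]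
      constructor
      · nlinarith [h1.1, h2.1]
      · nlinarith [h1.2, h2.2]
    rw [hcvx.closure_interior_eq_closure_of_nonempty_interior ⟨_, mem_interior_closedCube⟩]
    exact subset_closure fun i _ => by simp
  have hpos := IsOpen.measure_pos volume (hu.inter isOpen_interior)
    (mem_closure_iff.1 h0 _ hu (by simp [peakBase_zero]))
  rw [setIntegral_pos_iff_support_of_nonneg_ae (Eventually.of_forall hn)
    (hc.continuousOn.integrableOn_compact isCompact_closedCube)]
  refine hpos.trans_le (measure_mono fun x hx => ⟨?_, interior_subset hx.2⟩)
  have := hx.1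
  simp only [sub_zero, mem_ofPred_eq] at this
  exact (pow_pos this N).ne'

lemma peakKer_nonneg (N : ℕ) (x : E3) : 0 ≤ peakKer N x :=
  mul_nonneg (inv_nonneg.2 (integral_peakBase_pos N).le) (pow_nonneg (peakBase_nonneg x) N)

lemma integral_peakKer (N : ℕ) : ∫ x in cube, peakKer N x = 1 := by
  simp only [peakKer, integral_const_mul]
  exact inv_mul_cancel₀ (integral_peakBase_pos N).ne'

/-- Convolution with the trigonometric approximation of the identity. -/
def conv (N : ℕ) (f : E3 → ℝ) : E3 → ℝ := kerOp (peakKer N) f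

lemma conv_eq {f : E3 → ℝ} (hf : Per f) (N : ℕ) (x : E3) :
    conv N f x = ∫ l in cube, peakKer N l * f (x + l) :=
  kerOp_eq_shift (tp_peakKer N).sp.per hf x

lemma tp_conv {f : E3 → ℝ} (hf : IntegrableOn f cube) (N : ℕ) : TP (conv N f) :=
  kerOp_mem (tp_peakKer N) hf

/-- The probability measure `K_N dx` on the cube. -/
def peakMeasure (N : ℕ) : Measure E3 :=
  (volume.restrict cube).withDensity fun l => ENNReal.ofReal (peakKer N l)

lemma measurable_ofReal_peakKer (N : ℕ) : Measurable fun l => ENNReal.ofReal (peakKer N l) :=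
  (tp_peakKer N).sp.continuous.measurable.ennreal_ofReal

instance (N : ℕ) : IsProbabilityMeasure (peakMeasure N) := by
  refine ⟨?_⟩
  rw [peakMeasure, withDensity_apply _ MeasurableSet.univ, Measure.restrict_univ,
    ← ofReal_integral_eq_lintegral_ofReal (tp_peakKer N).sp.integrableOn
      (Eventually.of_forall (peakKer_nonneg N)), integral_peakKer, ENNReal.ofReal_one]

lemma integral_peakMeasure (N : ℕ) (g : E3 → ℝ) :
    ∫ l, g l ∂(peakMeasure N) = ∫ l in cube, peakKer N l * g l := by
  rw [peakMeasure, integral_withDensity_eq_integral_toReal_smul (measurable_ofReal_peakKer N)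
    (Eventually.of_forall fun _ => ENNReal.ofReal_lt_top)]
  simp only [ENNReal.toReal_ofReal (peakKer_nonneg N _), smul_eq_mul]

lemma peakMeasure_ac (N : ℕ) : peakMeasure N ≪ volume.restrict cube :=
  withDensity_absolutelyContinuous _ _

lemma aesm_shift_left {F : Type*} [NormedAddCommGroup F] {f : E3 → F} (hf : Per f)
    (h : AEStronglyMeasurable f (volume.restrict cube)) (x : E3) (N : ℕ) :
    AEStronglyMeasurable (fun l => f (x + l)) (peakMeasure N) := by
  simpa only [add_comm] using (aesm_shift hf h x).mono_ac (peakMeasure_ac N)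

/-- Jensen's inequality for an average. -/
lemma enorm_integral_rpow_le {α : Type*} [MeasurableSpace α] {μ : Measure α}
    [IsProbabilityMeasure μ] {g : α → ℝ} (hg : AEStronglyMeasurable g μ) {p : ℝ≥0∞} (h1 : 1 ≤ p)
    (hp : p ≠ ⊤) : ‖∫ l, g l ∂μ‖ₑ ^ p.toReal ≤ ∫⁻ l, ‖g l‖ₑ ^ p.toReal ∂μ := by
  have h0 : p ≠ 0 := (zero_lt_one.trans_le h1).ne'
  have hpos : 0 < p.toReal := ENNReal.toReal_pos h0 hp
  have h2 : ‖∫ l, g l ∂μ‖ₑ ≤ eLpNorm g p μ :=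
    (enorm_integral_le_lintegral_enorm g).trans (by
      rw [← eLpNorm_one_eq_lintegral_enorm]
      exact eLpNorm_le_eLpNorm_of_exponent_le h1 hg)
  rw [eLpNorm_eq_lintegral_rpow_enorm_toReal h0 hp] at h2
  have h3 := ENNReal.rpow_le_rpow h2 hpos.le
  rwa [← ENNReal.rpow_mul, one_div, inv_mul_cancel₀ hpos.ne', ENNReal.rpow_one] at h3

lemma aesm_add_prod {F : Type*} [NormedAddCommGroup F] {f : E3 → F} (hf : Per f)
    (h : AEStronglyMeasurable f (volume.restrict cube)) (N : ℕ) :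
    AEStronglyMeasurable (fun z : E3 × E3 => f (z.1 + z.2))
      ((volume.restrict cube).prod (peakMeasure N)) := by
  have h1 := (aesm_univ hf h).comp_quasiMeasurePreserving
    (quasiMeasurePreserving_add (volume : Measure E3) (volume : Measure E3))
  refine h1.mono_ac (Measure.AbsolutelyContinuous.prod Measure.restrict_le_self.absolutelyContinuous
    ((peakMeasure_ac N).trans Measure.restrict_le_self.absolutelyContinuous))

/-- The convolution is an average of translates: Jensen for the probability measure `peakMeasure N`,
then Tonelli and translation invariance. -/
lemma eLpNorm_conv_le {f : E3 → ℝ} (hf : Per f) {p : ℝ≥0∞} (h1 : 1 ≤ p) (hp : p ≠ ⊤)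
    (h : AEStronglyMeasurable f (volume.restrict cube)) (N : ℕ) :
    eLpNorm (conv N f) p (volume.restrict cube) ≤ eLpNorm f p (volume.restrict cube) := by
  have h0 : p ≠ 0 := (zero_lt_one.trans_le h1).ne'
  rw [eLpNorm_eq_lintegral_rpow_enorm_toReal h0 hp, eLpNorm_eq_lintegral_rpow_enorm_toReal h0 hp]
  refine ENNReal.rpow_le_rpow ?_ (by positivity)
  calc ∫⁻ x in cube, ‖conv N f x‖ₑ ^ p.toReal
      ≤ ∫⁻ x in cube, ∫⁻ l, ‖f (x + l)‖ₑ ^ p.toReal ∂(peakMeasure N) := by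
        refine lintegral_mono fun x => ?_
        rw [conv_eq hf, ← integral_peakMeasure]
        exact enorm_integral_rpow_le (aesm_shift_left hf h x N) h1 hp
    _ = ∫⁻ l, (∫⁻ x in cube, ‖f (x + l)‖ₑ ^ p.toReal) ∂(peakMeasure N) :=
        lintegral_lintegral_swap (f := fun x l => ‖f (x + l)‖ₑ ^ p.toReal)
          ((aesm_add_prod hf h N).enorm.pow_const _)
    _ = ∫⁻ x in cube, ‖f x‖ₑ ^ p.toReal := by
        have : ∀ l, ∫⁻ x in cube, ‖f (x + l)‖ₑ ^ p.toReal = ∫⁻ x in cube, ‖f x‖ₑ ^ p.toReal :=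
          fun l => lintegral_shift (hf.comp fun y => ‖y‖ₑ ^ p.toReal) l
        simp only [this]
        simp

/-- By Jensen and Tonelli the `p`-th power of the norm is at most the `peakMeasure N`-average of `W
l = ‖f(· + l) - f‖_p ^ p`. This `W` is bounded, continuous at `0` and zero there, so its averages
tend to zero. -/
lemma tendsto_eLpNorm_conv {f : E3 → ℝ} (hf : Per f) {p : ℝ≥0∞} (h1 : 1 ≤ p) (hp : p ≠ ⊤)
    (h : MemLp f p (volume.restrict cube)) :
    Tendsto (fun N => eLpNorm (fun x => conv N f x - f x) p (volume.restrict cube)) atTop (𝓝 0) := by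
  have h0 : p ≠ 0 := (zero_lt_one.trans_le h1).ne'
  have hpos : 0 < p.toReal := ENNReal.toReal_pos h0 hp
  set W : E3 → ℝ≥0∞ := fun l => ∫⁻ x in cube, ‖f (x + l) - f x‖ₑ ^ p.toReal with hWdef
  have hint : IntegrableOn f cube := h.integrable h1
  have hle : ∀ N, ∫⁻ x in cube, ‖conv N f x - f x‖ₑ ^ p.toReal ≤ ∫⁻ l, W l ∂(peakMeasure N) := by
    intro N
    have hm : AEStronglyMeasurable (fun z : E3 × E3 => f (z.1 + z.2) - f z.1)
        ((volume.restrict cube).prod (peakMeasure N)) :=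
      (aesm_add_prod hf h.1 N).sub h.1.comp_fst
    calc ∫⁻ x in cube, ‖conv N f x - f x‖ₑ ^ p.toReal
        ≤ ∫⁻ x in cube, ∫⁻ l, ‖f (x + l) - f x‖ₑ ^ p.toReal ∂(peakMeasure N) := by
          refine lintegral_mono fun x => ?_
          have e : conv N f x - f x = ∫ l, (f (x + l) - f x) ∂(peakMeasure N) := by
            rw [integral_sub _ (integrable_const _), integral_peakMeasure, ← conv_eq hf]
            · simp
            · have := integrable_sp_mul (tp_peakKer N).sp (integrable_shift hf x hint)
              rw [IntegrableOn] at this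
              rw [peakMeasure, integrable_withDensity_iff_integrable_smul₀'
                (measurable_ofReal_peakKer N).aemeasurable
                (Eventually.of_forall fun _ => ENNReal.ofReal_lt_top)]
              simpa only [ENNReal.toReal_ofReal (peakKer_nonneg N _), smul_eq_mul, add_comm] using this
          rw [e]
          exact enorm_integral_rpow_le ((aesm_shift_left hf h.1 x N).sub aestronglyMeasurable_const)
            h1 hp
      _ = ∫⁻ l, W l ∂(peakMeasure N) := lintegral_lintegral_swap (hm.enorm.pow_const _)
  have hWper : Per W := fun l i => by
    simp only [hWdef, ← add_assoc, hf _ i]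
  have hWeq : ∀ l, W l = (eLpNorm (fun x => f (x + l) - f x) p (volume.restrict cube)) ^ p.toReal := by
    intro l
    rw [eLpNorm_eq_lintegral_rpow_enorm_toReal h0 hp, ← ENNReal.rpow_mul, one_div,
      inv_mul_cancel₀ hpos.ne', ENNReal.rpow_one]
  have hWb : ∀ l, W l ≤ (eLpNorm f p (volume.restrict cube) + eLpNorm f p (volume.restrict cube)) ^ p.toReal := by
    intro l
    rw [hWeq]
    refine ENNReal.rpow_le_rpow ?_ hpos.le
    refine (eLpNorm_sub_le (aesm_shift hf h.1 l) h.1 h1).trans ?_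
    rw [eLpNorm_shift hf l hp]
  have hBtop : (eLpNorm f p (volume.restrict cube) + eLpNorm f p (volume.restrict cube)) ^ p.toReal ≠ ⊤ :=
    ENNReal.rpow_ne_top_of_nonneg hpos.le (ENNReal.add_ne_top.2 ⟨h.2.ne, h.2.ne⟩)
  have hWtop : ∀ l, W l ≠ ⊤ := fun l => ne_top_of_le_ne_top hBtop (hWb l)
  have hW0 : W 0 = 0 := by
    simp only [hWdef, add_zero, sub_self, enorm_zero]
    simp [hpos]
  have hWt : Tendsto W (𝓝 0) (𝓝 0) := by
    have h2 := ((ENNReal.continuous_rpow_const (y := p.toReal)).tendsto 0).comp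
      (tendsto_eLpNorm_shift hf h1 hp h)
    rw [ENNReal.zero_rpow_of_pos hpos] at h2
    exact h2.congr fun l => (hWeq l).symm
  have hWm : AEMeasurable W (volume.restrict cube) := by
    have hm : AEStronglyMeasurable (fun z : E3 × E3 => f (z.2 + z.1) - f z.2)
        ((volume.restrict cube).prod (volume.restrict cube)) := by
      refine AEStronglyMeasurable.sub ?_ h.1.comp_snd
      have h1 := (aesm_univ hf h.1).comp_quasiMeasurePreserving
        (quasiMeasurePreserving_add (volume : Measure E3) (volume : Measure E3))
      have h3 := h1.mono_ac (Measure.AbsolutelyContinuous.prod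
        (Measure.restrict_le_self (s := cube)).absolutelyContinuous
        (Measure.restrict_le_self (s := cube)).absolutelyContinuous)
      simpa only [Function.comp_def, add_comm] using h3
    exact (hm.enorm.pow_const p.toReal).lintegral_prod_right'
  have hlim := tendsto_integral_peakKer (W := fun l => (W l).toReal) (hWper.comp ENNReal.toReal)
    (Integrable.of_bound hWm.ennreal_toReal.aestronglyMeasurable _
      (Eventually.of_forall fun l => by
        rw [Real.norm_of_nonneg ENNReal.toReal_nonneg]
        exact ENNReal.toReal_mono hBtop (hWb l)))
    (by
      have := (ENNReal.tendsto_toReal (hWtop 0))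
      rw [ContinuousAt]
      exact this.comp (by rw [hW0]; exact hWt))
  simp only [hW0, ENNReal.toReal_zero] at hlim
  have hup : Tendsto (fun N => ∫⁻ l, W l ∂(peakMeasure N)) atTop (𝓝 0) := by
    have h3 := (ENNReal.continuous_ofReal.tendsto 0).comp hlim
    rw [ENNReal.ofReal_zero] at h3
    refine h3.congr fun N => ?_
    simp only [Function.comp]
    rw [← integral_peakMeasure, integral_toReal (hWm.mono_ac (peakMeasure_ac N))
      (Eventually.of_forall fun l => (hWtop l).lt_top), ENNReal.ofReal_toReal]
    refine ne_top_of_le_ne_top hBtop ((lintegral_mono hWb).trans ?_)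
    simp
  have hlow := tendsto_of_tendsto_of_tendsto_of_le_of_le tendsto_const_nhds hup
    (fun _ => zero_le) hle
  have h4 := ((ENNReal.continuous_rpow_const (y := 1 / p.toReal)).tendsto 0).comp hlow
  rw [ENNReal.zero_rpow_of_pos (by positivity)] at h4
  refine h4.congr fun N => ?_
  rw [eLpNorm_eq_lintegral_rpow_enorm_toReal h0 hp]
  rfl

lemma tendsto_conv {f : E3 → ℝ} (hf : Per f) (hc : Continuous f) (x : E3) :
    Tendsto (fun N => conv N f x) atTop (𝓝 (f x)) := by
  have h := tendsto_integral_peakKer (W := fun l => f (x + l))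
    (by simpa only [add_comm] using hf.shift x)
    (by simpa only [add_comm] using integrable_shift hf x (hf.integrableOn hc))
    (hc.comp (by fun_prop)).continuousAt
  simp only [add_zero] at h
  exact h.congr fun N => (conv_eq hf N x).symm

lemma abs_conv_le {f : E3 → ℝ} (hf : Per f) {C : ℝ} (hC : ∀ x, |f x| ≤ C) (N : ℕ) (x : E3) :
    |conv N f x| ≤ C := by
  rw [conv_eq hf, ← integral_peakMeasure, ← Real.norm_eq_abs]
  have := norm_integral_le_of_norm_le_const (μ := peakMeasure N) (f := fun l => f (x + l)) (C := C)
    (Eventually.of_forall fun l => hC (x + l))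
  simpa using this

lemma pd_conv {f g : E3 → ℝ} (hf : IntegrableOn f cube) {i : Fin 3}
    (h : ∀ θ, TP θ → ∫ x in cube, f x * pd i θ x = - ∫ x in cube, g x * θ x) (N : ℕ) :
    pd i (conv N f) = conv N g := pd_kerOp_of_weak (tp_peakKer N) hf h

lemma pd_conv_sp {f : E3 → ℝ} (hf : SP f) (i : Fin 3) (N : ℕ) :
    pd i (conv N f) = conv N (pd i f) :=
  pd_conv hf.integrableOn (fun θ hθ => by rw [integral_pd_mul hf hθ.sp, neg_neg]) N

/-! ### The heat flow of trigonometric polynomials -/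

/-- The Laplacian. -/
def lap (f : E3 → ℝ) (x : E3) : ℝ := ∑ i, pd i (pd i f) x

/-- The eigenvalue of `-Δ` on the plane waves of frequency `n`. -/
def eig (n : Fin 3 → ℤ) : ℝ := ∑ i, (n i * (2 * Real.pi)) ^ 2

/-- The heat evolution of a plane wave. -/
def heatWave (p : (Fin 3 → ℤ) × ℝ) (s : ℝ) (x : E3) : ℝ := Real.exp (-(eig p.1) * s) * wave p.1 p.2 x

/-- Heat flows of trigonometric polynomials. -/
def HF (U : ℝ → E3 → ℝ) : Prop := U ∈ Submodule.span ℝ (range heatWave)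

lemma HF.induction {P : (ℝ → E3 → ℝ) → Prop} (hw : ∀ n θ, P (heatWave (n, θ)))
    (hadd : ∀ f g, HF f → HF g → P f → P g → P (fun s x => f s x + g s x))
    (hsmul : ∀ (c : ℝ) f, HF f → P f → P (fun s x => c * f s x)) {f : ℝ → E3 → ℝ} (hf : HF f) :
    P f := by
  refine Submodule.span_induction (p := fun f _ => P f) ?_ ?_ ?_ ?_ hf
  · rintro _ ⟨p, rfl⟩; exact hw _ _
  · have := hsmul 0 _ (Submodule.subset_span ⟨(0, 0), rfl⟩) (hw 0 0)
    simp only [zero_mul] at this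
    exact this
  · exact fun f g hf hg h1 h2 => hadd f g hf hg h1 h2
  · exact fun c f hf h => hsmul c f hf h

lemma hf_heatWave (p : (Fin 3 → ℤ) × ℝ) : HF (heatWave p) := Submodule.subset_span ⟨p, rfl⟩

lemma HF.add {f g : ℝ → E3 → ℝ} (hf : HF f) (hg : HF g) : HF (fun s x => f s x + g s x) :=
  Submodule.add_mem _ hf hg

lemma HF.const_mul {f : ℝ → E3 → ℝ} (hf : HF f) (c : ℝ) : HF (fun s x => c * f s x) :=
  Submodule.smul_mem _ c hf

lemma HF.tp {f : ℝ → E3 → ℝ} (hf : HF f) (s : ℝ) : TP (f s) :=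
  HF.induction (P := fun f => TP (f s)) (fun n θ => TP.const_mul (wave_mem n θ) _)
    (fun _ _ _ _ h1 h2 => TP.add h1 h2) (fun c _ _ h => TP.const_mul h c) hf

lemma HF.continuous {f : ℝ → E3 → ℝ} (hf : HF f) : Continuous fun p : ℝ × E3 => f p.1 p.2 := by
  refine HF.induction (P := fun f => Continuous fun p : ℝ × E3 => f p.1 p.2) (fun n θ => ?_)
    (fun _ _ _ _ h1 h2 => h1.add h2) (fun c _ _ h => continuous_const.mul h) hf
  have := (wave_sp n θ).continuous
  simp only [heatWave]
  fun_prop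

lemma HF.pd {f : ℝ → E3 → ℝ} (hf : HF f) (i : Fin 3) : HF (fun s => pd i (f s)) := by
  refine HF.induction (P := fun f => HF (fun s => HallMHD.pd i (f s))) (fun n θ => ?_)
    (fun f g hf hg h1 h2 => ?_) (fun c f hf h => ?_) hf
  · have : (fun s => HallMHD.pd i (heatWave (n, θ) s))
        = fun s x => (n i * (2 * Real.pi)) * heatWave (n, θ + Real.pi / 2) s x := by
      ext s x
      have := congrFun (pd_const_mul (wave_sp n θ).differentiable (Real.exp (-(eig n) * s)) i) x
      rw [pd_wave] at this
      simp only [heatWave]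
      refine this.trans ?_
      ring
    rw [this]
    exact (hf_heatWave _).const_mul _
  · have : (fun s => HallMHD.pd i fun x => f s x + g s x)
        = fun s x => HallMHD.pd i (f s) x + HallMHD.pd i (g s) x :=
      funext fun s => pd_add (hf.tp s).sp.differentiable (hg.tp s).sp.differentiable i
    rw [this]; exact h1.add h2
  · have : (fun s => HallMHD.pd i fun x => c * f s x) = fun s x => c * HallMHD.pd i (f s) x :=
      funext fun s => pd_const_mul (hf.tp s).sp.differentiable c i
    rw [this]; exact h.const_mul c

lemma lap_add {f g : E3 → ℝ} (hf : SP f) (hg : SP g) :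
    lap (fun x => f x + g x) = fun x => lap f x + lap g x := by
  ext x
  simp only [lap, ← Finset.sum_add_distrib]
  refine Finset.sum_congr rfl fun i _ => ?_
  rw [pd_add hf.differentiable hg.differentiable,
    pd_add (hf.pd i).differentiable (hg.pd i).differentiable]

lemma lap_const_mul {f : E3 → ℝ} (hf : SP f) (c : ℝ) :
    lap (fun x => c * f x) = fun x => c * lap f x := by
  ext x
  simp only [lap, Finset.mul_sum]
  refine Finset.sum_congr rfl fun i _ => ?_
  rw [pd_const_mul hf.differentiable, pd_const_mul (hf.pd i).differentiable]

lemma pd_pd_wave (n : Fin 3 → ℤ) (θ : ℝ) (i k : Fin 3) :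
    pd i (pd k (wave n θ)) = fun x => -((n i * (2 * Real.pi)) * (n k * (2 * Real.pi))) * wave n θ x := by
  rw [pd_wave, pd_const_mul (wave_sp _ _).differentiable, pd_wave]
  ext x
  beta_reduce
  rw [show θ + Real.pi / 2 + Real.pi / 2 = θ + Real.pi by ring, wave_add_pi]
  ring

lemma lap_wave (n : Fin 3 → ℤ) (θ : ℝ) : lap (wave n θ) = fun x => -(eig n) * wave n θ x := by
  ext x
  simp only [lap, pd_pd_wave, eig, ← Finset.sum_mul, ← Finset.sum_neg_distrib, sq]

lemma SP.lap {f : E3 → ℝ} (hf : SP f) : SP (lap f) := SP.sum _ fun i _ => (hf.pd i).pd i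

lemma TP.lap {f : E3 → ℝ} (hf : TP f) : TP (lap f) := TP.sum _ fun i _ => (hf.pd i).pd i

lemma HF.heat {f : ℝ → E3 → ℝ} (hf : HF f) (s : ℝ) (x : E3) :
    HasDerivAt (fun s => f s x) (lap (f s) x) s := by
  refine HF.induction (P := fun f => HasDerivAt (fun s => f s x) (lap (f s) x) s) (fun n θ => ?_)
    (fun f g hf hg h1 h2 => ?_) (fun c f hf h => ?_) hf
  · have h1 : HasDerivAt (fun s => Real.exp (-(eig n) * s) * wave n θ x)
        (Real.exp (-(eig n) * s) * (-(eig n) * 1) * wave n θ x) s :=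
      (((hasDerivAt_id s).const_mul (-(eig n))).exp).mul_const _
    have e : lap (heatWave (n, θ) s) x = Real.exp (-(eig n) * s) * (-(eig n) * 1) * wave n θ x := by
      have := congrFun (lap_const_mul (wave_sp n θ) (Real.exp (-(eig n) * s))) x
      rw [lap_wave] at this
      refine Eq.trans this ?_
      ring
    rw [e]; exact h1
  · rw [lap_add (hf.tp s).sp (hg.tp s).sp]; exact h1.add h2
  · rw [lap_const_mul (hf.tp s).sp]; exact h.const_mul c

lemma eig_nonneg (n : Fin 3 → ℤ) : 0 ≤ eig n := Finset.sum_nonneg fun _ _ => sq_nonneg _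

lemma abs_wave_le (n : Fin 3 → ℤ) (θ : ℝ) (x : E3) : |wave n θ x| ≤ 1 := Real.abs_cos_le_one _

lemma HF.exists_bound {f : ℝ → E3 → ℝ} (hf : HF f) : ∃ C, ∀ s, 0 ≤ s → ∀ x, |f s x| ≤ C := by
  refine HF.induction (P := fun f => ∃ C, ∀ s, 0 ≤ s → ∀ x, |f s x| ≤ C) (fun n θ => ⟨1, ?_⟩)
    (fun f g hf hg ⟨C, hC⟩ ⟨C', hC'⟩ => ⟨C + C', fun s hs x => ?_⟩)
    (fun c f hf ⟨C, hC⟩ => ⟨|c| * C, fun s hs x => ?_⟩) hf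
  · intro s hs x
    rw [heatWave, abs_mul, Real.abs_exp]
    refine mul_le_one₀ (Real.exp_le_one_iff.2 ?_) (abs_nonneg _) (abs_wave_le _ _ _)
    nlinarith [eig_nonneg n]
  · exact (abs_add_le _ _).trans (add_le_add (hC s hs x) (hC' s hs x))
  · rw [abs_mul]; exact mul_le_mul_of_nonneg_left (hC s hs x) (abs_nonneg c)

/-- The spectral gap. The crude value `1` in place of `4π²` suffices for the decay `exp (-s)` of
heat flows without constant mode. -/
lemma one_le_eig {n : Fin 3 → ℤ} (hn : n ≠ 0) : 1 ≤ eig n := by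
  obtain ⟨i, hi⟩ : ∃ i, n i ≠ 0 := by
    by_contra! h; exact hn (funext h)
  have h1 : (1 : ℝ) ≤ (n i : ℝ) ^ 2 := by
    have : (1 : ℤ) ≤ n i ^ 2 := by
      have := sq_pos_of_ne_zero hi
      omega
    exact_mod_cast this
  have h2 : (n i * (2 * Real.pi)) ^ 2 ≤ eig n :=
    Finset.single_le_sum (f := fun i => (n i * (2 * Real.pi)) ^ 2) (fun _ _ => sq_nonneg _)
      (Finset.mem_univ i)
  have h3 := Real.pi_gt_three
  have h4 : 1 ≤ (2 * Real.pi) ^ 2 := by nlinarith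
  rw [mul_pow] at h2
  nlinarith [sq_nonneg (n i : ℝ)]

lemma exists_heatFlow {f : E3 → ℝ} (hf : TP f) : ∃ U, HF U ∧ U 0 = f := by
  refine TP.induction (P := fun f => ∃ U, HF U ∧ U 0 = f) (fun n θ => ⟨_, hf_heatWave (n, θ), ?_⟩)
    ?_ ?_ hf
  · ext x; simp [heatWave]
  · rintro f g - - ⟨U, hU, rfl⟩ ⟨V, hV, rfl⟩
    exact ⟨_, hU.add hV, rfl⟩
  · rintro c f - ⟨U, hU, rfl⟩
    exact ⟨_, hU.const_mul c, rfl⟩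

/-- The heat flow of `f` together with the decaying heat flow of `∂_i ∂_k Δ⁻¹ f`. -/
lemma exists_riesz_heatFlow {f : E3 → ℝ} (hf : TP f) (i k : Fin 3) :
    ∃ U V, HF U ∧ HF V ∧ U 0 = f ∧ (∀ s, lap (V s) = pd i (pd k (U s))) ∧
      ∃ C, ∀ s, 0 ≤ s → ∀ x, |V s x| ≤ C * Real.exp (-s) := by
  refine TP.induction (P := fun f => ∃ U V, HF U ∧ HF V ∧ U 0 = f ∧
    (∀ s, lap (V s) = pd i (pd k (U s))) ∧ ∃ C, ∀ s, 0 ≤ s → ∀ x, |V s x| ≤ C * Real.exp (-s))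
    (fun n θ => ?_) ?_ ?_ hf
  -- The constant mode has no second derivatives, so its transform is zero. All other modes decay by
  -- the spectral gap.
  · rcases eq_or_ne n 0 with rfl | hn
    · refine ⟨_, fun _ _ => 0, hf_heatWave (0, θ), ?_, ?_, fun s => ?_, 0, fun s _ x => by simp⟩
      · simpa using (hf_heatWave (0, θ)).const_mul 0
      · ext x; simp [heatWave]
      · have e : heatWave (0, θ) s = fun x => Real.exp (-(eig 0) * s) * wave 0 θ x := rfl
        rw [e, pd_const_mul (wave_sp _ _).differentiable,
          pd_const_mul ((wave_sp _ _).pd k).differentiable, pd_pd_wave]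
        ext x
        simp [lap, pd_const]
    · have hpos : 0 < eig n := zero_lt_one.trans_le (one_le_eig hn)
      -- The Fourier symbol of `∂_i ∂_k Δ⁻¹` at frequency `n`.
      set c := (n i * (2 * Real.pi)) * (n k * (2 * Real.pi)) / eig n with hc
      refine ⟨_, fun s x => c * heatWave (n, θ) s x, hf_heatWave (n, θ), (hf_heatWave _).const_mul _,
        ?_, fun s => ?_, |c|, fun s hs x => ?_⟩
      · ext x; simp [heatWave]
      · have e : heatWave (n, θ) s = fun x => Real.exp (-(eig n) * s) * wave n θ x := rfl
        rw [lap_const_mul ((hf_heatWave (n, θ)).tp s).sp, e, lap_const_mul (wave_sp _ _), lap_wave,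
          pd_const_mul (wave_sp _ _).differentiable,
          pd_const_mul ((wave_sp _ _).pd k).differentiable, pd_pd_wave]
        ext x
        rw [hc]
        field_simp
      · rw [abs_mul, heatWave, abs_mul, Real.abs_exp]
        refine mul_le_mul_of_nonneg_left ?_ (abs_nonneg _)
        have h1 : Real.exp (-(eig n) * s) ≤ Real.exp (-s) :=
          Real.exp_le_exp.2 (by nlinarith [one_le_eig hn])
        calc Real.exp (-(eig n) * s) * |wave n θ x| ≤ Real.exp (-s) * 1 :=
              mul_le_mul h1 (abs_wave_le _ _ _) (abs_nonneg _) (Real.exp_pos _).le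
          _ = _ := mul_one _
  · rintro f g - - ⟨U, V, hU, hV, rfl, h, C, hC⟩ ⟨U', V', hU', hV', rfl, h', C', hC'⟩
    refine ⟨_, _, hU.add hU', hV.add hV', rfl, fun s => ?_, C + C', fun s hs x => ?_⟩
    · rw [lap_add (hV.tp s).sp (hV'.tp s).sp,
        pd_add (hU.tp s).sp.differentiable (hU'.tp s).sp.differentiable,
        pd_add ((hU.tp s).sp.pd k).differentiable ((hU'.tp s).sp.pd k).differentiable, h, h']
    · rw [add_mul]
      exact (abs_add_le _ _).trans (add_le_add (hC s hs x) (hC' s hs x))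
  · rintro c f - ⟨U, V, hU, hV, rfl, h, C, hC⟩
    refine ⟨_, _, hU.const_mul c, hV.const_mul c, rfl, fun s => ?_, |c| * C, fun s hs x => ?_⟩
    · rw [lap_const_mul (hV.tp s).sp, pd_const_mul (hU.tp s).sp.differentiable,
        pd_const_mul ((hU.tp s).sp.pd k).differentiable, h]
    · rw [abs_mul, mul_assoc]
      exact mul_le_mul_of_nonneg_left (hC s hs x) (abs_nonneg c)

/-- Differentiation under the integral over the torus. -/
lemma hasDerivAt_integral_cube {F F' : ℝ → E3 → ℝ} (hF : ∀ s, Continuous (F s))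
    (hd : ∀ s x, HasDerivAt (fun s => F s x) (F' s x) s)
    (hc : Continuous fun p : ℝ × E3 => F' p.1 p.2) (s₀ : ℝ) :
    HasDerivAt (fun s => ∫ x in cube, F s x) (∫ x in cube, F' s₀ x) s₀ := by
  obtain ⟨C, hC⟩ := ((isCompact_Icc (a := s₀ - 1) (b := s₀ + 1)).prod
    (isCompact_closedBall (0 : E3) 2)).exists_bound_of_continuousOn hc.continuousOn
  have hint : ∀ s, IntegrableOn (F s) cube := fun s =>
    ((hF s).continuousOn.integrableOn_compact (isCompact_closedBall (0 : E3) 2)).mono_set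
      fun x hx => by simpa using norm_le_of_mem_cube hx
  refine (hasDerivAt_integral_of_dominated_loc_of_deriv_le (μ := volume.restrict cube) (F := F)
    (F' := F') (x₀ := s₀) (s := Icc (s₀ - 1) (s₀ + 1)) (bound := fun _ => C)
    (Icc_mem_nhds (by linarith) (by linarith))
    (Eventually.of_forall fun s => (hF s).aestronglyMeasurable) (hint s₀)
    (by fun_prop : Continuous (F' s₀)).aestronglyMeasurable ?_ (integrable_const C)
    (Eventually.of_forall fun x s _ => hd s x)).2
  filter_upwards [ae_restrict_mem measurableSet_cube] with x hx s hs
  exact hC (s, x) ⟨hs, by simpa using norm_le_of_mem_cube hx⟩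

lemma integral_lap_mul {f g : E3 → ℝ} (hf : SP f) (hg : SP g) :
    ∫ x in cube, lap f x * g x = - ∫ x in cube, ∑ i, pd i f x * pd i g x := by
  simp only [lap, Finset.sum_mul]
  rw [integral_finsetSum _ fun i _ => (((hf.pd i).pd i).mul hg).integrableOn,
    integral_finsetSum _ fun i _ => ((hf.pd i).mul (hg.pd i)).integrableOn,
    ← Finset.sum_neg_distrib]
  exact Finset.sum_congr rfl fun i _ => integral_pd_mul (hf.pd i) hg i

lemma integral_lap_mul_comm {f g : E3 → ℝ} (hf : SP f) (hg : SP g) :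
    ∫ x in cube, lap f x * g x = ∫ x in cube, f x * lap g x := by
  have h := integral_lap_mul hg hf
  simp only [mul_comm] at h ⊢
  rw [h]
  have := integral_lap_mul hf hg
  simp only [mul_comm] at this
  exact this

/-! ### The Bellman function estimate -/

lemma SP.sqrt {f : E3 → ℝ} (hf : SP f) (h0 : ∀ x, 0 < f x) : SP (fun x => √(f x)) :=
  ⟨hf.smooth.sqrt fun x => (h0 x).ne', hf.per.comp _⟩

lemma SP.div {f g : E3 → ℝ} (hf : SP f) (hg : SP g) (h0 : ∀ x, g x ≠ 0) : SP (fun x => f x / g x) :=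
  ⟨hf.smooth.div hg.smooth h0, fun x i => by simp only [hf.per x i, hg.per x i]⟩

lemma pd_sqrt {f : E3 → ℝ} (hf : Differentiable ℝ f) (h0 : ∀ x, 0 < f x) (i : Fin 3) (x : E3) :
    pd i (fun x => √(f x)) x = pd i f x / (2 * √(f x)) := by
  rw [pd_comp (Real.hasDerivAt_sqrt (h0 x).ne') (hf x)]
  ring

lemma pd_inv {f : E3 → ℝ} (hf : Differentiable ℝ f) (h0 : ∀ x, f x ≠ 0) (i : Fin 3) (x : E3) :
    pd i (fun x => (f x)⁻¹) x = -(pd i f x) / f x ^ 2 := by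
  rw [pd_comp (hasDerivAt_inv (h0 x)) (hf x)]
  ring

lemma SP.inv {f : E3 → ℝ} (hf : SP f) (h0 : ∀ x, f x ≠ 0) : SP (fun x => (f x)⁻¹) :=
  ⟨hf.smooth.inv h0, hf.per.comp _⟩

/-- `√(u² + δ²)`. -/
def regAbs (δ u : ℝ) : ℝ := √(u ^ 2 + δ ^ 2)

/-- `w² + √(u² + δ²)`. -/
def bellArg (δ w u : ℝ) : ℝ := w ^ 2 + regAbs δ u

/-- The Bellman function `(w² + √(u² + δ²))^{3/2}`. -/
def bell (δ w u : ℝ) : ℝ := bellArg δ w u * √(bellArg δ w u)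

lemma regAbs_pos {δ : ℝ} (hδ : 0 < δ) (u : ℝ) : 0 < regAbs δ u := Real.sqrt_pos.2 (by positivity)

lemma regAbs_sq (δ u : ℝ) : regAbs δ u ^ 2 = u ^ 2 + δ ^ 2 := Real.sq_sqrt (by positivity)

lemma bellArg_pos {δ : ℝ} (hδ : 0 < δ) (w u : ℝ) : 0 < bellArg δ w u :=
  add_pos_of_nonneg_of_pos (sq_nonneg w) (regAbs_pos hδ u)

/-- The Hessian of the Bellman function evaluated at `(p, q)`. -/
def bellHess (δ w u p q : ℝ) : ℝ :=
  3 * √(bellArg δ w u) * p ^ 2 + 3 / 4 * (2 * w * p + u * q / regAbs δ u) ^ 2 / √(bellArg δ w u)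
    + 3 / 2 * √(bellArg δ w u) * (δ ^ 2 * q ^ 2 / regAbs δ u ^ 3)

lemma bellHess_ge_left {δ : ℝ} (hδ : 0 < δ) (w u p q : ℝ) :
    √(bellArg δ w u) * p ^ 2 ≤ 1 / 3 * bellHess δ w u p q := by
  have hr := Real.sqrt_pos.2 (bellArg_pos hδ w u)
  have hh := regAbs_pos hδ u
  have h1 : 0 ≤ 3 / 4 * (2 * w * p + u * q / regAbs δ u) ^ 2 / √(bellArg δ w u) := by positivity
  have h2 : 0 ≤ 3 / 2 * √(bellArg δ w u) * (δ ^ 2 * q ^ 2 / regAbs δ u ^ 3) := by positivity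
  rw [bellHess]; linarith

/-- Split `q² = (uq/h)² + δ²q²/h²` with `h = regAbs δ u`. The first part is the square in the
Hessian up to the error `2wp`, which the `p²` term absorbs, since `w² ≤ r²` for `r = √(bellArg δ w
u)`. The second part is the last term of the Hessian, since `h ≤ r²`. -/
lemma bellHess_ge_right {δ : ℝ} (hδ : 0 < δ) (w u p q : ℝ) :
    q ^ 2 / √(bellArg δ w u) ≤ 8 / 3 * bellHess δ w u p q := by
  have hr := Real.sqrt_pos.2 (bellArg_pos hδ w u)
  have hh := regAbs_pos hδ u
  have hr2 : √(bellArg δ w u) ^ 2 = w ^ 2 + regAbs δ u := Real.sq_sqrt (bellArg_pos hδ w u).le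
  have hh2 := regAbs_sq δ u
  rw [bellHess]
  set r := √(bellArg δ w u)
  set h := regAbs δ u
  have e1 : q ^ 2 / r = ((u * q / h) ^ 2 + δ ^ 2 * q ^ 2 / h ^ 2) / r := by
    field_simp
    rw [hh2]
  have e2 : (u * q / h) ^ 2 ≤ 2 * (2 * w * p + u * q / h) ^ 2 + 8 * (w ^ 2 * p ^ 2) := by
    nlinarith [sq_nonneg ((2 * w * p + u * q / h) + 2 * w * p)]
  have e3 : w ^ 2 * p ^ 2 / r ≤ r * p ^ 2 := by
    rw [div_le_iff₀ hr]
    have : r * p ^ 2 * r = (w ^ 2 + h) * p ^ 2 := by rw [← hr2]; ring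
    rw [this]
    nlinarith [mul_nonneg hh.le (sq_nonneg p)]
  have e4 : δ ^ 2 * q ^ 2 / h ^ 2 / r ≤ r * (δ ^ 2 * q ^ 2 / h ^ 3) := by
    rw [div_le_iff₀ hr]
    have : r * (δ ^ 2 * q ^ 2 / h ^ 3) * r = (w ^ 2 + h) * (δ ^ 2 * q ^ 2 / h ^ 3) := by
      rw [← hr2]; ring
    rw [this]
    have e5 : δ ^ 2 * q ^ 2 / h ^ 2 = h * (δ ^ 2 * q ^ 2 / h ^ 3) := by field_simp
    rw [e5]
    have : 0 ≤ w ^ 2 * (δ ^ 2 * q ^ 2 / h ^ 3) := by positivity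
    linarith
  have e6 : q ^ 2 / r ≤ (2 * (2 * w * p + u * q / h) ^ 2) / r + 8 * (w ^ 2 * p ^ 2 / r)
      + δ ^ 2 * q ^ 2 / h ^ 2 / r := by
    rw [e1, add_div]
    have := div_le_div_of_nonneg_right e2 hr.le
    rw [add_div] at this
    have e7 : 8 * (w ^ 2 * p ^ 2) / r = 8 * (w ^ 2 * p ^ 2 / r) := by ring
    linarith
  have e8 : 3 / 4 * (2 * w * p + u * q / h) ^ 2 / r
      = 3 / 8 * ((2 * (2 * w * p + u * q / h) ^ 2) / r) := by ring
  have e9 : 0 ≤ r * (δ ^ 2 * q ^ 2 / h ^ 3) := by positivity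
  rw [e8]
  nlinarith

lemma bellHess_nonneg {δ : ℝ} (hδ : 0 < δ) (w u p q : ℝ) : 0 ≤ bellHess δ w u p q := by
  have h := bellHess_ge_left hδ w u p q
  have : 0 ≤ √(bellArg δ w u) * p ^ 2 := by positivity
  linarith

/-- The Hessian controls `p²` with weight `r` and `q²` with weight `1/r`. The weights are
reciprocal, so they cancel in the arithmetic-geometric inequality, leaving `½ (8/3 + 1/3) = 3/2`. -/
lemma abs_mul_le_bellHess {δ : ℝ} (hδ : 0 < δ) (w u : ℝ) (p q : Fin 3 → ℝ) (i k : Fin 3) :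
    |q k * p i| ≤ 3 / 2 * ∑ m, bellHess δ w u (p m) (q m) := by
  have hr := Real.sqrt_pos.2 (bellArg_pos hδ w u)
  have hle : ∀ i, bellHess δ w u (p i) (q i) ≤ ∑ m, bellHess δ w u (p m) (q m) := fun i =>
    Finset.single_le_sum (f := fun m => bellHess δ w u (p m) (q m))
      (fun m _ => bellHess_nonneg hδ w u _ _) (Finset.mem_univ i)
  have h1 := bellHess_ge_left hδ w u (p i) (q i)
  have h2 := bellHess_ge_right hδ w u (p k) (q k)
  have h3 := hle i
  have h4 := hle k
  set r := √(bellArg δ w u)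
  have h5 : |q k * p i| ≤ 1 / 2 * (q k ^ 2 / r + r * p i ^ 2) := by
    have e : q k ^ 2 / r + r * p i ^ 2 = (q k ^ 2 + (r * p i) ^ 2) / r := by field_simp
    rw [e, abs_le]
    have h6 := sq_nonneg (q k + r * p i)
    have h7 := sq_nonneg (q k - r * p i)
    constructor
    · rw [neg_le, ← mul_div_assoc, le_div_iff₀ hr]; nlinarith
    · rw [← mul_div_assoc, le_div_iff₀ hr]; nlinarith
  linarith

lemma hasDerivAt_bell {δ : ℝ} (hδ : 0 < δ) {w u : ℝ → ℝ} {w' u' s : ℝ} (hw : HasDerivAt w w' s)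
    (hu : HasDerivAt u u' s) :
    HasDerivAt (fun s => bell δ (w s) (u s))
      (3 * (√(bellArg δ (w s) (u s)) * w s) * w'
        + 3 / 2 * (√(bellArg δ (w s) (u s)) * (u s * (regAbs δ (u s))⁻¹)) * u') s := by
  have hh := regAbs_pos hδ (u s)
  have hσ := bellArg_pos hδ (w s) (u s)
  have h1 : HasDerivAt (fun s => regAbs δ (u s)) (u s * u' / regAbs δ (u s)) s := by
    have := ((hu.pow 2).add_const (δ ^ 2)).sqrt (by simp only [Pi.pow_apply]; positivity)
    refine this.congr_deriv ?_
    simp only [regAbs, Pi.pow_apply]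
    field_simp
    ring
  have h2 : HasDerivAt (fun s => bellArg δ (w s) (u s))
      (2 * w s * w' + u s * u' / regAbs δ (u s)) s := by
    refine ((hw.pow 2).add h1).congr_deriv ?_
    simp
  refine (h2.mul (h2.sqrt hσ.ne')).congr_deriv ?_
  have hr := Real.sqrt_pos.2 hσ
  have hr2 : √(bellArg δ (w s) (u s)) ^ 2 = bellArg δ (w s) (u s) := Real.sq_sqrt hσ.le
  field_simp
  rw [hr2]; ring

section
variable {δ : ℝ} {w u : E3 → ℝ}

lemma SP.regAbs (hδ : 0 < δ) (hu : SP u) : SP (fun x => regAbs δ (u x)) := by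
  refine SP.sqrt (f := fun x => u x ^ 2 + δ ^ 2) ?_ fun x => by positivity
  simpa only [sq] using (hu.mul hu).add (SP.const (δ * δ))

lemma pd_regAbs (hδ : 0 < δ) (hu : SP u) (i : Fin 3) (x : E3) :
    HallMHD.pd i (fun x => HallMHD.regAbs δ (u x)) x = u x * HallMHD.pd i u x / HallMHD.regAbs δ (u x) := by
  have h := pd_sqrt (f := fun x => u x * u x + δ ^ 2) ((hu.mul hu).add (SP.const _)).differentiable
    (fun x => add_pos_of_nonneg_of_pos (mul_self_nonneg _) (by positivity)) i x
  rw [pd_add (hu.mul hu).differentiable (SP.const _).differentiable, pd_mul hu.differentiable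
    hu.differentiable, pd_const] at h
  simp only [← sq] at h
  refine h.trans ?_
  have := regAbs_pos hδ (u x)
  simp only [HallMHD.regAbs] at this ⊢
  field_simp
  ring

lemma SP.bellArg (hδ : 0 < δ) (hw : SP w) (hu : SP u) : SP (fun x => bellArg δ (w x) (u x)) := by
  simp only [HallMHD.bellArg, sq]
  exact (hw.mul hw).add (hu.regAbs hδ)

lemma SP.bell (hδ : 0 < δ) (hw : SP w) (hu : SP u) : SP (fun x => bell δ (w x) (u x)) :=
  (hw.bellArg hδ hu).mul ((hw.bellArg hδ hu).sqrt fun _ => bellArg_pos hδ _ _)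

lemma pd_bellArg (hδ : 0 < δ) (hw : SP w) (hu : SP u) (i : Fin 3) (x : E3) :
    HallMHD.pd i (fun x => HallMHD.bellArg δ (w x) (u x)) x
      = 2 * w x * HallMHD.pd i w x + u x * HallMHD.pd i u x / HallMHD.regAbs δ (u x) := by
  have h : (fun x => HallMHD.bellArg δ (w x) (u x)) = fun x => w x * w x + HallMHD.regAbs δ (u x) := by
    ext x; rw [HallMHD.bellArg, sq]
  rw [h, pd_add (hw.mul hw).differentiable (hu.regAbs hδ).differentiable,
    pd_mul hw.differentiable hw.differentiable]
  beta_reduce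
  rw [pd_regAbs hδ hu]
  ring

/-- The gradients of the two partial derivatives of the Bellman function pair to its Hessian. -/
lemma integral_bell_grad (hδ : 0 < δ) (hw : SP w) (hu : SP u) :
    ∫ x in cube, (3 * (√(HallMHD.bellArg δ (w x) (u x)) * w x) * lap w x
        + 3 / 2 * (√(HallMHD.bellArg δ (w x) (u x)) * (u x * (HallMHD.regAbs δ (u x))⁻¹)) * lap u x)
      = - ∫ x in cube, ∑ i, bellHess δ (w x) (u x) (HallMHD.pd i w x) (HallMHD.pd i u x) := by
  have hr : SP (fun x => √(HallMHD.bellArg δ (w x) (u x))) :=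
    (hw.bellArg hδ hu).sqrt fun _ => bellArg_pos hδ _ _
  have hinv : SP (fun x => (HallMHD.regAbs δ (u x))⁻¹) :=
    (hu.regAbs hδ).inv fun x => (regAbs_pos hδ _).ne'
  have ha : SP (fun x => 3 * (√(HallMHD.bellArg δ (w x) (u x)) * w x)) := (hr.mul hw).const_mul 3
  have hb : SP (fun x => 3 / 2 * (√(HallMHD.bellArg δ (w x) (u x)) * (u x * (HallMHD.regAbs δ (u x))⁻¹))) :=
    (hr.mul (hu.mul hinv)).const_mul _
  rw [integral_add (ha.mul hw.lap).integrableOn (hb.mul hu.lap).integrableOn]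
  have e1 := integral_lap_mul hw ha
  have e2 := integral_lap_mul hu hb
  simp only [mul_comm (lap _ _)] at e1 e2
  rw [e1, e2, ← neg_add, ← integral_add
    (SP.sum _ fun i _ => (hw.pd i).mul (ha.pd i)).integrableOn
    (SP.sum _ fun i _ => (hu.pd i).mul (hb.pd i)).integrableOn]
  congr 1
  refine integral_congr_ae (Eventually.of_forall fun x => ?_)
  simp only [← Finset.sum_add_distrib]
  refine Finset.sum_congr rfl fun i _ => ?_
  rw [pd_const_mul (hr.mul hw).differentiable, pd_const_mul (hr.mul (hu.mul hinv)).differentiable,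
    pd_mul hr.differentiable hw.differentiable, pd_mul hr.differentiable (hu.mul hinv).differentiable,
    pd_mul hu.differentiable hinv.differentiable]
  beta_reduce
  rw [pd_sqrt (hw.bellArg hδ hu).differentiable (fun _ => bellArg_pos hδ _ _),
    pd_inv (hu.regAbs hδ).differentiable (fun x => (regAbs_pos hδ _).ne'), pd_bellArg hδ hw hu,
    pd_regAbs hδ hu, bellHess]
  have hh := regAbs_pos hδ (u x)
  have hh2 := regAbs_sq δ (u x)
  have hrp := Real.sqrt_pos.2 (bellArg_pos hδ (w x) (u x))
  set r := √(HallMHD.bellArg δ (w x) (u x))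
  set h := HallMHD.regAbs δ (u x)
  have hδ2 : δ ^ 2 = h ^ 2 - u x ^ 2 := by linarith
  rw [hδ2]
  field_simp
  ring

end

/-! ### The `L^{3/2}` bound for second order Riesz transforms -/

lemma eq_zero_of_integral_eq_zero {f : E3 → ℝ} (hf : Per f) (hc : Continuous f) (h0 : ∀ x, 0 ≤ f x)
    (h : ∫ x in cube, f x = 0) : f = 0 := by
  have h1 := (integral_eq_zero_iff_of_nonneg h0 (hf.integrableOn hc)).1 h
  have h2 : volume ({x | f x ≠ 0} ∩ cube) = 0 := by
    have := ae_iff.1 h1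
    rwa [Measure.restrict_apply₀'] at this
    exact measurableSet_cube.nullMeasurableSet
  have h3 : volume {x | f x ≠ 0} = 0 := by
    refine cube_fd.measure_zero_of_invariant _ (fun g => ?_) h2
    ext x
    rw [Set.mem_vadd_set_iff_neg_vadd_mem]
    simp only [ne_eq, mem_ofPred_eq, hf.latt]
  exact (hc.ae_eq_iff_eq volume continuous_const).1 (ae_iff.2 h3)

lemma fderiv_eq_zero_of_pd {f : E3 → ℝ} (h : ∀ i x, pd i f x = 0) (x : E3) : fderiv ℝ f x = 0 := by
  refine ContinuousLinearMap.coe_injective (stdBasis.ext fun i => ?_)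
  have := h i x
  simpa [pd, basisVec] using this

/-- Energy identity: pairing with `f` shows that the gradient has zero `L²` norm. -/
lemma const_of_lap_eq_zero {f : E3 → ℝ} (hf : SP f) (h : ∀ x, lap f x = 0) (x y : E3) : f x = f y := by
  have h1 := integral_lap_mul hf hf
  simp only [h, zero_mul, integral_zero] at h1
  have hs : SP fun x => ∑ i, pd i f x * pd i f x := SP.sum _ fun i _ => (hf.pd i).mul (hf.pd i)
  have h2 := eq_zero_of_integral_eq_zero hs.per hs.continuous
    (fun x => Finset.sum_nonneg fun i _ => mul_self_nonneg _) (by linarith)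
  have h3 : ∀ i x, pd i f x = 0 := fun i x => by
    have := congrFun h2 x
    simp only [Pi.zero_apply] at this
    exact mul_self_eq_zero.1 ((Finset.sum_eq_zero_iff_of_nonneg fun i _ => mul_self_nonneg _).1 this i
      (Finset.mem_univ i))
  exact is_const_of_fderiv_eq_zero hf.differentiable (fderiv_eq_zero_of_pd h3) x y

lemma integral_lap {f : E3 → ℝ} (hf : SP f) : ∫ x in cube, lap f x = 0 := by
  have h := integral_lap_mul hf (SP.const 1)
  simpa [pd_const] using h

lemma tendsto_integral_zero_of_decay {F : ℝ → E3 → ℝ} {C : ℝ}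
    (h : ∀ s, 0 ≤ s → ∀ x, |F s x| ≤ C * Real.exp (-s)) :
    Tendsto (fun s => ∫ x in cube, F s x) atTop (𝓝 0) := by
  have h1 : Tendsto (fun s : ℝ => C * Real.exp (-s)) atTop (𝓝 0) := by
    simpa using (Real.tendsto_exp_neg_atTop_nhds_zero.const_mul C)
  refine squeeze_zero_norm' ?_ h1
  filter_upwards [eventually_ge_atTop 0] with s hs
  have := norm_integral_le_of_norm_le_const (μ := volume.restrict cube) (f := F s)
    (C := C * Real.exp (-s)) (Eventually.of_forall fun x => h s hs x)
  simpa using this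

/-- The heat flow conserves the mean, and the decay forces the conserved value to be zero. -/
lemma integral_eq_zero_of_heatFlow_decay {V : ℝ → E3 → ℝ} (hV : HF V) {C : ℝ}
    (hC : ∀ s, 0 ≤ s → ∀ x, |V s x| ≤ C * Real.exp (-s)) : ∫ x in cube, V 0 x = 0 := by
  have hl : Continuous fun p : ℝ × E3 => lap (V p.1) p.2 := by
    have := fun i => ((hV.pd i).pd i).continuous
    simp only [lap]; fun_prop
  have hd : ∀ s, HasDerivAt (fun s => ∫ x in cube, V s x) 0 s := fun s => by
    have := hasDerivAt_integral_cube (fun s => (hV.tp s).sp.continuous) hV.heat hl s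
    rwa [integral_lap (hV.tp s).sp] at this
  have hconst := is_const_of_deriv_eq_zero (fun s => (hd s).differentiableAt) (fun s => (hd s).deriv)
  have ht := tendsto_integral_zero_of_decay hC
  have : (fun s => ∫ x in cube, V s x) = fun _ => ∫ x in cube, V 0 x := funext fun s => hconst s 0
  rw [this] at ht
  exact tendsto_const_nhds_iff.1 ht

/-- Let all three functions run by the heat flow. The pairing `∫ V W` has derivative `-2 ∫ ∂_k U ∂_i
W`, by symmetry of the Laplacian and `ΔV = ∂_i ∂_k U`. The Bellman integral has derivative minus the
integral of the Hessian, which dominates the product `∂_k U ∂_i W`. Hence `∫ V W - 3 ∫ bell` is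
nondecreasing. Since `bell ≥ 0` and the pairing decays to zero, its initial value is at most zero.
-/
lemma riesz_pairing {U V W : ℝ → E3 → ℝ} (hU : HF U) (hV : HF V) (hW : HF W) {i k : Fin 3}
    (hUV : ∀ s, lap (V s) = pd i (pd k (U s))) {C : ℝ}
    (hC : ∀ s, 0 ≤ s → ∀ x, |V s x| ≤ C * Real.exp (-s)) {δ : ℝ} (hδ : 0 < δ) :
    ∫ x in cube, V 0 x * W 0 x ≤ 3 * ∫ x in cube, bell δ (W 0 x) (U 0 x) := by
  have hlap : ∀ {X : ℝ → E3 → ℝ}, HF X → Continuous fun p : ℝ × E3 => lap (X p.1) p.2 := fun hX => by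
    have := fun i => ((hX.pd i).pd i).continuous
    simp only [lap]; fun_prop
  have cU := hU.continuous
  have cV := hV.continuous
  have cW := hW.continuous
  have lU := hlap hU
  have lV := hlap hV
  have lW := hlap hW
  have d1 : ∀ s, HasDerivAt (fun s => ∫ x in cube, V s x * W s x)
      (-2 * ∫ x in cube, pd k (U s) x * pd i (W s) x) s := fun s => by
    have h1 := hasDerivAt_integral_cube (F := fun s x => V s x * W s x)
      (F' := fun s x => lap (V s) x * W s x + V s x * lap (W s) x)
      (fun s => ((hV.tp s).sp.mul (hW.tp s).sp).continuous)
      (fun s x => (hV.heat s x).mul (hW.heat s x)) (by fun_prop) s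
    refine h1.congr_deriv ?_
    rw [integral_add ((hV.tp s).sp.lap.mul (hW.tp s).sp).integrableOn
      ((hV.tp s).sp.mul (hW.tp s).sp.lap).integrableOn,
      ← integral_lap_mul_comm (hV.tp s).sp (hW.tp s).sp, hUV,
      integral_pd_mul ((hU.tp s).sp.pd k) (hW.tp s).sp]
    ring
  have hregc : Continuous (regAbs δ) := by unfold regAbs; fun_prop
  have hrinv : Continuous fun u => (regAbs δ u)⁻¹ := hregc.inv₀ fun u => (regAbs_pos hδ u).ne'
  have d2 : ∀ s, HasDerivAt (fun s => ∫ x in cube, bell δ (W s x) (U s x))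
      (- ∫ x in cube, ∑ m, bellHess δ (W s x) (U s x) (pd m (W s) x) (pd m (U s) x)) s := fun s => by
    have h1 := hasDerivAt_integral_cube (F := fun s x => bell δ (W s x) (U s x))
      (F' := fun s x => 3 * (√(bellArg δ (W s x) (U s x)) * W s x) * lap (W s) x
        + 3 / 2 * (√(bellArg δ (W s x) (U s x)) * (U s x * (regAbs δ (U s x))⁻¹)) * lap (U s) x)
      (fun s => ((hW.tp s).sp.bell hδ (hU.tp s).sp).continuous)
      (fun s x => hasDerivAt_bell hδ (hW.heat s x) (hU.heat s x))
      (by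
        have c1 : Continuous fun p : ℝ × E3 => (regAbs δ (U p.1 p.2))⁻¹ := hrinv.comp cU
        have c2 : Continuous fun p : ℝ × E3 => √(bellArg δ (W p.1 p.2) (U p.1 p.2)) :=
          ((cW.pow 2).add (hregc.comp cU)).sqrt
        exact ((continuous_const.mul (c2.mul cW)).mul lW).add
          ((continuous_const.mul (c2.mul (cU.mul c1))).mul lU)) s
    refine h1.congr_deriv ?_
    exact integral_bell_grad hδ (hW.tp s).sp (hU.tp s).sp
  have hle : ∀ s, 3 * (- ∫ x in cube, ∑ m, bellHess δ (W s x) (U s x) (pd m (W s) x) (pd m (U s) x))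
      ≤ -2 * ∫ x in cube, pd k (U s) x * pd i (W s) x := fun s => by
    have hcH : Continuous fun x => ∑ m, bellHess δ (W s x) (U s x) (pd m (W s) x) (pd m (U s) x) := by
      have c1 := (hW.tp s).sp.continuous
      have c2 := (hU.tp s).sp.continuous
      have c3 := fun m => ((hW.tp s).sp.pd m).continuous
      have c4 := fun m => ((hU.tp s).sp.pd m).continuous
      have c5 : Continuous fun x => regAbs δ (U s x) := hregc.comp c2
      have c6 : Continuous fun x => √(bellArg δ (W s x) (U s x)) := by unfold bellArg; fun_prop
      refine continuous_finsetSum _ fun m _ => ?_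
      unfold bellHess
      refine ((continuous_const.mul c6).mul ((c3 m).pow 2)).add ?_ |>.add ?_
      · refine Continuous.div ?_ c6 fun x => (Real.sqrt_pos.2 (bellArg_pos hδ _ _)).ne'
        refine continuous_const.mul (Continuous.pow (((continuous_const.mul c1).mul (c3 m)).add ?_) 2)
        exact (c2.mul (c4 m)).div c5 fun x => (regAbs_pos hδ _).ne'
      · refine (continuous_const.mul c6).mul ?_
        exact (continuous_const.mul ((c4 m).pow 2)).div (c5.pow 3) fun x =>
          (pow_pos (regAbs_pos hδ _) 3).ne'
    have hpH : Per fun x => ∑ m, bellHess δ (W s x) (U s x) (pd m (W s) x) (pd m (U s) x) :=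
      fun x j => by
        simp only [(hW.tp s).sp.per x j, (hU.tp s).sp.per x j, ((hW.tp s).sp.pd _).per x j,
          ((hU.tp s).sp.pd _).per x j]
    have h1 : ∫ x in cube, pd k (U s) x * pd i (W s) x
        ≤ ∫ x in cube, 3 / 2 * ∑ m, bellHess δ (W s x) (U s x) (pd m (W s) x) (pd m (U s) x) := by
      refine integral_mono (((hU.tp s).sp.pd k).mul ((hW.tp s).sp.pd i)).integrableOn
        ((hpH.integrableOn hcH).const_mul _) fun x => ?_
      exact (le_abs_self _).trans
        (abs_mul_le_bellHess hδ (W s x) (U s x) (fun m => pd m (W s) x) (fun m => pd m (U s) x) i k)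
    rw [integral_const_mul] at h1
    linarith
  have hmono : Monotone fun s => (∫ x in cube, V s x * W s x) - 3 * ∫ x in cube, bell δ (W s x) (U s x) := by
    have hd := fun s => (d1 s).sub ((d2 s).const_mul 3)
    refine monotone_of_deriv_nonneg (fun s => (hd s).differentiableAt) fun s => ?_
    rw [show deriv (fun s => (∫ x in cube, V s x * W s x) - 3 * ∫ x in cube, bell δ (W s x) (U s x)) s = _
      from (hd s).deriv]
    linarith [hle s]
  obtain ⟨C', hC'⟩ := hW.exists_bound
  have hlim : Tendsto (fun s => ∫ x in cube, V s x * W s x) atTop (𝓝 0) := by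
    refine tendsto_integral_zero_of_decay (C := C * C') fun s hs x => ?_
    rw [abs_mul, mul_right_comm]
    exact mul_le_mul (hC s hs x) (hC' s hs x) (abs_nonneg _) ((abs_nonneg _).trans (hC s hs x))
  have hfin : ∀ s, 0 ≤ s → (∫ x in cube, V 0 x * W 0 x) - 3 * (∫ x in cube, bell δ (W 0 x) (U 0 x))
      ≤ ∫ x in cube, V s x * W s x := fun s hs => by
    refine (hmono hs).trans ?_
    have : 0 ≤ ∫ x in cube, bell δ (W s x) (U s x) := integral_nonneg fun x =>
      mul_nonneg (bellArg_pos hδ _ _).le (Real.sqrt_nonneg _)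
    simp only
    linarith
  have := ge_of_tendsto hlim ((eventually_ge_atTop 0).mono hfin)
  linarith

/-- `|x|^{3/2}`. -/
def p32 (x : ℝ) : ℝ := |x| * √|x|

lemma continuous_p32 : Continuous p32 := by unfold p32; fun_prop

lemma p32_eq_rpow (x : ℝ) : p32 x = |x| ^ (3 / 2 : ℝ) := by
  rcases (abs_nonneg x).eq_or_lt' with h | h
  · rw [p32, h]; simp
  · rw [p32, Real.sqrt_eq_rpow, show (3 / 2 : ℝ) = 1 + 1 / 2 by norm_num, Real.rpow_add h, Real.rpow_one]

lemma mul_sqrt_add_le {a b c : ℝ} (ha : 0 ≤ a) (hb : 0 ≤ b) (hc : 0 ≤ c) :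
    (a + b + c) * √(a + b + c) ≤ 6 * (a * √a + b * √b + c * √c) := by
  have key : ∀ m, 0 ≤ m → a ≤ m → b ≤ m → c ≤ m → (a + b + c) * √(a + b + c) ≤ 6 * (m * √m) := by
    intro m hm h1 h2 h3
    have h4 : √(a + b + c) ≤ 2 * √m := by
      rw [show (2 : ℝ) * √m = √(4 * m) by
        rw [Real.sqrt_mul (by norm_num), show (4 : ℝ) = 2 ^ 2 by norm_num, Real.sqrt_sq (by norm_num)]]
      exact Real.sqrt_le_sqrt (by linarith)
    calc (a + b + c) * √(a + b + c) ≤ (3 * m) * (2 * √m) :=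
          mul_le_mul (by linarith) h4 (Real.sqrt_nonneg _) (by linarith)
      _ = _ := by ring
  have pa := mul_nonneg ha (Real.sqrt_nonneg a)
  have pb := mul_nonneg hb (Real.sqrt_nonneg b)
  have pc := mul_nonneg hc (Real.sqrt_nonneg c)
  rcases le_total a b with h1 | h1 <;> rcases le_total b c with h2 | h2 <;>
    rcases le_total a c with h3 | h3
  · linarith [key c hc (by linarith) (by linarith) le_rfl]
  · linarith [key c hc (by linarith) (by linarith) le_rfl]
  · linarith [key b hb (by linarith) le_rfl (by linarith)]
  · linarith [key b hb (by linarith) le_rfl (by linarith)]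
  · linarith [key c hc (by linarith) (by linarith) le_rfl]
  · linarith [key a ha le_rfl (by linarith) (by linarith)]
  · linarith [key a ha le_rfl (by linarith) (by linarith)]
  · linarith [key a ha le_rfl (by linarith) (by linarith)]

lemma regAbs_le {δ : ℝ} (hδ : 0 < δ) (u : ℝ) : regAbs δ u ≤ |u| + δ := by
  rw [regAbs, Real.sqrt_le_left (by positivity)]
  have := abs_nonneg u
  nlinarith [sq_abs u]

lemma le_regAbs (δ u : ℝ) : |u| ≤ regAbs δ u := by
  rw [regAbs, ← Real.sqrt_sq_eq_abs]
  exact Real.sqrt_le_sqrt (by nlinarith [sq_nonneg δ])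

lemma bell_le {δ : ℝ} (hδ : 0 < δ) (w u : ℝ) : bell δ w u ≤ 6 * (|w| ^ 3 + p32 u + δ * √δ) := by
  have h1 : bellArg δ w u ≤ w ^ 2 + |u| + δ := by
    rw [bellArg]; linarith [regAbs_le hδ u]
  have h2 : bell δ w u ≤ (w ^ 2 + |u| + δ) * √(w ^ 2 + |u| + δ) :=
    mul_le_mul h1 (Real.sqrt_le_sqrt h1) (Real.sqrt_nonneg _) (by positivity)
  refine h2.trans ((mul_sqrt_add_le (sq_nonneg w) (abs_nonneg u) hδ.le).trans (le_of_eq ?_))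
  rw [Real.sqrt_sq_eq_abs, p32, ← sq_abs w]
  ring

/-- A mean zero solution of `Δv = ∂_i ∂_k f` is unique, so `v` is the initial value of the heat flow
constructed for `f`. Then the regularisation `δ` of the Bellman function tends to zero; `18 = 3 · 6`
combines `riesz_pairing` and `bell_le`. -/
lemma riesz_pairing_le {f g v : E3 → ℝ} (hf : TP f) (hg : TP g) (hv : TP v) {i k : Fin 3}
    (h : lap v = pd i (pd k f)) (h0 : ∫ x in cube, v x = 0) :
    ∫ x in cube, v x * g x ≤ 18 * ((∫ x in cube, |g x| ^ 3) + ∫ x in cube, p32 (f x)) := by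
  obtain ⟨U, V, hU, hV, rfl, hUV, C, hC⟩ := exists_riesz_heatFlow hf i k
  obtain ⟨W, hW, rfl⟩ := exists_heatFlow hg
  have hV0 := integral_eq_zero_of_heatFlow_decay hV hC
  have hd : SP fun x => v x - V 0 x := hv.sp.sub (hV.tp 0).sp
  have hl : ∀ x, lap (fun x => v x - V 0 x) x = 0 := fun x => by
    have := congrFun (lap_add hv.sp ((hV.tp 0).sp.const_mul (-1))) x
    rw [lap_const_mul (hV.tp 0).sp] at this
    simp only [neg_mul, one_mul, ← sub_eq_add_neg] at this
    rw [this, h, hUV, sub_self]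
  have hc := const_of_lap_eq_zero hd hl
  have hv0 : v = V 0 := by
    have h1 : ∫ x in cube, (v x - V 0 x) = 0 := by
      rw [integral_sub hv.sp.integrableOn (hV.tp 0).sp.integrableOn, h0, hV0, sub_self]
    have h2 : (fun x => v x - V 0 x) = fun _ => v 0 - V 0 0 := funext fun x => hc x 0
    rw [h2] at h1
    simp only [integral_const, smul_eq_mul, measureReal_restrict_apply MeasurableSet.univ, univ_inter,
      measureReal_def, volume_cube, ENNReal.toReal_one, one_mul] at h1
    ext x
    have := hc x 0
    linarith
  rw [hv0]
  have iW : IntegrableOn (fun x => |W 0 x| ^ 3) cube :=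
    ((hW.tp 0).sp.per.comp fun y => |y| ^ 3).integrableOn ((hW.tp 0).sp.continuous.abs.pow 3)
  have iU : IntegrableOn (fun x => p32 (U 0 x)) cube :=
    ((hU.tp 0).sp.per.comp p32).integrableOn (continuous_p32.comp (hU.tp 0).sp.continuous)
  have key : ∀ δ : ℝ, 0 < δ → ∫ x in cube, V 0 x * W 0 x
      ≤ 18 * ((∫ x in cube, |W 0 x| ^ 3) + ∫ x in cube, p32 (U 0 x)) + 18 * (δ * √δ) := fun δ hδ => by
    have h1 := riesz_pairing hU hV hW hUV hC hδ
    have h2 : ∫ x in cube, bell δ (W 0 x) (U 0 x)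
        ≤ ∫ x in cube, 6 * (|W 0 x| ^ 3 + p32 (U 0 x) + δ * √δ) :=
      integral_mono ((hW.tp 0).sp.bell hδ (hU.tp 0).sp).integrableOn
        (((Integrable.add iW iU).add (integrable_const _)).const_mul 6) fun x => bell_le hδ _ _
    have iS : IntegrableOn (fun x => |W 0 x| ^ 3 + p32 (U 0 x)) cube := iW.add iU
    rw [integral_const_mul, integral_add iS (integrable_const _), integral_add iW iU] at h2
    simp only [integral_const, smul_eq_mul, measureReal_restrict_apply MeasurableSet.univ, univ_inter,
      measureReal_def, volume_cube, ENNReal.toReal_one, one_mul] at h2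
    linarith
  have hlim : Tendsto (fun δ : ℝ => 18 * ((∫ x in cube, |W 0 x| ^ 3) + ∫ x in cube, p32 (U 0 x))
      + 18 * (δ * √δ)) (𝓝[>] 0) (𝓝 (18 * ((∫ x in cube, |W 0 x| ^ 3) + ∫ x in cube, p32 (U 0 x)))) := by
    have hc : Continuous fun δ : ℝ => 18 * ((∫ x in cube, |W 0 x| ^ 3) + ∫ x in cube, p32 (U 0 x))
      + 18 * (δ * √δ) := by fun_prop
    have := hc.tendsto 0
    simp only [Real.sqrt_zero, mul_zero, add_zero] at this
    exact this.mono_left nhdsWithin_le_nhds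
  exact ge_of_tendsto hlim (eventually_mem_nhdsWithin.mono key)

lemma ofReal_integral_rpow {α : Type*} [MeasurableSpace α] {μ : Measure α} {f : α → ℝ} {p : ℝ≥0∞}
    (h0 : p ≠ 0) (hp : p ≠ ⊤) (hf : MemLp f p μ) :
    ENNReal.ofReal (∫ x, |f x| ^ p.toReal ∂μ) = eLpNorm f p μ ^ p.toReal := by
  have hpos : 0 < p.toReal := ENNReal.toReal_pos h0 hp
  rw [eLpNorm_eq_lintegral_rpow_enorm_toReal h0 hp, ← ENNReal.rpow_mul, one_div,
    inv_mul_cancel₀ hpos.ne', ENNReal.rpow_one, ofReal_integral_eq_lintegral_ofReal]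
  · refine lintegral_congr fun x => ?_
    rw [← ENNReal.ofReal_rpow_of_nonneg (abs_nonneg _) hpos.le, Real.enorm_eq_ofReal_abs]
  · simpa only [Real.norm_eq_abs] using hf.integrable_norm_rpow h0 hp
  · exact Eventually.of_forall fun x => Real.rpow_nonneg (abs_nonneg _) _

lemma toReal_three_halves : ((3 / 2 : ℝ≥0∞)).toReal = 3 / 2 := by simp

lemma three_halves_ne_top : (3 / 2 : ℝ≥0∞) ≠ ⊤ := by
  exact ENNReal.div_ne_top (by simp) (by simp)

lemma three_halves_ne_zero : (3 / 2 : ℝ≥0∞) ≠ 0 := by simp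

lemma one_le_three_halves : (1 : ℝ≥0∞) ≤ 3 / 2 := by
  rw [ENNReal.le_div_iff_mul_le (by simp) (by simp)]
  norm_num

lemma ofReal_integral_p32 {f : E3 → ℝ} (hf : MemLp f (3 / 2) (volume.restrict cube)) :
    ENNReal.ofReal (∫ x in cube, p32 (f x)) = eLpNorm f (3 / 2) (volume.restrict cube) ^ (3 / 2 : ℝ) := by
  have := ofReal_integral_rpow three_halves_ne_zero three_halves_ne_top hf
  rw [toReal_three_halves] at this
  simpa only [p32_eq_rpow] using this

lemma ofReal_integral_cube_pow {f : E3 → ℝ} (hf : MemLp f 3 (volume.restrict cube)) :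
    ENNReal.ofReal (∫ x in cube, |f x| ^ 3) = eLpNorm f 3 (volume.restrict cube) ^ (3 : ℝ) := by
  have := ofReal_integral_rpow (by simp) (by simp) hf
  simpa using this

lemma integral_cube_pow_conv_le {g : E3 → ℝ} (hg : SP g) (N : ℕ) :
    ∫ x in cube, |conv N g x| ^ 3 ≤ ∫ x in cube, |g x| ^ 3 := by
  have h1 := ENNReal.rpow_le_rpow (z := 3)
    (eLpNorm_conv_le hg.per (p := 3) (by norm_num) (by simp) hg.continuous.aestronglyMeasurable N)
    (by norm_num)
  rw [← ofReal_integral_cube_pow (hg.memLp 3),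
    ← ofReal_integral_cube_pow ((tp_conv hg.integrableOn N).sp.memLp 3)] at h1
  exact (ENNReal.ofReal_le_ofReal_iff (integral_nonneg fun x => by positivity)).1 h1

lemma tendsto_integral_mul_conv {v g : E3 → ℝ} (hv : IntegrableOn v cube) (hg : Per g)
    (hc : Continuous g) :
    Tendsto (fun N => ∫ x in cube, v x * conv N g x) atTop (𝓝 (∫ x in cube, v x * g x)) := by
  obtain ⟨C, -, hC⟩ := hg.exists_bound hc
  refine tendsto_integral_of_dominated_convergence (fun x => ‖v x‖ * C)
    (fun N => hv.aestronglyMeasurable.mul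
      (tp_conv (hg.integrableOn hc) N).sp.continuous.aestronglyMeasurable)
    (hv.norm.mul_const C) (fun N => Eventually.of_forall fun x => ?_)
    (Eventually.of_forall fun x => (tendsto_conv hg hc x).const_mul _)
  rw [norm_mul]
  exact mul_le_mul_of_nonneg_left (abs_conv_le hg hC N x) (norm_nonneg _)

/-- The dual function used for the norm of `v` is smooth but not a trigonometric polynomial, so the
pairing is extended by density. -/
lemma riesz_pairing_sp {f g v : E3 → ℝ} (hf : TP f) (hg : SP g) (hv : TP v) {i k : Fin 3}
    (h : lap v = pd i (pd k f)) (h0 : ∫ x in cube, v x = 0) :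
    ∫ x in cube, v x * g x ≤ 18 * ((∫ x in cube, |g x| ^ 3) + ∫ x in cube, p32 (f x)) := by
  refine le_of_tendsto (tendsto_integral_mul_conv hv.sp.integrableOn hg.per hg.continuous)
    (Eventually.of_forall fun N => ?_)
  refine (riesz_pairing_le hf (tp_conv hg.integrableOn N) hv h h0).trans ?_
  linarith [integral_cube_pow_conv_le hg N]

lemma integrableOn_p32 {f : E3 → ℝ} (hf : SP f) : IntegrableOn (fun x => p32 (f x)) cube :=
  (hf.per.comp p32).integrableOn (continuous_p32.comp hf.continuous)

lemma integral_const_cube (c : ℝ) : ∫ _ in cube, c = c := by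
  simp

/-- Duality with `g = (1/6) v / √|v|`, with `|v|` regularised by `δ`. For `X = ∫ |v|^{3/2}` and `Y =
∫ |f|^{3/2}` the pairing is about `X/6` and `∫ |g|³ ≤ X/216`, so `X/6 ≤ 18 (X/216 + Y) = X/12 + 18
Y`. The factor `1/6` in `g` is what allows `X` to be absorbed. -/
lemma integral_p32_riesz_le {f v : E3 → ℝ} (hf : TP f) (hv : TP v) {i k : Fin 3}
    (h : lap v = pd i (pd k f)) (h0 : ∫ x in cube, v x = 0) :
    ∫ x in cube, p32 (v x) ≤ 216 * ∫ x in cube, p32 (f x) := by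
  have key : ∀ δ : ℝ, 0 < δ → ∫ x in cube, p32 (v x)
      ≤ 216 * (∫ x in cube, p32 (f x)) + 2 * (δ * √δ) := fun δ hδ => by
    have hh : SP fun x => √(regAbs δ (v x)) := (hv.sp.regAbs hδ).sqrt fun x => regAbs_pos hδ _
    have hpos : ∀ x, 0 < √(regAbs δ (v x)) := fun x => Real.sqrt_pos.2 (regAbs_pos hδ _)
    have hg : SP fun x => 1 / 6 * (v x / √(regAbs δ (v x))) :=
      (hv.sp.div hh fun x => (hpos x).ne').const_mul _
    have h1 := riesz_pairing_sp hf hg hv h h0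
    have h2 : ∫ x in cube, (1 / 6 * (p32 (v x) - δ * √δ))
        ≤ ∫ x in cube, v x * (1 / 6 * (v x / √(regAbs δ (v x)))) := by
      refine integral_mono (((integrableOn_p32 hv.sp).sub (integrable_const _)).const_mul _)
        (hv.sp.mul hg).integrableOn fun x => ?_
      have e : v x * (1 / 6 * (v x / √(regAbs δ (v x)))) = 1 / 6 * (v x ^ 2 / √(regAbs δ (v x))) := by ring
      rw [e]
      refine mul_le_mul_of_nonneg_left ?_ (by norm_num)
      rw [le_div_iff₀ (hpos x)]
      have e1 := le_regAbs δ (v x)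
      have e2 := regAbs_sq δ (v x)
      have e3 : δ ≤ regAbs δ (v x) := by
        refine le_of_not_gt fun h => ?_
        nlinarith [sq_nonneg (v x), regAbs_pos hδ (v x)]
      have s1 := Real.sqrt_le_sqrt e1
      have s2 := Real.sqrt_le_sqrt e3
      have s3 := Real.sq_sqrt (regAbs_pos hδ (v x)).le
      have s4 := hpos x
      set r := √(regAbs δ (v x))
      have hx : v x ^ 2 = |v x| ^ 2 := (sq_abs _).symm
      have q1 := Real.sq_sqrt (abs_nonneg (v x))
      have q2 := Real.sq_sqrt hδ.le
      have q3 := Real.sqrt_nonneg |v x|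
      have q4 := Real.sqrt_pos.2 hδ
      rw [p32]
      set A := √|v x|
      set D := √δ
      have e4 : v x ^ 2 = r ^ 4 - D ^ 4 := by
        have : r ^ 4 = regAbs δ (v x) ^ 2 := by rw [← s3]; ring
        have : D ^ 4 = δ ^ 2 := by rw [← q2]; ring
        linarith
      have e5 : A ^ 4 = r ^ 4 - D ^ 4 := by rw [← e4, hx, ← q1]; ring
      rw [e4, ← q1, ← q2]
      -- `(A³ - D³) r ≤ A⁴`
      have f1 : A ^ 4 ≤ r ^ 4 := pow_le_pow_left₀ q3 s1 4
      have f2 : A ≤ r := s1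
      have f3 : D ≤ r := s2
      have f4 : A ^ 3 * r - D ^ 3 * r ≤ r ^ 4 - D ^ 4 := by
        have f5 : A ^ 3 ≤ r ^ 3 := pow_le_pow_left₀ q3 f2 3
        have f6 : D ^ 3 * D ≤ D ^ 3 * r := mul_le_mul_of_nonneg_left f3 (pow_nonneg q4.le 3)
        have f7 : A ^ 3 * r ≤ r ^ 3 * r := mul_le_mul_of_nonneg_right f5 s4.le
        nlinarith
      nlinarith
    have h3 : ∫ x in cube, |1 / 6 * (v x / √(regAbs δ (v x)))| ^ 3
        ≤ ∫ x in cube, 1 / 216 * p32 (v x) := by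
      refine integral_mono ((hg.per.comp fun y => |y| ^ 3).integrableOn (hg.continuous.abs.pow 3))
        ((integrableOn_p32 hv.sp).const_mul _) fun x => ?_
      have s1 := Real.sqrt_le_sqrt (le_regAbs δ (v x))
      have s4 := hpos x
      set r := √(regAbs δ (v x))
      have q1 := Real.sq_sqrt (abs_nonneg (v x))
      have q3 := Real.sqrt_nonneg |v x|
      simp only [p32]
      set A := √|v x|
      have : |1 / 6 * (v x / r)| = 1 / 6 * (A ^ 2 / r) := by
        rw [abs_mul, abs_of_pos (by norm_num : (0 : ℝ) < 1 / 6), abs_div, abs_of_pos s4, q1]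
      rw [this, ← q1]
      have f1 : A ^ 2 / r ≤ A := by rw [div_le_iff₀ s4]; nlinarith
      calc (1 / 6 * (A ^ 2 / r)) ^ 3 ≤ (1 / 6 * A) ^ 3 :=
            pow_le_pow_left₀ (by positivity) (by linarith) 3
        _ = _ := by ring
    rw [integral_const_mul] at h2 h3
    rw [integral_sub (integrableOn_p32 hv.sp) (integrable_const _), integral_const_cube] at h2
    linarith
  have hlim : Tendsto (fun δ : ℝ => 216 * (∫ x in cube, p32 (f x)) + 2 * (δ * √δ)) (𝓝[>] 0)
      (𝓝 (216 * ∫ x in cube, p32 (f x))) := by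
    have hc : Continuous fun δ : ℝ => 216 * (∫ x in cube, p32 (f x)) + 2 * (δ * √δ) := by fun_prop
    have := hc.tendsto 0
    simp only [Real.sqrt_zero, mul_zero, add_zero] at this
    exact this.mono_left nhdsWithin_le_nhds
  exact ge_of_tendsto hlim (eventually_mem_nhdsWithin.mono key)

/-- Second order Riesz transforms are bounded on `L^{3/2}`. -/
lemma eLpNorm_riesz_le {f v : E3 → ℝ} (hf : TP f) (hv : TP v) {i k : Fin 3}
    (h : lap v = pd i (pd k f)) (h0 : ∫ x in cube, v x = 0) :
    eLpNorm v (3 / 2) (volume.restrict cube) ≤ 216 * eLpNorm f (3 / 2) (volume.restrict cube) := by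
  have h1 := ENNReal.ofReal_le_ofReal (integral_p32_riesz_le hf hv h h0)
  rw [ENNReal.ofReal_mul (by norm_num), ofReal_integral_p32 (hf.sp.memLp _),
    ofReal_integral_p32 (hv.sp.memLp _)] at h1
  -- The constant is moved inside the power `3/2` at the price of replacing it by a larger one.
  have h2 : ENNReal.ofReal 216 ≤ (216 : ℝ≥0∞) ^ (3 / 2 : ℝ) := by
    have : ENNReal.ofReal 216 = (216 : ℝ≥0∞) ^ (1 : ℝ) := by simp
    rw [this]
    exact ENNReal.rpow_le_rpow_of_exponent_le (by norm_num) (by norm_num)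
  have h3 : eLpNorm v (3 / 2) (volume.restrict cube) ^ (3 / 2 : ℝ)
      ≤ (216 * eLpNorm f (3 / 2) (volume.restrict cube)) ^ (3 / 2 : ℝ) := by
    rw [ENNReal.mul_rpow_of_nonneg _ _ (by norm_num)]
    exact h1.trans (mul_le_mul_left h2 _)
  exact (ENNReal.rpow_le_rpow_iff (by norm_num)).1 h3

lemma eq_of_lap_eq {u v : E3 → ℝ} (hu : SP u) (hv : SP v) (h : lap u = lap v)
    (h0 : ∫ x in cube, u x = ∫ x in cube, v x) : u = v := by
  have hd : SP fun x => u x - v x := hu.sub hv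
  have hl : ∀ x, lap (fun x => u x - v x) x = 0 := fun x => by
    have := congrFun (lap_add hu (hv.const_mul (-1))) x
    rw [lap_const_mul hv] at this
    simp only [neg_mul, one_mul, ← sub_eq_add_neg] at this
    rw [this, h, sub_self]
  have hc := const_of_lap_eq_zero hd hl
  have h1 : ∫ x in cube, (u x - v x) = 0 := by
    rw [integral_sub hu.integrableOn hv.integrableOn, h0, sub_self]
  have h2 : (fun x => u x - v x) = fun _ => u 0 - v 0 := funext fun x => hc x 0
  rw [h2, integral_const_cube] at h1
  ext x
  have := hc x 0
  linarith

lemma lap_sum {ι : Type*} (s : Finset ι) {f : ι → E3 → ℝ} (hf : ∀ a ∈ s, SP (f a)) :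
    lap (fun x => ∑ a ∈ s, f a x) = fun x => ∑ a ∈ s, lap (f a) x := by
  ext x
  simp only [lap]
  rw [Finset.sum_comm]
  refine Finset.sum_congr rfl fun i _ => ?_
  rw [pd_sum s (fun a ha => (hf a ha).differentiable),
    pd_sum s (fun a ha => ((hf a ha).pd i).differentiable)]

lemma exists_riesz {f : E3 → ℝ} (hf : TP f) (i k : Fin 3) :
    ∃ v, TP v ∧ lap v = pd i (pd k f) ∧ ∫ x in cube, v x = 0 := by
  obtain ⟨U, V, hU, hV, rfl, hUV, C, hC⟩ := exists_riesz_heatFlow hf i k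
  exact ⟨V 0, hV.tp 0, hUV 0, integral_eq_zero_of_heatFlow_decay hV hC⟩

lemma eLpNorm_sum_le' {ι : Type*} [Fintype ι] {α : Type*} [MeasurableSpace α] {μ : Measure α}
    {f : ι → α → ℝ} {p : ℝ≥0∞} (hp : 1 ≤ p) (hf : ∀ a, AEStronglyMeasurable (f a) μ) :
    eLpNorm (fun x => ∑ a, f a x) p μ ≤ ∑ a, eLpNorm (f a) p μ := by
  have := eLpNorm_sum_le (s := Finset.univ) (f := f) (fun a _ => hf a) hp
  convert this using 2
  ext x; simp

lemma eLpNorm_riesz_sum_le {ι : Type*} [Fintype ι] {i k : ι → Fin 3} {M : ι → E3 → ℝ}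
    (hM : ∀ a, TP (M a)) {v : E3 → ℝ} (hv : SP v)
    (h : lap v = fun x => ∑ a, pd (i a) (pd (k a) (M a)) x) (h0 : ∫ x in cube, v x = 0) :
    eLpNorm v (3 / 2) (volume.restrict cube)
      ≤ 216 * ∑ a, eLpNorm (M a) (3 / 2) (volume.restrict cube) := by
  choose w hw1 hw2 hw3 using fun a => exists_riesz (hM a) (i a) (k a)
  have e : v = fun x => ∑ a, w a x := by
    refine eq_of_lap_eq hv (SP.sum _ fun a _ => (hw1 a).sp) ?_ ?_
    · rw [h, lap_sum _ fun a _ => (hw1 a).sp]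
      simp only [hw2]
    · rw [h0, integral_finsetSum _ fun a _ => (hw1 a).sp.integrableOn]
      simp [hw3]
  rw [e, Finset.mul_sum]
  refine (eLpNorm_sum_le' one_le_three_halves fun a =>
    (hw1 a).sp.continuous.aestronglyMeasurable).trans (Finset.sum_le_sum fun a _ => ?_)
  exact eLpNorm_riesz_le (hM a) (hw1 a) (hw2 a) (hw3 a)

/-! ### Poincaré's inequality -/

lemma eLpNorm_average_le {α : Type*} [MeasurableSpace α] {μ : Measure α} [IsProbabilityMeasure μ]
    {g : E3 → ℝ} (hg : Per g) (hc : Continuous g) {φ : α → E3} (hφ : Measurable φ) {p : ℝ≥0∞}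
    (h1 : 1 ≤ p) (hp : p ≠ ⊤) :
    eLpNorm (fun x => ∫ a, g (x + φ a) ∂μ) p (volume.restrict cube)
      ≤ eLpNorm g p (volume.restrict cube) := by
  have h0 : p ≠ 0 := (zero_lt_one.trans_le h1).ne'
  have hm : Measurable fun z : E3 × α => g (z.1 + φ z.2) :=
    hc.measurable.comp (measurable_fst.add (hφ.comp measurable_snd))
  rw [eLpNorm_eq_lintegral_rpow_enorm_toReal h0 hp, eLpNorm_eq_lintegral_rpow_enorm_toReal h0 hp]
  refine ENNReal.rpow_le_rpow ?_ (by positivity)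
  calc ∫⁻ x in cube, ‖∫ a, g (x + φ a) ∂μ‖ₑ ^ p.toReal
      ≤ ∫⁻ x in cube, ∫⁻ a, ‖g (x + φ a)‖ₑ ^ p.toReal ∂μ := by
        refine lintegral_mono fun x => ?_
        exact enorm_integral_rpow_le (hm.comp measurable_prodMk_left).aestronglyMeasurable h1 hp
    _ = ∫⁻ a, (∫⁻ x in cube, ‖g (x + φ a)‖ₑ ^ p.toReal) ∂μ :=
        lintegral_lintegral_swap (f := fun x a => ‖g (x + φ a)‖ₑ ^ p.toReal)
          (hm.enorm.pow_const _).aemeasurable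
    _ = ∫⁻ x in cube, ‖g x‖ₑ ^ p.toReal := by
        have : ∀ l, ∫⁻ x in cube, ‖g (x + l)‖ₑ ^ p.toReal = ∫⁻ x in cube, ‖g x‖ₑ ^ p.toReal :=
          fun l => lintegral_shift (hg.comp fun y => ‖y‖ₑ ^ p.toReal) l
        simp only [this]
        simp

lemma fderiv_eq_sum_pd (f : E3 → ℝ) (x l : E3) : fderiv ℝ f x l = ∑ i, l i * pd i f x := by
  have : l = ∑ i, l i • basisVec i := by
    ext j
    simp [basisVec, Pi.single_apply, Finset.sum_apply]
  conv_lhs => rw [this]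
  simp [pd]

lemma sub_eq_integral_pd {f : E3 → ℝ} (hf : SP f) (x l : E3) :
    f (x + l) - f x = ∫ r in Icc (0 : ℝ) 1, ∑ i, l i * pd i f (x + r • l) := by
  have hd : ∀ r : ℝ, HasDerivAt (fun r : ℝ => f (x + r • l)) (∑ i, l i * pd i f (x + r • l)) r := by
    intro r
    have h1 : HasDerivAt (fun r : ℝ => x + r • l) l r := by
      simpa using ((hasDerivAt_id r).smul_const l).const_add x
    have := (hf.differentiable (x + r • l)).hasFDerivAt.comp_hasDerivAt r h1
    rwa [fderiv_eq_sum_pd] at this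
  have hcont : Continuous fun r : ℝ => ∑ i, l i * pd i f (x + r • l) := by
    have := fun i => (hf.pd i).continuous
    fun_prop
  have := intervalIntegral.integral_eq_sub_of_hasDerivAt (a := 0) (b := 1) (fun r _ => hd r)
    (hcont.intervalIntegrable _ _)
  rw [intervalIntegral.integral_of_le zero_le_one, ← integral_Icc_eq_integral_Ioc] at this
  simpa using this.symm

/-- As the mean is zero, `f x` is minus the average of `f (x + l) - f x` over the cube, and each
increment is an integral of derivatives along the segment. The coordinates of `l` lie in `[0, 1)`,
so what remains is an average of translates of `|∂_i f|`. -/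
lemma eLpNorm_poincare {f : E3 → ℝ} (hf : SP f) (h0 : ∫ x in cube, f x = 0) {p : ℝ≥0∞}
    (h1 : 1 ≤ p) (hp : p ≠ ⊤) :
    eLpNorm f p (volume.restrict cube) ≤ ∑ i, eLpNorm (pd i f) p (volume.restrict cube) := by
  have : IsProbabilityMeasure ((volume : Measure ℝ).restrict (Icc 0 1)) := ⟨by simp⟩
  set μ : Measure (E3 × ℝ) := ((volume : Measure E3).restrict cube).prod (volume.restrict (Icc 0 1))
  have hcont : ∀ i, Continuous fun z : E3 × E3 × ℝ => |pd i f (z.1 + z.2.2 • z.2.1)| := fun i => by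
    have := (hf.pd i).continuous
    fun_prop
  have hint : ∀ i x, Integrable (fun a : E3 × ℝ => |pd i f (x + a.2 • a.1)|) μ := fun i x => by
    obtain ⟨C, -, hC⟩ := (hf.pd i).exists_bound
    exact Integrable.of_bound (Continuous.aestronglyMeasurable (by
      have := (hf.pd i).continuous
      fun_prop)) C (Eventually.of_forall fun a => by simpa using hC _)
  have hpt : ∀ x, ‖f x‖ ≤ ‖∑ i, ∫ a, |pd i f (x + a.2 • a.1)| ∂μ‖ := fun x => by
    have e1 : f x = - ∫ l in cube, (f (x + l) - f x) := by
      have h2 : IntegrableOn (fun l => f (x + l)) cube := by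
        simpa only [add_comm] using integrable_shift hf.per x hf.integrableOn
      rw [integral_sub h2 (integrable_const _), integral_const_cube]
      have := integral_shift hf.per x
      simp only [add_comm] at this
      rw [this, h0]; ring
    have e2 : ∫ l in cube, (f (x + l) - f x) = ∫ a, ∑ i, a.1 i * pd i f (x + a.2 • a.1) ∂μ := by
      rw [integral_prod]
      · exact integral_congr_ae (Eventually.of_forall fun l => sub_eq_integral_pd hf x l)
      · have hb : ∀ i, Integrable (fun a : E3 × ℝ => a.1 i * pd i f (x + a.2 • a.1)) μ := fun i => by
          refine ((hint i x).mono' (Continuous.aestronglyMeasurable (by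
            have := (hf.pd i).continuous
            fun_prop)) ?_)
          have : ∀ᵐ a ∂μ, a.1 ∈ cube := by
            have h4 : MeasurePreserving (Prod.fst : E3 × ℝ → E3) μ (volume.restrict cube) :=
              measurePreserving_fst
            exact h4.quasiMeasurePreserving.ae (ae_restrict_mem measurableSet_cube)
          filter_upwards [this] with a ha
          rw [norm_mul, Real.norm_eq_abs, Real.norm_eq_abs, abs_of_nonneg (ha i).1]
          exact mul_le_of_le_one_left (abs_nonneg _) (ha i).2.le
        exact integrable_finsetSum _ fun i _ => hb i
    rw [e1, e2, norm_neg, Real.norm_of_nonneg (Finset.sum_nonneg fun i _ => integral_nonneg fun a => abs_nonneg _),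
      ← integral_finsetSum _ fun i _ => hint i x]
    refine norm_integral_le_of_norm_le (integrable_finsetSum _ fun i _ => hint i x) ?_
    have : ∀ᵐ a ∂μ, a.1 ∈ cube := by
      have h4 : MeasurePreserving (Prod.fst : E3 × ℝ → E3) μ (volume.restrict cube) :=
        measurePreserving_fst
      exact h4.quasiMeasurePreserving.ae (ae_restrict_mem measurableSet_cube)
    filter_upwards [this] with a ha
    refine (norm_sum_le _ _).trans (Finset.sum_le_sum fun i _ => ?_)
    rw [norm_mul, Real.norm_eq_abs, Real.norm_eq_abs, abs_of_nonneg (ha i).1]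
    exact mul_le_of_le_one_left (abs_nonneg _) (ha i).2.le
  refine (eLpNorm_mono hpt).trans ?_
  have hmeas : ∀ i, AEStronglyMeasurable (fun x => ∫ a, |pd i f (x + a.2 • a.1)| ∂μ)
      (volume.restrict cube) := fun i =>
    ((hcont i).stronglyMeasurable.integral_prod_right' (ν := μ)).aestronglyMeasurable
  refine (eLpNorm_sum_le' h1 hmeas).trans (Finset.sum_le_sum fun i _ => ?_)
  have h5 := eLpNorm_average_le (μ := μ) (g := fun x => |pd i f x|) ((hf.pd i).per.comp _)
    (hf.pd i).continuous.abs (φ := fun a => a.2 • a.1) (by fun_prop) h1 hp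
  refine h5.trans (le_of_eq ?_)
  exact eLpNorm_congr_norm_ae (Eventually.of_forall fun x => by simp)

/-! ### Elliptic estimates for trigonometric polynomials -/

lemma exists_lap_eq_pd {f : E3 → ℝ} (hf : TP f) (k : Fin 3) :
    ∃ w, TP w ∧ lap w = pd k f ∧ ∫ x in cube, w x = 0 := by
  suffices h : ∃ w, TP w ∧ lap w = pd k f by
    obtain ⟨w, hw, h⟩ := h
    refine ⟨fun x => w x + -(∫ y in cube, w y), hw.add (TP.const _), ?_, ?_⟩
    · rw [lap_add hw.sp (SP.const _), h]
      ext x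
      simp [lap, pd_const]
    · rw [integral_add hw.sp.integrableOn (integrable_const _), integral_const_cube]
      ring
  refine TP.induction (P := fun f => ∃ w, TP w ∧ lap w = pd k f) (fun n θ => ?_)
    (fun f g hf hg ⟨v, hv, h1⟩ ⟨w, hw, h2⟩ => ⟨fun x => v x + w x, hv.add hw, ?_⟩)
    (fun c f hf ⟨v, hv, h1⟩ => ⟨fun x => c * v x, hv.const_mul c, ?_⟩) hf
  · rcases eq_or_ne n 0 with rfl | hn
    · refine ⟨_, TP.const 0, ?_⟩
      rw [pd_wave]
      ext x
      simp [lap, pd_const]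
    · refine ⟨fun x => -((n k * (2 * Real.pi)) / eig n) * wave n (θ + Real.pi / 2) x,
        (wave_mem _ _).const_mul _, ?_⟩
      rw [lap_const_mul (wave_sp _ _), lap_wave, pd_wave]
      have := (zero_lt_one.trans_le (one_le_eig hn)).ne'
      ext x
      field_simp
  · rw [lap_add hv.sp hw.sp, h1, h2, pd_add hf.sp.differentiable hg.sp.differentiable]
  · rw [lap_const_mul hv.sp, h1, pd_const_mul hf.sp.differentiable]

lemma lap_pd {f : E3 → ℝ} (hf : SP f) (i : Fin 3) : lap (pd i f) = pd i (lap f) := by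
  have : pd i (lap f) = fun x => ∑ m, pd i (pd m (pd m f)) x :=
    pd_sum Finset.univ (fun m _ => ((hf.pd m).pd m).differentiable) i
  rw [this]
  ext x
  refine Finset.sum_congr rfl fun m _ => ?_
  rw [pd_comm hf m i, pd_comm (hf.pd m) m i]

/-- The second order part is a sum of Riesz transforms. For the first order part, the three
derivatives of `Δ⁻¹ ∂_k f_k` are Riesz transforms of `f_k`, and Poincaré bounds the function by
their sum; hence `648 = 3 · 216`. -/
lemma eLpNorm_pressure_le {p : E3 → ℝ} (hp : SP p) (h0 : ∫ x in cube, p x = 0)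
    {f : Fin 3 → E3 → ℝ} (hf : ∀ k, TP (f k)) {M : Fin 3 → Fin 3 → E3 → ℝ} (hM : ∀ i k, TP (M i k))
    (h : lap p = fun x => (∑ k, pd k (f k) x) + ∑ i, ∑ k, pd i (pd k (M i k)) x) :
    eLpNorm p (3 / 2) (volume.restrict cube)
      ≤ (∑ k, 648 * eLpNorm (f k) (3 / 2) (volume.restrict cube))
        + ∑ i, ∑ k, 216 * eLpNorm (M i k) (3 / 2) (volume.restrict cube) := by
  choose r hr hr1 hr0 using fun k => exists_lap_eq_pd (hf k) k
  choose R hR hR1 hR0 using fun i k => exists_riesz (hM i k) i k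
  have hsr : SP fun x => ∑ k, r k x := SP.sum _ fun k _ => (hr k).sp
  have hsR : SP fun x => ∑ i, ∑ k, R i k x := SP.sum _ fun i _ => SP.sum _ fun k _ => (hR i k).sp
  have hpe : p = fun x => (∑ k, r k x) + ∑ i, ∑ k, R i k x := by
    refine eq_of_lap_eq hp (hsr.add hsR) ?_ ?_
    · rw [h, lap_add hsr hsR, lap_sum _ fun k _ => (hr k).sp,
        lap_sum _ fun i _ => SP.sum _ fun k _ => (hR i k).sp]
      ext x
      congr 1
      · exact Finset.sum_congr rfl fun k _ => by rw [hr1]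
      · refine Finset.sum_congr rfl fun i _ => ?_
        rw [lap_sum _ fun k _ => (hR i k).sp]
        exact Finset.sum_congr rfl fun k _ => by rw [hR1]
    · rw [h0, integral_add hsr.integrableOn hsR.integrableOn,
        integral_finsetSum _ fun k _ => (hr k).sp.integrableOn,
        integral_finsetSum _ fun i _ => (SP.sum _ fun k _ => (hR i k).sp).integrableOn]
      have : ∀ i, ∫ x in cube, ∑ k, R i k x = 0 := fun i => by
        rw [integral_finsetSum _ fun k _ => (hR i k).sp.integrableOn]
        simp [hR0]
      simp [hr0, this]
  have hrk : ∀ k, eLpNorm (r k) (3 / 2) (volume.restrict cube)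
      ≤ 648 * eLpNorm (f k) (3 / 2) (volume.restrict cube) := fun k => by
    refine (eLpNorm_poincare (hr k).sp (hr0 k) one_le_three_halves three_halves_ne_top).trans ?_
    calc ∑ i, eLpNorm (pd i (r k)) (3 / 2) (volume.restrict cube)
        ≤ ∑ _i : Fin 3, 216 * eLpNorm (f k) (3 / 2) (volume.restrict cube) := by
          refine Finset.sum_le_sum fun i _ => ?_
          exact eLpNorm_riesz_le (hf k) ((hr k).pd i) (by rw [lap_pd (hr k).sp, hr1 k])
            (integral_pd (hr k).sp i)
      _ = _ := by
          rw [Finset.sum_const, Finset.card_univ, Fintype.card_fin, nsmul_eq_mul, ← mul_assoc]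
          norm_num
  rw [hpe]
  refine (eLpNorm_add_le hsr.continuous.aestronglyMeasurable hsR.continuous.aestronglyMeasurable
    one_le_three_halves).trans (add_le_add ?_ ?_)
  · exact (eLpNorm_sum_le' one_le_three_halves fun k => (hr k).sp.continuous.aestronglyMeasurable).trans
      (Finset.sum_le_sum fun k _ => hrk k)
  · refine (eLpNorm_sum_le' one_le_three_halves fun i => (SP.sum Finset.univ fun k _ =>
      (hR i k).sp).continuous.aestronglyMeasurable).trans (Finset.sum_le_sum fun i _ => ?_)
    exact (eLpNorm_sum_le' one_le_three_halves fun k =>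
      (hR i k).sp.continuous.aestronglyMeasurable).trans
      (Finset.sum_le_sum fun k _ => eLpNorm_riesz_le (hM i k) (hR i k) (hR1 i k) (hR0 i k))

/-- The components of the curl. -/
def curlc (v : Fin 3 → E3 → ℝ) (k : Fin 3) (x : E3) : ℝ :=
  pd (k + 1) (v (k + 2)) x - pd (k + 2) (v (k + 1)) x

lemma SP.curlc {v : Fin 3 → E3 → ℝ} (hv : ∀ k, SP (v k)) (k : Fin 3) : SP (curlc v k) :=
  ((hv _).pd _).sub ((hv _).pd _)

lemma sum_fin3 {α : Type*} [AddCommMonoid α] (f : Fin 3 → α) (k : Fin 3) :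
    ∑ i, f i = f k + f (k + 1) + f (k + 2) := by
  rw [Fin.sum_univ_three]
  fin_cases k
  · rfl
  · change _ = f 1 + f 2 + f 0
    rw [add_assoc, add_comm]
  · change _ = f 2 + f 0 + f 1
    rw [add_comm, add_assoc]

lemma sum_succ3 {α : Type*} [AddCommMonoid α] (f : Fin 3 → α) : ∑ k, f (k + 1) = ∑ k, f k :=
  Equiv.sum_comp (Equiv.addRight (1 : Fin 3)) f

lemma sum_succ_succ3 {α : Type*} [AddCommMonoid α] (f : Fin 3 → α) : ∑ k, f (k + 2) = ∑ k, f k :=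
  Equiv.sum_comp (Equiv.addRight (2 : Fin 3)) f

lemma fin3_one_one (k : Fin 3) : k + 1 + 1 = k + 2 := by fin_cases k <;> rfl
lemma fin3_one_two (k : Fin 3) : k + 1 + 2 = k := by fin_cases k <;> rfl
lemma fin3_two_one (k : Fin 3) : k + 2 + 1 = k := by fin_cases k <;> rfl
lemma fin3_two_two (k : Fin 3) : k + 2 + 2 = k + 1 := by fin_cases k <;> rfl

/-- This is `Δ = ∇ div - curl curl`, with the components numbered modulo three. -/
lemma lap_eq_of_div_eq_zero {b : Fin 3 → E3 → ℝ} (hb : ∀ k, SP (b k))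
    (hdiv : ∀ x, ∑ k, pd k (b k) x = 0) (k : Fin 3) :
    lap (b k) = fun x => pd (k + 2) (curlc b (k + 1)) x - pd (k + 1) (curlc b (k + 2)) x := by
  have h1 : pd k (fun x => ∑ m, pd m (b m) x) = fun x => ∑ m, pd k (pd m (b m)) x :=
    pd_sum Finset.univ (fun m _ => ((hb m).pd m).differentiable) k
  rw [funext hdiv, pd_const] at h1
  have h2 : curlc b (k + 1) = fun x => pd (k + 2) (b k) x - pd k (b (k + 2)) x := by
    ext x; rw [curlc, fin3_one_one, fin3_one_two]
  have h3 : curlc b (k + 2) = fun x => pd k (b (k + 1)) x - pd (k + 1) (b k) x := by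
    ext x; rw [curlc, fin3_two_one, fin3_two_two]
  rw [h2, h3, pd_sub ((hb _).pd _).differentiable ((hb _).pd _).differentiable,
    pd_sub ((hb _).pd _).differentiable ((hb _).pd _).differentiable]
  ext x
  have h4 := congrFun h1 x
  simp only [sum_fin3 _ k] at h4
  rw [lap, sum_fin3 _ k, pd_comm (hb (k + 2)) (k + 2) k, pd_comm (hb (k + 1)) (k + 1) k]
  linarith

/-- `∂_i b_k = ∂_i Δ⁻¹ (-curl curl b)_k`, a sum of two second order Riesz transforms of the curl. -/
lemma eLpNorm_pd_le_curl {b : Fin 3 → E3 → ℝ} (hb : ∀ k, TP (b k))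
    (hdiv : ∀ x, ∑ k, pd k (b k) x = 0) (i k : Fin 3) :
    eLpNorm (pd i (b k)) (3 / 2) (volume.restrict cube)
      ≤ 216 * ∑ m, eLpNorm (curlc b m) (3 / 2) (volume.restrict cube) := by
  have hc : ∀ m, TP (curlc b m) := fun m => ((hb _).pd _).sub ((hb _).pd _)
  have h1 := eLpNorm_riesz_sum_le (ι := Fin 2) (i := fun _ => i) (k := ![k + 2, k + 1])
    (M := ![curlc b (k + 1), fun x => - curlc b (k + 2) x]) (v := pd i (b k))
    (by intro a; fin_cases a; exacts [hc _, (hc _).neg]) ((hb k).pd i).sp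
    (by
      rw [lap_pd (hb k).sp, lap_eq_of_div_eq_zero (fun k => (hb k).sp) hdiv,
        pd_sub ((hc _).pd _).sp.differentiable ((hc _).pd _).sp.differentiable]
      ext x
      simp only [Fin.sum_univ_two, Matrix.cons_val_zero, Matrix.cons_val_one]
      rw [pd_neg, pd_neg]
      rfl) (integral_pd (hb k).sp i)
  refine h1.trans (mul_le_mul_right ?_ _)
  rw [Fin.sum_univ_two, sum_fin3 _ k]
  simp only [Matrix.cons_val_zero, Matrix.cons_val_one]
  have : eLpNorm (fun x => - curlc b (k + 2) x) (3 / 2) (volume.restrict cube)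
      = eLpNorm (curlc b (k + 2)) (3 / 2) (volume.restrict cube) := eLpNorm_neg _ _ _
  rw [this, add_assoc]
  exact le_add_self

/-- Young's inequality with the coefficient of `h³` small enough to be absorbed in
`integral_cube_pow_curl_le`. -/
lemma young_p32 {h y : ℝ} (hh : 0 ≤ h) (hy : 0 ≤ y) : h * y ≤ 1 / 2 * h ^ 3 + 2 * p32 y := by
  rw [p32, abs_of_nonneg hy]
  have h1 := Real.sq_sqrt hy
  have h2 := Real.sqrt_nonneg y
  set s := √y
  rw [← h1]
  rcases le_total (2 * s) h with h3 | h3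
  · have : s ^ 2 ≤ 1 / 2 * h ^ 2 := by nlinarith
    nlinarith [mul_le_mul_of_nonneg_left this hh, mul_nonneg (sq_nonneg s) h2]
  · nlinarith [mul_le_mul_of_nonneg_right h3 (sq_nonneg s), pow_nonneg hh 3]

lemma integral_curlc_mul {a : Fin 3 → E3 → ℝ} {g : Fin 3 → E3 → ℝ} (ha : ∀ k, SP (a k))
    (hg : ∀ k, SP (g k)) :
    ∫ x in cube, ∑ k, curlc a k x * g k x
      = ∫ x in cube, ∑ k, (a (k + 1) x * pd (k + 2) (g k) x - a (k + 2) x * pd (k + 1) (g k) x) := by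
  rw [integral_finsetSum _ fun k _ => ((SP.curlc ha k).mul (hg k)).integrableOn,
    integral_finsetSum _ fun k _ => (((ha _).mul ((hg k).pd _)).sub
      ((ha _).mul ((hg k).pd _))).integrableOn]
  refine Finset.sum_congr rfl fun k _ => ?_
  simp only [curlc, sub_mul]
  rw [integral_sub (((ha _).pd _).mul (hg k)).integrableOn (((ha _).pd _).mul (hg k)).integrableOn,
    integral_sub ((ha _).mul ((hg k).pd _)).integrableOn ((ha _).mul ((hg k).pd _)).integrableOn,
    integral_pd_mul (ha _) (hg k), integral_pd_mul (ha _) (hg k)]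
  ring

/-- An interpolation between `a ∈ L^∞` and second derivatives in `L^{3/2}`. With `h` a
regularisation of the length of `b = curl a`, integration by parts gives `∫ h |b|² = ∫ a · curl (h
b)`. Both `|b|` and `|∇h|` are bounded by `h` and by the sum `S` of the `|∂_i b_k|`, so the right
side is at most `12 M ∫ h S`: three components, two terms in each curl, two in each product rule.
Young's inequality then absorbs `h³`. -/
lemma integral_cube_pow_curl_le {a : Fin 3 → E3 → ℝ} (ha : ∀ k, SP (a k)) {M : ℝ}
    (hM : ∀ k x, |a k x| ≤ M) (m : Fin 3) :
    ∫ x in cube, |curlc a m x| ^ 3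
      ≤ 8 * ∫ x in cube, p32 (12 * M * ∑ i, ∑ k, |pd i (curlc a k) x|) := by
  have hM0 : 0 ≤ M := (abs_nonneg _).trans (hM 0 0)
  set b := curlc a with hbdef
  have hb : ∀ k, SP (b k) := SP.curlc ha
  set S : E3 → ℝ := fun x => ∑ i, ∑ k, |pd i (b k) x| with hS
  have hSc : Continuous S := by
    have := fun i k => ((hb k).pd i).continuous
    fun_prop
  have hSp : Per S := fun x l => by simp only [hS, ((hb _).pd _).per x l]
  have hS0 : ∀ x, 0 ≤ S x := fun x => Finset.sum_nonneg fun i _ => Finset.sum_nonneg fun k _ => abs_nonneg _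
  have hSle : ∀ i x, ∑ k, |pd i (b k) x| ≤ S x := fun i x =>
    Finset.single_le_sum (f := fun i => ∑ k, |pd i (b k) x|)
      (fun i _ => Finset.sum_nonneg fun k _ => abs_nonneg _) (Finset.mem_univ i)
  -- The length of `b` is not smooth where `b` vanishes, hence `√(|b|² + δ²)`.
  have key : ∀ δ : ℝ, 0 < δ → δ ≤ 1 / 2 → ∫ x in cube, |b m x| ^ 3
      ≤ 8 * (∫ x in cube, p32 (12 * M * S x)) + 4 * δ := fun δ hδ hδ1 => by
    have hqs : SP fun x => (∑ k, b k x * b k x) + δ ^ 2 :=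
      (SP.sum _ fun k _ => (hb k).mul (hb k)).add (SP.const _)
    have hq0 : ∀ x, 0 ≤ ∑ k, b k x * b k x := fun x => Finset.sum_nonneg fun k _ => mul_self_nonneg _
    have hqp : ∀ x, 0 < (∑ k, b k x * b k x) + δ ^ 2 := fun x => by
      have := hq0 x; positivity
    set h : E3 → ℝ := fun x => √((∑ k, b k x * b k x) + δ ^ 2) with hh
    have hsp : SP h := hqs.sqrt hqp
    have hpos : ∀ x, 0 < h x := fun x => Real.sqrt_pos.2 (hqp x)
    have hsq : ∀ x, h x ^ 2 = (∑ k, b k x * b k x) + δ ^ 2 := fun x => Real.sq_sqrt (hqp x).le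
    have hbh : ∀ k x, |b k x| ≤ h x := fun k x => by
      refine abs_le_of_sq_le_sq ?_ (hpos x).le
      rw [hsq, sq]
      have := Finset.single_le_sum (f := fun k => b k x * b k x) (fun i _ => mul_self_nonneg _)
        (Finset.mem_univ k)
      nlinarith [sq_nonneg δ]
    have hpd : ∀ i x, |pd i h x| ≤ S x := fun i x => by
      have h1 : pd i (fun x => h x * h x) x = 2 * (h x * pd i h x) := by
        rw [pd_mul hsp.differentiable hsp.differentiable]; ring
      have h2 : (fun x => h x * h x) = fun x => (∑ k, b k x * b k x) + δ ^ 2 := by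
        ext x; rw [← sq, hsq]
      have h3 : pd i (fun x => (∑ k, b k x * b k x) + δ ^ 2) x = ∑ k, 2 * (b k x * pd i (b k) x) := by
        rw [pd_add (SP.sum _ fun k _ => (hb k).mul (hb k)).differentiable (SP.const _).differentiable,
          pd_const, pd_sum _ fun k _ => ((hb k).mul (hb k)).differentiable]
        simp only [add_zero]
        refine Finset.sum_congr rfl fun k _ => ?_
        rw [pd_mul (hb k).differentiable (hb k).differentiable]
        ring
      rw [h2, h3, ← Finset.mul_sum] at h1
      have h4 : h x * |pd i h x| ≤ h x * ∑ k, |pd i (b k) x| := by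
        rw [← abs_of_pos (hpos x), ← abs_mul, abs_of_pos (hpos x)]
        rw [show h x * pd i h x = ∑ k, b k x * pd i (b k) x by linarith, Finset.mul_sum]
        refine (Finset.abs_sum_le_sum_abs _ _).trans (Finset.sum_le_sum fun k _ => ?_)
        rw [abs_mul]
        exact mul_le_mul_of_nonneg_right (hbh k x) (abs_nonneg _)
      exact (le_of_mul_le_mul_left h4 (hpos x)).trans (hSle i x)
    have hpd2 : ∀ i k x, |pd i (fun x => h x * b k x) x| ≤ 2 * (h x * S x) := fun i k x => by
      rw [pd_mul hsp.differentiable (hb k).differentiable]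
      refine (abs_add_le _ _).trans ?_
      rw [abs_mul, abs_mul, abs_of_pos (hpos x)]
      have h1 : |pd i (b k) x| ≤ S x :=
        (Finset.single_le_sum (f := fun k => |pd i (b k) x|) (fun k _ => abs_nonneg _)
          (Finset.mem_univ k)).trans (hSle i x)
      nlinarith [mul_le_mul (hpd i x) (hbh k x) (abs_nonneg _) (hS0 x),
        mul_le_mul_of_nonneg_left h1 (hpos x).le]
    have e1 : ∫ x in cube, ∑ k, b k x * (h x * b k x) ≤ ∫ x in cube, h x * (12 * M * S x) := by
      rw [hbdef, integral_curlc_mul ha fun k => hsp.mul (hb k)]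
      refine integral_mono (SP.sum _ fun k _ => ((ha _).mul ((hsp.mul (hb k)).pd _)).sub
        ((ha _).mul ((hsp.mul (hb k)).pd _))).integrableOn ?_ fun x => ?_
      · refine Per.integrableOn (fun x l => ?_) (hsp.continuous.mul (continuous_const.mul hSc))
        simp only [hsp.per x l, hSp x l]
      · have h1 : ∀ i j k, |a j x * pd i (fun x => h x * b k x) x| ≤ M * (2 * (h x * S x)) :=
          fun i j k => by
            rw [abs_mul]
            exact mul_le_mul (hM j x) (hpd2 i k x) (abs_nonneg _) hM0
        have h2 : ∀ k, a (k + 1) x * pd (k + 2) (fun x => h x * b k x) x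
            - a (k + 2) x * pd (k + 1) (fun x => h x * b k x) x ≤ 4 * (M * (h x * S x)) := fun k => by
          have := le_of_abs_le (h1 (k + 2) (k + 1) k)
          have := neg_le_of_abs_le (h1 (k + 1) (k + 2) k)
          linarith
        calc _ ≤ ∑ _k : Fin 3, 4 * (M * (h x * S x)) := Finset.sum_le_sum fun k _ => h2 k
          _ = _ := by
            rw [Finset.sum_const, Finset.card_univ, Fintype.card_fin, nsmul_eq_mul]; push_cast; ring
    have e2 : ∫ x in cube, h x * (12 * M * S x)
        ≤ ∫ x in cube, (1 / 2 * h x ^ 3 + 2 * p32 (12 * M * S x)) := by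
      refine integral_mono (Per.integrableOn (fun x l => by simp only [hsp.per x l, hSp x l])
        (hsp.continuous.mul (continuous_const.mul hSc))) (Per.integrableOn (fun x l => by
          simp only [hsp.per x l, hSp x l]) ?_) fun x => young_p32 (hpos x).le ?_
      · exact (continuous_const.mul (hsp.continuous.pow 3)).add
          (continuous_const.mul (continuous_p32.comp (continuous_const.mul hSc)))
      · have := hS0 x; positivity
    have hi3 : IntegrableOn (fun x => h x ^ 3) cube :=
      (hsp.per.comp fun y => y ^ 3).integrableOn (hsp.continuous.pow 3)
    have hip : IntegrableOn (fun x => p32 (12 * M * S x)) cube :=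
      (hSp.comp fun y => p32 (12 * M * y)).integrableOn
        (continuous_p32.comp (continuous_const.mul hSc))
    -- The regularisation costs `δ² h ≤ δ² + h³/4`. With `½ h³` from Young, a quarter of `∫ h³` is
    -- left, which produces the factor `8`.
    have e3 : ∫ x in cube, (3 / 4 * h x ^ 3 - δ ^ 2)
        ≤ ∫ x in cube, ∑ k, b k x * (h x * b k x) := by
      refine integral_mono ((hi3.const_mul _).sub (integrable_const _))
        (SP.sum _ fun k _ => (hb k).mul (hsp.mul (hb k))).integrableOn fun x => ?_
      have h1 : ∑ k, b k x * (h x * b k x) = h x ^ 3 - δ ^ 2 * h x := by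
        rw [show h x ^ 3 - δ ^ 2 * h x = h x * (h x ^ 2 - δ ^ 2) by ring, hsq, add_sub_cancel_right,
          Finset.mul_sum]
        exact Finset.sum_congr rfl fun k _ => by ring
      have h2 : h x ≤ 1 + h x ^ 3 := by
        rcases le_total (h x) 1 with h3 | h3
        · have := pow_pos (hpos x) 3; linarith
        · nlinarith [mul_nonneg (hpos x).le (mul_nonneg (sub_nonneg.2 h3) (by linarith : 0 ≤ h x + 1))]
      have h3 : δ ^ 2 ≤ 1 / 4 := by nlinarith
      have h4 := pow_pos (hpos x) 3
      simp only [h1]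
      nlinarith [mul_le_mul_of_nonneg_left h2 (sq_nonneg δ), mul_le_mul_of_nonneg_right h3 h4.le]
    have e4 : ∫ x in cube, |b m x| ^ 3 ≤ ∫ x in cube, h x ^ 3 :=
      integral_mono ((hb m).per.comp (fun y => |y| ^ 3) |>.integrableOn ((hb m).continuous.abs.pow 3))
        hi3 fun x => pow_le_pow_left₀ (abs_nonneg _) (hbh m x) 3
    rw [integral_sub (hi3.const_mul _) (integrable_const _), integral_const_mul,
      integral_const_cube] at e3
    rw [integral_add (hi3.const_mul _) (hip.const_mul _), integral_const_mul, integral_const_mul] at e2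
    nlinarith
  have : Tendsto (fun δ : ℝ => 8 * (∫ x in cube, p32 (12 * M * S x)) + 4 * δ) (𝓝[>] 0)
      (𝓝 (8 * (∫ x in cube, p32 (12 * M * S x)) + 4 * 0)) :=
    tendsto_nhdsWithin_of_tendsto_nhds (by
      have : Continuous fun δ : ℝ => 8 * (∫ x in cube, p32 (12 * M * S x)) + 4 * δ := by fun_prop
      exact this.tendsto 0)
  rw [mul_zero, add_zero] at this
  refine ge_of_tendsto this ?_
  filter_upwards [Ioc_mem_nhdsGT (show (0 : ℝ) < 1 / 2 by norm_num)] with δ hδ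
  exact key δ hδ.1 hδ.2

lemma pd_curlc_sum {a : Fin 3 → E3 → ℝ} (ha : ∀ k, SP (a k)) (x : E3) :
    ∑ k, pd k (curlc a k) x = 0 := by
  have : ∀ k, pd k (curlc a k) x
      = pd k (pd (k + 1) (a (k + 2))) x - pd (k + 1) (pd (k + 2) (a k)) x
        + (pd (k + 1) (pd (k + 2) (a k)) x - pd (k + 2) (pd k (a (k + 1))) x) := fun k => by
    have : pd k (curlc a k) = fun x => pd k (pd (k + 1) (a (k + 2))) x - pd k (pd (k + 2) (a (k + 1))) x :=
      pd_sub ((ha _).pd _).differentiable ((ha _).pd _).differentiable k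
    rw [this, pd_comm (ha (k + 1)) k (k + 2)]
    ring
  simp only [this, Finset.sum_add_distrib, Finset.sum_sub_distrib]
  have h1 := sum_succ3 fun k => pd k (pd (k + 1) (a (k + 2))) x
  have h2 := sum_succ_succ3 fun k => pd k (pd (k + 1) (a (k + 2))) x
  simp only [fin3_one_one, fin3_one_two, fin3_two_one, fin3_two_two] at h1 h2
  rw [h1, h2]
  ring

lemma sum_sum_const_fin3 (X : ℝ≥0∞) : ∑ _i : Fin 3, ∑ _k : Fin 3, X = 9 * X := by
  simp only [Finset.sum_const, Finset.card_univ, Fintype.card_fin, smul_smul]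
  norm_num

lemma eLpNorm_sum_abs_pd_le {b : Fin 3 → E3 → ℝ} (hb : ∀ k, TP (b k))
    (hdiv : ∀ x, ∑ k, pd k (b k) x = 0) :
    eLpNorm (fun x => ∑ i, ∑ k, |pd i (b k) x|) (3 / 2) (volume.restrict cube)
      ≤ 9 * (216 * ∑ k, eLpNorm (curlc b k) (3 / 2) (volume.restrict cube)) := by
  have hc : ∀ i k, Continuous fun x => |pd i (b k) x| := fun i k => ((hb k).pd i).sp.continuous.abs
  have h1 : ∀ i k, eLpNorm (fun x => |pd i (b k) x|) (3 / 2) (volume.restrict cube)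
      ≤ 216 * ∑ k, eLpNorm (curlc b k) (3 / 2) (volume.restrict cube) := fun i k =>
    (eLpNorm_norm (pd i (b k))).trans_le (eLpNorm_pd_le_curl hb hdiv i k)
  generalize 216 * ∑ k, eLpNorm (curlc b k) (3 / 2) (volume.restrict cube) = X at *
  rw [← sum_sum_const_fin3]
  have h2 : ∀ i, eLpNorm (fun x => ∑ k, |pd i (b k) x|) (3 / 2) (volume.restrict cube)
      ≤ ∑ _k : Fin 3, X := fun i =>
    (eLpNorm_sum_le' one_le_three_halves fun k => (hc i k).aestronglyMeasurable).trans
      (Finset.sum_le_sum fun k _ => h1 i k)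
  have h3 : ∀ i, Continuous fun x => ∑ k, |pd i (b k) x| := fun i =>
    continuous_finsetSum _ fun k _ => hc i k
  exact (eLpNorm_sum_le' one_le_three_halves fun i => (h3 i).aestronglyMeasurable).trans
    (Finset.sum_le_sum fun i _ => h2 i)

lemma ofReal_integral_p32_const_mul {f : E3 → ℝ} (hf : MemLp f (3 / 2) (volume.restrict cube))
    {c : ℝ} (hc : 0 ≤ c) :
    ENNReal.ofReal (∫ x in cube, p32 (c * f x))
      = (ENNReal.ofReal c * eLpNorm f (3 / 2) (volume.restrict cube)) ^ (3 / 2 : ℝ) := by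
  rw [ofReal_integral_p32 (hf.const_mul c)]
  congr 1
  have := eLpNorm_const_smul c f (3 / 2) (volume.restrict cube)
  rw [Real.enorm_eq_ofReal hc] at this
  exact this

lemma eLpNorm_curl_cube_le {a : Fin 3 → E3 → ℝ} (ha : ∀ k, TP (a k)) {M : ℝ}
    (hM : ∀ k x, |a k x| ≤ M) (m : Fin 3) :
    eLpNorm (curlc a m) 3 (volume.restrict cube) ^ (3 : ℝ)
      ≤ 8 * (ENNReal.ofReal (12 * M) * (9 * (216 * ∑ k,
        eLpNorm (curlc (curlc a) k) (3 / 2) (volume.restrict cube)))) ^ (3 / 2 : ℝ) := by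
  have hM0 : 0 ≤ 12 * M := mul_nonneg (by norm_num) ((abs_nonneg _).trans (hM 0 0))
  have hb : ∀ k, TP (curlc a k) := fun k => ((ha _).pd _).sub ((ha _).pd _)
  have hS : MemLp (fun x => ∑ i, ∑ k, |pd i (curlc a k) x|) (3 / 2) (volume.restrict cube) :=
    Per.memLp (fun x l => by simp only [((hb _).pd _).sp.per x l])
      (continuous_finsetSum _ fun i _ => continuous_finsetSum _ fun k _ =>
        ((hb k).pd i).sp.continuous.abs) _
  have h1 := integral_cube_pow_curl_le (fun k => (ha k).sp) hM m
  have h2 := ENNReal.ofReal_le_ofReal h1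
  rw [ofReal_integral_cube_pow ((hb m).sp.memLp 3), ENNReal.ofReal_mul (by norm_num),
    ofReal_integral_p32_const_mul hS hM0] at h2
  have e8 : ENNReal.ofReal 8 = 8 := by norm_num
  rw [e8] at h2
  refine h2.trans ?_
  have h3 := eLpNorm_sum_abs_pd_le hb (pd_curlc_sum fun k => (ha k).sp)
  gcongr

/-! ### Elliptic estimates for weak solutions on the torus -/

/-- Fatou along a subsequence that converges almost everywhere. Only `f ∈ L¹` is assumed, so this
proves membership in `L^p` and not just a bound. -/
lemma eLpNorm_le_of_conv {f : E3 → ℝ} (hf : Per f) (hi : IntegrableOn f cube) {p C : ℝ≥0∞}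
    (h : ∀ N, eLpNorm (conv N f) p (volume.restrict cube) ≤ C) :
    eLpNorm f p (volume.restrict cube) ≤ C := by
  have hm : ∀ N, AEStronglyMeasurable (conv N f) (volume.restrict cube) := fun N =>
    (tp_conv hi N).sp.continuous.aestronglyMeasurable
  have h1 := tendsto_eLpNorm_conv hf le_rfl ENNReal.one_ne_top (memLp_one_iff_integrable.2 hi)
  obtain ⟨ns, -, hns⟩ := (tendstoInMeasure_of_tendsto_eLpNorm one_ne_zero hm
    hi.aestronglyMeasurable h1).exists_seq_tendsto_ae
  refine (Lp.eLpNorm_lim_le_liminf_eLpNorm (fun n => hm (ns n)) f hns).trans ?_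
  exact (liminf_le_liminf (Eventually.of_forall fun n => h (ns n))).trans (by simp)

lemma peakKer_neg (N : ℕ) (x : E3) : peakKer N (-x) = peakKer N x := by
  have : peakBase (-x) = peakBase x := by
    simp only [peakBase, peakFactor_eq, PiLp.neg_apply, mul_neg, Real.cos_neg]
  rw [peakKer, this, peakKer]

lemma conv_sub {f g : E3 → ℝ} (hf : IntegrableOn f cube) (hg : IntegrableOn g cube) (N : ℕ) :
    conv N (fun x => f x - g x) = fun x => conv N f x - conv N g x := by
  ext x
  simp only [conv, kerOp, mul_sub]
  exact integral_sub (integrable_sp_mul ((tp_peakKer N).sp.shift_sub x) hf)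
    (integrable_sp_mul ((tp_peakKer N).sp.shift_sub x) hg)

/-- `b = ∇ × a` weakly on the torus. -/
def WeakCurlS (a b : Fin 3 → E3 → ℝ) : Prop :=
  ∀ k θ, TP θ → ∫ x in cube, b k x * θ x
    = (∫ x in cube, a (k + 1) x * pd (k + 2) θ x) - ∫ x in cube, a (k + 2) x * pd (k + 1) θ x

lemma curlc_conv {a b : Fin 3 → E3 → ℝ} (ha : ∀ k, IntegrableOn (a k) cube) (h : WeakCurlS a b)
    (N : ℕ) (k : Fin 3) : curlc (fun k => conv N (a k)) k = conv N (b k) := by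
  ext x
  have h1 := h k _ ((tp_peakKer N).shift_sub x)
  simp only [pd_shift_sub] at h1
  rw [curlc]
  simp only [conv]
  rw [pd_kerOp (tp_peakKer N) (ha _), pd_kerOp (tp_peakKer N) (ha _)]
  simp only [kerOp]
  simp only [mul_comm (peakKer N _), mul_comm (pd _ (peakKer N) _), h1]
  ring

/-- The smooth estimate holds for the mollified fields with the same constants, since mollification
commutes with the weak curl and increases neither the sup norm of `a` nor the `L^{3/2}` norm of `j`.
-/
lemma eLpNorm_cube_le_of_weakCurl {a b j : Fin 3 → E3 → ℝ} (hap : ∀ k, Per (a k))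
    (hai : ∀ k, IntegrableOn (a k) cube) (hbp : ∀ k, Per (b k)) (hbi : ∀ k, IntegrableOn (b k) cube)
    (hjp : ∀ k, Per (j k)) (hj : ∀ k, AEStronglyMeasurable (j k) (volume.restrict cube))
    (hab : WeakCurlS a b) (hbj : WeakCurlS b j) {M : ℝ} (hM : ∀ k x, |a k x| ≤ M) (m : Fin 3) :
    eLpNorm (b m) 3 (volume.restrict cube)
      ≤ (8 * (ENNReal.ofReal (12 * M) * (9 * (216 * ∑ k,
        eLpNorm (j k) (3 / 2) (volume.restrict cube)))) ^ (3 / 2 : ℝ)) ^ (3⁻¹ : ℝ) := by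
  refine eLpNorm_le_of_conv (hbp m) (hbi m) fun N => ?_
  rw [ENNReal.le_rpow_inv_iff (by norm_num)]
  have h1 := eLpNorm_curl_cube_le (a := fun k => conv N (a k)) (fun k => tp_conv (hai k) N)
    (fun k x => abs_conv_le (hap k) (hM k) N x) m
  have h2 : curlc (fun k => conv N (a k)) = fun k => conv N (b k) := funext (curlc_conv hai hab N)
  rw [h2] at h1
  refine h1.trans (mul_le_mul_right (ENNReal.rpow_le_rpow (mul_le_mul_right (mul_le_mul_right
    (mul_le_mul_right (Finset.sum_le_sum fun k _ => ?_) _) _) _) (by norm_num)) _)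
  rw [curlc_conv hbi hbj]
  exact eLpNorm_conv_le (hjp k) one_le_three_halves three_halves_ne_top (hj k) N

lemma pd_conv_sum_of_weakCurl {a b : Fin 3 → E3 → ℝ} (hai : ∀ k, IntegrableOn (a k) cube)
    (hab : WeakCurlS a b) (N : ℕ) (x : E3) : ∑ k, pd k (conv N (b k)) x = 0 := by
  have h2 : curlc (fun k => conv N (a k)) = fun k => conv N (b k) := funext (curlc_conv hai hab N)
  have := pd_curlc_sum (fun k => (tp_conv (hai k) N).sp) x
  rwa [h2] at this

/-- The div-curl estimate for a difference of two mollifications. It makes the gradients of the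
mollified field Cauchy when the mollified currents are. -/
lemma eLpNorm_pd_conv_sub_le {a b j : Fin 3 → E3 → ℝ} (hai : ∀ k, IntegrableOn (a k) cube)
    (hbi : ∀ k, IntegrableOn (b k) cube) (hab : WeakCurlS a b) (hbj : WeakCurlS b j)
    (N N' : ℕ) (i k : Fin 3) :
    eLpNorm (fun x => pd i (conv N (b k)) x - pd i (conv N' (b k)) x) (3 / 2) (volume.restrict cube)
      ≤ 216 * ∑ m, eLpNorm (fun x => conv N (j m) x - conv N' (j m) x) (3 / 2)
        (volume.restrict cube) := by
  have ht := fun N k => tp_conv (hbi k) N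
  have e : ∀ i k, pd i (fun x => conv N (b k) x - conv N' (b k) x)
      = fun x => pd i (conv N (b k)) x - pd i (conv N' (b k)) x := fun i k =>
    pd_sub (ht N k).sp.differentiable (ht N' k).sp.differentiable i
  have h1 := eLpNorm_pd_le_curl (b := fun k x => conv N (b k) x - conv N' (b k) x)
    (fun k => (ht N k).sub (ht N' k)) (fun x => by
      simp only [e, Finset.sum_sub_distrib, pd_conv_sum_of_weakCurl hai hab, sub_zero]) i k
  rw [e] at h1
  refine h1.trans (le_of_eq ?_)
  congr 1
  refine Finset.sum_congr rfl fun m _ => ?_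
  rw [← curlc_conv hbi hbj N, ← curlc_conv hbi hbj N']
  congr 1
  ext x
  simp only [curlc, e]
  ring

/-- Mollification commutes with the equation, so the smooth estimate applies to `conv N p` with a
bound independent of `N`. The equation determines `p` only up to a constant, hence the mean. -/
lemma memLp_sub_mean_of_weak_lap {p : E3 → ℝ} (hp : Per p) (hpi : IntegrableOn p cube)
    {f : Fin 3 → E3 → ℝ} (hfp : ∀ k, Per (f k))
    (hf : ∀ k, AEStronglyMeasurable (f k) (volume.restrict cube)) (hfi : ∀ k, IntegrableOn (f k) cube)
    {M : Fin 3 → Fin 3 → E3 → ℝ} (hMp : ∀ i k, Per (M i k))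
    (hM : ∀ i k, AEStronglyMeasurable (M i k) (volume.restrict cube))
    (hMi : ∀ i k, IntegrableOn (M i k) cube)
    (h : ∀ θ, TP θ → ∫ x in cube, p x * lap θ x
      = -(∑ k, ∫ x in cube, f k x * pd k θ x) + ∑ i, ∑ k, ∫ x in cube, M i k x * pd i (pd k θ) x) :
    eLpNorm (fun x => p x - ∫ y in cube, p y) (3 / 2) (volume.restrict cube)
      ≤ (∑ k, 648 * eLpNorm (f k) (3 / 2) (volume.restrict cube))
        + ∑ i, ∑ k, 216 * eLpNorm (M i k) (3 / 2) (volume.restrict cube) := by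
  set c := ∫ y in cube, p y
  refine eLpNorm_le_of_conv (f := fun x => p x - c) (fun x i => by beta_reduce; rw [hp x i])
    (hpi.sub (integrable_const _)) fun N => ?_
  have hK := tp_peakKer N
  have e1 : conv N (fun x => p x - c) = fun x => conv N p x - c := by
    rw [conv_sub hpi (integrable_const _)]
    ext x
    congr 1
    rw [conv_eq (fun _ _ => rfl), integral_mul_const, integral_peakKer, one_mul]
  have hsp : SP fun x => conv N p x - c := (tp_conv hpi N).sp.sub (SP.const c)
  have hz : ∫ x in cube, (conv N p x - c) = 0 := by
    -- Mollification keeps the mean: the kernel is even and has integral one.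
    have : ∫ x in cube, conv N p x = c := by
      have h3 : ∀ x, conv N p x = ∫ y in cube, peakKer N (y - x) * p y := fun x => rfl
      simp only [h3]
      have hint : Integrable (fun z : E3 × E3 => peakKer N (z.2 - z.1) * p z.2)
          ((volume.restrict cube).prod (volume.restrict cube)) := by
        obtain ⟨C, -, hC⟩ := hK.sp.exists_bound
        have h4 : Integrable (fun z : E3 × E3 => p z.2)
          ((volume.restrict cube).prod (volume.restrict cube)) := hpi.comp_snd _
        refine h4.bdd_mul (c := C) ?_ (Eventually.of_forall fun z => hC _)
        exact (hK.sp.continuous.comp (continuous_snd.sub continuous_fst)).aestronglyMeasurable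
      rw [integral_integral_swap hint]
      refine integral_congr_ae (Eventually.of_forall fun y => ?_)
      have h5 : ∫ x in cube, peakKer N (y - x) = 1 := by
        have h6 := integral_shift (f := fun x => peakKer N (y - x)) (hK.sp.per.sub_shift y) y
        rw [← h6]
        have h7 : ∀ x, peakKer N (y - (x + y)) = peakKer N (-x) := fun x => by congr 1; abel
        simp only [h7, peakKer_neg, integral_peakKer]
      simp only [integral_mul_const, h5, one_mul]
    rw [integral_sub (tp_conv hpi N).sp.integrableOn (integrable_const _), this, integral_const_cube,
      sub_self]
  rw [e1]
  have hl : lap (fun x => conv N p x - c)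
      = fun x => (∑ k, pd k (conv N (f k)) x) + ∑ i, ∑ k, pd i (pd k (conv N (M i k))) x := by
    ext x
    have h1 := h _ (hK.shift_sub x)
    have h2 : ∀ i, pd i (fun y => peakKer N (y - x)) = fun y => pd i (peakKer N) (y - x) := fun i =>
      funext fun y => pd_shift_sub _ _ _ _
    simp only [lap, h2, pd_shift_sub] at h1
    have h3 : ∀ (g : E3 → ℝ), IntegrableOn g cube → ∀ i k, pd i (pd k (conv N g)) x
        = ∫ y in cube, g y * pd i (pd k (peakKer N)) (y - x) := fun g hg i k => by
      rw [conv, pd_kerOp hK hg, pd_neg]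
      rw [pd_kerOp (hK.pd k) hg]
      simp only [kerOp, mul_comm, neg_neg]
    have h4 : ∀ (g : E3 → ℝ), IntegrableOn g cube → ∀ k, pd k (conv N g) x
        = - ∫ y in cube, g y * pd k (peakKer N) (y - x) := fun g hg k => by
      rw [conv, pd_kerOp hK hg]
      simp only [kerOp, mul_comm]
    have h5 : lap (fun x => conv N p x - c) x = lap (conv N p) x := by
      have : ∀ i, pd i (fun x => conv N p x - c) = pd i (conv N p) := fun i => by
        rw [pd_sub (tp_conv hpi N).sp.differentiable (SP.const c).differentiable, pd_const]
        simp
      simp only [lap, this]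
    rw [h5, lap]
    simp only [h3 p hpi, h3 _ (hMi _ _), h4 _ (hfi _)]
    rw [Finset.sum_neg_distrib, ← h1, ← integral_finsetSum _ fun i _ => ?_]
    · simp only [Finset.mul_sum]
    · have := integrable_sp_mul (((hK.sp.pd i).pd i).shift_sub x) hpi
      simp only [mul_comm] at this ⊢
      exact this
  refine (eLpNorm_pressure_le hsp hz (fun k => tp_conv (hfi k) N) (fun i k => tp_conv (hMi i k) N)
    hl).trans (add_le_add (Finset.sum_le_sum fun k _ => mul_le_mul_right ?_ _)
      (Finset.sum_le_sum fun i _ => Finset.sum_le_sum fun k _ => mul_le_mul_right ?_ _))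
  · exact eLpNorm_conv_le (hfp k) one_le_three_halves three_halves_ne_top (hf k) N
  · exact eLpNorm_conv_le (hMp i k) one_le_three_halves three_halves_ne_top (hM i k) N

/-! ### Time slices -/

lemma Ioo_eq_iUnion_Icc (T : ℝ) :
    Ioo 0 T = ⋃ n : ℕ, Icc (1 / ((n : ℝ) + 1)) (T - 1 / ((n : ℝ) + 1)) := by
  ext t
  simp only [mem_iUnion, mem_Icc, mem_Ioo]
  constructor
  · rintro ⟨h0, h1⟩
    obtain ⟨n, hn⟩ := exists_nat_one_div_lt (lt_min h0 (sub_pos.2 h1))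
    refine ⟨n, (hn.trans_le (min_le_left _ _)).le, ?_⟩
    have := hn.trans_le (min_le_right _ _)
    linarith
  · rintro ⟨n, h0, h1⟩
    have : (0 : ℝ) < 1 / ((n : ℝ) + 1) := by positivity
    constructor <;> linarith

lemma Icc_subset_Ioo' {a c T : ℝ} (ha : 0 < a) (hc : c < T) : Icc a c ⊆ Ioo 0 T :=
  fun _ ht => ⟨ha.trans_le ht.1, ht.2.trans_lt hc⟩

lemma ae_Ioo_of_Icc {T : ℝ} {p : ℝ → Prop}
    (h : ∀ a c, 0 < a → c < T → ∀ᵐ t ∂volume.restrict (Icc a c), p t) :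
    ∀ᵐ t ∂volume.restrict (Ioo 0 T), p t := by
  rw [Ioo_eq_iUnion_Icc, ae_restrict_iUnion_iff]
  intro n
  have : (0 : ℝ) < 1 / ((n : ℝ) + 1) := by positivity
  exact h _ _ this (by linarith)

lemma MemLpLoc.aesm {F : Type*} [NormedAddCommGroup F] {T : ℝ} {p : ℝ≥0∞} {f : ℝ × E3 → F}
    (hf : MemLpLoc T p f) : AEStronglyMeasurable f (tcube (Ioo 0 T)) := by
  rw [tcube, Ioo_eq_iUnion_Icc, iUnion_prod_const, aestronglyMeasurable_iUnion_iff]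
  intro n
  have : (0 : ℝ) < 1 / ((n : ℝ) + 1) := by positivity
  exact (hf _ _ this (by linarith)).1

lemma tcube_mono {S S' : Set ℝ} (h : S ⊆ S') : tcube S ≤ tcube S' :=
  Measure.restrict_mono (prod_mono h Subset.rfl) le_rfl

instance (a c : ℝ) : IsFiniteMeasure (tcube (Icc a c)) := by
  rw [tcube_eq]; infer_instance

lemma ae_integrableOn_slice {S : Set ℝ} {f : ℝ × E3 → ℝ} (h : Integrable f (tcube S)) :
    ∀ᵐ t ∂volume.restrict S, IntegrableOn (fun x => f (t, x)) cube := by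
  rw [tcube_eq] at h
  exact h.prod_right_ae

lemma MemLpLoc.ae_integrableOn_slice {T : ℝ} {f : ℝ × E3 → ℝ} (h : MemLpLoc T 1 f) :
    ∀ᵐ t ∂volume.restrict (Ioo 0 T), IntegrableOn (fun x => f (t, x)) cube :=
  ae_Ioo_of_Icc fun a c ha hc =>
    HallMHD.ae_integrableOn_slice (memLp_one_iff_integrable.1 (h a c ha hc))

lemma ae_aesm_slice {S : Set ℝ} {f : ℝ × E3 → ℝ} (h : AEStronglyMeasurable f (tcube S)) :
    ∀ᵐ t ∂volume.restrict S, AEStronglyMeasurable (fun x => f (t, x)) (volume.restrict cube) := by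
  rw [tcube_eq] at h
  exact h.prodMk_left

/-- Test functions of the time variable. -/
def TimeTest (T : ℝ) (η : ℝ → ℝ) : Prop :=
  ContDiff ℝ ∞ η ∧ ∃ a c : ℝ, 0 < a ∧ c < T ∧ ∀ t, t ∉ Icc a c → η t = 0

lemma setIntegral_slab_eq {T a c : ℝ} (ha : 0 < a) (hc : c < T) {F : ℝ × E3 → ℝ}
    (h : ∀ t x, t ∉ Icc a c → F (t, x) = 0) :
    ∫ z in slab T, F z = ∫ z, F z ∂(tcube (Icc a c)) := by
  refine setIntegral_eq_of_subset_of_forall_sdiff_eq_zero (measurableSet_Ioo.prod measurableSet_cube)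
    (prod_mono (Icc_subset_Ioo' ha hc) Subset.rfl) fun z hz => ?_
  exact h z.1 z.2 fun hm => hz.2 ⟨hm, hz.1.2⟩

lemma integrable_slab_of_Icc {T a c : ℝ} {F : ℝ × E3 → ℝ}
    (h : ∀ t x, t ∉ Icc a c → F (t, x) = 0) (hi : Integrable F (tcube (Icc a c))) :
    Integrable F (tcube (Ioo 0 T)) :=
  IntegrableOn.of_forall_sdiff_eq_zero (s := Icc a c ×ˢ cube) (t := Ioo 0 T ×ˢ cube) hi
    (measurableSet_Ioo.prod measurableSet_cube) fun z hz => h z.1 z.2 fun hm => hz.2 ⟨hm, hz.1.2⟩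

lemma exists_Icc_of_compact_subset_Ioo {T : ℝ} {K : Set ℝ} (hK : IsCompact K) (h : K ⊆ Ioo 0 T) :
    ∃ a c, 0 < a ∧ c < T ∧ K ⊆ Icc a c := by
  rcases K.eq_empty_or_nonempty with rfl | hne
  · exact ⟨1, T - 1, one_pos, by linarith, empty_subset _⟩
  · obtain ⟨a, ha, ha'⟩ := hK.exists_isLeast hne
    obtain ⟨c, hc, hc'⟩ := hK.exists_isGreatest hne
    exact ⟨a, c, (h ha).1, (h hc).2, fun t ht => ⟨ha' ht, hc' ht⟩⟩

lemma integrable_slice_integral {S : Set ℝ} {f : ℝ × E3 → ℝ} (h : Integrable f (tcube S)) :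
    IntegrableOn (fun t => ∫ x in cube, f (t, x)) S := by
  rw [tcube_eq] at h
  exact h.integral_prod_left

lemma integral_tcube {S : Set ℝ} {f : ℝ × E3 → ℝ} (h : Integrable f (tcube S)) :
    ∫ z, f z ∂(tcube S) = ∫ t in S, ∫ x in cube, f (t, x) := by
  rw [tcube_eq] at h ⊢
  exact integral_prod _ h

/-- du Bois-Reymond in time. -/
lemma ae_integral_slice_eq_zero {T : ℝ} {f : ℝ × E3 → ℝ} (hf : MemLpLoc T 1 f)
    (h : ∀ η, TimeTest T η → ∫ z in slab T, η z.1 * f z = 0) :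
    ∀ᵐ t ∂volume.restrict (Ioo 0 T), ∫ x in cube, f (t, x) = 0 := by
  have hi : ∀ a c, 0 < a → c < T → IntegrableOn (fun t => ∫ x in cube, f (t, x)) (Icc a c) :=
    fun a c ha hc => integrable_slice_integral (memLp_one_iff_integrable.1 (hf a c ha hc))
  rw [ae_restrict_iff' measurableSet_Ioo]
  refine isOpen_Ioo.ae_eq_zero_of_integral_contDiff_smul_eq_zero ?_ fun η hη hc hs => ?_
  · rw [locallyIntegrableOn_iff isOpen_Ioo.isLocallyClosed]
    intro K hK hKc
    obtain ⟨a, c, ha, hc, hKs⟩ := exists_Icc_of_compact_subset_Ioo hKc hK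
    exact (hi a c ha hc).mono_set hKs
  · obtain ⟨a, c, ha, hcT, hKs⟩ := exists_Icc_of_compact_subset_Ioo hc hs
    have h0 : ∀ t, t ∉ Icc a c → η t = 0 := fun t ht =>
      image_eq_zero_of_notMem_tsupport fun h => ht (hKs h)
    have h1 := h η ⟨hη, a, c, ha, hcT, h0⟩
    rw [setIntegral_slab_eq ha hcT fun t x ht => by simp [h0 t ht], integral_tcube] at h1
    · rw [← setIntegral_eq_integral_of_forall_compl_eq_zero (s := Icc a c) fun t ht => by
        simp [h0 t ht]]
      simpa only [smul_eq_mul, integral_const_mul] using h1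
    · obtain ⟨C, hC⟩ := hc.exists_bound_of_continuous hη.continuous
      exact (memLp_one_iff_integrable.1 (hf a c ha hcT)).bdd_mul (c := C)
        (hη.continuous.comp continuous_fst).aestronglyMeasurable (Eventually.of_forall fun z => hC _)

/-! ### Test functions -/

lemma mem_testSpace_smul_basisVec {T : ℝ} {φ : ℝ × E3 → ℝ} (hφ : φ ∈ testSpace T ℝ) (m : Fin 3) :
    (fun z => φ z • basisVec m) ∈ testSpace T E3 := by
  obtain ⟨h1, h2, a, c, ha, hc, h0⟩ := hφ
  exact ⟨h1.smul contDiff_const, fun t x i => by simp only [h2 t x i], a, c, ha, hc,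
    fun t x ht => by simp [h0 t x ht]⟩

lemma mem_testSpace_mul {T : ℝ} {φ g : ℝ × E3 → ℝ} (hφ : φ ∈ testSpace T ℝ) (hg : ContDiff ℝ ∞ g)
    (hgp : SpacePeriodic g) : (fun z => φ z * g z) ∈ testSpace T ℝ := by
  obtain ⟨h1, h2, a, c, ha, hc, h0⟩ := hφ
  exact ⟨h1.mul hg, fun t x i => by simp only [h2 t x i, hgp t x i], a, c, ha, hc,
    fun t x ht => by simp [h0 t x ht]⟩

lemma mem_testSpace_time_mul {T : ℝ} {η : ℝ → ℝ} (hη : TimeTest T η) {g : ℝ × E3 → ℝ}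
    (hg : ContDiff ℝ ∞ g) (hgp : SpacePeriodic g) :
    (fun z : ℝ × E3 => η z.1 * g z) ∈ testSpace T ℝ := by
  obtain ⟨h1, a, c, ha, hc, h0⟩ := hη
  exact ⟨(h1.comp contDiff_fst).mul hg, fun t x i => by simp only [hgp t x i], a, c, ha, hc,
    fun t x ht => by simp [h0 t ht]⟩

lemma SP.contDiff_snd {θ : E3 → ℝ} (hθ : SP θ) : ContDiff ℝ ∞ fun z : ℝ × E3 => θ z.2 :=
  hθ.smooth.comp _root_.contDiff_snd

lemma SP.periodic_snd {θ : E3 → ℝ} (hθ : SP θ) : SpacePeriodic fun z : ℝ × E3 => θ z.2 :=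
  fun _ x i => hθ.per x i

lemma dx_mul {f g : ℝ × E3 → ℝ} (hf : Differentiable ℝ f) (hg : Differentiable ℝ g) (i : Fin 3)
    (z : ℝ × E3) : dx i (fun z => f z * g z) z = dx i f z * g z + f z * dx i g z := by
  rw [dx, fderiv_fun_mul (hf z) (hg z)]
  simp only [add_apply, smul_apply, smul_eq_mul, dx]
  ring

lemma dt_mul {f g : ℝ × E3 → ℝ} (hf : Differentiable ℝ f) (hg : Differentiable ℝ g)
    (z : ℝ × E3) : dt (fun z => f z * g z) z = dt f z * g z + f z * dt g z := by
  rw [dt, fderiv_fun_mul (hf z) (hg z)]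
  simp only [add_apply, smul_apply, smul_eq_mul, dt]
  ring

lemma dx_snd {θ : E3 → ℝ} (hθ : Differentiable ℝ θ) (i : Fin 3) (z : ℝ × E3) :
    dx i (fun z => θ z.2) z = pd i θ z.2 := by
  have := (hθ z.2).hasFDerivAt.comp z (hasFDerivAt_snd (𝕜 := ℝ) (E := ℝ) (F := E3))
  rw [dx, show fderiv ℝ (fun z : ℝ × E3 => θ z.2) z = _ from this.fderiv]
  simp [pd]

lemma dt_snd {θ : E3 → ℝ} (hθ : Differentiable ℝ θ) (z : ℝ × E3) :
    dt (fun z => θ z.2) z = 0 := by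
  have := (hθ z.2).hasFDerivAt.comp z (hasFDerivAt_snd (𝕜 := ℝ) (E := ℝ) (F := E3))
  rw [dt, show fderiv ℝ (fun z : ℝ × E3 => θ z.2) z = _ from this.fderiv]
  simp

lemma dx_fst {η : ℝ → ℝ} (hη : Differentiable ℝ η) (i : Fin 3) (z : ℝ × E3) :
    dx i (fun z => η z.1) z = 0 := by
  have := (hη z.1).hasFDerivAt.comp z (hasFDerivAt_fst (𝕜 := ℝ) (E := ℝ) (F := E3))
  rw [dx, show fderiv ℝ (fun z : ℝ × E3 => η z.1) z = _ from this.fderiv]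
  simp

lemma dt_fst {η : ℝ → ℝ} (hη : Differentiable ℝ η) (z : ℝ × E3) :
    dt (fun z => η z.1) z = deriv η z.1 := by
  have := (hη z.1).hasFDerivAt.comp z (hasFDerivAt_fst (𝕜 := ℝ) (E := ℝ) (F := E3))
  rw [dt, show fderiv ℝ (fun z : ℝ × E3 => η z.1) z = _ from this.fderiv]
  simp

lemma dx_smul_basisVec {φ : ℝ × E3 → ℝ} (hφ : Differentiable ℝ φ) (i m : Fin 3) (z : ℝ × E3) :
    dx i (fun z => φ z • basisVec m) z = dx i φ z • basisVec m := by
  rw [dx, fderiv_smul_const (hφ z)]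
  rfl

lemma dt_smul_basisVec {φ : ℝ × E3 → ℝ} (hφ : Differentiable ℝ φ) (m : Fin 3) (z : ℝ × E3) :
    dt (fun z => φ z • basisVec m) z = dt φ z • basisVec m := by
  rw [dt, fderiv_smul_const (hφ z)]
  rfl

lemma inner_smul_basisVec (v : E3) (s : ℝ) (m : Fin 3) : inner ℝ v (s • basisVec m) = v m * s := by
  rw [inner_smul_right, basisVec, EuclideanSpace.inner_single_right]
  simp [mul_comm]

lemma inner_eq_sum (v w : E3) : inner ℝ v w = ∑ i, v i * w i := by
  simp [PiLp.inner_apply, mul_comm]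

lemma inner_grad (v : E3) (φ : ℝ × E3 → ℝ) (z : ℝ × E3) :
    inner ℝ v (grad φ z) = ∑ i, v i * dx i φ z := by
  rw [inner_eq_sum, Fin.sum_univ_three, Fin.sum_univ_three]
  rfl

lemma divergence_smul_basisVec {φ : ℝ × E3 → ℝ} (hφ : Differentiable ℝ φ) (m : Fin 3)
    (z : ℝ × E3) : divergence (fun z => φ z • basisVec m) z = dx m φ z := by
  simp only [divergence, dx_smul_basisVec hφ]
  simp [basisVec]

lemma inner_curl_smul_basisVec {φ : ℝ × E3 → ℝ} (hφ : Differentiable ℝ φ) (v : E3) (m : Fin 3)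
    (z : ℝ × E3) : inner ℝ v (curl (fun z => φ z • basisVec m) z)
      = v (m + 1) * dx (m + 2) φ z - v (m + 2) * dx (m + 1) φ z := by
  rw [inner_eq_sum, Fin.sum_univ_three]
  simp only [curl, dx_smul_basisVec hφ]
  fin_cases m <;> simp [basisVec] <;> ring

lemma cross_apply (v w : E3) (k : Fin 3) :
    cross v w k = v (k + 1) * w (k + 2) - v (k + 2) * w (k + 1) := by
  rw [cross, crossProduct]
  fin_cases k <;> simp

lemma testSpace_differentiable {T : ℝ} {F : Type*} [NormedAddCommGroup F] [NormedSpace ℝ F]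
    {φ : ℝ × E3 → F} (hφ : φ ∈ testSpace T F) : Differentiable ℝ φ :=
  hφ.1.differentiable (by simp)

lemma mem_testSpace_apply {T : ℝ} {F : Type*} [NormedAddCommGroup F] [NormedSpace ℝ F]
    {φ : ℝ × E3 → F} (hφ : φ ∈ testSpace T F) (v : ℝ × E3) :
    (fun z => fderiv ℝ φ z v) ∈ testSpace T F := by
  obtain ⟨h1, h2, a, c, ha, hc, h0⟩ := hφ
  refine ⟨(h1.fderiv_right (m := ∞) (by simp)).clm_apply contDiff_const, fun t x i => ?_, a, c, ha, hc,
    fun t x ht => ?_⟩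
  · have : (fun z : ℝ × E3 => φ (z + (0, basisVec i))) = φ := by
      ext ⟨s, y⟩
      simpa using h2 s y i
    have h3 : fderiv ℝ φ (t, x + basisVec i) = fderiv ℝ φ (t, x) := by
      conv_rhs => rw [← this]
      rw [fderiv_comp_add_right]
      simp
    simp only [h3]
  · have : φ =ᶠ[𝓝 (t, x)] fun _ => 0 := by
      filter_upwards [(isClosed_Icc.isOpen_compl.preimage continuous_fst).mem_nhds ht] with z hz
      exact h0 z.1 z.2 hz
    simp only [this.fderiv_eq]
    simp

lemma mem_testSpace_dt {T : ℝ} {φ : ℝ × E3 → ℝ} (hφ : φ ∈ testSpace T ℝ) : dt φ ∈ testSpace T ℝ :=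
  mem_testSpace_apply hφ _

lemma mem_testSpace_dx {T : ℝ} {φ : ℝ × E3 → ℝ} (hφ : φ ∈ testSpace T ℝ) (i : Fin 3) :
    dx i φ ∈ testSpace T ℝ :=
  mem_testSpace_apply hφ _

lemma testSpace_exists_bound {T : ℝ} {φ : ℝ × E3 → ℝ} (hφ : φ ∈ testSpace T ℝ) :
    ∃ C, 0 ≤ C ∧ ∀ z, |φ z| ≤ C := by
  obtain ⟨h1, h2, a, c, ha, hc, h0⟩ := hφ
  obtain ⟨C, hC⟩ := ((isCompact_Icc (a := a) (b := c)).prod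
    (isCompact_closedBall (0 : E3) 2)).exists_bound_of_continuousOn h1.continuous.continuousOn
  refine ⟨max C 0, le_max_right _ _, fun ⟨t, x⟩ => ?_⟩
  by_cases ht : t ∈ Icc a c
  · obtain ⟨y, hy, hyf⟩ := exists_mem_cube_eq (F := ℝ) x
    rw [hyf (fun x => φ (t, x)) (slice_per h2 t)]
    exact (hC (t, y) ⟨ht, by simpa using norm_le_of_mem_cube hy⟩).trans (le_max_left _ _)
  · rw [h0 t x ht]; simp

/-! ### Weak identities on almost every time slice -/

/-- Linear operators on trigonometric polynomials. -/
structure TPOp (D : (E3 → ℝ) → E3 → ℝ) : Prop where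
  add : ∀ f g, TP f → TP g → D (fun x => f x + g x) = fun x => D f x + D g x
  smul : ∀ (c : ℝ) f, TP f → D (fun x => c * f x) = fun x => c * D f x
  mem : ∀ f, TP f → TP (D f)

lemma TPOp.id : TPOp fun f => f := ⟨fun _ _ _ _ => rfl, fun _ _ _ => rfl, fun _ h => h⟩

lemma TPOp.pd (i : Fin 3) : TPOp (pd i) :=
  ⟨fun _ _ hf hg => pd_add hf.sp.differentiable hg.sp.differentiable i,
    fun c _ hf => pd_const_mul hf.sp.differentiable c i, fun _ hf => hf.pd i⟩

lemma TPOp.lap : TPOp lap :=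
  ⟨fun _ _ hf hg => lap_add hf.sp hg.sp, fun c _ hf => lap_const_mul hf.sp c, fun _ hf => hf.lap⟩

lemma wave_eq (n : Fin 3 → ℤ) (θ : ℝ) :
    wave n θ = fun x => Real.cos θ * wave n 0 x + Real.sin θ * wave n (Real.pi / 2) x := by
  ext x
  simp only [wave, Real.cos_add_pi_div_two, add_zero]
  rw [Real.cos_add]
  ring

lemma integrable_mul_sp {e f : E3 → ℝ} (he : SP e) (hf : IntegrableOn f cube) :
    IntegrableOn (fun y => f y * e y) cube := by
  have := integrable_sp_mul he hf
  simpa only [mul_comm] using this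

/-- The exceptional null set of times must not depend on the test function. It is chosen for the
countably many waves with phases `0` and `π/2`, which span all trigonometric polynomials; linearity
gives the rest. -/
lemma ae_forall_tp {T : ℝ} {ι : Type*} [Fintype ι] {c : ι → ℝ × E3 → ℝ}
    (hc : ∀ a, MemLpLoc T 1 (c a)) {D : ι → (E3 → ℝ) → E3 → ℝ} (hD : ∀ a, TPOp (D a))
    (h : ∀ η, TimeTest T η → ∀ θ, TP θ →
      ∫ z in slab T, η z.1 * ∑ a, c a z * D a θ z.2 = 0) :
    ∀ᵐ t ∂volume.restrict (Ioo 0 T), ∀ θ, TP θ → ∑ a, ∫ x in cube, c a (t, x) * D a θ x = 0 := by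
  have hw : ∀ n θ, ∀ᵐ t ∂volume.restrict (Ioo 0 T),
      ∫ x in cube, ∑ a, c a (t, x) * D a (wave n θ) x = 0 := fun n θ => by
    refine ae_integral_slice_eq_zero (f := fun z => ∑ a, c a z * D a (wave n θ) z.2) ?_
      fun η hη => h η hη _ (wave_mem n θ)
    intro a c' ha hc'
    refine memLp_finsetSum _ fun i _ => ?_
    obtain ⟨C, -, hC⟩ := ((hD i).mem _ (wave_mem n θ)).sp.exists_bound
    have := (memLp_one_iff_integrable.1 (hc i a c' ha hc')).bdd_mul (c := C)
      (f := fun z : ℝ × E3 => D i (wave n θ) z.2)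
      (((hD i).mem _ (wave_mem n θ)).sp.continuous.comp continuous_snd).aestronglyMeasurable
      (Eventually.of_forall fun z => hC _)
    refine memLp_one_iff_integrable.2 ?_
    simpa only [mul_comm] using this
  have h1 : ∀ᵐ t ∂volume.restrict (Ioo 0 T), ∀ n : Fin 3 → ℤ,
      ∫ x in cube, ∑ a, c a (t, x) * D a (wave n 0) x = 0 := ae_all_iff.2 fun n => hw n 0
  have h2 : ∀ᵐ t ∂volume.restrict (Ioo 0 T), ∀ n : Fin 3 → ℤ,
      ∫ x in cube, ∑ a, c a (t, x) * D a (wave n (Real.pi / 2)) x = 0 := ae_all_iff.2 fun n => hw n _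
  have h3 : ∀ᵐ t ∂volume.restrict (Ioo 0 T), ∀ a, IntegrableOn (fun x => c a (t, x)) cube :=
    ae_all_iff.2 fun a => (hc a).ae_integrableOn_slice
  filter_upwards [h1, h2, h3] with t e1 e2 e3 θ hθ
  have hint : ∀ θ, TP θ → ∀ a, Integrable (fun x => c a (t, x) * D a θ x) (volume.restrict cube) :=
    fun θ hθ a => integrable_mul_sp ((hD a).mem θ hθ).sp (e3 a)
  have hadd : ∀ f g, TP f → TP g → ∑ a, ∫ x in cube, c a (t, x) * D a f x = 0 →
      ∑ a, ∫ x in cube, c a (t, x) * D a g x = 0 →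
      ∑ a, ∫ x in cube, c a (t, x) * D a (fun x => f x + g x) x = 0 := fun f g hf hg h4 h5 => by
    refine Eq.trans ?_ ((congrArg₂ (· + ·) h4 h5).trans (add_zero 0))
    rw [← Finset.sum_add_distrib]
    refine Finset.sum_congr rfl fun a _ => ?_
    rw [(hD a).add f g hf hg, ← integral_add (hint f hf a) (hint g hg a)]
    simp only [mul_add]
  have hsmul : ∀ (r : ℝ) f, TP f → ∑ a, ∫ x in cube, c a (t, x) * D a f x = 0 →
      ∑ a, ∫ x in cube, c a (t, x) * D a (fun x => r * f x) x = 0 := fun r f hf h4 => by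
    rw [← mul_zero r, ← h4, Finset.mul_sum]
    refine Finset.sum_congr rfl fun a _ => ?_
    rw [(hD a).smul r f hf, ← integral_const_mul]
    simp only [mul_left_comm]
  refine TP.induction (P := fun θ => ∑ a, ∫ x in cube, c a (t, x) * D a θ x = 0) (fun n θ => ?_)
    hadd hsmul hθ
  have e4 : ∀ θ, TP θ → ∫ x in cube, ∑ a, c a (t, x) * D a θ x = 0 →
      ∑ a, ∫ x in cube, c a (t, x) * D a θ x = 0 := fun θ hθ h4 => by
    rwa [integral_finsetSum _ fun a _ => hint θ hθ a] at h4
  rw [wave_eq]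
  exact hadd _ _ ((wave_mem n 0).const_mul _) ((wave_mem n _).const_mul _)
    (hsmul _ _ (wave_mem n 0) (e4 _ (wave_mem n 0) (e1 n)))
    (hsmul _ _ (wave_mem n _) (e4 _ (wave_mem n _) (e2 n)))

lemma MemLpLoc.apply {T : ℝ} {p : ℝ≥0∞} {f : ℝ × E3 → E3} (hf : MemLpLoc T p f) (k : Fin 3) :
    MemLpLoc T p fun z => f z k := fun a c ha hc =>
  (EuclideanSpace.proj (𝕜 := ℝ) k).comp_memLp' (hf a c ha hc)

lemma MemLpLoc.add {T : ℝ} {p : ℝ≥0∞} {f g : ℝ × E3 → ℝ} (hf : MemLpLoc T p f)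
    (hg : MemLpLoc T p g) : MemLpLoc T p fun z => f z + g z :=
  fun a c ha hc => (hf a c ha hc).add (hg a c ha hc)

lemma MemLpLoc.sub {T : ℝ} {p : ℝ≥0∞} {f g : ℝ × E3 → ℝ} (hf : MemLpLoc T p f)
    (hg : MemLpLoc T p g) : MemLpLoc T p fun z => f z - g z :=
  fun a c ha hc => (hf a c ha hc).sub (hg a c ha hc)

lemma MemLpLoc.neg {T : ℝ} {p : ℝ≥0∞} {f : ℝ × E3 → ℝ} (hf : MemLpLoc T p f) :
    MemLpLoc T p fun z => - f z :=
  fun a c ha hc => (hf a c ha hc).neg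

lemma WeakCurl.apply {T : ℝ} {f g : ℝ × E3 → E3} (h : WeakCurl T f g) {φ : ℝ × E3 → ℝ}
    (hφ : φ ∈ testSpace T ℝ) (m : Fin 3) :
    ∫ z in slab T, g z m * φ z
      = ∫ z in slab T, (f z (m + 1) * dx (m + 2) φ z - f z (m + 2) * dx (m + 1) φ z) := by
  have := h ⟨_, mem_testSpace_smul_basisVec hφ m⟩
  simpa only [inner_smul_basisVec, inner_curl_smul_basisVec (testSpace_differentiable hφ)] using this

lemma TimeTest.differentiable {T : ℝ} {η : ℝ → ℝ} (hη : TimeTest T η) : Differentiable ℝ η :=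
  hη.1.differentiable (by simp)

lemma TimeTest.mem {T : ℝ} {η : ℝ → ℝ} (hη : TimeTest T η) {θ : E3 → ℝ} (hθ : SP θ) :
    (fun z : ℝ × E3 => η z.1 * θ z.2) ∈ testSpace T ℝ :=
  mem_testSpace_time_mul hη hθ.contDiff_snd hθ.periodic_snd

lemma dx_time_mul {η : ℝ → ℝ} (hη : Differentiable ℝ η) {g : ℝ × E3 → ℝ} (hg : Differentiable ℝ g)
    (i : Fin 3) (z : ℝ × E3) : dx i (fun z : ℝ × E3 => η z.1 * g z) z = η z.1 * dx i g z := by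
  rw [dx_mul (f := fun z : ℝ × E3 => η z.1) (hη.comp differentiable_fst) hg, dx_fst hη]
  ring

lemma dt_time_mul {η : ℝ → ℝ} (hη : Differentiable ℝ η) {g : ℝ × E3 → ℝ} (hg : Differentiable ℝ g)
    (z : ℝ × E3) :
    dt (fun z : ℝ × E3 => η z.1 * g z) z = deriv η z.1 * g z + η z.1 * dt g z := by
  rw [dt_mul (f := fun z : ℝ × E3 => η z.1) (hη.comp differentiable_fst) hg, dt_fst hη]

lemma dx_time_mul_snd {η : ℝ → ℝ} (hη : Differentiable ℝ η) {θ : E3 → ℝ} (hθ : Differentiable ℝ θ)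
    (i : Fin 3) (z : ℝ × E3) : dx i (fun z : ℝ × E3 => η z.1 * θ z.2) z = η z.1 * pd i θ z.2 := by
  rw [dx_time_mul (g := fun z : ℝ × E3 => θ z.2) hη (hθ.comp differentiable_snd), dx_snd hθ]

lemma TimeTest.deriv {T : ℝ} {η : ℝ → ℝ} (hη : TimeTest T η) : TimeTest T (deriv η) := by
  obtain ⟨h, a, c, ha, hc, h0⟩ := hη
  refine ⟨(contDiff_infty_iff_deriv.1 h).2, a, c, ha, hc, fun t ht => ?_⟩
  have : η =ᶠ[𝓝 t] fun _ => 0 := by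
    filter_upwards [isClosed_Icc.isOpen_compl.mem_nhds ht] with s hs
    exact h0 s hs
  rw [this.deriv_eq]
  simp

/-- The product of a locally integrable function and a test function is integrable. -/
lemma MemLpLoc.integrable_mul {T : ℝ} {f φ : ℝ × E3 → ℝ} (hf : MemLpLoc T 1 f)
    (hφ : φ ∈ testSpace T ℝ) : Integrable (fun z => f z * φ z) (tcube (Ioo 0 T)) := by
  obtain ⟨C, -, hC⟩ := testSpace_exists_bound hφ
  obtain ⟨h1, h2, a, c, ha, hc, h0⟩ := hφ
  refine integrable_slab_of_Icc (a := a) (c := c) (fun t x ht => by simp [h0 t x ht]) ?_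
  have := (memLp_one_iff_integrable.1 (hf a c ha hc)).bdd_mul (c := C) (f := φ)
    h1.continuous.aestronglyMeasurable (Eventually.of_forall fun z => hC _)
  simpa only [mul_comm] using this

lemma WeakCurl.ae_slice {T : ℝ} {f g : ℝ × E3 → E3} (h : WeakCurl T f g) (hf : MemLpLoc T 1 f)
    (hg : MemLpLoc T 1 g) : ∀ᵐ t ∂volume.restrict (Ioo 0 T),
      WeakCurlS (fun k x => f (t, x) k) (fun k x => g (t, x) k) := by
  have key : ∀ m : Fin 3, ∀ᵐ t ∂volume.restrict (Ioo 0 T), ∀ θ, TP θ →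
      ∑ a, ∫ x in cube, (![fun z => g z m, fun z => - f z (m + 1), fun z => f z (m + 2)] :
        Fin 3 → ℝ × E3 → ℝ) a (t, x) * (![fun f => f, pd (m + 2), pd (m + 1)] :
        Fin 3 → (E3 → ℝ) → E3 → ℝ) a θ x = 0 := fun m => by
    refine ae_forall_tp ?_ ?_ fun η hη θ hθ => ?_
    · intro a
      fin_cases a
      exacts [hg.apply m, (hf.apply _).neg, hf.apply _]
    · intro a
      fin_cases a
      exacts [TPOp.id, TPOp.pd _, TPOp.pd _]
    · have h1 := h.apply (hη.mem hθ.sp) m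
      simp only [dx_time_mul_snd hη.differentiable hθ.sp.differentiable] at h1
      rw [← sub_eq_zero, ← integral_sub] at h1
      · rw [← h1]
        refine integral_congr_ae (Eventually.of_forall fun z => ?_)
        simp only [Fin.sum_univ_three, Matrix.cons_val_zero, Matrix.cons_val_one, Matrix.cons_val]
        ring
      · exact (hg.apply m).integrable_mul (hη.mem hθ.sp)
      · exact ((hf.apply _).integrable_mul (hη.mem (hθ.pd _).sp)).sub
          ((hf.apply _).integrable_mul (hη.mem (hθ.pd _).sp))
  filter_upwards [ae_all_iff.2 key] with t ht k θ hθ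
  have := ht k θ hθ
  simp only [Fin.sum_univ_three, Matrix.cons_val_zero, Matrix.cons_val_one, Matrix.cons_val,
    neg_mul, integral_neg] at this
  linarith

/-! ### Slicewise norms -/

lemma eLpNorm_tcube_rpow {S : Set ℝ} {f : ℝ × E3 → ℝ} {p : ℝ≥0∞} (h0 : p ≠ 0) (hp : p ≠ ⊤)
    (hf : AEStronglyMeasurable f (tcube S)) :
    eLpNorm f p (tcube S) ^ p.toReal
      = ∫⁻ t in S, eLpNorm (fun x => f (t, x)) p (volume.restrict cube) ^ p.toReal := by
  have h1 : p.toReal ≠ 0 := (ENNReal.toReal_pos h0 hp).ne'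
  simp only [eLpNorm_eq_lintegral_rpow_enorm_toReal h0 hp, one_div, ENNReal.rpow_inv_rpow h1]
  rw [tcube_eq] at hf ⊢
  exact lintegral_prod _ (hf.enorm.pow_const _)

lemma aemeasurable_eLpNorm_slice {S : Set ℝ} {f : ℝ × E3 → ℝ} {p : ℝ≥0∞} (h0 : p ≠ 0) (hp : p ≠ ⊤)
    (hf : AEStronglyMeasurable f (tcube S)) :
    AEMeasurable (fun t => eLpNorm (fun x => f (t, x)) p (volume.restrict cube))
      (volume.restrict S) := by
  simp only [eLpNorm_eq_lintegral_rpow_enorm_toReal h0 hp]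
  rw [tcube_eq] at hf
  exact ((hf.enorm.pow_const p.toReal).lintegral_prod_right').pow_const _

lemma ae_memLp_slice {S : Set ℝ} {f : ℝ × E3 → ℝ} {p : ℝ≥0∞} (h0 : p ≠ 0) (hp : p ≠ ⊤)
    (hf : MemLp f p (tcube S)) :
    ∀ᵐ t ∂volume.restrict S, MemLp (fun x => f (t, x)) p (volume.restrict cube) := by
  have h1 := eLpNorm_tcube_rpow h0 hp hf.1
  have h2 : ∫⁻ t in S, eLpNorm (fun x => f (t, x)) p (volume.restrict cube) ^ p.toReal ≠ ⊤ := by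
    rw [← h1]
    exact ENNReal.rpow_ne_top_of_nonneg ENNReal.toReal_nonneg hf.2.ne
  filter_upwards [ae_aesm_slice hf.1, ae_lt_top' ((aemeasurable_eLpNorm_slice h0 hp hf.1).pow_const _) h2]
    with t h3 h4
  exact ⟨h3, lt_top_iff_ne_top.2 fun h => by
    rw [h, ENNReal.top_rpow_of_pos (ENNReal.toReal_pos h0 hp)] at h4; exact lt_irrefl _ h4⟩

/-- Convolution in space of a function on space-time. -/
def tker (e : E3 → ℝ) (f : ℝ × E3 → ℝ) (z : ℝ × E3) : ℝ := kerOp e (fun y => f (z.1, y)) z.2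

lemma aesm_tker {e : E3 → ℝ} (he : Continuous e) {S : Set ℝ} {f : ℝ × E3 → ℝ}
    (hf : AEStronglyMeasurable f (tcube S)) : AEStronglyMeasurable (tker e f) (tcube S) := by
  have hq : Measure.QuasiMeasurePreserving (Prod.map Prod.fst _root_.id : (ℝ × E3) × E3 → ℝ × E3)
      ((tcube S).prod (volume.restrict cube)) ((volume.restrict S).prod (volume.restrict cube)) := by
    rw [tcube_eq]
    exact QuasiMeasurePreserving.prodMap Measure.quasiMeasurePreserving_fst
      (Measure.QuasiMeasurePreserving.id _)
  have h1 : AEStronglyMeasurable (fun w : (ℝ × E3) × E3 => e (w.2 - w.1.2) * f (w.1.1, w.2))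
      ((tcube S).prod (volume.restrict cube)) := by
    refine AEStronglyMeasurable.mul ?_ ?_
    · exact (he.comp (continuous_snd.sub (continuous_snd.comp continuous_fst))).aestronglyMeasurable
    · rw [tcube_eq] at hf
      exact hf.comp_quasiMeasurePreserving hq
  exact h1.integral_prod_right'

/-- Convergence on almost every slice together with the dominating function supplied by the
contraction property of the convolution. -/
lemma tendsto_eLpNorm_tconv {S : Set ℝ} {f : ℝ × E3 → ℝ} (hp : SpacePeriodic f) {p : ℝ≥0∞}
    (h1 : 1 ≤ p) (htop : p ≠ ⊤) (hf : MemLp f p (tcube S)) :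
    Tendsto (fun N => eLpNorm (fun z => tker (peakKer N) f z - f z) p (tcube S)) atTop (𝓝 0) := by
  have h0 : p ≠ 0 := (zero_lt_one.trans_le h1).ne'
  have hpos : 0 < p.toReal := ENNReal.toReal_pos h0 htop
  have hm : ∀ N, AEStronglyMeasurable (fun z => tker (peakKer N) f z - f z) (tcube S) := fun N =>
    (aesm_tker (tp_peakKer N).sp.continuous hf.1).sub hf.1
  have hsl := ae_memLp_slice h0 htop hf
  suffices h : Tendsto (fun N => eLpNorm (fun z => tker (peakKer N) f z - f z) p (tcube S) ^ p.toReal)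
      atTop (𝓝 0) by
    have := h.ennrpow_const (p.toReal⁻¹)
    simpa only [ENNReal.rpow_rpow_inv hpos.ne', ENNReal.zero_rpow_of_pos (inv_pos.2 hpos)] using this
  simp only [eLpNorm_tcube_rpow h0 htop (hm _)]
  rw [← lintegral_zero (μ := (volume : Measure ℝ).restrict S)]
  refine tendsto_lintegral_of_dominated_convergence'
    (fun t => (2 * eLpNorm (fun x => f (t, x)) p (volume.restrict cube)) ^ p.toReal)
    (fun N => (aemeasurable_eLpNorm_slice h0 htop (hm N)).pow_const _) (fun N => ?_) ?_ ?_
  · filter_upwards [hsl] with t ht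
    refine ENNReal.rpow_le_rpow ?_ hpos.le
    have hi : IntegrableOn (fun x => f (t, x)) cube := ht.integrable h1
    refine (eLpNorm_sub_le (f := conv N fun x => f (t, x)) (tp_conv hi N).sp.continuous.aestronglyMeasurable ht.1 h1).trans ?_
    rw [two_mul]
    exact add_le_add (eLpNorm_conv_le (slice_per hp t) h1 htop ht.1 N) le_rfl
  · simp only [ENNReal.mul_rpow_of_nonneg _ _ hpos.le]
    rw [lintegral_const_mul'' _ ((aemeasurable_eLpNorm_slice h0 htop hf.1).pow_const _),
      ← eLpNorm_tcube_rpow h0 htop hf.1]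
    exact ENNReal.mul_ne_top (ENNReal.rpow_ne_top_of_nonneg hpos.le (by simp))
      (ENNReal.rpow_ne_top_of_nonneg hpos.le hf.2.ne)
  · filter_upwards [hsl] with t ht
    have := (tendsto_eLpNorm_conv (slice_per hp t) h1 htop ht).ennrpow_const p.toReal
    rwa [ENNReal.zero_rpow_of_pos hpos] at this

/-! ### The gradient of the magnetic field -/

lemma peakKer_zero : peakKer 0 = fun _ => 1 := by
  ext x
  simp [peakKer]

lemma eLpNorm_rpow_le_of_slice_le {ι : Type*} [Fintype ι] {S : Set ℝ} {f : ℝ × E3 → ℝ}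
    {g : ι → ℝ × E3 → ℝ} {p C : ℝ≥0∞}
    (h1 : 1 ≤ p) (hp : p ≠ ⊤) (hf : AEStronglyMeasurable f (tcube S))
    (hg : ∀ m, AEStronglyMeasurable (g m) (tcube S))
    (h : ∀ᵐ t ∂volume.restrict S, eLpNorm (fun x => f (t, x)) p (volume.restrict cube)
      ≤ C * ∑ m, eLpNorm (fun x => g m (t, x)) p (volume.restrict cube)) :
    eLpNorm f p (tcube S) ^ p.toReal
      ≤ C ^ p.toReal * ((Fintype.card ι : ℝ≥0∞) ^ (p.toReal - 1)
        * ∑ m, eLpNorm (g m) p (tcube S) ^ p.toReal) := by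
  have h0 : p ≠ 0 := (zero_lt_one.trans_le h1).ne'
  have hpos : 1 ≤ p.toReal := by
    rw [← ENNReal.toReal_one]; exact ENNReal.toReal_mono hp h1
  have hpos' : 0 ≤ p.toReal := zero_le_one.trans hpos
  rw [eLpNorm_tcube_rpow h0 hp hf]
  simp only [eLpNorm_tcube_rpow h0 hp (hg _)]
  have hm : ∀ m, AEMeasurable (fun t => eLpNorm (fun x => g m (t, x)) p (volume.restrict cube) ^ p.toReal)
      (volume.restrict S) := fun m => (aemeasurable_eLpNorm_slice h0 hp (hg m)).pow_const _
  rw [← lintegral_finsetSum' _ fun m _ => hm m,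
    ← lintegral_const_mul'' _ (Finset.aemeasurable_fun_sum _ fun m _ => hm m),
    ← lintegral_const_mul'' _ ((Finset.aemeasurable_fun_sum _ fun m _ => hm m).const_mul _)]
  refine lintegral_mono_ae ?_
  filter_upwards [h] with t ht
  refine (ENNReal.rpow_le_rpow ht hpos').trans ?_
  rw [ENNReal.mul_rpow_of_nonneg _ _ hpos']
  refine mul_le_mul_right ?_ _
  exact ENNReal.rpow_sum_le_const_mul_sum_rpow Finset.univ
    (fun m => eLpNorm (fun x => g m (t, x)) p (volume.restrict cube)) hpos

lemma exists_tendsto_of_cauchy {α : Type*} [MeasurableSpace α] {μ : Measure α} {p : ℝ≥0∞}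
    [Fact (1 ≤ p)] {F : ℕ → α → ℝ} (hF : ∀ N, MemLp (F N) p μ)
    (h : Tendsto (fun q : ℕ × ℕ => eLpNorm (fun z => F q.1 z - F q.2 z) p μ) atTop (𝓝 0)) :
    ∃ B, MemLp B p μ ∧ Tendsto (fun N => eLpNorm (fun z => F N z - B z) p μ) atTop (𝓝 0) := by
  have hc : CauchySeq fun N => (hF N).toLp := by
    rw [EMetric.cauchySeq_iff]
    intro ε hε
    have h1 := (ENNReal.tendsto_nhds_zero.1 h (ε / 2) (ENNReal.half_pos hε.ne'))
    rcases eq_or_ne ε ⊤ with rfl | htop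
    · exact ⟨0, fun m _ n _ => (edist_ne_top _ _).lt_top⟩
    obtain ⟨⟨a, b⟩, hab⟩ := eventually_atTop.1 h1
    refine ⟨max a b, fun m hm n hn => ?_⟩
    rw [Lp.edist_toLp_toLp]
    exact (hab (m, n) ⟨(le_max_left _ _).trans hm, (le_max_right _ _).trans hn⟩).trans_lt
      (ENNReal.half_lt_self hε.ne' htop)
  obtain ⟨g, hg⟩ := cauchySeq_tendsto_of_complete hc
  refine ⟨g, Lp.memLp g, ?_⟩
  have := (Lp.tendsto_Lp_iff_tendsto_eLpNorm' _ _).1 hg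
  refine this.congr fun N => eLpNorm_congr_ae ?_
  filter_upwards [(hF N).coeFn_toLp] with z hz
  simp [hz]

instance : Fact ((1 : ℝ≥0∞) ≤ 3 / 2) := ⟨one_le_three_halves⟩

/-- Extension of a function on the unit cube to a periodic function. -/
def periodize (f : ℝ × E3 → ℝ) (z : ℝ × E3) : ℝ := f (z.1, ZSpan.fract stdBasis z.2)

lemma spacePeriodic_periodize (f : ℝ × E3 → ℝ) : SpacePeriodic (periodize f) := fun t x i => by
  simp only [periodize]
  have : ZSpan.fract stdBasis (x + basisVec i) = ZSpan.fract stdBasis x := by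
    refine ZSpan.fract_add_ZSpan stdBasis x ?_
    exact Submodule.subset_span ⟨i, by simp [stdBasis, basisVec]⟩
  rw [this]

lemma periodize_eq {f : ℝ × E3 → ℝ} {z : ℝ × E3} (hz : z.2 ∈ cube) : periodize f z = f z := by
  rw [cube_eq] at hz
  rw [periodize, ZSpan.fract_eq_self.2 hz]

lemma tendsto_integral_of_eLpNorm {α : Type*} [MeasurableSpace α] {μ : Measure α}
    {F : ℕ → α → ℝ} {f : α → ℝ} (hF : ∀ N, Integrable (F N) μ) (hf : Integrable f μ)
    (h : Tendsto (fun N => eLpNorm (fun z => F N z - f z) 1 μ) atTop (𝓝 0)) {w : α → ℝ} {C : ℝ}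
    (hw : AEStronglyMeasurable w μ) (hC : ∀ z, |w z| ≤ C) :
    Tendsto (fun N => ∫ z, F N z * w z ∂μ) atTop (𝓝 (∫ z, f z * w z ∂μ)) := by
  have hfw : Integrable (fun z => f z * w z) μ := by
    simpa only [mul_comm] using hf.bdd_mul hw (Eventually.of_forall hC)
  refine tendsto_integral_of_L1' _ hfw.1 (Eventually.of_forall fun N => by
    simpa only [mul_comm] using (hF N).bdd_mul hw (Eventually.of_forall hC)) ?_
  have h2 : Tendsto (fun N => ENNReal.ofReal C * eLpNorm (fun z => F N z - f z) 1 μ) atTop (𝓝 0) := by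
    have := ENNReal.Tendsto.const_mul (a := ENNReal.ofReal C) h (Or.inr ENNReal.ofReal_ne_top)
    simpa using this
  refine tendsto_of_tendsto_of_tendsto_of_le_of_le tendsto_const_nhds h2 (fun N => zero_le) fun N => ?_
  rw [eLpNorm_one_eq_lintegral_enorm, eLpNorm_one_eq_lintegral_enorm,
    ← lintegral_const_mul' _ _ ENNReal.ofReal_ne_top]
  refine lintegral_mono fun z => ?_
  simp only [Pi.sub_apply]
  rw [← sub_mul, enorm_mul, mul_comm]
  refine mul_le_mul_left ?_ _
  rw [Real.enorm_eq_ofReal_abs]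
  exact ENNReal.ofReal_le_ofReal (hC z)

/-- The gradient is obtained as a limit in `L^{3/2}` of space-time rather than slice by slice, so
that it is jointly measurable. The approximants are the derivatives of the mollified field, and they
are Cauchy because the mollified currents converge. -/
lemma exists_weak_gradient {T : ℝ} {A b j : Fin 3 → ℝ × E3 → ℝ} (hbp : ∀ k, SpacePeriodic (b k))
    (hjp : ∀ k, SpacePeriodic (j k)) (hA : ∀ k, MemLpLoc T 1 (A k)) (hb : ∀ k, MemLpLoc T 1 (b k))
    (hj : ∀ k, MemLp (j k) (3 / 2) (tcube (Ioo 0 T)))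
    (hAb : ∀ᵐ t ∂volume.restrict (Ioo 0 T), WeakCurlS (fun k x => A k (t, x)) (fun k x => b k (t, x)))
    (hbj : ∀ᵐ t ∂volume.restrict (Ioo 0 T), WeakCurlS (fun k x => b k (t, x)) (fun k x => j k (t, x)))
    (i k : Fin 3) :
    ∃ B : ℝ × E3 → ℝ, SpacePeriodic B ∧ MemLp B (3 / 2) (tcube (Ioo 0 T)) ∧
      ∀ᵐ t ∂volume.restrict (Ioo 0 T), ∀ θ, TP θ →
        ∫ x in cube, b k (t, x) * pd i θ x = - ∫ x in cube, B (t, x) * θ x := by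
  set F : ℕ → ℝ × E3 → ℝ := fun N z => - tker (pd i (peakKer N)) (b k) z with hF
  have hFm : ∀ N, AEStronglyMeasurable (F N) (tcube (Ioo 0 T)) := fun N =>
    (aesm_tker ((tp_peakKer N).pd i).sp.continuous (hb k).aesm).neg
  have hjm : ∀ m N, AEStronglyMeasurable (tker (peakKer N) (j m)) (tcube (Ioo 0 T)) := fun m N =>
    aesm_tker (tp_peakKer N).sp.continuous (hj m).1
  have hbi : ∀ᵐ t ∂volume.restrict (Ioo 0 T), ∀ k, IntegrableOn (fun x => b k (t, x)) cube :=
    ae_all_iff.2 fun k => (hb k).ae_integrableOn_slice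
  have hAi : ∀ᵐ t ∂volume.restrict (Ioo 0 T), ∀ k, IntegrableOn (fun x => A k (t, x)) cube :=
    ae_all_iff.2 fun k => (hA k).ae_integrableOn_slice
  have hFs : ∀ᵐ t ∂volume.restrict (Ioo 0 T), ∀ N,
      (fun x => F N (t, x)) = pd i (conv N fun x => b k (t, x)) := by
    filter_upwards [hbi] with t ht N
    rw [conv, pd_kerOp (tp_peakKer N) (ht k)]
    rfl
  have hdiff : ∀ N N', eLpNorm (fun z => F N z - F N' z) (3 / 2) (tcube (Ioo 0 T)) ^ (3 / 2 : ℝ)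
      ≤ 216 ^ (3 / 2 : ℝ) * (3 ^ ((3 / 2 : ℝ) - 1) * ∑ m, eLpNorm
        (fun z => tker (peakKer N) (j m) z - tker (peakKer N') (j m) z) (3 / 2)
          (tcube (Ioo 0 T)) ^ (3 / 2 : ℝ)) := fun N N' => by
    have := eLpNorm_rpow_le_of_slice_le (S := Ioo 0 T) (C := 216) one_le_three_halves three_halves_ne_top
      ((hFm N).sub (hFm N')) (g := fun m z => tker (peakKer N) (j m) z - tker (peakKer N') (j m) z)
      (fun m => (hjm m N).sub (hjm m N')) (by
        filter_upwards [hAb, hbj, hbi, hAi, hFs] with t h1 h2 h3 h4 h5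
        have h6 := eLpNorm_pd_conv_sub_le h4 h3 h1 h2 N N' i k
        rw [← h5 N, ← h5 N'] at h6
        exact h6)
    rw [toReal_three_halves, Fintype.card_fin] at this
    exact_mod_cast this
  have hjN : ∀ m N, MemLp (fun z => tker (peakKer N) (j m) z - j m z) (3 / 2) (tcube (Ioo 0 T)) := by
    intro m N
    have hj' : MemLp (tker (peakKer N) (j m)) (3 / 2) (tcube (Ioo 0 T)) := by
      refine ⟨hjm m N, ?_⟩
      have h7 : eLpNorm (tker (peakKer N) (j m)) (3 / 2) (tcube (Ioo 0 T)) ^ (3 / 2 : ℝ)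
          ≤ eLpNorm (j m) (3 / 2) (tcube (Ioo 0 T)) ^ (3 / 2 : ℝ) := by
        have e1 := eLpNorm_tcube_rpow three_halves_ne_zero three_halves_ne_top (hjm m N)
        have e2 := eLpNorm_tcube_rpow three_halves_ne_zero three_halves_ne_top (hj m).1
        rw [toReal_three_halves] at e1 e2
        rw [e1, e2]
        refine lintegral_mono_ae ?_
        filter_upwards [ae_aesm_slice (hj m).1] with t ht
        exact ENNReal.rpow_le_rpow (eLpNorm_conv_le (slice_per (hjp m) t) one_le_three_halves
          three_halves_ne_top ht N) (by norm_num)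
      exact ((ENNReal.rpow_le_rpow_iff (by norm_num)).1 h7).trans_lt (hj m).2
    exact hj'.sub (hj m)
  have hjj : ∀ m, Tendsto (fun q : ℕ × ℕ => eLpNorm
      (fun z => tker (peakKer q.1) (j m) z - tker (peakKer q.2) (j m) z) (3 / 2)
        (tcube (Ioo 0 T))) atTop (𝓝 0) := fun m => by
    have h1 := tendsto_eLpNorm_tconv (hjp m) one_le_three_halves three_halves_ne_top (hj m)
    have h2 : Tendsto (fun q : ℕ × ℕ =>
        eLpNorm (fun z => tker (peakKer q.1) (j m) z - j m z) (3 / 2) (tcube (Ioo 0 T))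
        + eLpNorm (fun z => tker (peakKer q.2) (j m) z - j m z) (3 / 2) (tcube (Ioo 0 T)))
        atTop (𝓝 (0 + 0)) := by
      rw [← prod_atTop_atTop_eq]
      exact (h1.comp tendsto_fst).add (h1.comp tendsto_snd)
    rw [add_zero] at h2
    refine tendsto_of_tendsto_of_tendsto_of_le_of_le tendsto_const_nhds h2 (fun _ => zero_le)
      fun q => ?_
    have h3 := eLpNorm_sub_le (hjN m q.1).1 (hjN m q.2).1 one_le_three_halves
    have h4 : ((fun z => tker (peakKer q.1) (j m) z - j m z) - fun z => tker (peakKer q.2) (j m) z - j m z)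
        = fun z => tker (peakKer q.1) (j m) z - tker (peakKer q.2) (j m) z := by ext z; simp
    rwa [h4] at h3
  have hcauchy : Tendsto (fun q : ℕ × ℕ => eLpNorm (fun z => F q.1 z - F q.2 z) (3 / 2)
      (tcube (Ioo 0 T))) atTop (𝓝 0) := by
    have h1 : Tendsto (fun q : ℕ × ℕ => 216 ^ (3 / 2 : ℝ) * (3 ^ ((3 / 2 : ℝ) - 1) * ∑ m, eLpNorm
        (fun z => tker (peakKer q.1) (j m) z - tker (peakKer q.2) (j m) z) (3 / 2)
          (tcube (Ioo 0 T)) ^ (3 / 2 : ℝ))) atTop (𝓝 (216 ^ (3 / 2 : ℝ) *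
            (3 ^ ((3 / 2 : ℝ) - 1) * ∑ _m : Fin 3, (0 : ℝ≥0∞) ^ (3 / 2 : ℝ)))) := by
      refine ENNReal.Tendsto.const_mul (ENNReal.Tendsto.const_mul (tendsto_finsetSum _ fun m _ =>
        (hjj m).ennrpow_const _) (Or.inr ?_)) (Or.inr ?_)
      · exact ENNReal.rpow_ne_top_of_nonneg (by norm_num) (by simp)
      · exact ENNReal.rpow_ne_top_of_nonneg (by norm_num) (by simp)
    have h2 : (216 : ℝ≥0∞) ^ (3 / 2 : ℝ) *
            (3 ^ ((3 / 2 : ℝ) - 1) * ∑ _m : Fin 3, (0 : ℝ≥0∞) ^ (3 / 2 : ℝ)) = 0 := by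
      rw [ENNReal.zero_rpow_of_pos (by norm_num)]
      simp
    rw [h2] at h1
    have h3 := tendsto_of_tendsto_of_tendsto_of_le_of_le tendsto_const_nhds h1 (fun _ => zero_le)
      fun q : ℕ × ℕ => hdiff q.1 q.2
    have := h3.ennrpow_const ((3 / 2 : ℝ)⁻¹)
    simpa only [ENNReal.rpow_rpow_inv (show (3 / 2 : ℝ) ≠ 0 by norm_num),
      ENNReal.zero_rpow_of_pos (show (0 : ℝ) < (3 / 2 : ℝ)⁻¹ by norm_num)] using this
  -- The kernel `peakKer 0` is the constant one, so the difference estimate with `N' = 0` bounds `F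
  -- N` itself.
  have hF0 : F 0 = fun _ => 0 := by
    ext z
    simp only [hF, tker, peakKer_zero, pd_const, kerOp]
    simp
  have hFL : ∀ N, MemLp (F N) (3 / 2) (tcube (Ioo 0 T)) := fun N => by
    refine ⟨hFm N, ?_⟩
    have h1 := hdiff N 0
    simp only [hF0, sub_zero] at h1
    have h2 : eLpNorm (F N) (3 / 2) (tcube (Ioo 0 T)) ^ (3 / 2 : ℝ) < ⊤ := by
      refine h1.trans_lt (ENNReal.mul_lt_top (ENNReal.rpow_lt_top_of_nonneg (by norm_num) (by simp))
        (ENNReal.mul_lt_top (ENNReal.rpow_lt_top_of_nonneg (by norm_num) (by simp))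
          (ENNReal.sum_lt_top.2 fun m _ => ENNReal.rpow_lt_top_of_nonneg (by norm_num) ?_)))
      have h3 := (hjN m N).sub (hjN m 0)
      have h4 : ((fun z => tker (peakKer N) (j m) z - j m z) - fun z => tker (peakKer 0) (j m) z - j m z)
        = fun z => tker (peakKer N) (j m) z - tker (peakKer 0) (j m) z := by ext z; simp
      rw [h4] at h3
      exact h3.2.ne
    exact (ENNReal.rpow_lt_top_iff_of_pos (by norm_num)).1 h2
  obtain ⟨B, hB, hlim⟩ := exists_tendsto_of_cauchy hFL hcauchy
  -- The limit is only meaningful almost everywhere on the slab; it is replaced there by a periodic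
  -- representative.
  have hae : periodize B =ᵐ[tcube (Ioo 0 T)] B := by
    filter_upwards [ae_restrict_mem (measurableSet_Ioo.prod measurableSet_cube)] with z hz
    exact periodize_eq hz.2
  refine ⟨periodize B, spacePeriodic_periodize B, (memLp_congr_ae hae).2 hB, ?_⟩
  have hB1 : MemLpLoc T 1 B := fun a c ha hc =>
    (hB.mono_measure (tcube_mono (Icc_subset_Ioo' ha hc))).mono_exponent one_le_three_halves
  have key := ae_forall_tp (T := T) (ι := Fin 2) (c := ![b k, B]) (D := ![pd i, fun f => f])
    (by intro a; fin_cases a; exacts [hb k, hB1]) (by intro a; fin_cases a; exacts [TPOp.pd i, TPOp.id])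
    fun η hη θ hθ => by
      simp only [Fin.sum_univ_two, Matrix.cons_val_zero, Matrix.cons_val_one]
      have hηb := hη
      obtain ⟨hη1, a, c, ha, hc, h0⟩ := hηb
      obtain ⟨C1, -, hC1⟩ := testSpace_exists_bound (hη.mem (hθ.pd i).sp)
      obtain ⟨C2, -, hC2⟩ := testSpace_exists_bound (hη.mem hθ.sp)
      have hsub := tcube_mono (Icc_subset_Ioo' ha hc)
      have hbi' := memLp_one_iff_integrable.1 (hb k a c ha hc)
      have hBi' := memLp_one_iff_integrable.1 (hB1 a c ha hc)
      have hc1 : Continuous fun z : ℝ × E3 => η z.1 * pd i θ z.2 :=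
        (hη1.continuous.comp continuous_fst).mul ((hθ.pd i).sp.continuous.comp continuous_snd)
      have hc2 : Continuous fun z : ℝ × E3 => η z.1 * θ z.2 :=
        (hη1.continuous.comp continuous_fst).mul (hθ.sp.continuous.comp continuous_snd)
      have hFi : ∀ N, Integrable (F N) (tcube (Icc a c)) := fun N =>
        memLp_one_iff_integrable.1 (((hFL N).mono_measure hsub).mono_exponent one_le_three_halves)
      have hbN := tendsto_eLpNorm_tconv (hbp k) le_rfl ENNReal.one_ne_top (hb k a c ha hc)
      -- Integrability of the mollification is read off from its closeness to `b`, hence only for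
      -- large `N`; the sequences below are shifted by `N0`.
      have hbNi : ∃ N0, ∀ N, N0 ≤ N → Integrable (fun z => tker (peakKer N) (b k) z) (tcube (Icc a c)) := by
        obtain ⟨N0, hN0⟩ := eventually_atTop.1 (hbN.eventually (gt_mem_nhds zero_lt_one))
        refine ⟨N0, fun N hN => ?_⟩
        have hm : AEStronglyMeasurable (fun z => tker (peakKer N) (b k) z - b k z) (tcube (Icc a c)) :=
          (aesm_tker (tp_peakKer N).sp.continuous hbi'.1).sub hbi'.1
        have : MemLp (fun z => tker (peakKer N) (b k) z - b k z) 1 (tcube (Icc a c)) :=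
          ⟨hm, (hN0 N hN).trans ENNReal.one_lt_top⟩
        have := (memLp_one_iff_integrable.1 this).add hbi'
        refine this.congr (Eventually.of_forall fun z => by simp)
      obtain ⟨N0, hN0⟩ := hbNi
      have l1 : Tendsto (fun N => ∫ z, tker (peakKer (N + N0)) (b k) z * (η z.1 * pd i θ z.2)
          ∂(tcube (Icc a c))) atTop (𝓝 (∫ z, b k z * (η z.1 * pd i θ z.2) ∂(tcube (Icc a c)))) :=
        tendsto_integral_of_eLpNorm (fun N => hN0 _ (Nat.le_add_left _ _)) hbi'
          (hbN.comp (tendsto_add_atTop_nat N0)) hc1.aestronglyMeasurable hC1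
      have hl2 : Tendsto (fun N => eLpNorm (fun z => F N z - B z) 1 (tcube (Icc a c))) atTop (𝓝 0) := by
        have h5 : Tendsto (fun N => eLpNorm (fun z => F N z - B z) (3 / 2) (tcube (Ioo 0 T))
            * (tcube (Icc a c)) univ ^ (1 / (1 : ℝ≥0∞).toReal - 1 / (3 / 2 : ℝ≥0∞).toReal)) atTop (𝓝 0) := by
          have := ENNReal.Tendsto.mul_const (b := (tcube (Icc a c)) univ ^
            (1 / (1 : ℝ≥0∞).toReal - 1 / (3 / 2 : ℝ≥0∞).toReal)) hlim (Or.inr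
              (ENNReal.rpow_ne_top_of_nonneg (by rw [toReal_three_halves]; norm_num) (measure_ne_top _ _)))
          simpa using this
        refine tendsto_of_tendsto_of_tendsto_of_le_of_le tendsto_const_nhds h5 (fun _ => zero_le) fun N => ?_
        refine (eLpNorm_le_eLpNorm_mul_rpow_measure_univ one_le_three_halves
          (((hFm N).mono_measure hsub).sub (hB.1.mono_measure hsub))).trans ?_
        exact mul_le_mul_left (eLpNorm_mono_measure _ hsub) _
      have l2 : Tendsto (fun N => ∫ z, F (N + N0) z * (η z.1 * θ z.2) ∂(tcube (Icc a c))) atTop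
          (𝓝 (∫ z, B z * (η z.1 * θ z.2) ∂(tcube (Icc a c)))) :=
        tendsto_integral_of_eLpNorm (fun N => hFi _) hBi' (hl2.comp (tendsto_add_atTop_nat N0))
          hc2.aestronglyMeasurable hC2
      have hmulc : ∀ (f w : ℝ × E3 → ℝ) (C : ℝ), Integrable f (tcube (Icc a c)) → Continuous w →
          (∀ z, |w z| ≤ C) → Integrable (fun z => f z * w z) (tcube (Icc a c)) := fun f w C h1 h2 h3 => by
        simpa only [mul_comm] using h1.bdd_mul h2.aestronglyMeasurable (Eventually.of_forall h3)
      have heq : ∀ N, ∫ z, tker (peakKer (N + N0)) (b k) z * (η z.1 * pd i θ z.2) ∂(tcube (Icc a c))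
          = - ∫ z, F (N + N0) z * (η z.1 * θ z.2) ∂(tcube (Icc a c)) := fun N => by
        rw [integral_tcube (hmulc _ _ _ (hN0 _ (Nat.le_add_left _ _)) hc1 hC1),
          integral_tcube (hmulc _ _ _ (hFi _) hc2 hC2), ← integral_neg]
        refine integral_congr_ae ?_
        have hr : (volume : Measure ℝ).restrict (Icc a c) ≤ volume.restrict (Ioo 0 T) :=
          Measure.restrict_mono (Icc_subset_Ioo' ha hc) le_rfl
        filter_upwards [ae_mono hr hFs, ae_mono hr hbi] with t h1 h2
        have e1 : ∀ x, tker (peakKer (N + N0)) (b k) (t, x) * (η t * pd i θ x)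
            = η t * (conv (N + N0) (fun x => b k (t, x)) x * pd i θ x) := fun x => by
          simp only [tker, conv]; ring
        have e2 : ∀ x, F (N + N0) (t, x) * (η t * θ x)
            = η t * (pd i (conv (N + N0) (fun x => b k (t, x))) x * θ x) := fun x => by
          rw [← h1]; ring
        simp only [e1, e2, integral_const_mul]
        rw [integral_pd_mul (tp_conv (h2 k) _).sp hθ.sp]
        ring
      have l3 := tendsto_nhds_unique l1 ((l2.neg).congr fun N => (heq N).symm)
      rw [setIntegral_slab_eq ha hc fun t x ht => by simp [h0 t ht]]
      have e3 : ∀ z : ℝ × E3, η z.1 * (b k z * pd i θ z.2 + B z * θ z.2)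
          = b k z * (η z.1 * pd i θ z.2) + B z * (η z.1 * θ z.2) := fun z => by ring
      simp only [e3]
      rw [integral_add (hmulc _ _ _ hbi' hc1 hC1) (hmulc _ _ _ hBi' hc2 hC2), l3]
      ring
  filter_upwards [key] with t ht θ hθ
  have h1 := ht θ hθ
  simp only [Fin.sum_univ_two, Matrix.cons_val_zero, Matrix.cons_val_one] at h1
  have h2 : ∫ x in cube, periodize B (t, x) * θ x = ∫ x in cube, B (t, x) * θ x :=
    setIntegral_congr_fun measurableSet_cube fun x hx => by
      rw [periodize_eq (z := (t, x)) hx]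
  rw [h2]
  linarith

/-! ### Hölder duality and product rules -/

instance : ENNReal.HolderConjugate 3 (3 / 2) where
  inv_add_inv_eq_inv := by
    rw [ENNReal.inv_div (by simp) (by simp), ← one_div, ENNReal.div_add_div_same, inv_one,
      show (1 + 2 : ℝ≥0∞) = 3 by norm_num]
    exact ENNReal.div_self (by simp) (by simp)

instance : ENNReal.HolderConjugate (3 / 2) 3 := ENNReal.HolderConjugate.symm

instance : ENNReal.HolderTriple 3 3 (3 / 2) where
  inv_add_inv_eq_inv := by
    rw [ENNReal.inv_div (by simp) (by simp), ← one_div, ENNReal.div_add_div_same,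
      show (1 + 1 : ℝ≥0∞) = 2 by norm_num]

instance : ENNReal.HolderConjugate ⊤ 1 where
  inv_add_inv_eq_inv := by simp

instance : ENNReal.HolderConjugate 1 ⊤ where
  inv_add_inv_eq_inv := by simp

lemma one_le_three : (1 : ℝ≥0∞) ≤ 3 := by norm_num

lemma enorm_integral_mul_le {α : Type*} [MeasurableSpace α] {μ : Measure α} {f g : α → ℝ}
    (p q : ℝ≥0∞) [ENNReal.HolderConjugate p q] (hf : AEStronglyMeasurable f μ)
    (hg : AEStronglyMeasurable g μ) : ‖∫ x, f x * g x ∂μ‖ₑ ≤ eLpNorm f p μ * eLpNorm g q μ := by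
  have h := eLpNorm_smul_le_mul_eLpNorm (p := p) (q := q) (r := 1) hg hf
  rw [eLpNorm_one_eq_lintegral_enorm] at h
  exact (enorm_integral_le_lintegral_enorm fun x => f x * g x).trans h

lemma tendsto_integral_mul_of_eLpNorm {α ι : Type*} [MeasurableSpace α] {μ : Measure α} {l : Filter ι}
    {f g : α → ℝ} {F : ι → α → ℝ} (p q : ℝ≥0∞) [ENNReal.HolderConjugate p q] (hf : MemLp f p μ)
    (hg : MemLp g q μ) (hF : ∀ a, MemLp (F a) q μ)
    (h : Tendsto (fun a => eLpNorm (fun x => F a x - g x) q μ) l (𝓝 0)) :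
    Tendsto (fun a => ∫ x, f x * F a x ∂μ) l (𝓝 (∫ x, f x * g x ∂μ)) := by
  rw [tendsto_iff_edist_tendsto_0]
  have h2 : Tendsto (fun a => eLpNorm f p μ * eLpNorm (fun x => F a x - g x) q μ) l (𝓝 0) := by
    have := ENNReal.Tendsto.const_mul (a := eLpNorm f p μ) h (Or.inr hf.2.ne)
    simpa using this
  refine tendsto_of_tendsto_of_tendsto_of_le_of_le tendsto_const_nhds h2 (fun _ => zero_le) fun a => ?_
  have e : (∫ x, f x * F a x ∂μ) - ∫ x, f x * g x ∂μ = ∫ x, f x * (F a x - g x) ∂μ := by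
    simp only [mul_sub]
    exact (integral_sub (hf.integrable_mul (hF a)) (hf.integrable_mul hg)).symm
  rw [edist_eq_enorm_sub, e]
  exact enorm_integral_mul_le p q hf.1 ((hF a).1.sub hg.1)

lemma memLp_conv {f : E3 → ℝ} {p : ℝ≥0∞} (h1 : 1 ≤ p)
    (h : MemLp f p (volume.restrict cube)) (N : ℕ) : MemLp (conv N f) p (volume.restrict cube) :=
  (tp_conv (h.integrable h1) N).sp.memLp p

lemma tendsto_integral_mul_conv_of_memLp {f g : E3 → ℝ} (p q : ℝ≥0∞) [ENNReal.HolderConjugate p q]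
    (hq : 1 ≤ q) (hqt : q ≠ ⊤) (hf : MemLp f p (volume.restrict cube)) (hgp : Per g)
    (hg : MemLp g q (volume.restrict cube)) :
    Tendsto (fun N => ∫ x in cube, f x * conv N g x) atTop (𝓝 (∫ x in cube, f x * g x)) :=
  tendsto_integral_mul_of_eLpNorm p q hf hg (fun N => memLp_conv hq hg N)
    (tendsto_eLpNorm_conv hgp hq hqt hg)

/-- Weak identities of first order extend from trigonometric polynomials to smooth functions. -/
lemma weak_identity_sp {f : E3 → ℝ} {g : Fin 3 → E3 → ℝ} (hf : IntegrableOn f cube)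
    (hg : ∀ i, IntegrableOn (g i) cube)
    (h : ∀ θ, TP θ → ∑ i, ∫ x in cube, g i x * pd i θ x = ∫ x in cube, f x * θ x) {θ : E3 → ℝ}
    (hθ : SP θ) : ∑ i, ∫ x in cube, g i x * pd i θ x = ∫ x in cube, f x * θ x := by
  have h1 := fun N => h _ (tp_conv hθ.integrableOn N)
  simp only [pd_conv_sp hθ] at h1
  refine tendsto_nhds_unique ((tendsto_finsetSum _ fun i _ => tendsto_integral_mul_conv (hg i)
    (hθ.pd i).per (hθ.pd i).continuous).congr h1)
    (tendsto_integral_mul_conv hf hθ.per hθ.continuous)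

/-- `g` is the weak derivative of `f` in the direction `i`. -/
def WeakPd (i : Fin 3) (f g : E3 → ℝ) : Prop :=
  ∀ θ, SP θ → ∫ x in cube, f x * pd i θ x = - ∫ x in cube, g x * θ x

lemma weakPd_of_tp {i : Fin 3} {f g : E3 → ℝ} (hf : IntegrableOn f cube) (hg : IntegrableOn g cube)
    (h : ∀ θ, TP θ → ∫ x in cube, f x * pd i θ x = - ∫ x in cube, g x * θ x) : WeakPd i f g := by
  intro θ hθ
  have e : ∀ θ, ∑ m, ∫ x in cube, (fun m x => if m = i then f x else 0) m x * pd m θ x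
      = ∫ x in cube, f x * pd i θ x := fun θ => by
    rw [Finset.sum_eq_single i (fun m _ hm => by simp [hm]) (by simp)]
    simp
  have h1 := weak_identity_sp (f := fun x => - g x) (g := fun m x => if m = i then f x else 0) hg.neg
    (fun m => by by_cases hm : m = i <;> simp [hm, hf]) (fun θ hθ => by
      rw [e, h θ hθ]; simp only [neg_mul, integral_neg]) hθ
  rw [e] at h1
  rw [h1]
  simp only [neg_mul, integral_neg]

/-- Mollify `g` only: then `θ` times the mollification is an admissible test function for `f`. The
limits are products of an `L³` with an `L^{3/2}` factor. -/
lemma WeakPd.mul {i : Fin 3} {f g f' g' : E3 → ℝ} (hgp : Per g) (hgp' : Per g')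
    (hf : MemLp f 3 (volume.restrict cube)) (hg : MemLp g 3 (volume.restrict cube))
    (hf' : MemLp f' (3 / 2) (volume.restrict cube)) (hg' : MemLp g' (3 / 2) (volume.restrict cube))
    (h : WeakPd i f f') (h2 : WeakPd i g g') :
    WeakPd i (fun x => f x * g x) fun x => f' x * g x + f x * g' x := by
  have i1 : IntegrableOn g cube := hg.integrable one_le_three
  have hL : MemLp f (3 / 2) (volume.restrict cube) := hf.mono_exponent
    (ENNReal.div_le_of_le_mul (by norm_num))
  have hmulb : ∀ {p : ℝ≥0∞} {f θ : E3 → ℝ}, MemLp f p (volume.restrict cube) → SP θ →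
      MemLp (fun x => θ x * f x) p (volume.restrict cube) := fun {p f θ} hf hθ => by
    exact hf.mul' (hθ.memLp ⊤) (r := p)
  have i2 : IntegrableOn (fun x => f' x * g x) cube := hf'.integrable_mul hg
  have i3 : IntegrableOn (fun x => f x * g' x) cube := hf.integrable_mul hg'
  refine weakPd_of_tp (hL.integrable_mul hg) (i2.add i3) fun θ hθ => ?_
  have h3 : ∀ N, ∫ x in cube, pd i θ x * f x * conv N g x
      = - (∫ x in cube, θ x * f' x * conv N g x) - ∫ x in cube, θ x * f x * conv N g' x := fun N => by
    have hc := (tp_conv i1 N).sp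
    have e1 := h _ (hc.mul hθ.sp)
    have e2 : pd i (conv N g) = conv N g' := pd_conv i1 (fun θ hθ => h2 θ hθ.sp) N
    rw [pd_mul hc.differentiable hθ.sp.differentiable, e2] at e1
    have hc' : SP (conv N g') := (tp_conv (hg'.integrable one_le_three_halves) N).sp
    have hfi : IntegrableOn f cube := hf.integrable one_le_three
    have e3 : ∫ x in cube, f x * (conv N g' x * θ x + conv N g x * pd i θ x)
        = (∫ x in cube, θ x * f x * conv N g' x) + ∫ x in cube, pd i θ x * f x * conv N g x := by
      rw [← integral_add]
      · exact integral_congr_ae (Eventually.of_forall fun x => by ring)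
      · exact integrable_mul_sp hc' (integrable_sp_mul hθ.sp hfi)
      · exact integrable_mul_sp hc (integrable_sp_mul (hθ.pd i).sp hfi)
    rw [e3] at e1
    have e4 : ∫ x in cube, f' x * (conv N g x * θ x) = ∫ x in cube, θ x * f' x * conv N g x :=
      integral_congr_ae (Eventually.of_forall fun x => by ring)
    rw [e4] at e1
    linarith
  have l1 := tendsto_integral_mul_conv_of_memLp (3 / 2) 3 one_le_three (by simp)
    (hmulb hL (hθ.pd i).sp) hgp hg
  have l2 := tendsto_integral_mul_conv_of_memLp (3 / 2) 3 one_le_three (by simp)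
    (hmulb hf' hθ.sp) hgp hg
  have l3 := tendsto_integral_mul_conv_of_memLp 3 (3 / 2) one_le_three_halves three_halves_ne_top
    (hmulb hf hθ.sp) hgp' hg'
  have h4 := tendsto_nhds_unique l1 ((l2.neg.sub l3).congr fun N => (h3 N).symm)
  have e5 : ∫ x in cube, f x * g x * pd i θ x = ∫ x in cube, pd i θ x * f x * g x :=
    integral_congr_ae (Eventually.of_forall fun x => by ring)
  have e6 : ∫ x in cube, (f' x * g x + f x * g' x) * θ x
      = (∫ x in cube, θ x * f' x * g x) + ∫ x in cube, θ x * f x * g' x := by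
    rw [← integral_add]
    · exact integral_congr_ae (Eventually.of_forall fun x => by ring)
    · exact (hmulb hf' hθ.sp).integrable_mul hg
    · exact (hmulb hf hθ.sp).integrable_mul hg'
  rw [e5, e6, h4]
  ring

/-- Translated kernels are admissible tests, so all mollifications of `f` vanish. -/
lemma ae_eq_zero_of_weak {f : E3 → ℝ} (hp : Per f) (hf : IntegrableOn f cube)
    (h : ∀ θ, TP θ → ∫ x in cube, f x * θ x = 0) : f =ᵐ[volume.restrict cube] 0 := by
  have h1 : ∀ N, conv N f = fun _ => 0 := fun N => by
    ext x
    have := h _ ((tp_peakKer N).shift_sub x)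
    rw [conv, kerOp, ← this]
    simp only [mul_comm]
  have h2 := eLpNorm_le_of_conv (p := 1) (C := 0) hp hf fun N => by rw [h1]; simp
  exact (eLpNorm_eq_zero_iff hf.aestronglyMeasurable one_ne_zero).1 (le_antisymm h2 zero_le)

/-- The identities that hold on almost every time slice of the magnetic field. -/
structure SliceData (b : Fin 3 → E3 → ℝ) (B : Fin 3 → Fin 3 → E3 → ℝ) : Prop where
  per_b : ∀ k, Per (b k)
  per_B : ∀ i k, Per (B i k)
  memLp_b : ∀ k, MemLp (b k) 3 (volume.restrict cube)
  memLp_B : ∀ i k, MemLp (B i k) (3 / 2) (volume.restrict cube)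
  grad : ∀ i k, WeakPd i (b k) (B i k)
  div : (fun x => ∑ i, B i i x) =ᵐ[volume.restrict cube] 0

namespace SliceData

variable {b : Fin 3 → E3 → ℝ} {B : Fin 3 → Fin 3 → E3 → ℝ}

lemma integrable_bb (h : SliceData b B) (i k : Fin 3) : IntegrableOn (fun x => b i x * b k x) cube :=
  ((h.memLp_b i).mono_exponent (p := 3 / 2)
    (ENNReal.div_le_of_le_mul (by norm_num))).integrable_mul (h.memLp_b k)

lemma integrable_bB (h : SliceData b B) (i m k : Fin 3) : IntegrableOn (fun x => b i x * B m k x) cube :=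
  (h.memLp_b i).integrable_mul (h.memLp_B m k)

lemma weakPd_mul (h : SliceData b B) (m i k : Fin 3) :
    WeakPd m (fun x => b i x * b k x) fun x => B m i x * b k x + b i x * B m k x :=
  (h.grad m i).mul (h.per_b k) (h.per_B m k) (h.memLp_b i) (h.memLp_b k)
    (h.memLp_B m i) (h.memLp_B m k) (h.grad m k)

/-- The product rule for each `b_i b_k`; the term `b_k div b` drops, leaving `(b · ∇) b_k`. -/
lemma div_tensor (h : SliceData b B) (k : Fin 3) {θ : E3 → ℝ} (hθ : SP θ) :
    ∑ i, ∫ x in cube, b i x * b k x * pd i θ x = - ∫ x in cube, (∑ i, b i x * B i k x) * θ x := by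
  have e : ∀ i, ∫ x in cube, b i x * b k x * pd i θ x
      = - ∫ x in cube, (B i i x * b k x + b i x * B i k x) * θ x := fun i => h.weakPd_mul i i k θ hθ
  have hi : ∀ i, Integrable (fun x => (B i i x * b k x + b i x * B i k x) * θ x) (volume.restrict cube) := by
    intro i
    refine integrable_mul_sp hθ (Integrable.add ?_ (h.integrable_bB i i k))
    have := h.integrable_bB k i i
    simp only [mul_comm] at this ⊢
    exact this
  simp only [e, Finset.sum_neg_distrib]
  rw [← integral_finsetSum _ fun i _ => hi i]
  congr 1
  refine integral_congr_ae ?_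
  filter_upwards [h.div] with x hx
  rw [← Finset.sum_mul]
  simp only [Finset.sum_add_distrib, ← Finset.sum_mul]
  simp only [Pi.zero_apply] at hx
  rw [hx]
  ring

lemma grad_sq (h : SliceData b B) (k : Fin 3) {θ : E3 → ℝ} (hθ : SP θ) :
    ∫ x in cube, (∑ i, b i x ^ 2) * pd k θ x = - ∫ x in cube, 2 * (∑ i, b i x * B k i x) * θ x := by
  have e : ∀ i, ∫ x in cube, b i x * b i x * pd k θ x
      = - ∫ x in cube, (B k i x * b i x + b i x * B k i x) * θ x := fun i => h.weakPd_mul k i i θ hθ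
  have hi : ∀ i, Integrable (fun x => (B k i x * b i x + b i x * B k i x) * θ x) (volume.restrict cube) := by
    intro i
    refine integrable_mul_sp hθ (Integrable.add ?_ (h.integrable_bB i k i))
    have := h.integrable_bB i k i
    simp only [mul_comm] at this ⊢
    exact this
  have e2 : ∀ x, (∑ i, b i x ^ 2) * pd k θ x = ∑ i, b i x * b i x * pd k θ x := fun x => by
    rw [Finset.sum_mul]; exact Finset.sum_congr rfl fun i _ => by ring
  simp only [e2]
  rw [integral_finsetSum _ fun i _ => integrable_mul_sp (hθ.pd k) (h.integrable_bb i i)]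
  simp only [e, Finset.sum_neg_distrib]
  rw [← integral_finsetSum _ fun i _ => hi i]
  congr 1
  refine integral_congr_ae (Eventually.of_forall fun x => ?_)
  beta_reduce
  rw [Finset.mul_sum, Finset.sum_mul]
  exact Finset.sum_congr rfl fun i _ => by ring

end SliceData

/-! ### Regularity of the fields of a weak solution -/

lemma memLp_tcube_of_slice_le {S : Set ℝ} (hS : volume S ≠ ⊤) {f : ℝ × E3 → ℝ} {p J : ℝ≥0∞}
    (h0 : p ≠ 0) (hp : p ≠ ⊤) (hf : AEStronglyMeasurable f (tcube S)) (hJ : J ≠ ⊤)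
    (h : ∀ᵐ t ∂volume.restrict S, eLpNorm (fun x => f (t, x)) p (volume.restrict cube) ≤ J) :
    MemLp f p (tcube S) := by
  have hpos := ENNReal.toReal_pos h0 hp
  refine ⟨hf, (ENNReal.rpow_lt_top_iff_of_pos hpos).1 ?_⟩
  rw [eLpNorm_tcube_rpow h0 hp hf]
  refine (lintegral_mono_ae (g := fun _ => J ^ p.toReal) ?_).trans_lt ?_
  · filter_upwards [h] with t ht
    exact ENNReal.rpow_le_rpow ht hpos.le
  · rw [lintegral_const, Measure.restrict_apply_univ]
    exact ENNReal.mul_lt_top (ENNReal.rpow_lt_top_of_nonneg hpos.le hJ) hS.lt_top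

lemma norm_apply_le (v : E3) (k : Fin 3) : ‖v k‖ ≤ ‖v‖ := PiLp.norm_apply_le v k

lemma aesm_apply {μ : Measure (ℝ × E3)} {f : ℝ × E3 → E3} (hf : AEStronglyMeasurable f μ)
    (k : Fin 3) : AEStronglyMeasurable (fun z => f z k) μ :=
  (EuclideanSpace.proj (𝕜 := ℝ) k).continuous.comp_aestronglyMeasurable hf

lemma MemLpLq.exists_bound {T : ℝ} {q : ℝ≥0∞} {f : ℝ × E3 → E3} (hf : MemLpLq T ⊤ q f) :
    ∃ J : ℝ≥0∞, J ≠ ⊤ ∧ ∀ᵐ t ∂volume.restrict (Ioo 0 T), ∀ k,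
      eLpNorm (fun x => f (t, x) k) q (volume.restrict cube) ≤ J := by
  refine ⟨_, hf.2.ne, ?_⟩
  rw [eLpNorm_exponent_top]
  filter_upwards [ae_le_eLpNormEssSup (μ := (volume : Measure ℝ).restrict (Ioo 0 T))
    (f := fun t : ℝ => eLpNorm (fun x : E3 => f (t, x)) q (volume.restrict cube))] with t ht k
  rw [enorm_eq_self] at ht
  exact (eLpNorm_mono fun x => norm_apply_le _ k).trans ht

lemma MemLpLq.memLp {T : ℝ} {p : ℝ≥0∞} (h0 : p ≠ 0) (hp : p ≠ ⊤) {f : ℝ × E3 → E3}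
    (hf : MemLpLq T p p f) (k : Fin 3) : MemLp (fun z => f z k) p (tcube (Ioo 0 T)) := by
  have hpos := ENNReal.toReal_pos h0 hp
  have hm := aesm_apply hf.1 k
  refine ⟨hm, (ENNReal.rpow_lt_top_iff_of_pos hpos).1 ?_⟩
  have h1 := ENNReal.rpow_lt_top_of_nonneg hpos.le hf.2.ne
  rw [eLpNorm_eq_lintegral_rpow_enorm_toReal h0 hp, one_div, ENNReal.rpow_inv_rpow hpos.ne'] at h1
  rw [eLpNorm_tcube_rpow h0 hp hm]
  refine (lintegral_mono fun t => ?_).trans_lt h1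
  rw [enorm_eq_self]
  exact ENNReal.rpow_le_rpow (eLpNorm_mono fun x => norm_apply_le _ k) hpos.le

lemma exists_bound_of_continuousOn {T : ℝ} {A : ℝ × E3 → E3} (hp : SpacePeriodic A)
    (hA : ContinuousOn A (Ioo 0 T ×ˢ univ)) {a c : ℝ} (ha : 0 < a) (hc : c < T) :
    ∃ M, ∀ t ∈ Icc a c, ∀ x k, |A (t, x) k| ≤ M := by
  obtain ⟨M, hM⟩ := ((isCompact_Icc (a := a) (b := c)).prod
    (isCompact_closedBall (0 : E3) 2)).exists_bound_of_continuousOn (hA.mono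
      (prod_mono (Icc_subset_Ioo' ha hc) (subset_univ _)))
  refine ⟨M, fun t ht x k => ?_⟩
  obtain ⟨y, hy, hyf⟩ := exists_mem_cube_eq (F := E3) x
  rw [hyf (fun x => A (t, x)) (slice_per hp t)]
  exact (norm_apply_le _ k).trans (hM (t, y) ⟨ht, by simpa using norm_le_of_mem_cube hy⟩)

/-- `div (b ⊗ b)` in terms of the gradient `B` of `b`. -/
def tensorDiv (b : Fin 3 → ℝ × E3 → ℝ) (B : Fin 3 → Fin 3 → ℝ × E3 → ℝ) (k : Fin 3) (z : ℝ × E3) : ℝ :=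
  ∑ i, b i z * B i k z

/-- The spatial mean. -/
def smean (P : ℝ × E3 → ℝ) (t : ℝ) : ℝ := ∫ y in cube, P (t, y)

/-- The components of the vector potential `A`, of the magnetic field `b`, of `f = u × b`, of the
gradient `B` of `b`, and the total pressure `P`, with all their regularity and equations. -/
structure Fields (T : ℝ) (A b f : Fin 3 → ℝ × E3 → ℝ) (B : Fin 3 → Fin 3 → ℝ × E3 → ℝ)
    (P : ℝ × E3 → ℝ) : Prop where
  per_b : ∀ k, SpacePeriodic (b k)
  per_f : ∀ k, SpacePeriodic (f k)
  per_B : ∀ i k, SpacePeriodic (B i k)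
  bdd_A : ∀ a c, 0 < a → c < T → ∃ M, ∀ t ∈ Icc a c, ∀ x k, |A k (t, x)| ≤ M
  aesm_A : ∀ k, AEStronglyMeasurable (A k) (tcube (Ioo 0 T))
  loc_b : ∀ k, MemLpLoc T 3 (b k)
  bdd_b : ∀ a c, 0 < a → c < T → ∃ C : ℝ≥0∞, C ≠ ⊤ ∧ ∀ᵐ t ∂volume.restrict (Icc a c), ∀ k,
    eLpNorm (fun x => b k (t, x)) 3 (volume.restrict cube) ≤ C
  loc_f : ∀ k, MemLpLoc T (3 / 2) (f k)
  loc_B : ∀ i k, MemLpLoc T (3 / 2) (B i k)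
  loc_P : MemLpLoc T 1 P
  loc_P0 : MemLpLoc T (3 / 2) fun z => P z - smean P z.1
  slice : ∀ᵐ t ∂volume.restrict (Ioo 0 T), SliceData (fun k x => b k (t, x)) fun i k x => B i k (t, x)
  curl : ∀ᵐ t ∂volume.restrict (Ioo 0 T), ∀ k θ, SP θ → ∫ x in cube, b k (t, x) * θ x
    = (∫ x in cube, A (k + 1) (t, x) * pd (k + 2) θ x) - ∫ x in cube, A (k + 2) (t, x) * pd (k + 1) θ x
  eqn : ∀ φ ∈ testSpace T ℝ, ∀ m, ∫ z in slab T, (A m z * dt φ z + (f m z - tensorDiv b B m z) * φ z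
    + P z * dx m φ z) = 0

lemma MemLpLoc.mono {F : Type*} [NormedAddCommGroup F] {T : ℝ} {p q : ℝ≥0∞} {f : ℝ × E3 → F} (hf : MemLpLoc T q f) (h : p ≤ q) :
    MemLpLoc T p f := fun a c ha hc => (hf a c ha hc).mono_exponent h

lemma MemLpLoc.mul {T : ℝ} (p q r : ℝ≥0∞) [ENNReal.HolderTriple p q r] {f g : ℝ × E3 → ℝ}
    (hf : MemLpLoc T p f) (hg : MemLpLoc T q g) : MemLpLoc T r fun z => f z * g z :=
  fun a c ha hc => (hg a c ha hc).mul' (hf a c ha hc)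

lemma MemLpLoc.const_mul {T : ℝ} {p : ℝ≥0∞} {f : ℝ × E3 → ℝ} (hf : MemLpLoc T p f) (c : ℝ) :
    MemLpLoc T p fun z => c * f z := fun a c' ha hc => (hf a c' ha hc).const_mul c

lemma MemLpLoc.sum {T : ℝ} {p : ℝ≥0∞} {ι : Type*} (s : Finset ι) {f : ι → ℝ × E3 → ℝ}
    (hf : ∀ i ∈ s, MemLpLoc T p (f i)) : MemLpLoc T p fun z => ∑ i ∈ s, f i z :=
  fun a c ha hc => memLp_finsetSum _ fun i hi => hf i hi a c ha hc

lemma weakCurlS_sp {a b : Fin 3 → E3 → ℝ} (ha : ∀ k, IntegrableOn (a k) cube)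
    (hb : ∀ k, IntegrableOn (b k) cube) (h : WeakCurlS a b) (k : Fin 3) {θ : E3 → ℝ} (hθ : SP θ) :
    ∫ x in cube, b k x * θ x
      = (∫ x in cube, a (k + 1) x * pd (k + 2) θ x) - ∫ x in cube, a (k + 2) x * pd (k + 1) θ x := by
  have hne : k + 2 ≠ k + 1 := by fin_cases k <;> decide
  set g : Fin 3 → E3 → ℝ := fun i x => if i = k + 2 then a (k + 1) x else
    if i = k + 1 then - a (k + 2) x else 0 with hg
  have e : ∀ θ, ∑ i, ∫ x in cube, g i x * pd i θ x = (∫ x in cube, a (k + 1) x * pd (k + 2) θ x)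
      - ∫ x in cube, a (k + 2) x * pd (k + 1) θ x := fun θ => by
    have hk1 : k ≠ k + 1 := by fin_cases k <;> decide
    have hk2 : k ≠ k + 2 := by fin_cases k <;> decide
    rw [sum_fin3 _ k]
    simp [hg, hne.symm, hk1, hk2, integral_neg]
    ring
  have h1 := weak_identity_sp (f := b k) (g := g) (hb k) (fun i => by
    simp only [hg]
    split_ifs
    exacts [ha _, (ha _).neg, integrable_zero _ _ _]) (fun θ hθ => by rw [e, h k θ hθ]) hθ
  rw [e] at h1
  exact h1.symm

lemma div_of_weakCurlS {a b : Fin 3 → E3 → ℝ} (h : WeakCurlS a b) {θ : E3 → ℝ} (hθ : TP θ) :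
    ∑ k, ∫ x in cube, b k x * pd k θ x = 0 := by
  simp only [h _ _ (hθ.pd _), Finset.sum_sub_distrib]
  have h1 := sum_succ3 fun k => ∫ x in cube, a k x * pd (k + 1) (pd (k + 2) θ) x
  have h2 := sum_succ_succ3 fun k => ∫ x in cube, a k x * pd (k + 1) (pd (k + 2) θ) x
  simp only [fin3_one_one, fin3_one_two, fin3_two_one, fin3_two_two] at h1 h2
  rw [h1, ← h2, sub_eq_zero]
  refine Finset.sum_congr rfl fun k _ => ?_
  rw [pd_comm hθ.sp]

lemma sliceData_of_weak {a b : Fin 3 → E3 → ℝ} {B : Fin 3 → Fin 3 → E3 → ℝ} (hb : ∀ k, Per (b k))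
    (hB : ∀ i k, Per (B i k)) (hbL : ∀ k, MemLp (b k) 3 (volume.restrict cube))
    (hBL : ∀ i k, MemLp (B i k) (3 / 2) (volume.restrict cube)) (hab : WeakCurlS a b)
    (h : ∀ i k θ, TP θ → ∫ x in cube, b k x * pd i θ x = - ∫ x in cube, B i k x * θ x) :
    SliceData b B := by
  have hbi := fun k => (hbL k).integrable one_le_three
  have hBi := fun i k => (hBL i k).integrable one_le_three_halves
  refine ⟨hb, hB, hbL, hBL, fun i k => weakPd_of_tp (hbi k) (hBi i k) (h i k), ?_⟩
  refine ae_eq_zero_of_weak (fun x l => ?_) (integrable_finsetSum _ fun i _ => hBi i i) fun θ hθ => ?_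
  · simp only [hB _ _ x l]
  · have h1 := div_of_weakCurlS hab hθ
    simp only [h _ _ θ hθ, Finset.sum_neg_distrib, neg_eq_zero] at h1
    rw [← h1, ← integral_finsetSum _ fun i _ => integrable_mul_sp hθ.sp (hBi i i)]
    simp only [Finset.sum_mul]

lemma SliceData.current {b j : Fin 3 → E3 → ℝ} {B : Fin 3 → Fin 3 → E3 → ℝ} (h : SliceData b B)
    (hjp : ∀ k, Per (j k)) (hj : ∀ k, IntegrableOn (j k) cube) (hbj : WeakCurlS b j) (k : Fin 3) :
    j k =ᵐ[volume.restrict cube] fun x => B (k + 1) (k + 2) x - B (k + 2) (k + 1) x := by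
  have hBi := fun i k => (h.memLp_B i k).integrable one_le_three_halves
  have h1 := ae_eq_zero_of_weak (f := fun x => j k x - (B (k + 1) (k + 2) x - B (k + 2) (k + 1) x))
    (fun x l => by simp only [hjp k x l, h.per_B _ _ x l])
    ((hj k).sub ((hBi _ _).sub (hBi _ _))) fun θ hθ => by
      have e := hbj k θ hθ
      rw [h.grad _ _ θ hθ.sp, h.grad _ _ θ hθ.sp] at e
      simp only [sub_mul]
      have i3 : IntegrableOn (fun x => B (k + 1) (k + 2) x * θ x - B (k + 2) (k + 1) x * θ x) cube :=
        (integrable_mul_sp hθ.sp (hBi _ _)).sub (integrable_mul_sp hθ.sp (hBi _ _))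
      rw [integral_sub (integrable_mul_sp hθ.sp (hj k)) i3, integral_sub (integrable_mul_sp hθ.sp (hBi _ _))
        (integrable_mul_sp hθ.sp (hBi _ _)), e]
      ring
  filter_upwards [h1] with x hx
  simp only [Pi.zero_apply] at hx
  linarith

/-- `j × b = div (b ⊗ b) - ½ ∇|b|²`. -/
lemma SliceData.lorentz {b j : Fin 3 → E3 → ℝ} {B : Fin 3 → Fin 3 → E3 → ℝ} (h : SliceData b B)
    (hjp : ∀ k, Per (j k)) (hj : ∀ k, IntegrableOn (j k) cube) (hbj : WeakCurlS b j) (k : Fin 3)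
    {θ : E3 → ℝ} (hθ : SP θ) :
    ∫ x in cube, (j (k + 1) x * b (k + 2) x - j (k + 2) x * b (k + 1) x) * θ x
      = (∫ x in cube, (∑ i, b i x * B i k x) * θ x)
        + 1 / 2 * ∫ x in cube, (∑ i, b i x ^ 2) * pd k θ x := by
  have i1 : IntegrableOn (fun x => (∑ i, b i x * B i k x) * θ x) cube :=
    integrable_mul_sp hθ (integrable_finsetSum _ fun i _ => h.integrable_bB i i k)
  have i2 : IntegrableOn (fun x => (∑ i, b i x * B k i x) * θ x) cube :=
    integrable_mul_sp hθ (integrable_finsetSum _ fun i _ => h.integrable_bB i k i)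
  have e : ∫ x in cube, (j (k + 1) x * b (k + 2) x - j (k + 2) x * b (k + 1) x) * θ x
      = ∫ x in cube, ((∑ i, b i x * B i k x) * θ x - (∑ i, b i x * B k i x) * θ x) := by
    refine integral_congr_ae ?_
    filter_upwards [h.current hjp hj hbj (k + 1), h.current hjp hj hbj (k + 2)] with x h1 h2
    rw [h1, h2, fin3_one_one, fin3_one_two, fin3_two_one, fin3_two_two, sum_fin3 _ k, sum_fin3 _ k]
    ring
  have e2 : ∫ x in cube, 2 * (∑ i, b i x * B k i x) * θ x = 2 * ∫ x in cube, (∑ i, b i x * B k i x) * θ x := by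
    rw [← integral_const_mul]
    exact integral_congr_ae (Eventually.of_forall fun x => by ring)
  rw [e, integral_sub i1 i2, h.grad_sq k hθ, e2]
  ring

lemma testSpace_slice_sp {T : ℝ} {φ : ℝ × E3 → ℝ} (hφ : φ ∈ testSpace T ℝ) (t : ℝ) :
    SP fun x => φ (t, x) :=
  ⟨hφ.1.comp (contDiff_const.prodMk contDiff_id), fun x i => hφ.2.1 t x i⟩

lemma pd_slice {φ : ℝ × E3 → ℝ} (hφ : Differentiable ℝ φ) (i : Fin 3) (t : ℝ) (x : E3) :
    pd i (fun x => φ (t, x)) x = dx i φ (t, x) := by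
  have h := (hφ (t, x)).hasFDerivAt.comp x
    ((hasFDerivAt_const t x).prodMk (hasFDerivAt_id x))
  exact (pd_eq h i).trans (by simp [dx])

lemma norm_sq_eq_sum (v : E3) : ‖v‖ ^ 2 = ∑ i, v i ^ 2 := EuclideanSpace.real_norm_sq_eq v

lemma three_halves_le_three : (3 / 2 : ℝ≥0∞) ≤ 3 := ENNReal.div_le_of_le_mul (by norm_num)

lemma one_le_two' : (1 : ℝ≥0∞) ≤ 2 := by norm_num

lemma integral_slab_eq_zero_of_slice {T : ℝ} {F : ℝ × E3 → ℝ} (hF : Integrable F (tcube (Ioo 0 T)))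
    (h : ∀ᵐ t ∂volume.restrict (Ioo 0 T), ∫ x in cube, F (t, x) = 0) : ∫ z in slab T, F z = 0 := by
  rw [show ∫ z in slab T, F z = _ from integral_tcube hF, integral_congr_ae h]
  simp

lemma aesm_smean {S : Set ℝ} {P : ℝ × E3 → ℝ} (hP : AEStronglyMeasurable P (tcube S)) :
    AEStronglyMeasurable (fun z : ℝ × E3 => smean P z.1) (tcube S) := by
  have := aesm_tker (e := fun _ => 1) continuous_const hP
  refine this.congr (Eventually.of_forall fun z => ?_)
  simp [tker, kerOp, smean]

section

variable {T : ℝ} {u b j A : ℝ × E3 → E3} {π : ℝ × E3 → ℝ}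

lemma exists_memLp_current (hj : MemLpLq T ⊤ (3 / 2) j) :
    ∃ J : ℝ≥0∞, J ≠ ⊤ ∧ (∀ᵐ t ∂volume.restrict (Ioo 0 T), ∀ k,
      eLpNorm (fun x => j (t, x) k) (3 / 2) (volume.restrict cube) ≤ J) ∧
      ∀ k, MemLp (fun z => j z k) (3 / 2) (tcube (Ioo 0 T)) := by
  obtain ⟨J, hJ, h⟩ := hj.exists_bound
  refine ⟨J, hJ, h, fun k => memLp_tcube_of_slice_le (by simp) three_halves_ne_zero
    three_halves_ne_top (aesm_apply hj.1 k) hJ ?_⟩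
  filter_upwards [h] with t ht
  exact ht k

/-- The `L³` estimate on each slice depends on the slice only through a bound for `A` and the
`L^{3/2}` norm of `j`, both uniform on compact time intervals. -/
lemma bdd_field (hsol : IsWeakSolution T u b j) (hpot : IsVectorPotential T u b j A π)
    (hj : MemLpLq T ⊤ (3 / 2) j) (hA : ContinuousOn A (Ioo 0 T ×ˢ univ)) {a c : ℝ} (ha : 0 < a)
    (hc : c < T) : ∃ C : ℝ≥0∞, C ≠ ⊤ ∧ ∀ᵐ t ∂volume.restrict (Icc a c), ∀ k,
      eLpNorm (fun x => b (t, x) k) 3 (volume.restrict cube) ≤ C := by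
  obtain ⟨J, hJ, hJb, hjL⟩ := exists_memLp_current hj
  obtain ⟨M, hM⟩ := exists_bound_of_continuousOn hpot.periodic_A hA ha hc
  have hr : (volume : Measure ℝ).restrict (Icc a c) ≤ volume.restrict (Ioo 0 T) :=
    Measure.restrict_mono (Icc_subset_Ioo' ha hc) le_rfl
  have hb1 : MemLpLoc T 1 b := hsol.b_loc.mono one_le_two'
  refine ⟨(8 * (ENNReal.ofReal (12 * M) * (9 * (216 * ∑ _k : Fin 3, J))) ^ (3 / 2 : ℝ)) ^ (3⁻¹ : ℝ),
    ?_, ?_⟩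
  · refine ENNReal.rpow_ne_top_of_nonneg (by norm_num) (ENNReal.mul_ne_top (by simp)
      (ENNReal.rpow_ne_top_of_nonneg (by norm_num) (ENNReal.mul_ne_top ENNReal.ofReal_ne_top
        (ENNReal.mul_ne_top (by simp) (ENNReal.mul_ne_top (by simp) ?_)))))
    exact ENNReal.sum_ne_top.2 fun _ _ => hJ
  · filter_upwards [ae_mono hr (hpot.curl_A.ae_slice hpot.A_loc hb1),
      ae_mono hr (hsol.current.ae_slice hb1 hsol.j_loc), ae_mono hr hJb,
      ae_mono hr (ae_all_iff.2 fun k => (hb1.apply k).ae_integrableOn_slice),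
      ae_mono hr (ae_all_iff.2 fun k => (hpot.A_loc.apply k).ae_integrableOn_slice),
      ae_mono hr (ae_all_iff.2 fun k => ae_aesm_slice (hjL k).1),
      ae_restrict_mem measurableSet_Icc] with t h1 h2 h3 h4 h5 h6 ht k
    have h7 := eLpNorm_cube_le_of_weakCurl (a := fun k x => A (t, x) k) (b := fun k x => b (t, x) k)
      (j := fun k x => j (t, x) k) (fun k => (slice_per hpot.periodic_A t).comp fun v => v k) h5
      (fun k => (slice_per hsol.periodic_b t).comp fun v => v k) h4
      (fun k => (slice_per hsol.periodic_j t).comp fun v => v k) h6 h1 h2 (M := M)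
      (fun k x => hM t ht x k) k
    refine h7.trans ?_
    gcongr
    exact h3 _

lemma loc_field (hsol : IsWeakSolution T u b j) (hpot : IsVectorPotential T u b j A π)
    (hj : MemLpLq T ⊤ (3 / 2) j) (hA : ContinuousOn A (Ioo 0 T ×ˢ univ)) (k : Fin 3) :
    MemLpLoc T 3 fun z => b z k := by
  intro a c ha hc
  obtain ⟨C, hC, h⟩ := bdd_field hsol hpot hj hA ha hc
  refine memLp_tcube_of_slice_le (by simp) (by simp) (by simp)
    (aesm_apply (hsol.b_loc a c ha hc).1 k) hC ?_
  filter_upwards [h] with t ht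
  exact ht k

/-- Component `m` of the equation for `A` is tested against `η(t) ∂_m θ` and the components are
summed, that is, the divergence is taken. The time derivative disappears because `div A = 0`. -/
lemma weak_pressure_equation {A b f : Fin 3 → ℝ × E3 → ℝ} {B : Fin 3 → Fin 3 → ℝ × E3 → ℝ}
    {P : ℝ × E3 → ℝ} (hA : ∀ k, MemLpLoc T 1 (A k)) (hf : ∀ k, MemLpLoc T 1 (f k))
    (hG : ∀ k, MemLpLoc T 1 (tensorDiv b B k)) (hP : MemLpLoc T 1 P)
    (hdiv : ∀ φ ∈ testSpace T ℝ, ∫ z in slab T, ∑ k, A k z * dx k φ z = 0)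
    (heqn : ∀ φ ∈ testSpace T ℝ, ∀ m, ∫ z in slab T, (A m z * dt φ z
      + (f m z - tensorDiv b B m z) * φ z + P z * dx m φ z) = 0) :
    ∀ᵐ t ∂volume.restrict (Ioo 0 T), ∀ θ, TP θ → (∫ x in cube, P (t, x) * lap θ x)
      + ∑ m, ∫ x in cube, (f m (t, x) - tensorDiv b B m (t, x)) * pd m θ x = 0 := by
  have h := ae_forall_tp (T := T) (ι := Option (Fin 3))
    (c := fun o => o.elim P fun m z => f m z - tensorDiv b B m z)
    (D := fun o => o.elim lap fun m => pd m)
    (by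
      rintro (_ | m)
      exacts [hP, (hf m).sub (hG m)])
    (by
      rintro (_ | m)
      exacts [TPOp.lap, TPOp.pd m]) fun η hη θ hθ => by
    simp only [Fintype.sum_option, Option.elim_none, Option.elim_some]
    have e0 := hdiv _ (hη.deriv.mem hθ.sp)
    simp only [dx_time_mul_snd hη.deriv.differentiable hθ.sp.differentiable] at e0
    have e1 : ∀ m, ∫ z in slab T, (A m z * (deriv η z.1 * pd m θ z.2)
        + (f m z - tensorDiv b B m z) * (η z.1 * pd m θ z.2)
        + P z * (η z.1 * pd m (pd m θ) z.2)) = 0 := fun m => by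
      have := heqn _ (hη.mem (hθ.pd m).sp) m
      simp only [dx_time_mul_snd hη.differentiable (hθ.pd m).sp.differentiable,
        dt_time_mul (g := fun z : ℝ × E3 => pd m θ z.2) hη.differentiable
          ((hθ.pd m).sp.differentiable.comp differentiable_snd),
        dt_snd (hθ.pd m).sp.differentiable, mul_zero, add_zero] at this
      exact this
    have i1 : ∀ m, Integrable (fun z : ℝ × E3 => A m z * (deriv η z.1 * pd m θ z.2)) (tcube (Ioo 0 T)) :=
      fun m => (hA m).integrable_mul (hη.deriv.mem (hθ.pd m).sp)
    have i2 : ∀ m, Integrable (fun z : ℝ × E3 => (f m z - tensorDiv b B m z) * (η z.1 * pd m θ z.2))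
      (tcube (Ioo 0 T)) := fun m => ((hf m).sub (hG m)).integrable_mul (hη.mem (hθ.pd m).sp)
    have i3 : ∀ m, Integrable (fun z : ℝ × E3 => P z * (η z.1 * pd m (pd m θ) z.2)) (tcube (Ioo 0 T)) :=
      fun m => hP.integrable_mul (hη.mem ((hθ.pd m).pd m).sp)
    have e2 : ∑ m, ∫ z in slab T, (A m z * (deriv η z.1 * pd m θ z.2)
        + (f m z - tensorDiv b B m z) * (η z.1 * pd m θ z.2)
        + P z * (η z.1 * pd m (pd m θ) z.2)) = 0 := Finset.sum_eq_zero fun m _ => e1 m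
    have hi : ∀ m, Integrable (fun z : ℝ × E3 => A m z * (deriv η z.1 * pd m θ z.2)
        + (f m z - tensorDiv b B m z) * (η z.1 * pd m θ z.2)
        + P z * (η z.1 * pd m (pd m θ) z.2)) (tcube (Ioo 0 T)) :=
      fun m => ((i1 m).add (i2 m)).add (i3 m)
    replace e2 := (integral_finsetSum Finset.univ fun m _ => hi m).trans e2
    change ∫ z in slab T, _ = 0 at e2
    rw [← e2, ← sub_eq_zero, ← integral_sub]
    · rw [← neg_eq_zero, ← integral_neg, ← e0]
      refine integral_congr_ae (Eventually.of_forall fun z => ?_)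
      simp only [Finset.sum_add_distrib, lap, mul_add, Finset.mul_sum]
      have q1 : ∀ m, η z.1 * ((f m z - tensorDiv b B m z) * pd m θ z.2)
        = (f m z - tensorDiv b B m z) * (η z.1 * pd m θ z.2) := fun m => by ring
      have q2 : ∀ m, η z.1 * (P z * pd m (pd m θ) z.2) = P z * (η z.1 * pd m (pd m θ) z.2) :=
        fun m => by ring
      simp only [q1, q2]
      ring
    · have := (integrable_finsetSum Finset.univ fun m _ => i2 m).add
        (integrable_finsetSum Finset.univ fun m _ => i3 m)
      refine this.congr (Eventually.of_forall fun z => ?_)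
      simp only [Pi.add_apply, lap, mul_add, Finset.mul_sum]
      rw [add_comm]
      congr 1 <;> exact Finset.sum_congr rfl fun m _ => by ring
    · exact integrable_finsetSum _ fun m _ => hi m
  filter_upwards [h] with t ht θ hθ
  have := ht θ hθ
  simpa only [Fintype.sum_option, Option.elim_none, Option.elim_some] using this

/-- In the pressure equation the term `div (b ⊗ b)`, which is only in `L¹`, is integrated by parts
once more. Then only `u × b` and `b ⊗ b`, both in `L^{3/2}`, act as sources. -/
lemma loc_pressure {b f : Fin 3 → ℝ × E3 → ℝ} {B : Fin 3 → Fin 3 → ℝ × E3 → ℝ}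
    {P : ℝ × E3 → ℝ} (hbp : ∀ k, SpacePeriodic (b k)) (hfp : ∀ k, SpacePeriodic (f k))
    (hPp : SpacePeriodic P) (hb : ∀ k, MemLpLoc T 3 (b k))
    (hf : ∀ k, MemLpLoc T (3 / 2) (f k)) (hP : MemLpLoc T 1 P)
    (hs : ∀ᵐ t ∂volume.restrict (Ioo 0 T), SliceData (fun k x => b k (t, x)) fun i k x => B i k (t, x))
    (h : ∀ᵐ t ∂volume.restrict (Ioo 0 T), ∀ θ, TP θ → (∫ x in cube, P (t, x) * lap θ x)
      + ∑ m, ∫ x in cube, (f m (t, x) - tensorDiv b B m (t, x)) * pd m θ x = 0) :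
    MemLpLoc T (3 / 2) fun z => P z - smean P z.1 := by
  intro a c ha hc
  have hr : (volume : Measure ℝ).restrict (Icc a c) ≤ volume.restrict (Ioo 0 T) :=
    Measure.restrict_mono (Icc_subset_Ioo' ha hc) le_rfl
  set g : Fin 3 ⊕ Fin 3 × Fin 3 → ℝ × E3 → ℝ :=
    Sum.elim f fun q z => -(b q.1 z * b q.2 z) with hg
  have hgL : ∀ m, MemLp (g m) (3 / 2) (tcube (Icc a c)) := by
    rintro (m | ⟨i, k⟩)
    · exact hf m a c ha hc
    · exact (((hb i).mul 3 3 (3 / 2) (hb k)).neg) a c ha hc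
  have hm : AEStronglyMeasurable (fun z => P z - smean P z.1) (tcube (Icc a c)) :=
    (hP a c ha hc).1.sub (aesm_smean (hP a c ha hc).1)
  have hsl : ∀ᵐ t ∂volume.restrict (Icc a c), eLpNorm (fun x => P (t, x) - smean P t) (3 / 2)
      (volume.restrict cube) ≤ 648 * ∑ m, eLpNorm (fun x => g m (t, x)) (3 / 2) (volume.restrict cube) := by
    filter_upwards [ae_mono hr hs, ae_mono hr h, ae_mono hr hP.ae_integrableOn_slice,
      ae_all_iff.2 fun k => ae_memLp_slice three_halves_ne_zero three_halves_ne_top (hf k a c ha hc)]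
      with t h1 h2 h3 h4
    have hbb : ∀ i k, MemLp (fun x => -(b i (t, x) * b k (t, x))) (3 / 2) (volume.restrict cube) :=
      fun i k => ((h1.memLp_b k).mul' (h1.memLp_b i)).neg
    have h5 := memLp_sub_mean_of_weak_lap (p := fun x => P (t, x)) (slice_per hPp t) h3
      (f := fun k x => f k (t, x)) (fun k => slice_per (hfp k) t) (fun k => (h4 k).1)
      (fun k => (h4 k).integrable one_le_three_halves) (M := fun i k x => -(b i (t, x) * b k (t, x)))
      (fun i k x l => by simp only [hbp _ t x l]) (fun i k => (hbb i k).1)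
      (fun i k => (hbb i k).integrable one_le_three_halves) (fun θ hθ => by
        have e := h2 θ hθ
        have e1 : ∀ m, ∫ x in cube, (f m (t, x) - tensorDiv b B m (t, x)) * pd m θ x
            = (∫ x in cube, f m (t, x) * pd m θ x)
              + ∑ i, ∫ x in cube, b i (t, x) * b m (t, x) * pd i (pd m θ) x := fun m => by
          rw [h1.div_tensor m (hθ.pd m).sp, ← sub_eq_add_neg, ← integral_sub]
          · simp only [tensorDiv, sub_mul]
          · exact integrable_mul_sp (hθ.pd m).sp ((h4 m).integrable one_le_three_halves)
          · exact integrable_mul_sp (hθ.pd m).sp (integrable_finsetSum _ fun i _ => h1.integrable_bB i i m)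
        simp only [e1, Finset.sum_add_distrib] at e
        simp only [neg_mul, integral_neg, Finset.sum_neg_distrib]
        rw [Finset.sum_comm] at e
        linarith)
    refine h5.trans ?_
    rw [Fintype.sum_sum_type, Fintype.sum_prod_type, mul_add]
    simp only [Finset.mul_sum, hg, Sum.elim_inl, Sum.elim_inr]
    gcongr
    norm_num
  have hfin := eLpNorm_rpow_le_of_slice_le one_le_three_halves three_halves_ne_top hm
    (fun m => (hgL m).1) hsl
  rw [toReal_three_halves] at hfin
  refine ⟨hm, (ENNReal.rpow_lt_top_iff_of_pos (show (0 : ℝ) < 3 / 2 by norm_num)).1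
    (hfin.trans_lt ?_)⟩
  refine ENNReal.mul_lt_top (ENNReal.rpow_lt_top_of_nonneg (by norm_num) (by simp))
    (ENNReal.mul_lt_top (ENNReal.rpow_lt_top_of_nonneg (by norm_num) (by simp)) ?_)
  exact ENNReal.sum_lt_top.2 fun m _ => ENNReal.rpow_lt_top_of_nonneg (by norm_num) (hgL m).2.ne

/-- The Hall term `j × b` is `div (b ⊗ b) - ½ ∇|b|²`. The gradient joins the pressure, which
explains the total pressure `π - |b|²/2` in the reduced equation for `A`. -/
theorem exists_fields (hsol : IsWeakSolution T u b j) (hpot : IsVectorPotential T u b j A π)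
    (hj : MemLpLq T ⊤ (3 / 2) j) (hu : MemLpLq T 3 3 u) (hA : ContinuousOn A (Ioo 0 T ×ˢ univ)) :
    ∃ B, Fields T (fun k z => A z k) (fun k z => b z k) (fun k z => cross (u z) (b z) k) B
      (fun z => π z - ‖b z‖ ^ 2 / 2) := by
  obtain ⟨J, hJ, hJb, hjL⟩ := exists_memLp_current hj
  have hb1 : MemLpLoc T 1 b := hsol.b_loc.mono one_le_two'
  have hAb := hpot.curl_A.ae_slice hpot.A_loc hb1
  have hbj := hsol.current.ae_slice hb1 hsol.j_loc
  have perb : ∀ k, SpacePeriodic fun z => b z k := fun k t x i => by simp only [hsol.periodic_b t x i]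
  have perj : ∀ k, SpacePeriodic fun z => j z k := fun k t x i => by simp only [hsol.periodic_j t x i]
  have perf : ∀ k, SpacePeriodic fun z => cross (u z) (b z) k := fun k t x i => by
    simp only [hsol.periodic_b t x i, hsol.periodic_u t x i]
  choose B hBp hBL hBw using exists_weak_gradient perb perj (fun k => hpot.A_loc.apply k)
    (fun k => hb1.apply k) hjL hAb hbj
  have locb := loc_field hsol hpot hj hA
  have locB : ∀ i k, MemLpLoc T (3 / 2) (B i k) := fun i k a c ha hc =>
    (hBL i k).mono_measure (tcube_mono (Icc_subset_Ioo' ha hc))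
  have locu : ∀ k, MemLpLoc T 3 fun z => u z k := fun k a c ha hc =>
    (hu.memLp (by simp) (by simp) k).mono_measure (tcube_mono (Icc_subset_Ioo' ha hc))
  have locf : ∀ k, MemLpLoc T (3 / 2) fun z => cross (u z) (b z) k := fun k => by
    simp only [cross_apply]
    exact ((locu _).mul 3 3 (3 / 2) (locb _)).sub ((locu _).mul 3 3 (3 / 2) (locb _))
  have locG : ∀ k, MemLpLoc T 1 (tensorDiv (fun k z => b z k) B k) := fun k =>
    MemLpLoc.sum _ fun i _ => (locb i).mul 3 (3 / 2) 1 (locB i k)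
  have locb2 : MemLpLoc T 1 fun z => ‖b z‖ ^ 2 := by
    simp only [norm_sq_eq_sum]
    simp only [sq]
    exact MemLpLoc.sum _ fun i _ => ((locb i).mono three_halves_le_three).mul (3 / 2) 3 1 (locb i)
  have locP : MemLpLoc T 1 fun z => π z - ‖b z‖ ^ 2 / 2 := by
    have := hpot.π_loc.sub (locb2.const_mul (1 / 2))
    simpa only [one_div_mul_eq_div] using this
  have perP : SpacePeriodic fun z => π z - ‖b z‖ ^ 2 / 2 := fun t x i => by
    simp only [hsol.periodic_b t x i, hpot.periodic_π t x i]
  have hs : ∀ᵐ t ∂volume.restrict (Ioo 0 T),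
      SliceData (fun k x => b (t, x) k) fun i k x => B i k (t, x) := by
    filter_upwards [hAb, ae_Ioo_of_Icc fun a c ha hc => ae_all_iff.2 fun k =>
        ae_memLp_slice (by simp) (by simp) (locb k a c ha hc),
      ae_all_iff.2 fun i => ae_all_iff.2 fun k =>
        ae_memLp_slice three_halves_ne_zero three_halves_ne_top (hBL i k),
      ae_all_iff.2 fun i => ae_all_iff.2 fun k => hBw i k] with t h1 h2 h3 h4
    exact sliceData_of_weak (fun k => slice_per (perb k) t) (fun i k => slice_per (hBp i k) t) h2 h3 h1 h4
  have hji : ∀ᵐ t ∂volume.restrict (Ioo 0 T), ∀ k, IntegrableOn (fun x => j (t, x) k) cube :=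
    ae_all_iff.2 fun k => (hsol.j_loc.apply k).ae_integrableOn_slice
  have heqn : ∀ φ ∈ testSpace T ℝ, ∀ m, ∫ z in slab T, (A z m * dt φ z
      + (cross (u z) (b z) m - tensorDiv (fun k z => b z k) B m z) * φ z
      + (π z - ‖b z‖ ^ 2 / 2) * dx m φ z) = 0 := by
    intro φ hφ m
    have hd := testSpace_differentiable hφ
    have e1 := hpot.equation ⟨_, mem_testSpace_smul_basisVec hφ m⟩
    simp only [dt_smul_basisVec hd, inner_smul_basisVec, divergence_smul_basisVec hd] at e1
    have i1 := (hpot.A_loc.apply m).integrable_mul (mem_testSpace_dt hφ)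
    have i2 := ((locf m).mono one_le_three_halves).integrable_mul hφ
    have i3 := (hsol.hall_loc.apply m).integrable_mul hφ
    have i4 := hpot.π_loc.integrable_mul (mem_testSpace_dx hφ m)
    have i5 := (locG m).integrable_mul hφ
    have i6 := locb2.integrable_mul (mem_testSpace_dx hφ m)
    -- The identity of `SliceData.lorentz`, integrated in time. It is exactly the difference between
    -- the given equation and the reduced one.
    have e2 : ∫ z in slab T, (cross (j z) (b z) m * φ z - tensorDiv (fun k z => b z k) B m z * φ z
        - 1 / 2 * (‖b z‖ ^ 2 * dx m φ z)) = 0 := by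
      refine integral_slab_eq_zero_of_slice ((i3.sub i5).sub (i6.const_mul _)) ?_
      filter_upwards [hs, hji, hbj] with t h1 h2 h3
      have hθ := testSpace_slice_sp hφ t
      have h4 := h1.lorentz (fun k => slice_per (perj k) t) h2 h3 m hθ
      simp only [pd_slice hd] at h4
      have n1 : IntegrableOn (fun x => tensorDiv (fun k z => b z k) B m (t, x) * φ (t, x)) cube :=
        integrable_mul_sp hθ (integrable_finsetSum _ fun i _ => h1.integrable_bB i i m)
      have n2 : IntegrableOn (fun x => ‖b (t, x)‖ ^ 2 * dx m φ (t, x)) cube := by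
        have := integrable_mul_sp (hθ.pd m) (integrable_finsetSum Finset.univ fun i _ => h1.integrable_bb i i)
        simp only [pd_slice hd] at this
        simp only [norm_sq_eq_sum]
        simp only [sq]
        exact this
      have n3 : IntegrableOn (fun x => cross (j (t, x)) (b (t, x)) m * φ (t, x)) cube := by
        refine integrable_mul_sp hθ ?_
        have hc := h1.current (fun k => slice_per (perj k) t) h2 h3
        simp only [cross_apply]
        have hBb : ∀ i k l, IntegrableOn (fun x => B i k (t, x) * b (t, x) l) cube := fun i k l => by
          have := h1.integrable_bB l i k
          simp only [mul_comm] at this ⊢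
          exact this
        have n4 : ∀ k l, IntegrableOn (fun x => j (t, x) k * b (t, x) l) cube := fun k l => by
          refine Integrable.congr ((hBb (k + 1) (k + 2) l).sub (hBb (k + 2) (k + 1) l)) ?_
          filter_upwards [hc k] with x hx
          rw [hx]
          simp only [Pi.sub_apply]
          ring
        exact (n4 _ _).sub (n4 _ _)
      have n5 : IntegrableOn (fun x => cross (j (t, x)) (b (t, x)) m * φ (t, x)
        - tensorDiv (fun k z => b z k) B m (t, x) * φ (t, x)) cube := n3.sub n1
      rw [integral_sub n5 (n2.const_mul _), integral_sub n3 n1, integral_const_mul]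
      simp only [cross_apply, norm_sq_eq_sum, tensorDiv]
      rw [h4]
      ring
    have hi1 : Integrable (fun z => A z m * dt φ z + cross (u z) (b z) m * φ z
      - cross (j z) (b z) m * φ z + π z * dx m φ z) (tcube (Ioo 0 T)) := ((i1.add i2).sub i3).add i4
    have hi2 : Integrable (fun z => cross (j z) (b z) m * φ z
      - tensorDiv (fun k z => b z k) B m z * φ z - 1 / 2 * (‖b z‖ ^ 2 * dx m φ z)) (tcube (Ioo 0 T)) :=
      (i3.sub i5).sub (i6.const_mul _)
    have e3 := integral_add hi1 hi2
    change ∫ z in slab T, _ = (∫ z in slab T, _) + ∫ z in slab T, _ at e3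
    rw [e1, e2, add_zero] at e3
    rw [← e3]
    refine integral_congr_ae (Eventually.of_forall fun z => ?_)
    beta_reduce
    ring
  have hdivA : ∀ φ ∈ testSpace T ℝ, ∫ z in slab T, ∑ k, A z k * dx k φ z = 0 := fun φ hφ => by
    have := hpot.div_A ⟨φ, hφ⟩
    simpa only [inner_grad] using this
  refine ⟨B, perb, perf, hBp, fun a c ha hc =>
    exists_bound_of_continuousOn hpot.periodic_A hA ha hc, fun k => (hpot.A_loc.apply k).aesm, locb,
    fun a c ha hc => bdd_field hsol hpot hj hA ha hc, locf, locB, locP,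
    loc_pressure perb perf perP locb locf locP hs (weak_pressure_equation
      (fun k => hpot.A_loc.apply k) (fun k => (locf k).mono one_le_three_halves) locG locP hdivA heqn),
    hs, ?_, heqn⟩
  filter_upwards [hAb, ae_all_iff.2 fun k => (hb1.apply k).ae_integrableOn_slice,
    ae_all_iff.2 fun k => (hpot.A_loc.apply k).ae_integrableOn_slice] with t h1 h2 h3 k θ hθ
  exact weakCurlS_sp h3 h2 h1 k hθ

end

/-! ### Weak derivatives and the product rule in time -/

lemma integral_mul_deriv_primitive {a c : ℝ} {γ η : ℝ → ℝ} (hγ : IntervalIntegrable γ volume a c)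
    (hη : ContDiff ℝ 1 η) (hc : η c = 0) :
    ∫ t in a..c, (∫ s in a..t, γ s) * deriv η t = - ∫ t in a..c, γ t * η t := by
  have h1 := hγ.absolutelyContinuousOnInterval_intervalIntegral (c := a) left_mem_uIcc
  have h2 := (hη.contDiffOn (s := uIcc a c)).absolutelyContinuousOnInterval
  rw [h1.integral_mul_deriv_eq_deriv_mul h2, hc, intervalIntegral.integral_same, mul_zero, zero_mul,
    sub_self, zero_sub, neg_inj]
  refine intervalIntegral.integral_congr_ae ?_
  filter_upwards [hγ.ae_hasDerivAt_integral] with t ht h3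
  rw [(ht (uIoc_subset_uIcc h3) a left_mem_uIcc).deriv]

/-- After subtracting the primitive of `γ` the weak derivative is zero, and the remainder is
constant by du Bois-Reymond's argument. -/
lemma ae_eq_const_add_primitive {a c : ℝ} (hac : a < c) {β γ : ℝ → ℝ}
    (hβ : IntervalIntegrable β volume a c) (hγ : IntervalIntegrable γ volume a c)
    (h : ∀ η : ℝ → ℝ, ContDiff ℝ ∞ η → HasCompactSupport η → tsupport η ⊆ Ioo a c →
      ∫ t in a..c, β t * deriv η t = - ∫ t in a..c, γ t * η t) :
    ∃ k, ∀ᵐ t, t ∈ Ioo a c → β t = k + ∫ s in a..t, γ s := by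
  have hG : IntervalIntegrable (fun t => ∫ s in a..t, γ s) volume a c :=
    (hγ.absolutelyContinuousOnInterval_intervalIntegral (c := a) left_mem_uIcc).continuousOn.intervalIntegrable
  have hh := hβ.sub hG
  set g : ℝ → ℝ := fun t => β t - ∫ s in a..t, γ s with hg
  have hdec : ∀ η : ℝ → ℝ, ContDiff ℝ ∞ η → HasCompactSupport η → tsupport η ⊆ Ioo a c →
      ∫ t in a..c, g t * deriv η t = 0 := fun η h1 h2 h3 => by
    have hc : η c = 0 := image_eq_zero_of_notMem_tsupport fun h' => (h3 h').2.false
    have hd : ContinuousOn (deriv η) (uIcc a c) := (h1.continuous_deriv (by simp)).continuousOn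
    simp only [hg, sub_mul]
    rw [intervalIntegral.integral_sub (hβ.mul_continuousOn hd) (hG.mul_continuousOn hd), h η h1 h2 h3,
      integral_mul_deriv_primitive hγ (h1.of_le (by simp)) hc, sub_self]
  obtain ⟨e, he0, hec, heI, he1⟩ : ∃ e : ℝ → ℝ, ContDiff ℝ ∞ e ∧ HasCompactSupport e ∧
      tsupport e ⊆ Ioo a c ∧ ∫ t in a..c, e t = 1 := by
    let φ : ContDiffBump ((a + c) / 2) := ⟨(c - a) / 8, (c - a) / 4, by linarith, by linarith⟩
    have hs : tsupport (φ.normed volume) ⊆ Ioo a c := by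
      rw [φ.tsupport_normed_eq, Real.closedBall_eq_Icc]
      exact fun t ht => ⟨by have := ht.1; simp only [φ] at this; linarith,
        by have := ht.2; simp only [φ] at this; linarith⟩
    refine ⟨φ.normed volume, φ.contDiff_normed, φ.hasCompactSupport_normed, hs, ?_⟩
    rw [intervalIntegral.integral_of_le hac.le, setIntegral_eq_integral_of_forall_compl_eq_zero,
      φ.integral_normed]
    exact fun t ht => image_eq_zero_of_notMem_tsupport fun h' => ht (Ioo_subset_Ioc_self (hs h'))
  set k := ∫ t in a..c, g t * e t with hk
  refine ⟨k, ?_⟩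
  have key : ∀ᵐ t, t ∈ Ioo a c → g t - k = 0 := by
    refine isOpen_Ioo.ae_eq_zero_of_integral_contDiff_smul_eq_zero ?_ fun χ hχ hχc hχs => ?_
    · exact (((hh.sub intervalIntegrable_const).1).mono_set Ioo_subset_Ioc_self).locallyIntegrableOn
    -- Subtracting `m e`, where `e` has integral one, makes the integral of the test function zero.
    -- Its primitive then has compact support and is an admissible test function.
    · set m := ∫ t in a..c, χ t with hm
      have hω : ContDiff ℝ ∞ fun t => χ t - m * e t := hχ.sub (contDiff_const.mul he0)
      set η : ℝ → ℝ := fun t => ∫ s in a..t, (χ s - m * e s) with hη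
      have hd : ∀ t, HasDerivAt η (χ t - m * e t) t := fun t =>
        intervalIntegral.integral_hasDerivAt_right (hω.continuous.intervalIntegrable _ _)
          (hω.continuous.stronglyMeasurableAtFilter _ _) hω.continuous.continuousAt
      have hdη : deriv η = fun t => χ t - m * e t := funext fun t => (hd t).deriv
      have hsm : ContDiff ℝ ∞ η := by
        rw [contDiff_infty_iff_deriv]
        exact ⟨fun t => (hd t).differentiableAt, hdη ▸ hω⟩
      have hK : IsCompact (tsupport χ ∪ tsupport e) := hχc.isCompact.union hec.isCompact
      have hz : ∀ s, s ∉ tsupport χ ∪ tsupport e → χ s - m * e s = 0 := fun s hs => by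
        rw [image_eq_zero_of_notMem_tsupport fun h' => hs (Or.inl h'),
          image_eq_zero_of_notMem_tsupport fun h' => hs (Or.inr h')]
        ring
      have hzc : η c = 0 := by
        simp only [hη]
        rw [intervalIntegral.integral_sub (hχ.continuous.intervalIntegrable _ _)
          ((he0.continuous.const_mul m).intervalIntegrable _ _), intervalIntegral.integral_const_mul, he1]
        simp [hm]
      obtain ⟨a', c', ha', hc', hKs⟩ : ∃ a' c', a < a' ∧ c' < c ∧ tsupport χ ∪ tsupport e ⊆ Icc a' c' := by
        by_cases hne : (tsupport χ ∪ tsupport e).Nonempty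
        · refine ⟨_, _, (union_subset hχs heI (hK.sInf_mem hne)).1, (union_subset hχs heI (hK.sSup_mem hne)).2,
            fun t ht => ⟨csInf_le hK.bddBelow ht, le_csSup hK.bddAbove ht⟩⟩
        · rw [not_nonempty_iff_eq_empty] at hne
          exact ⟨(a + c) / 2, (a + c) / 2, by linarith, by linarith, by simp [hne]⟩
      have hsupp : ∀ t, t ∉ Icc a' c' → η t = 0 := fun t ht => by
        rcases lt_or_ge t a' with h1 | h1
        · refine intervalIntegral.integral_zero_ae (Eventually.of_forall fun s hs => hz s fun h' => ?_)
          exact absurd (hKs h').1 (not_le.2 (hs.2.trans_lt (max_lt ha' h1)))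
        · have h2 : c' < t := not_le.1 fun h' => ht ⟨h1, h'⟩
          suffices h3 : η t - η c = 0 by rwa [hzc, sub_zero] at h3
          simp only [hη]
          rw [intervalIntegral.integral_interval_sub_left (hω.continuous.intervalIntegrable _ _)
            (hω.continuous.intervalIntegrable _ _)]
          refine intervalIntegral.integral_zero_ae (Eventually.of_forall fun s hs => hz s fun h' => ?_)
          exact absurd (hKs h').2 (not_le.2 ((lt_min hc' h2).trans hs.1))
      have hts : tsupport η ⊆ Icc a' c' :=
        closure_minimal (fun t ht => by_contra fun h' => ht (hsupp t h')) isClosed_Icc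
      have h0 := hdec η hsm (isCompact_Icc.of_isClosed_subset (isClosed_tsupport _) hts)
        (hts.trans (Icc_subset_Ioo ha' hc'))
      rw [hdη] at h0
      have i1 : IntervalIntegrable (fun t => g t * χ t) volume a c :=
        hh.mul_continuousOn hχ.continuous.continuousOn
      have i2 : IntervalIntegrable (fun t => m * (g t * e t)) volume a c :=
        (hh.mul_continuousOn he0.continuous.continuousOn).const_mul m
      have h1 : ∫ t, χ t • (g t - k) = ∫ t in a..c, (g t * χ t - k * χ t) := by
        rw [intervalIntegral.integral_of_le hac.le, setIntegral_eq_integral_of_forall_compl_eq_zero]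
        · exact integral_congr_ae (Eventually.of_forall fun t => by simp only [smul_eq_mul]; ring)
        · intro t ht
          rw [image_eq_zero_of_notMem_tsupport fun h' => ht (Ioo_subset_Ioc_self (hχs h'))]
          ring
      rw [h1, intervalIntegral.integral_sub i1 ((hχ.continuous.intervalIntegrable _ _).const_mul k),
        intervalIntegral.integral_const_mul]
      rw [← hm]
      have h2 : ∫ t in a..c, (g t * χ t - m * (g t * e t)) = 0 := by
        rw [← h0]
        exact intervalIntegral.integral_congr fun t _ => by beta_reduce; ring
      rw [intervalIntegral.integral_sub i1 i2, intervalIntegral.integral_const_mul, ← hk] at h2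
      rw [mul_comm k, h2]
  filter_upwards [key] with t ht h1
  have := ht h1
  simp only [hg] at this
  linarith

/-- The product rule for weak derivatives in time, the first factor being compactly supported. -/
lemma integral_weak_deriv_mul {a a' c' c : ℝ} (haa : a < a') (hac : a' ≤ c') (hcc : c' < c)
    {α α' β γ : ℝ → ℝ}
    (hα : IntegrableOn α (Icc a c)) (hα' : IntegrableOn α' (Icc a c)) (hβ : IntegrableOn β (Icc a c))
    (hγ : IntegrableOn γ (Icc a c)) (h0 : ∀ t, t ∉ Icc a' c' → α t = 0)
    (h0' : ∀ t, t ∉ Icc a' c' → α' t = 0)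
    (h1 : ∀ η : ℝ → ℝ, ContDiff ℝ ∞ η → HasCompactSupport η → tsupport η ⊆ Ioo a c →
      ∫ t in Icc a c, α t * deriv η t = - ∫ t in Icc a c, α' t * η t)
    (h2 : ∀ η : ℝ → ℝ, ContDiff ℝ ∞ η → HasCompactSupport η → tsupport η ⊆ Ioo a c →
      ∫ t in Icc a c, β t * deriv η t = - ∫ t in Icc a c, γ t * η t) :
    ∫ t in Icc a c, (α' t * β t + α t * γ t) = 0 := by
  have hlt : a < c := by linarith
  simp only [integral_Icc_eq_integral_Ioc, ← intervalIntegral.integral_of_le hlt.le] at h1 h2 ⊢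
  have ii : ∀ {f : ℝ → ℝ}, IntegrableOn f (Icc a c) → IntervalIntegrable f volume a c := fun h =>
    (intervalIntegrable_iff_integrableOn_Icc_of_le hlt.le).2 h
  obtain ⟨k, hk⟩ := ae_eq_const_add_primitive hlt (ii hα) (ii hα') h1
  obtain ⟨m, hm⟩ := ae_eq_const_add_primitive hlt (ii hβ) (ii hγ) h2
  set L : ℝ → ℝ := fun t => ∫ s in a..t, α' s
  set G : ℝ → ℝ := fun t => ∫ s in a..t, γ s
  have hL : AbsolutelyContinuousOnInterval L a c :=
    (ii hα').absolutelyContinuousOnInterval_intervalIntegral (c := a) left_mem_uIcc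
  have hG : AbsolutelyContinuousOnInterval G a c :=
    (ii hγ).absolutelyContinuousOnInterval_intervalIntegral (c := a) left_mem_uIcc
  have hex : ∀ x y, a ≤ x → x < y → y ≤ c → ∃ t, t ∈ Ioo x y ∧ α t = k + L t := fun x y hx hxy hy => by
    have : ∃ᵐ t, t ∈ Ioo x y := by
      rw [frequently_ae_mem_iff]
      simp [hxy]
    obtain ⟨t, ht, h⟩ := (this.and_eventually hk).exists
    exact ⟨t, ht, h ⟨hx.trans_lt ht.1, ht.2.trans_le hy⟩⟩
  -- Between `a` and `a'` both `α` and the primitive of `α'` vanish.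
  have hk0 : k = 0 := by
    obtain ⟨t, ht, h⟩ := hex a a' le_rfl haa (by linarith)
    rw [h0 t fun h' => (h'.1.trans_lt ht.2).false, show L t = 0 from
      intervalIntegral.integral_zero_ae (Eventually.of_forall fun s hs => h0' s fun h' =>
        absurd h'.1 (not_le.2 (hs.2.trans_lt (max_lt haa ht.2))))] at h
    linarith
  -- Beyond `c'` the function `α` vanishes and the primitive no longer changes. So `L` vanishes at
  -- both ends and the product rule has no boundary terms.
  have hLc : L c = 0 := by
    obtain ⟨t, ht, h⟩ := hex c' c (by linarith) hcc le_rfl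
    have h3 : ∀ {x y}, x ∈ Icc a c → y ∈ Icc a c → IntervalIntegrable α' volume x y := fun hx hy =>
      (ii hα').mono_set (by rw [uIcc_of_le hlt.le]; exact uIcc_subset_Icc hx hy)
    have h4 : L c - L t = 0 := by
      simp only [L]
      rw [intervalIntegral.integral_interval_sub_left (h3 ⟨le_rfl, hlt.le⟩ ⟨hlt.le, le_rfl⟩)
        (h3 ⟨le_rfl, hlt.le⟩ ⟨by linarith [ht.1], ht.2.le⟩)]
      exact intervalIntegral.integral_zero_ae (Eventually.of_forall fun s hs => h0' s fun h' =>
        absurd h'.2 (not_le.2 ((lt_min ht.1 hcc).trans hs.1)))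
    rw [h0 t fun h' => (h'.2.trans_lt ht.1).false, hk0] at h
    linarith
  have key := hL.integral_deriv_mul_eq_sub hG
  rw [hLc, show L a = 0 from intervalIntegral.integral_same] at key
  have hd := (ii hα').ae_hasDerivAt_integral
  have hd2 := (ii hγ).ae_hasDerivAt_integral
  -- The unknown constant in `β` does not matter, as `α'` has integral zero.
  have hm0 : ∫ t in a..c, α' t * m = 0 := by
    rw [intervalIntegral.integral_mul_const, show ∫ t in a..c, α' t = 0 from hLc, zero_mul]
  have i1 : IntervalIntegrable (fun t => α' t * G t + L t * γ t) volume a c :=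
    ((ii hα').mul_continuousOn hG.continuousOn).add ((ii hγ).continuousOn_mul hL.continuousOn)
  have e1 : ∫ t in a..c, (α' t * G t + L t * γ t) = 0 := by
    rw [zero_mul, zero_mul, sub_self] at key
    rw [← key]
    refine intervalIntegral.integral_congr_ae ?_
    filter_upwards [hd, hd2] with t g1 g2 ht
    have ht' := uIoc_subset_uIcc ht
    rw [(g1 ht' a left_mem_uIcc).deriv, (g2 ht' a left_mem_uIcc).deriv]
  rw [← add_zero (0 : ℝ), ← e1]
  nth_rewrite 2 [e1]
  rw [← hm0, ← intervalIntegral.integral_add i1 ((ii hα').mul_const m)]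
  refine intervalIntegral.integral_congr_ae ?_
  have hc : ∀ᵐ t : ℝ, t ≠ c := by simp [ae_iff, measure_singleton]
  filter_upwards [hk, hm, hc] with t g1 g2 g3 ht
  rw [uIoc_of_le hlt.le] at ht
  have ht' : t ∈ Ioo a c := ⟨ht.1, lt_of_le_of_ne ht.2 g3⟩
  rw [g1 ht', g2 ht', hk0]
  ring

/-! ### Correlations as functions of the lag -/

/-- The space-time correlation of `f` and `g` at the spatial lag `l`. -/
def corr (S : Set ℝ) (f g : ℝ × E3 → ℝ) (l : E3) : ℝ := ∫ z, f z * g (z.1, z.2 + l) ∂tcube S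

lemma corr_zero (S : Set ℝ) (f g : ℝ × E3 → ℝ) : corr S f g 0 = ∫ z, f z * g z ∂tcube S := by
  simp [corr]

lemma per_corr {S : Set ℝ} {f g : ℝ × E3 → ℝ} (hg : SpacePeriodic g) : Per (corr S f g) := by
  intro l i
  simp only [corr, ← add_assoc, hg _ _ i]

/-- Hölder's inequality and continuity of translations in `L^q`; the exponent of the translated
factor has to be finite for the latter. -/
lemma continuous_corr {S : Set ℝ} (hS : MeasurableSet S) {f g : ℝ × E3 → ℝ} (p q : ℝ≥0∞)
    [ENNReal.HolderConjugate p q] (hq : 1 ≤ q) (hqt : q ≠ ⊤) (hf : MemLp f p (tcube S))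
    (hgp : SpacePeriodic g) (hg : MemLp g q (tcube S)) : Continuous (corr S f g) := by
  refine continuous_iff_continuousAt.2 fun l₀ => ?_
  refine tendsto_integral_mul_of_eLpNorm p q (F := fun l z => g (z.1, z.2 + l)) hf
    (memLp_tshift hgp l₀ hqt hg) (fun l => memLp_tshift hgp l hqt hg) ?_
  have h1 : Tendsto (fun l : E3 => l - l₀) (𝓝 l₀) (𝓝 0) := by
    have : Tendsto (fun l : E3 => l - l₀) (𝓝 l₀) (𝓝 (l₀ - l₀)) := (continuous_sub_right l₀).tendsto l₀
    rwa [sub_self] at this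
  refine ((tendsto_eLpNorm_tshift hgp hS hq hqt hg).comp h1).congr fun l => ?_
  have hp : SpacePeriodic fun z : ℝ × E3 => g (z.1, z.2 + (l - l₀)) - g z := fun t x i => by
    simp only [hgp t x i, add_right_comm x (basisVec i), hgp t _ i]
  have := eLpNorm_tshift hp ((memLp_tshift hgp (l - l₀) hqt hg).1.sub hg.1) l₀ hqt
  rw [Function.comp_apply, ← this]
  congr 1
  ext z
  simp only [add_assoc, add_sub_cancel]

section

variable {Λ : Type*} [MeasurableSpace Λ] {ν : Measure Λ} [SFinite ν]

lemma aesm_tshift_prod {S : Set ℝ} {f : ℝ × E3 → ℝ} (hf : SpacePeriodic f)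
    (h : AEStronglyMeasurable f (tcube S)) {L : Λ → E3} (hL : Measurable L) :
    AEStronglyMeasurable (fun q : (ℝ × E3) × Λ => f (q.1.1, q.1.2 + L q.2)) ((tcube S).prod ν) := by
  have hq : Measure.QuasiMeasurePreserving (fun q : (ℝ × E3) × Λ => (q.1.1, q.1.2 + L q.2))
      ((tcube S).prod ν) (volume.restrict (S ×ˢ univ)) := by
    refine QuasiMeasurePreserving.prod_of_left (by fun_prop) (Eventually.of_forall fun y => ?_)
    refine (measurePreserving_space_shift S (L y) cube measurableSet_cube).quasiMeasurePreserving.mono_right ?_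
    exact (Measure.restrict_mono (prod_mono le_rfl (subset_univ _)) le_rfl).absolutelyContinuous
  exact (aesm_tuniv hf h).comp_quasiMeasurePreserving hq

lemma integrable_prod_of_bound {α : Type*} [MeasurableSpace α] {μ : Measure α} [SFinite μ]
    {F : α × Λ → ℝ} (hF : AEStronglyMeasurable F (μ.prod ν)) {C : ℝ≥0∞} (hC : C ≠ ⊤)
    (hb : ∀ y, eLpNorm (fun z => F (z, y)) 1 μ ≤ C) {w : Λ → ℝ} (hw : Integrable w ν) :
    Integrable (fun q => w q.2 * F q) (μ.prod ν) := by
  have hm : AEStronglyMeasurable (fun q : α × Λ => w q.2 * F q) (μ.prod ν) := hw.1.comp_snd.mul hF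
  refine ⟨hm, ?_⟩
  rw [hasFiniteIntegral_iff_enorm, lintegral_prod_symm _ hm.enorm]
  simp only [enorm_mul]
  refine (lintegral_mono (g := fun y => ‖w y‖ₑ * C) fun y => ?_).trans_lt ?_
  · rw [lintegral_const_mul' _ _ enorm_ne_top, ← eLpNorm_one_eq_lintegral_enorm]
    exact mul_le_mul_right (hb y) _
  · rw [lintegral_mul_const' _ _ hC]
    exact ENNReal.mul_lt_top hw.2 hC.lt_top

end

/-! ### Separable kernels and products of moments -/

/-- `e (y - x) = ∑ⱼ pⱼ(x) rⱼ(y)` with smooth periodic factors. -/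
structure Sep {ι : Type} [Fintype ι] (e : E3 → ℝ) (p r : ι → E3 → ℝ) : Prop where
  sp : SP e
  left : ∀ j, SP (p j)
  right : ∀ j, SP (r j)
  eq : ∀ x y, e (y - x) = ∑ j, p j x * r j y

lemma TP.exists_sep {e : E3 → ℝ} (he : TP e) :
    ∃ (ι : Type) (_ : Fintype ι) (p r : ι → E3 → ℝ), Sep e p r := by
  refine he.induction (P := fun e => ∃ (ι : Type) (_ : Fintype ι) (p r : ι → E3 → ℝ), Sep e p r) ?_ ?_ ?_
  · intro n θ
    refine ⟨Fin 2, inferInstance, ![wave n (-θ), wave n (-θ - Real.pi / 2)],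
      ![wave n 0, wave n (-(Real.pi / 2))], wave_sp _ _, ?_, ?_, fun x y => ?_⟩
    · intro j; fin_cases j <;> exact wave_sp _ _
    · intro j; fin_cases j <;> exact wave_sp _ _
    · simp [Fin.sum_univ_two, wave_sub]
  · rintro f g - - ⟨ι, _, p, r, h⟩ ⟨ι', _, p', r', h'⟩
    refine ⟨ι ⊕ ι', inferInstance, Sum.elim p p', Sum.elim r r', h.sp.add h'.sp, ?_, ?_, fun x y => ?_⟩
    · rintro (j | j); exacts [h.left j, h'.left j]
    · rintro (j | j); exacts [h.right j, h'.right j]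
    · simp [h.eq, h'.eq]
  · rintro c f - ⟨ι, _, p, r, h⟩
    refine ⟨ι, inferInstance, fun j x => c * p j x, r, h.sp.const_mul c, fun j => (h.left j).const_mul c,
      h.right, fun x y => ?_⟩
    simp only [h.eq, Finset.mul_sum, mul_assoc]

section

variable {ι : Type} [Fintype ι]

/-- The pairing `∑ⱼ (∫ f pⱼ) (∫ g rⱼ)`. -/
def sep (p r : ι → E3 → ℝ) (f g : E3 → ℝ) : ℝ :=
  ∑ j, (∫ x in cube, f x * p j x) * ∫ x in cube, g x * r j x

lemma sep_eq {p r : ι → E3 → ℝ} (hp : ∀ j, SP (p j)) (hr : ∀ j, SP (r j)) {f g : E3 → ℝ}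
    (hf : IntegrableOn f cube) (hg : IntegrableOn g cube) :
    sep p r f g = ∫ x in cube, f x * ∫ y in cube, g y * ∑ j, p j x * r j y := by
  have h1 : ∀ x, f x * ∫ y in cube, g y * ∑ j, p j x * r j y
      = ∑ j, f x * p j x * ∫ y in cube, g y * r j y := fun x => by
    simp only [Finset.mul_sum]
    rw [integral_finsetSum _ fun j _ => ?_]
    · rw [Finset.mul_sum]
      refine Finset.sum_congr rfl fun j _ => ?_
      rw [mul_assoc, ← integral_const_mul (p j x)]
      congr 2
      ext y
      ring
    · refine ((integrable_mul_sp (hr j) hg).const_mul (p j x)).congr (Eventually.of_forall fun y => ?_)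
      beta_reduce
      ring
  simp only [h1, sep]
  rw [integral_finsetSum _ fun j _ => (integrable_mul_sp (hp j) hf).mul_const _]
  simp only [integral_mul_const]

variable {e : E3 → ℝ} {p r : ι → E3 → ℝ}

lemma Sep.pd (h : Sep e p r) (i : Fin 3) : Sep (pd i e) p fun j => pd i (r j) where
  sp := h.sp.pd i
  left := h.left
  right j := (h.right j).pd i
  eq x y := by
    rw [← pd_shift_sub]
    have : (fun y => e (y - x)) = fun y => ∑ j, p j x * r j y := funext fun y => h.eq x y
    rw [this, pd_sum _ fun j _ => (h.right j).differentiable.const_mul _]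
    refine Finset.sum_congr rfl fun j _ => ?_
    rw [pd_const_mul (h.right j).differentiable]

/-- Differentiating `e (y - x)` in `y` is minus differentiating in `x`, so a derivative can be moved
from one family of factors to the other even though the families are not unique. -/
lemma Sep.sep_pd_right (h : Sep e p r) (i : Fin 3) {f g : E3 → ℝ} (hf : IntegrableOn f cube)
    (hg : IntegrableOn g cube) :
    sep p (fun j => HallMHD.pd i (r j)) f g = - sep (fun j => HallMHD.pd i (p j)) r f g := by
  rw [sep_eq h.left (fun j => (h.right j).pd i) hf hg, sep_eq (fun j => (h.left j).pd i) h.right hf hg,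
    ← integral_neg]
  congr 1
  ext x
  rw [← mul_neg, ← integral_neg]
  congr 2
  ext y
  rw [← mul_neg, ← (h.pd i).eq]
  congr 1
  have : (fun x => e (y - x)) = fun x => ∑ j, p j x * r j y := funext fun x => h.eq x y
  have h2 := pd_sub_shift h.sp.differentiable y x i
  rw [this, pd_sum _ fun j _ => (h.left j).differentiable.mul_const _] at h2
  rw [← neg_eq_iff_eq_neg.2 h2, neg_inj]
  refine Finset.sum_congr rfl fun j _ => ?_
  have := pd_const_mul (h.left j).differentiable (r j y) i
  simp only [mul_comm (r j y)] at this
  rw [this]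

lemma integral_mul_corr {S : Set ℝ} {f g : ℝ × E3 → ℝ} (a b : ℝ≥0∞)
    [ENNReal.HolderConjugate a b] (hbt : b ≠ ⊤) (hf : MemLp f a (tcube S))
    (hgp : SpacePeriodic g) (hg : MemLp g b (tcube S)) (he : SP e) :
    Integrable (fun z => f z * tker e g z) (tcube S) ∧
      ∫ l in cube, e l * corr S f g l = ∫ z, f z * tker e g z ∂tcube S := by
  have hb : ∀ l : E3, eLpNorm (fun z : ℝ × E3 => f z * g (z.1, z.2 + l)) 1 (tcube S)
      ≤ eLpNorm f a (tcube S) * eLpNorm g b (tcube S) := fun l => by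
    have h1 := (memLp_tshift hgp l hbt hg).1
    have h2 := eLpNorm_smul_le_mul_eLpNorm (p := a) (q := b) (r := 1) h1 hf.1
    rw [eLpNorm_tshift hgp hg.1 l hbt] at h2
    exact h2
  have hm : AEStronglyMeasurable (fun q : (ℝ × E3) × E3 => f q.1 * g (q.1.1, q.1.2 + q.2))
      ((tcube S).prod (volume.restrict cube)) :=
    hf.1.comp_fst.mul (aesm_tshift_prod hgp hg.1 measurable_id)
  have hi : Integrable (fun q : (ℝ × E3) × E3 => e q.2 * (f q.1 * g (q.1.1, q.1.2 + q.2)))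
      ((tcube S).prod (volume.restrict cube)) :=
    integrable_prod_of_bound hm (ENNReal.mul_ne_top hf.2.ne hg.2.ne) hb he.integrableOn
  have h1 : ∀ z, ∫ l in cube, e l * (f z * g (z.1, z.2 + l)) = f z * tker e g z := fun z => by
    rw [tker, kerOp_eq_shift he.per (slice_per hgp z.1), ← integral_const_mul]
    congr 1
    ext l
    ring
  refine ⟨hi.integral_prod_left.congr (Eventually.of_forall h1), ?_⟩
  simp only [corr, ← integral_const_mul]
  rw [← integral_prod_symm _ hi, integral_prod _ hi]
  exact integral_congr_ae (Eventually.of_forall h1)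

/-- By Fubini, testing a correlation in the lag against a separable kernel gives a time integral of
products of moments. Identities in the lag thereby become identities on time slices together with a
product rule in time. -/
lemma Sep.integral_corr (h : Sep e p r) {S : Set ℝ} {f g : ℝ × E3 → ℝ} (a b : ℝ≥0∞)
    [ENNReal.HolderConjugate a b] (hbt : b ≠ ⊤) (hf : MemLp f a (tcube S)) (hf1 : Integrable f (tcube S))
    (hgp : SpacePeriodic g) (hg : MemLp g b (tcube S)) (hg1 : Integrable g (tcube S)) :
    IntegrableOn (fun t => sep p r (fun x => f (t, x)) fun x => g (t, x)) S ∧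
      ∫ l in cube, e l * corr S f g l
        = ∫ t in S, sep p r (fun x => f (t, x)) fun x => g (t, x) := by
  obtain ⟨h1, h2⟩ := integral_mul_corr a b hbt hf hgp hg h.sp
  have h3 : (fun t => ∫ x in cube, f (t, x) * tker e g (t, x)) =ᵐ[volume.restrict S]
      fun t => sep p r (fun x => f (t, x)) fun x => g (t, x) := by
    filter_upwards [ae_integrableOn_slice hf1, ae_integrableOn_slice hg1] with t h4 h5
    rw [sep_eq h.left h.right h4 h5]
    congr 1
    ext x
    simp only [tker, kerOp, h.eq]
    congr 2
    ext y
    ring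
  refine ⟨(integrable_slice_integral h1).congr h3, ?_⟩
  rw [h2, integral_tcube h1, integral_congr_ae h3]

end

namespace SliceData

variable {b : Fin 3 → E3 → ℝ} {B : Fin 3 → Fin 3 → E3 → ℝ} {ι : Type} [Fintype ι] {e θ : E3 → ℝ}
  {p r : ι → E3 → ℝ}

lemma integrable_b (h : SliceData b B) (k : Fin 3) : IntegrableOn (b k) cube :=
  (h.memLp_b k).integrable one_le_three

lemma integrable_sq (h : SliceData b B) : IntegrableOn (fun x => ∑ k, b k x ^ 2) cube :=
  integrable_finsetSum _ fun k _ => by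
    simp only [sq]
    exact h.integrable_bb k k

lemma integrable_cube (h : SliceData b B) (i : Fin 3) :
    IntegrableOn (fun x => b i x * ∑ k, b k x ^ 2) cube := by
  have h1 : ∀ k, MemLp (fun x => b k x ^ 2) (3 / 2) (volume.restrict cube) := fun k => by
    simpa only [sq] using (h.memLp_b k).mul' (r := 3 / 2) (h.memLp_b k)
  have h2 : MemLp (fun x => ∑ k, b k x ^ 2) (3 / 2) (volume.restrict cube) :=
    memLp_finsetSum _ fun k _ => h1 k
  exact memLp_one_iff_integrable.1 (h2.mul' (h.memLp_b i))

lemma integrable_tensorDiv (h : SliceData b B) (k : Fin 3) :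
    IntegrableOn (fun x => ∑ i, b i x * B i k x) cube :=
  integrable_finsetSum _ fun i _ => h.integrable_bB i i k

lemma integral_b_pd (h : SliceData b B) (hθ : SP θ) : ∑ i, ∫ x in cube, b i x * pd i θ x = 0 := by
  have h1 : ∀ i, IntegrableOn (fun x => B i i x * θ x) cube := fun i =>
    integrable_mul_sp hθ ((h.memLp_B i i).integrable one_le_three_halves)
  have h2 : ∀ i, ∫ x in cube, b i x * pd i θ x = - ∫ x in cube, B i i x * θ x := fun i => h.grad i i θ hθ
  simp only [h2, Finset.sum_neg_distrib, neg_eq_zero]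
  rw [← integral_finsetSum _ fun i _ => h1 i]
  refine integral_eq_zero_of_ae ?_
  filter_upwards [h.div] with x hx
  simp only [← Finset.sum_mul, hx, Pi.zero_apply, zero_mul]

lemma sep_smooth (hθ : SP θ) (hs : Sep e p r) (i : Fin 3) {g : E3 → ℝ} (hg : IntegrableOn g cube) :
    sep p (fun j => pd i (r j)) θ g = sep p r (pd i θ) g := by
  rw [hs.sep_pd_right i hθ.integrableOn hg, sep, sep, ← Finset.sum_neg_distrib]
  refine Finset.sum_congr rfl fun j _ => ?_
  rw [integral_pd_mul hθ (hs.left j), neg_mul]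

lemma integral_mul_pd (hθ : SP θ) {q f : E3 → ℝ} (hq : SP q) (hf : IntegrableOn f cube) (i : Fin 3) :
    ∫ x in cube, θ x * f x * pd i q x
      = (∫ x in cube, f x * pd i (fun x => θ x * q x) x) - ∫ x in cube, pd i θ x * f x * q x := by
  have h1 := integrable_mul_sp ((hθ.mul hq).pd i) hf
  have h2 : IntegrableOn (fun x => pd i θ x * f x * q x) cube :=
    integrable_mul_sp hq (integrable_sp_mul (hθ.pd i) hf)
  rw [← integral_sub h1 h2]
  congr 1
  ext x
  rw [pd_mul hθ.differentiable hq.differentiable]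
  ring

/-- The derivative is moved onto the left factors and then off them by parts; since `div b = 0` it
can only fall on `θ`. -/
lemma sep_linear (h : SliceData b B) (hθ : SP θ) (hs : Sep e p r) {g : E3 → ℝ} (hg : IntegrableOn g cube) :
    ∑ i, sep p (fun j => pd i (r j)) (fun x => θ x * b i x) g
      = ∑ i, sep p r (fun x => pd i θ x * b i x) g := by
  simp only [fun i => hs.sep_pd_right i (integrable_sp_mul hθ (h.integrable_b i)) hg]
  simp only [sep, ← Finset.sum_neg_distrib]
  rw [Finset.sum_comm]
  conv_rhs => rw [Finset.sum_comm]
  refine Finset.sum_congr rfl fun j _ => ?_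
  simp only [integral_mul_pd hθ (hs.left j) (h.integrable_b _), ← neg_mul, ← Finset.sum_mul]
  rw [Finset.sum_neg_distrib, Finset.sum_sub_distrib, h.integral_b_pd (hθ.mul (hs.left j)), zero_sub, neg_neg]

lemma sep_tensor_right (h : SliceData b B) (hs : Sep e p r) (k : Fin 3) (f : E3 → ℝ) :
    ∑ i, sep p (fun j => pd i (r j)) f (fun x => b i x * b k x)
      = - sep p r f fun x => ∑ i, b i x * B i k x := by
  simp only [sep]
  rw [Finset.sum_comm, ← Finset.sum_neg_distrib]
  refine Finset.sum_congr rfl fun j _ => ?_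
  rw [← Finset.mul_sum, h.div_tensor k (hs.right j), mul_neg]

/-- As in `sep_linear`, but the divergence of `b ⊗ b` is not zero and leaves the extra term `(b · ∇)
b_k`. -/
lemma sep_tensor_left (h : SliceData b B) (hθ : SP θ) (hs : Sep e p r) (k : Fin 3) {g : E3 → ℝ}
    (hg : IntegrableOn g cube) :
    ∑ i, sep p (fun j => pd i (r j)) (fun x => θ x * (b i x * b k x)) g
      = sep p r (fun x => θ x * ∑ i, b i x * B i k x) g
        + ∑ i, sep p r (fun x => pd i θ x * (b i x * b k x)) g := by
  simp only [fun i => hs.sep_pd_right i (integrable_sp_mul hθ (h.integrable_bb i k)) hg]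
  simp only [sep, ← Finset.sum_neg_distrib]
  rw [Finset.sum_comm]
  conv_rhs =>
    enter [2]
    rw [Finset.sum_comm]
  rw [← Finset.sum_add_distrib]
  refine Finset.sum_congr rfl fun j _ => ?_
  simp only [integral_mul_pd hθ (hs.left j) (h.integrable_bb _ k), ← neg_mul, ← Finset.sum_mul]
  rw [Finset.sum_neg_distrib, Finset.sum_sub_distrib, h.div_tensor k (hθ.mul (hs.left j)), ← add_mul]
  congr 1
  have : ∀ x, (∑ i, b i x * B i k x) * (θ x * p j x) = θ x * (∑ i, b i x * B i k x) * p j x := fun x => by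
    ring
  simp only [this]
  ring

lemma sep_b (h : SliceData b B) (hs : Sep e p r) (f : E3 → ℝ) :
    ∑ i, sep p (fun j => pd i (r j)) f (b i) = 0 := by
  simp only [sep]
  rw [Finset.sum_comm]
  refine Finset.sum_eq_zero fun j _ => ?_
  rw [← Finset.mul_sum, h.integral_b_pd (hs.right j), mul_zero]

end SliceData

lemma MemLpLoc.test_mul {T : ℝ} {p : ℝ≥0∞} {φ g : ℝ × E3 → ℝ} (hg : MemLpLoc T p g)
    (hφ : φ ∈ testSpace T ℝ) : MemLpLoc T p fun z => φ z * g z := by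
  intro a c ha hc
  obtain ⟨C, -, hC⟩ := testSpace_exists_bound hφ
  refine (hg a c ha hc).of_le_mul (c := C)
    (hφ.1.continuous.aestronglyMeasurable.mul (hg a c ha hc).1) (Eventually.of_forall fun z => ?_)
  rw [norm_mul]
  exact mul_le_mul_of_nonneg_right (hC z) (norm_nonneg _)

lemma memLpLoc_test {T : ℝ} (p : ℝ≥0∞) {φ : ℝ × E3 → ℝ} (hφ : φ ∈ testSpace T ℝ) : MemLpLoc T p φ := by
  intro a c ha hc
  obtain ⟨C, -, hC⟩ := testSpace_exists_bound hφ
  exact MemLp.of_bound hφ.1.continuous.aestronglyMeasurable C (Eventually.of_forall hC)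

lemma MemLpLoc.mul_snd {T : ℝ} {p : ℝ≥0∞} {g : ℝ × E3 → ℝ} (hg : MemLpLoc T p g) {θ : E3 → ℝ}
    (hθ : SP θ) : MemLpLoc T p fun z => g z * θ z.2 := by
  intro a c ha hc
  obtain ⟨C, -, hC⟩ := hθ.exists_bound
  refine (hg a c ha hc).of_le_mul (c := C) ((hg a c ha hc).1.mul
    hθ.contDiff_snd.continuous.aestronglyMeasurable) (Eventually.of_forall fun z => ?_)
  rw [norm_mul, mul_comm]
  exact mul_le_mul_of_nonneg_right (hC _) (norm_nonneg _)

lemma MemLpLoc.integrable {T : ℝ} {g : ℝ × E3 → ℝ} (hg : MemLpLoc T 1 g) {a c : ℝ} (ha : 0 < a)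
    (hc : c < T) : Integrable g (tcube (Icc a c)) :=
  memLp_one_iff_integrable.1 (hg a c ha hc)

lemma integral_slab_time_mul {T : ℝ} {g χ : ℝ × E3 → ℝ} (hg : MemLpLoc T 1 g) {η : ℝ → ℝ}
    (hη : TimeTest T η) (hχ : ContDiff ℝ ∞ χ) (hχp : SpacePeriodic χ) {a c : ℝ} (ha : 0 < a)
    (hc : c < T) (h0 : ∀ t, t ∉ Icc a c → η t = 0) :
    ∫ z in slab T, g z * (η z.1 * χ z) = ∫ t in Icc a c, (∫ x in cube, g (t, x) * χ (t, x)) * η t := by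
  rw [setIntegral_slab_eq ha hc fun t x ht => by simp [h0 t ht], integral_tcube]
  · congr 1
    ext t
    rw [← integral_mul_const]
    congr 1
    ext x
    ring
  · exact (hg.integrable_mul (mem_testSpace_time_mul hη hχ hχp)).mono_measure
      (tcube_mono (Icc_subset_Ioo' ha hc))

lemma timeTest_of_tsupport {T a c : ℝ} (ha : 0 < a) (hc : c < T) {η : ℝ → ℝ} (hη : ContDiff ℝ ∞ η)
    (hs : tsupport η ⊆ Ioo a c) : TimeTest T η ∧ ∀ t, t ∉ Icc a c → η t = 0 := by
  have h0 : ∀ t, t ∉ Icc a c → η t = 0 := fun t ht =>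
    image_eq_zero_of_notMem_tsupport fun h => ht (Ioo_subset_Icc_self (hs h))
  exact ⟨⟨hη, a, c, ha, hc, h0⟩, h0⟩

/-! ### Evolution of the spatial moments -/

namespace Fields

variable {T : ℝ} {A b f : Fin 3 → ℝ × E3 → ℝ} {B : Fin 3 → Fin 3 → ℝ × E3 → ℝ}
  {P : ℝ × E3 → ℝ}

lemma loc_G (h : Fields T A b f B P) (k : Fin 3) : MemLpLoc T 1 (tensorDiv b B k) :=
  MemLpLoc.sum _ fun i _ => (h.loc_b i).mul 3 (3 / 2) 1 (h.loc_B i k)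

lemma loc_F (h : Fields T A b f B P) (k : Fin 3) : MemLpLoc T 1 fun z => f k z - tensorDiv b B k z :=
  ((h.loc_f k).mono one_le_three_halves).sub (h.loc_G k)

lemma loc_A (h : Fields T A b f B P) (p : ℝ≥0∞) (k : Fin 3) : MemLpLoc T p (A k) := by
  intro a c ha hc
  obtain ⟨M, hM⟩ := h.bdd_A a c ha hc
  refine MemLp.of_bound ((h.aesm_A k).mono_measure (tcube_mono (Icc_subset_Ioo' ha hc))) M ?_
  rw [ae_restrict_iff' (measurableSet_Icc.prod measurableSet_cube)]
  exact Eventually.of_forall fun z hz => hM z.1 hz.1 z.2 k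

lemma loc_b1 (h : Fields T A b f B P) (k : Fin 3) : MemLpLoc T 1 (b k) := (h.loc_b k).mono one_le_three

lemma weak_dt (h : Fields T A b f B P) (m : Fin 3) {χ : ℝ × E3 → ℝ} (hχ : ContDiff ℝ ∞ χ)
    (hχp : SpacePeriodic χ) {a c : ℝ} (ha : 0 < a) (hc : c < T) {η : ℝ → ℝ} (hη : TimeTest T η)
    (h0 : ∀ t, t ∉ Icc a c → η t = 0) (h0' : ∀ t, t ∉ Icc a c → deriv η t = 0)
    (hdt : ContDiff ℝ ∞ (dt χ)) (hdtp : SpacePeriodic (dt χ)) (hdx : ContDiff ℝ ∞ (dx m χ))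
    (hdxp : SpacePeriodic (dx m χ)) :
    ∫ t in Icc a c, (∫ x in cube, A m (t, x) * χ (t, x)) * deriv η t
      = - ((∫ t in Icc a c, (∫ x in cube, A m (t, x) * dt χ (t, x)) * η t)
        + (∫ t in Icc a c, (∫ x in cube, (f m (t, x) - tensorDiv b B m (t, x)) * χ (t, x)) * η t)
        + ∫ t in Icc a c, (∫ x in cube, P (t, x) * dx m χ (t, x)) * η t) := by
  have hd : Differentiable ℝ χ := hχ.differentiable (by simp)
  have e := h.eqn _ (mem_testSpace_time_mul hη hχ hχp) m
  simp only [dt_time_mul hη.differentiable hd, dx_time_mul hη.differentiable hd, mul_add] at e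
  have i1 := (h.loc_A 1 m).integrable_mul (mem_testSpace_time_mul hη.deriv hχ hχp)
  have i2 := (h.loc_A 1 m).integrable_mul (mem_testSpace_time_mul hη hdt hdtp)
  have i3 := (h.loc_F m).integrable_mul (mem_testSpace_time_mul hη hχ hχp)
  have i4 := h.loc_P.integrable_mul (mem_testSpace_time_mul hη hdx hdxp)
  change Integrable _ (volume.restrict (slab T)) at i1 i2 i3 i4
  rw [← integral_slab_time_mul (h.loc_A 1 m) hη.deriv hχ hχp ha hc h0',
    ← integral_slab_time_mul (h.loc_A 1 m) hη hdt hdtp ha hc h0,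
    ← integral_slab_time_mul (h.loc_F m) hη hχ hχp ha hc h0,
    ← integral_slab_time_mul h.loc_P hη hdx hdxp ha hc h0]
  have i12 : Integrable (fun z : ℝ × E3 => A m z * (deriv η z.1 * χ z) + A m z * (η z.1 * dt χ z))
    (volume.restrict (slab T)) := i1.add i2
  have i123 : Integrable (fun z : ℝ × E3 => A m z * (deriv η z.1 * χ z) + A m z * (η z.1 * dt χ z)
    + (f m z - tensorDiv b B m z) * (η z.1 * χ z)) (volume.restrict (slab T)) := i12.add i3
  rw [integral_add i123 i4, integral_add i12 i3, integral_add i1 i2] at e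
  linarith

lemma weak_dt_snd (h : Fields T A b f B P) (m : Fin 3) {q : E3 → ℝ} (hq : SP q) {a c : ℝ}
    (ha : 0 < a) (hc : c < T) {η : ℝ → ℝ} (hη : TimeTest T η)
    (h0 : ∀ t, t ∉ Icc a c → η t = 0) (h0' : ∀ t, t ∉ Icc a c → deriv η t = 0) :
    ∫ t in Icc a c, (∫ x in cube, A m (t, x) * q x) * deriv η t
      = - ((∫ t in Icc a c, (∫ x in cube, (f m (t, x) - tensorDiv b B m (t, x)) * q x) * η t)
        + ∫ t in Icc a c, (∫ x in cube, P (t, x) * pd m q x) * η t) := by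
  have hdt : dt (fun z : ℝ × E3 => q z.2) = fun _ => 0 := funext (dt_snd hq.differentiable)
  have hdx : dx m (fun z : ℝ × E3 => q z.2) = fun z => pd m q z.2 := funext (dx_snd hq.differentiable m)
  have := h.weak_dt m hq.contDiff_snd hq.periodic_snd ha hc hη h0 h0'
    (hdt ▸ contDiff_const) (hdt ▸ fun _ _ _ => rfl) (hdx ▸ (hq.pd m).contDiff_snd)
    (hdx ▸ (hq.pd m).periodic_snd)
  simpa only [hdt, hdx, mul_zero, integral_zero, zero_mul, zero_add] using this

/-- The moments of `b` are moments of `A` against the curl of the test function, so the evolution of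
`b` is the curl of the evolution of `A`. The pressure drops out because mixed derivatives commute.
-/
lemma weak_dt_curl (h : Fields T A b f B P) (k : Fin 3) {q : E3 → ℝ} (hq : SP q) {a c : ℝ}
    (ha : 0 < a) (hc : c < T) {η : ℝ → ℝ} (hη : TimeTest T η)
    (h0 : ∀ t, t ∉ Icc a c → η t = 0) (h0' : ∀ t, t ∉ Icc a c → deriv η t = 0) :
    ∫ t in Icc a c, (∫ x in cube, b k (t, x) * q x) * deriv η t
      = - ∫ t in Icc a c, ((∫ x in cube, (f (k + 1) (t, x) - tensorDiv b B (k + 1) (t, x)) * pd (k + 2) q x)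
        - ∫ x in cube, (f (k + 2) (t, x) - tensorDiv b B (k + 2) (t, x)) * pd (k + 1) q x) * η t := by
  have hr : (volume : Measure ℝ).restrict (Icc a c) ≤ volume.restrict (Ioo 0 T) :=
    Measure.restrict_mono (Icc_subset_Ioo' ha hc) le_rfl
  have hint : ∀ {g : ℝ × E3 → ℝ} (_ : MemLpLoc T 1 g) {θ : E3 → ℝ} (_ : SP θ) {ζ : ℝ → ℝ}
      (_ : Continuous ζ), IntegrableOn (fun t => (∫ x in cube, g (t, x) * θ x) * ζ t) (Icc a c) := by
    intro g hg θ hθ ζ hζ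
    have h1 := integrable_slice_integral ((hg.mul_snd hθ).integrable ha hc)
    exact h1.mul_continuousOn hζ.continuousOn isCompact_Icc
  have hη1 := hη.differentiable.continuous
  have hη2 := hη.deriv.differentiable.continuous
  have e1 := h.weak_dt_snd (k + 1) (hq.pd (k + 2)) ha hc hη h0 h0'
  have e2 := h.weak_dt_snd (k + 2) (hq.pd (k + 1)) ha hc hη h0 h0'
  rw [pd_comm hq (k + 2) (k + 1)] at e2
  have e3 : ∫ t in Icc a c, (∫ x in cube, b k (t, x) * q x) * deriv η t
      = (∫ t in Icc a c, (∫ x in cube, A (k + 1) (t, x) * pd (k + 2) q x) * deriv η t)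
        - ∫ t in Icc a c, (∫ x in cube, A (k + 2) (t, x) * pd (k + 1) q x) * deriv η t := by
    rw [← integral_sub (hint (h.loc_A 1 _) (hq.pd _) hη2) (hint (h.loc_A 1 _) (hq.pd _) hη2)]
    refine integral_congr_ae ?_
    filter_upwards [ae_mono hr h.curl] with t ht
    rw [ht k q hq, sub_mul]
  simp only [sub_mul _ _ (η _)]
  rw [integral_sub (hint (h.loc_F _) (hq.pd _) hη1) (hint (h.loc_F _) (hq.pd _) hη1)]
  linarith

end Fields

/-- Spatial bookkeeping for the product rule. The left side is the time derivative of the products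
of a moment of `θ a_k` with a moment of `b_k`. The pressure terms in which the derivative falls on
`p` vanish by `div b = 0`. The curl acting on the right factors is moved to the left ones, where
`curl (θ a) = θ b + ∇θ × a`. -/
lemma SliceData.sep_time {b : Fin 3 → E3 → ℝ} {B : Fin 3 → Fin 3 → E3 → ℝ} {ι : Type} [Fintype ι]
    {e θ θ' P : E3 → ℝ} {p r : ι → E3 → ℝ} {a F : Fin 3 → E3 → ℝ} (h : SliceData b B) (hs : Sep e p r)
    (ha : ∀ k, IntegrableOn (a k) cube) (hF : ∀ k, IntegrableOn (F k) cube) (hP : IntegrableOn P cube)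
    (hθ : SP θ)
    (hcurl : ∀ k q, SP q → ∫ x in cube, b k x * q x
      = (∫ x in cube, a (k + 1) x * pd (k + 2) q x) - ∫ x in cube, a (k + 2) x * pd (k + 1) q x) :
    ∑ k, ∑ j, (((∫ x in cube, a k x * (θ' x * p j x)) + (∫ x in cube, F k x * (θ x * p j x))
        + ∫ x in cube, P x * (pd k θ x * p j x + θ x * pd k (p j) x)) * (∫ x in cube, b k x * r j x)
        + (∫ x in cube, a k x * (θ x * p j x)) * ((∫ x in cube, F (k + 1) x * pd (k + 2) (r j) x)
          - ∫ x in cube, F (k + 2) x * pd (k + 1) (r j) x))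
      = ∑ k, (sep p r (fun x => θ' x * a k x) (b k) + sep p r (fun x => θ x * F k x) (b k)
        + sep p r (fun x => pd k θ x * P x) (b k) + sep p r (fun x => θ x * b k x) (F k)
        - sep p r (fun x => pd (k + 2) θ x * a (k + 1) x - pd (k + 1) θ x * a (k + 2) x) (F k)) := by
  have c1 : ∀ {g u v : E3 → ℝ}, ∫ x in cube, g x * (u x * v x) = ∫ x in cube, u x * g x * v x :=
    fun {g u v} => by congr 1; ext x; ring
  have eP : ∑ k, ∑ j, (∫ x in cube, θ x * P x * pd k (p j) x) * ∫ x in cube, b k x * r j x = 0 := by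
    have := h.sep_b hs (fun x => θ x * P x)
    simp only [fun i => hs.sep_pd_right i (integrable_sp_mul hθ hP) (h.integrable_b i)] at this
    rw [Finset.sum_neg_distrib, neg_eq_zero] at this
    exact this
  have eP2 : ∀ k j, ∫ x in cube, P x * (pd k θ x * p j x + θ x * pd k (p j) x)
      = (∫ x in cube, pd k θ x * P x * p j x) + ∫ x in cube, θ x * P x * pd k (p j) x := fun k j => by
    rw [← integral_add (integrable_mul_sp (hs.left j) (integrable_sp_mul (hθ.pd k) hP))
      (integrable_mul_sp ((hs.left j).pd k) (integrable_sp_mul hθ hP))]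
    congr 1; ext x; ring
  have eC : ∑ k, ∑ j, (∫ x in cube, θ x * a k x * p j x) * ((∫ x in cube, F (k + 1) x * pd (k + 2) (r j) x)
          - ∫ x in cube, F (k + 2) x * pd (k + 1) (r j) x)
      = ∑ k, (sep p r (fun x => θ x * b k x) (F k)
        - sep p r (fun x => pd (k + 2) θ x * a (k + 1) x - pd (k + 1) θ x * a (k + 2) x) (F k)) := by
    have e1 : ∀ k, ∑ j, (∫ x in cube, θ x * a k x * p j x)
        * ((∫ x in cube, F (k + 1) x * pd (k + 2) (r j) x) - ∫ x in cube, F (k + 2) x * pd (k + 1) (r j) x)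
        = sep p (fun j => pd (k + 2) (r j)) (fun x => θ x * a k x) (F (k + 1))
          - sep p (fun j => pd (k + 1) (r j)) (fun x => θ x * a k x) (F (k + 2)) := fun k => by
      simp only [sep, mul_sub, Finset.sum_sub_distrib]
    have e2 : ∀ k, sep p r (fun x => θ x * b k x) (F k)
        - sep p r (fun x => pd (k + 2) θ x * a (k + 1) x - pd (k + 1) θ x * a (k + 2) x) (F k)
        = sep (fun j => pd (k + 2) (p j)) r (fun x => θ x * a (k + 1) x) (F k)
          - sep (fun j => pd (k + 1) (p j)) r (fun x => θ x * a (k + 2) x) (F k) := fun k => by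
      simp only [sep, ← Finset.sum_sub_distrib, ← sub_mul]
      refine Finset.sum_congr rfl fun j _ => ?_
      congr 1
      rw [integral_mul_pd hθ (hs.left j) (ha _), integral_mul_pd hθ (hs.left j) (ha _)]
      have h1 := hcurl k _ (hθ.mul (hs.left j))
      rw [c1] at h1
      rw [h1]
      have h2 : ∫ x in cube, (pd (k + 2) θ x * a (k + 1) x - pd (k + 1) θ x * a (k + 2) x) * p j x
          = (∫ x in cube, pd (k + 2) θ x * a (k + 1) x * p j x)
            - ∫ x in cube, pd (k + 1) θ x * a (k + 2) x * p j x := by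
        rw [← integral_sub (integrable_mul_sp (hs.left j) (integrable_sp_mul (hθ.pd _) (ha _)))
          (integrable_mul_sp (hs.left j) (integrable_sp_mul (hθ.pd _) (ha _)))]
        simp only [sub_mul]
      rw [h2]
      ring
    simp only [e1, e2, Finset.sum_sub_distrib]
    rw [← sum_succ3 fun k => sep (fun j => pd (k + 1) (p j)) r (fun x => θ x * a (k + 2) x) (F k),
      ← sum_succ_succ3 fun k => sep (fun j => pd (k + 2) (p j)) r (fun x => θ x * a (k + 1) x) (F k)]
    simp only [fin3_one_one, fin3_one_two, fin3_two_one, fin3_two_two,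
      fun i k l => hs.sep_pd_right i (integrable_sp_mul hθ (ha k)) (hF l), Finset.sum_neg_distrib]
    ring
  simp only [c1, eP2, add_mul, Finset.sum_add_distrib, Finset.sum_sub_distrib] at eC eP ⊢
  rw [eP, eC]
  simp only [sep]
  ring

namespace Fields

variable {T : ℝ} {A b f : Fin 3 → ℝ × E3 → ℝ} {B : Fin 3 → Fin 3 → ℝ × E3 → ℝ}
  {P : ℝ × E3 → ℝ} {ι : Type} [Fintype ι] {e : E3 → ℝ} {p r : ι → E3 → ℝ} {ψ : ℝ × E3 → ℝ}

lemma _root_.HallMHD.MemLpLoc.integrableOn_slice_mul {T : ℝ} {g χ : ℝ × E3 → ℝ} (hg : MemLpLoc T 1 g)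
    (hχ : χ ∈ testSpace T ℝ) {a c : ℝ} (ha : 0 < a) (hc : c < T) :
    IntegrableOn (fun t => ∫ x in cube, g (t, x) * χ (t, x)) (Icc a c) :=
  integrable_slice_integral ((hg.integrable_mul hχ).mono_measure (tcube_mono (Icc_subset_Ioo' ha hc)))

lemma _root_.HallMHD.MemLpLoc.integrableOn_slice_mul_snd {T : ℝ} {g : ℝ × E3 → ℝ} (hg : MemLpLoc T 1 g)
    {q : E3 → ℝ} (hq : SP q) {a c : ℝ} (ha : 0 < a) (hc : c < T) :
    IntegrableOn (fun t => ∫ x in cube, g (t, x) * q x) (Icc a c) :=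
  integrable_slice_integral ((hg.mul_snd hq).integrable ha hc)

lemma ae_moment_b_le (h : Fields T A b f B P) {q : E3 → ℝ} (hq : SP q) {a c : ℝ} (ha : 0 < a)
    (hc : c < T) (k : Fin 3) : ∃ C, ∀ᵐ t ∂volume.restrict (Icc a c), ‖∫ x in cube, b k (t, x) * q x‖ ≤ C := by
  obtain ⟨C, hC, hb⟩ := h.bdd_b a c ha hc
  have hr : (volume : Measure ℝ).restrict (Icc a c) ≤ volume.restrict (Ioo 0 T) :=
    Measure.restrict_mono (Icc_subset_Ioo' ha hc) le_rfl
  refine ⟨(C * eLpNorm q (3 / 2) (volume.restrict cube)).toReal, ?_⟩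
  filter_upwards [hb, ae_mono hr h.slice] with t h1 h2
  have h3 := enorm_integral_mul_le 3 (3 / 2) (h2.memLp_b k).1 (hq.memLp (3 / 2)).1
  rw [← toReal_enorm]
  exact ENNReal.toReal_mono (ENNReal.mul_ne_top hC (hq.memLp _).2.ne)
    (h3.trans (mul_le_mul_left (h1 k) _))

/-- This is the integrated evolution of `∫ ψ A(t,x) · b(t,x+l)`. For each component and each
separable term, the product rule in time is applied to the moment of `ψ A_k` against `p_j` and that
of `b_k` against `r_j`. The first one is compactly supported in time because `ψ` is, so the total
integral is zero. -/
lemma time_identity (h : Fields T A b f B P) (hs : Sep e p r) (hψ : ψ ∈ testSpace T ℝ)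
    {a a' c' c : ℝ} (ha : 0 < a) (haa : a < a') (hac : a' ≤ c') (hcc : c' < c) (hc : c < T)
    (h0 : ∀ t x, t ∉ Icc a' c' → ψ (t, x) = 0) :
    ∫ t in Icc a c, ∑ k, (sep p r (fun x => dt ψ (t, x) * A k (t, x)) (fun x => b k (t, x))
        + sep p r (fun x => ψ (t, x) * (f k (t, x) - tensorDiv b B k (t, x))) (fun x => b k (t, x))
        + sep p r (fun x => dx k ψ (t, x) * P (t, x)) (fun x => b k (t, x))
        + sep p r (fun x => ψ (t, x) * b k (t, x)) (fun x => f k (t, x) - tensorDiv b B k (t, x))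
        - sep p r (fun x => dx (k + 2) ψ (t, x) * A (k + 1) (t, x)
            - dx (k + 1) ψ (t, x) * A (k + 2) (t, x))
          (fun x => f k (t, x) - tensorDiv b B k (t, x))) = 0 := by
  have hr : (volume : Measure ℝ).restrict (Icc a c) ≤ volume.restrict (Ioo 0 T) :=
    Measure.restrict_mono (Icc_subset_Ioo' ha hc) le_rfl
  have hψd := testSpace_differentiable hψ
  have hfd : ∀ t x, t ∉ Icc a' c' → fderiv ℝ ψ (t, x) = 0 := fun t x ht => by
    have : ψ =ᶠ[𝓝 (t, x)] fun _ => 0 := by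
      filter_upwards [(isClosed_Icc.isOpen_compl.preimage continuous_fst).mem_nhds
        (show (t, x) ∈ Prod.fst ⁻¹' (Icc a' c')ᶜ from ht)] with z hz
      exact h0 z.1 z.2 hz
    rw [this.fderiv_eq, fderiv_const_apply]
  have hpm : ∀ j, (fun z : ℝ × E3 => ψ z * p j z.2) ∈ testSpace T ℝ := fun j =>
    mem_testSpace_mul hψ (hs.left j).contDiff_snd (hs.left j).periodic_snd
  have hdtm : ∀ j, (fun z : ℝ × E3 => dt ψ z * p j z.2) ∈ testSpace T ℝ := fun j =>
    mem_testSpace_mul (mem_testSpace_dt hψ) (hs.left j).contDiff_snd (hs.left j).periodic_snd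
  have hdt : ∀ j, dt (fun z : ℝ × E3 => ψ z * p j z.2) = fun z => dt ψ z * p j z.2 := fun j => by
    ext z
    rw [dt_mul hψd ((hs.left j).contDiff_snd.differentiable (by simp)), dt_snd (hs.left j).differentiable,
      mul_zero, add_zero]
  have hdx : ∀ j k, dx k (fun z : ℝ × E3 => ψ z * p j z.2)
      = fun z => dx k ψ z * p j z.2 + ψ z * pd k (p j) z.2 := fun j k => by
    ext z
    rw [dx_mul hψd ((hs.left j).contDiff_snd.differentiable (by simp)), dx_snd (hs.left j).differentiable]
  have hdxm : ∀ j k, (fun z : ℝ × E3 => dx k ψ z * p j z.2 + ψ z * pd k (p j) z.2) ∈ testSpace T ℝ :=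
    fun j k => hdx j k ▸ mem_testSpace_dx (hpm j) k
  have hA1 : ∀ k j, IntegrableOn (fun t => ∫ x in cube, A k (t, x) * (ψ (t, x) * p j x)) (Icc a c) :=
    fun k j => (h.loc_A 1 k).integrableOn_slice_mul (hpm j) ha hc
  have hA2 : ∀ k j, IntegrableOn (fun t => ∫ x in cube, A k (t, x) * (dt ψ (t, x) * p j x)) (Icc a c) :=
    fun k j => (h.loc_A 1 k).integrableOn_slice_mul (hdtm j) ha hc
  have hF1 : ∀ k j, IntegrableOn (fun t => ∫ x in cube,
      (f k (t, x) - tensorDiv b B k (t, x)) * (ψ (t, x) * p j x)) (Icc a c) :=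
    fun k j => (h.loc_F k).integrableOn_slice_mul (hpm j) ha hc
  have hP1 : ∀ k j, IntegrableOn (fun t => ∫ x in cube, P (t, x) * (dx k ψ (t, x) * p j x
      + ψ (t, x) * pd k (p j) x)) (Icc a c) :=
    fun k j => h.loc_P.integrableOn_slice_mul (hdxm j k) ha hc
  have hb1 : ∀ k j, IntegrableOn (fun t => ∫ x in cube, b k (t, x) * r j x) (Icc a c) :=
    fun k j => (h.loc_b1 k).integrableOn_slice_mul_snd (hs.right j) ha hc
  have hF2 : ∀ k m j, IntegrableOn (fun t => ∫ x in cube,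
      (f k (t, x) - tensorDiv b B k (t, x)) * pd m (r j) x) (Icc a c) :=
    fun k m j => (h.loc_F k).integrableOn_slice_mul_snd ((hs.right j).pd m) ha hc
  set α' : Fin 3 → ι → ℝ → ℝ := fun k j t => (∫ x in cube, A k (t, x) * (dt ψ (t, x) * p j x))
    + (∫ x in cube, (f k (t, x) - tensorDiv b B k (t, x)) * (ψ (t, x) * p j x))
    + ∫ x in cube, P (t, x) * (dx k ψ (t, x) * p j x + ψ (t, x) * pd k (p j) x) with hα'
  set γ : Fin 3 → ι → ℝ → ℝ := fun k j t =>
    (∫ x in cube, (f (k + 1) (t, x) - tensorDiv b B (k + 1) (t, x)) * pd (k + 2) (r j) x)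
      - ∫ x in cube, (f (k + 2) (t, x) - tensorDiv b B (k + 2) (t, x)) * pd (k + 1) (r j) x with hγ
  have hα'i : ∀ k j, IntegrableOn (α' k j) (Icc a c) := fun k j =>
    ((hA2 k j).add (hF1 k j)).add (hP1 k j)
  have hγi : ∀ k j, IntegrableOn (γ k j) (Icc a c) := fun k j => (hF2 _ _ j).sub (hF2 _ _ j)
  have key : ∀ k j, ∫ t in Icc a c, (α' k j t * (∫ x in cube, b k (t, x) * r j x)
      + (∫ x in cube, A k (t, x) * (ψ (t, x) * p j x)) * γ k j t) = 0 := by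
    intro k j
    refine integral_weak_deriv_mul haa hac hcc (hA1 k j) (hα'i k j) (hb1 k j) (hγi k j)
      (fun t ht => ?_) (fun t ht => ?_) (fun η hη _ hηs => ?_) fun η hη _ hηs => ?_
    · simp [h0 t _ ht]
    · simp [hα', h0 t _ ht, dt, dx, hfd t _ ht]
    · obtain ⟨hT, hη0⟩ := timeTest_of_tsupport ha hc hη hηs
      have hη0' : ∀ t, t ∉ Icc a c → deriv η t = 0 := fun t ht =>
        image_eq_zero_of_notMem_tsupport fun h' =>
          ht (Ioo_subset_Icc_self (hηs (tsupport_deriv_subset (𝕜 := ℝ) h')))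
      have := h.weak_dt k (hpm j).1 (hpm j).2.1 ha hc hT hη0 hη0' (hdt j ▸ (hdtm j).1)
        (hdt j ▸ (hdtm j).2.1) (hdx j k ▸ (hdxm j k).1) (hdx j k ▸ (hdxm j k).2.1)
      simp only [hdt, hdx] at this
      have hmul : ∀ {g : ℝ → ℝ}, IntegrableOn g (Icc a c) → IntegrableOn (fun t => g t * η t) (Icc a c) :=
        fun hg => hg.mul_continuousOn hη.continuous.continuousOn isCompact_Icc
      rw [this, neg_inj]
      simp only [hα', add_mul _ _ (η _)]
      have i12 : IntegrableOn (fun t => (∫ x in cube, A k (t, x) * (dt ψ (t, x) * p j x)) * η t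
        + (∫ x in cube, (f k (t, x) - tensorDiv b B k (t, x)) * (ψ (t, x) * p j x)) * η t) (Icc a c) :=
        (hmul (hA2 k j)).add (hmul (hF1 k j))
      rw [integral_add i12 (hmul (hP1 k j)), integral_add (hmul (hA2 k j)) (hmul (hF1 k j))]
    · obtain ⟨hT, hη0⟩ := timeTest_of_tsupport ha hc hη hηs
      have hη0' : ∀ t, t ∉ Icc a c → deriv η t = 0 := fun t ht =>
        image_eq_zero_of_notMem_tsupport fun h' =>
          ht (Ioo_subset_Icc_self (hηs (tsupport_deriv_subset (𝕜 := ℝ) h')))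
      exact h.weak_dt_curl k (hs.right j) ha hc hT hη0 hη0'
  have hint : ∀ k j, IntegrableOn (fun t => α' k j t * (∫ x in cube, b k (t, x) * r j x)
      + (∫ x in cube, A k (t, x) * (ψ (t, x) * p j x)) * γ k j t) (Icc a c) := by
    intro k j
    refine Integrable.add ?_ ?_
    · obtain ⟨C, hC⟩ := h.ae_moment_b_le (hs.right j) ha hc k
      exact (hα'i k j).mul_bdd (hb1 k j).1 hC
    · obtain ⟨M, hM⟩ := h.bdd_A a c ha hc
      obtain ⟨C, hC0, hC⟩ := testSpace_exists_bound (hpm j)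
      refine (hγi k j).bdd_mul (c := M * C) (hA1 k j).1 ?_
      filter_upwards [ae_restrict_mem measurableSet_Icc] with t ht
      refine (norm_integral_le_of_norm_le_const (C := M * C) (Eventually.of_forall fun x => ?_)).trans ?_
      · rw [norm_mul]
        exact mul_le_mul (hM t ht x k) (hC (t, x)) (norm_nonneg _) ((abs_nonneg _).trans (hM t ht x k))
      · simp
  have hsum : ∫ t in Icc a c, ∑ k, ∑ j, (α' k j t * (∫ x in cube, b k (t, x) * r j x)
      + (∫ x in cube, A k (t, x) * (ψ (t, x) * p j x)) * γ k j t) = 0 := by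
    rw [integral_finsetSum _ fun k _ => integrable_finsetSum _ fun j _ => hint k j]
    refine Finset.sum_eq_zero fun k _ => ?_
    rw [integral_finsetSum _ fun j _ => hint k j]
    exact Finset.sum_eq_zero fun j _ => key k j
  rw [← hsum]
  refine integral_congr_ae ?_
  filter_upwards [ae_mono hr h.slice, ae_mono hr h.curl,
    ae_mono hr (ae_all_iff.2 fun k => (h.loc_A 1 k).ae_integrableOn_slice),
    ae_mono hr (ae_all_iff.2 fun k => (h.loc_F k).ae_integrableOn_slice),
    ae_mono hr h.loc_P.ae_integrableOn_slice] with t h1 h2 h3 h4 h5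
  have := h1.sep_time (θ' := fun x => dt ψ (t, x)) hs h3 h4 h5 (testSpace_slice_sp hψ t) h2
  simp only [pd_slice hψd] at this
  exact this.symm

end Fields

section

variable {ι : Type} [Fintype ι] {p r : ι → E3 → ℝ}

lemma sep_sub_left (hp : ∀ j, SP (p j)) {f f' : E3 → ℝ} (hf : IntegrableOn f cube)
    (hf' : IntegrableOn f' cube) (g : E3 → ℝ) :
    sep p r (fun x => f x - f' x) g = sep p r f g - sep p r f' g := by
  simp only [sep, ← Finset.sum_sub_distrib, ← sub_mul]
  refine Finset.sum_congr rfl fun j _ => ?_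
  rw [← integral_sub (integrable_mul_sp (hp j) hf) (integrable_mul_sp (hp j) hf')]
  simp only [sub_mul]

lemma sep_sub_right (hr : ∀ j, SP (r j)) (f : E3 → ℝ) {g g' : E3 → ℝ} (hg : IntegrableOn g cube)
    (hg' : IntegrableOn g' cube) :
    sep p r f (fun x => g x - g' x) = sep p r f g - sep p r f g' := by
  simp only [sep, ← Finset.sum_sub_distrib, ← mul_sub]
  refine Finset.sum_congr rfl fun j _ => ?_
  rw [← integral_sub (integrable_mul_sp (hr j) hg) (integrable_mul_sp (hr j) hg')]
  simp only [sub_mul]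

end

/-- `∫ e h` over the cube equals the time integral of `m`. -/
structure Rep (S : Set ℝ) (e h : E3 → ℝ) (m : ℝ → ℝ) : Prop where
  int_cube : IntegrableOn (fun l => e l * h l) cube
  int_time : IntegrableOn m S
  eq : ∫ l in cube, e l * h l = ∫ t in S, m t

namespace Rep

variable {S : Set ℝ} {e h h' : E3 → ℝ} {m m' : ℝ → ℝ}

lemma add (H : Rep S e h m) (H' : Rep S e h' m') : Rep S e (fun l => h l + h' l) fun t => m t + m' t where
  int_cube := by
    simp only [mul_add]
    exact H.int_cube.add H'.int_cube
  int_time := H.int_time.add H'.int_time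
  eq := by
    simp only [mul_add]
    rw [integral_add H.int_cube H'.int_cube, integral_add H.int_time H'.int_time, H.eq, H'.eq]

lemma const_mul (H : Rep S e h m) (k : ℝ) : Rep S e (fun l => k * h l) fun t => k * m t where
  int_cube := by
    simp only [mul_left_comm _ k]
    exact H.int_cube.const_mul k
  int_time := H.int_time.const_mul k
  eq := by
    simp only [mul_left_comm _ k]
    rw [integral_const_mul, integral_const_mul, H.eq]

lemma sub (H : Rep S e h m) (H' : Rep S e h' m') : Rep S e (fun l => h l - h' l) fun t => m t - m' t := by
  simpa only [sub_eq_add_neg, neg_mul, one_mul] using H.add (H'.const_mul (-1))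

lemma sum {κ : Type*} (s : Finset κ) {h : κ → E3 → ℝ} {m : κ → ℝ → ℝ} (H : ∀ k ∈ s, Rep S e (h k) (m k)) :
    Rep S e (fun l => ∑ k ∈ s, h k l) fun t => ∑ k ∈ s, m k t where
  int_cube := by
    simp only [Finset.mul_sum]
    exact integrable_finsetSum _ fun k hk => (H k hk).int_cube
  int_time := integrable_finsetSum _ fun k hk => (H k hk).int_time
  eq := by
    simp only [Finset.mul_sum]
    rw [integral_finsetSum _ fun k hk => (H k hk).int_cube, integral_finsetSum _ fun k hk => (H k hk).int_time]
    exact Finset.sum_congr rfl fun k hk => (H k hk).eq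

end Rep

/-- The correlation of `f` and `g` is defined for all lags, continuous, and disintegrates in time. -/
structure CorrPair (S : Set ℝ) (f g : ℝ × E3 → ℝ) : Prop where
  int : ∀ l, Integrable (fun z : ℝ × E3 => f z * g (z.1, z.2 + l)) (tcube S)
  cont : Continuous (corr S f g)
  rep : ∀ {ι : Type} [Fintype ι] {e : E3 → ℝ} {p r : ι → E3 → ℝ}, Sep e p r →
    Rep S e (corr S f g) fun t => sep p r (fun x => f (t, x)) fun x => g (t, x)

lemma MemLpLoc.corrPair {T : ℝ} (p q : ℝ≥0∞) [ENNReal.HolderConjugate p q] (hp : 1 ≤ p) (hq : 1 ≤ q)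
    (hqt : q ≠ ⊤) {f g : ℝ × E3 → ℝ} (hf : MemLpLoc T p f) (hg : MemLpLoc T q g)
    (hgp : SpacePeriodic g) {a c : ℝ} (ha : 0 < a) (hc : c < T) : CorrPair (Icc a c) f g where
  int l := (hf a c ha hc).integrable_mul (memLp_tshift hgp l hqt (hg a c ha hc))
  cont := continuous_corr measurableSet_Icc p q hq hqt (hf a c ha hc) hgp (hg a c ha hc)
  rep hs := by
    have h1 := hs.integral_corr p q hqt (hf a c ha hc) ((hf.mono hp).integrable ha hc) hgp
      (hg a c ha hc) ((hg.mono hq).integrable ha hc)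
    refine ⟨?_, h1.1, h1.2⟩
    exact (((per_corr hgp)).integrableOn (continuous_corr measurableSet_Icc p q hq hqt
      (hf a c ha hc) hgp (hg a c ha hc))) |> integrable_sp_mul hs.sp

/-! ### The third-order flux in the lag and its divergence -/

/-- `|b|²` for a field given by its components. -/
def sqn (b : Fin 3 → ℝ × E3 → ℝ) (z : ℝ × E3) : ℝ := ∑ k, b k z ^ 2

/-- `δbᵢ |δb|²`. -/
def incrCube (b : Fin 3 → ℝ × E3 → ℝ) (i : Fin 3) (z : ℝ × E3) (l : E3) : ℝ :=
  (b i (z.1, z.2 + l) - b i z) * ∑ k, (b k (z.1, z.2 + l) - b k z) ^ 2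

/-- `∫ ψ δbᵢ |δb|²` as a function of the lag. -/
def lagFlux (S : Set ℝ) (ψ : ℝ × E3 → ℝ) (b : Fin 3 → ℝ × E3 → ℝ) (i : Fin 3) (l : E3) : ℝ :=
  ∫ z, ψ z * incrCube b i z l ∂tcube S

/-- The divergence in the lag of `∫ ψ δb |δb|²`, written through correlations. -/
def lagSource (S : Set ℝ) (A b f : Fin 3 → ℝ × E3 → ℝ) (B : Fin 3 → Fin 3 → ℝ × E3 → ℝ)
    (P ψ : ℝ × E3 → ℝ) (l : E3) : ℝ :=
  ∑ k, (-2 * corr S (fun z => ψ z * f k z) (b k) l + -2 * corr S (fun z => ψ z * b k z) (f k) l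
    + -2 * corr S (fun z => dt ψ z * A k z) (b k) l
    + 2 * corr S (fun z => dx (k + 2) ψ z * A (k + 1) z - dx (k + 1) ψ z * A (k + 2) z)
      (fun z => f k z - tensorDiv b B k z) l
    + -2 * corr S (fun z => dx k ψ z * (P z - smean P z.1)) (b k) l
    + -2 * corr S (dx k ψ) (fun z => smean P z.1 * b k z) l
    + -1 * corr S (dx k ψ) (fun z => b k z * sqn b z) l + corr S (fun z => dx k ψ z * b k z) (sqn b) l
    + -2 * ∑ m, corr S (fun z => dx m ψ z * (b m z * b k z)) (b k) l)

namespace Fields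

variable {T : ℝ} {A b f : Fin 3 → ℝ × E3 → ℝ} {B : Fin 3 → Fin 3 → ℝ × E3 → ℝ}
  {P : ℝ × E3 → ℝ} {ψ : ℝ × E3 → ℝ} {a c : ℝ}

lemma loc_bb (h : Fields T A b f B P) (i k : Fin 3) : MemLpLoc T (3 / 2) fun z => b i z * b k z :=
  (h.loc_b i).mul 3 3 (3 / 2) (h.loc_b k)

lemma loc_sqn (h : Fields T A b f B P) : MemLpLoc T (3 / 2) (sqn b) :=
  MemLpLoc.sum _ fun k _ => by simpa only [sq] using h.loc_bb k k

lemma loc_cube (h : Fields T A b f B P) (i : Fin 3) : MemLpLoc T 1 fun z => b i z * sqn b z :=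
  (h.loc_b i).mul 3 (3 / 2) 1 h.loc_sqn

lemma per_sqn (h : Fields T A b f B P) : SpacePeriodic (sqn b) := fun t x i => by
  simp only [sqn, h.per_b _ t x i]

/-- The mean of the pressure is only integrable in time. It is compensated by the bound on the `L³`
norm of `b` that is uniform in time. -/
lemma loc_mean_mul (h : Fields T A b f B P) (k : Fin 3) : MemLpLoc T 1 fun z => smean P z.1 * b k z := by
  intro a c ha hc
  obtain ⟨C, hC, hb⟩ := h.bdd_b a c ha hc
  have hP := h.loc_P.integrable ha hc
  have hm : AEStronglyMeasurable (fun z => smean P z.1 * b k z) (tcube (Icc a c)) :=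
    (aesm_smean hP.1).mul (h.loc_b k a c ha hc).1
  refine ⟨hm, ?_⟩
  have h1 := eLpNorm_tcube_rpow one_ne_zero ENNReal.one_ne_top hm
  simp only [ENNReal.toReal_one, ENNReal.rpow_one] at h1
  rw [h1]
  have hs := integrable_slice_integral hP
  refine (lintegral_mono_ae (g := fun t => ‖∫ x in cube, P (t, x)‖ₑ * C) ?_).trans_lt ?_
  · filter_upwards [hb, ae_aesm_slice (h.loc_b k a c ha hc).1] with t ht hm
    refine (eLpNorm_const_smul (smean P t) (fun x => b k (t, x)) 1 (volume.restrict cube)).le.trans ?_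
    refine mul_le_mul_right ?_ _
    exact (eLpNorm_le_eLpNorm_of_exponent_le one_le_three hm).trans (ht k)
  · rw [lintegral_mul_const' _ _ hC]
    exact ENNReal.mul_lt_top hs.2 hC.lt_top

/-- The correlations in the expansion of `∫ ψ δbᵢ |δb|²`. -/
lemma corrPair_flux (h : Fields T A b f B P) (hψ : ψ ∈ testSpace T ℝ) (ha : 0 < a) (hc : c < T)
    (i k : Fin 3) : CorrPair (Icc a c) ψ (fun z => b i z * sqn b z) ∧
      CorrPair (Icc a c) (fun z => ψ z * b i z) (sqn b) ∧
      CorrPair (Icc a c) (fun z => ψ z * b k z) (fun z => b i z * b k z) ∧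
      CorrPair (Icc a c) (fun z => ψ z * (b i z * b k z)) (b k) ∧
      CorrPair (Icc a c) (fun z => ψ z * sqn b z) (b i) :=
  ⟨(memLpLoc_test ⊤ hψ).corrPair ⊤ 1 (by simp) le_rfl (by simp) (h.loc_cube i)
      (fun t x m => by simp only [h.per_b _ t x m, h.per_sqn t x m]) ha hc,
    ((h.loc_b i).test_mul hψ).corrPair 3 (3 / 2) one_le_three one_le_three_halves three_halves_ne_top
      h.loc_sqn h.per_sqn ha hc,
    ((h.loc_b k).test_mul hψ).corrPair 3 (3 / 2) one_le_three one_le_three_halves three_halves_ne_top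
      (h.loc_bb i k) (fun t x m => by simp only [h.per_b _ t x m]) ha hc,
    ((h.loc_bb i k).test_mul hψ).corrPair (3 / 2) 3 one_le_three_halves one_le_three (by simp)
      (h.loc_b k) (h.per_b k) ha hc,
    (h.loc_sqn.test_mul hψ).corrPair (3 / 2) 3 one_le_three_halves one_le_three (by simp)
      (h.loc_b i) (h.per_b i) ha hc⟩

lemma integral_comb {α : Type*} [MeasurableSpace α] {μ : Measure α} {f₁ f₂ f₃ f₄ f₅ f₆ : α → ℝ}
    (h₁ : Integrable f₁ μ) (h₂ : Integrable f₂ μ) (h₃ : Integrable f₃ μ) (h₄ : Integrable f₄ μ)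
    (h₅ : Integrable f₅ μ) (h₆ : Integrable f₆ μ) :
    ∫ x, (f₁ x - f₂ x + -2 * f₃ x + 2 * f₄ x + f₅ x - f₆ x) ∂μ
      = (∫ x, f₁ x ∂μ) - (∫ x, f₂ x ∂μ) + -2 * (∫ x, f₃ x ∂μ) + 2 * (∫ x, f₄ x ∂μ) + (∫ x, f₅ x ∂μ)
        - ∫ x, f₆ x ∂μ := by
  rw [integral_sub (by fun_prop) h₆, integral_add (by fun_prop) h₅, integral_add (by fun_prop) (by fun_prop),
    integral_add (by fun_prop) (by fun_prop), integral_sub h₁ h₂, integral_const_mul, integral_const_mul]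

/-- Expansion of `(b_i' - b_i)(|b'|² - 2 b · b' + |b|²)`, the prime denoting the shift. The term
without shifted factors does not depend on the lag. In all others the shifted factor has a finite
Hölder exponent; when it is cubic in `b`, it lies in `L¹` and is paired with the bounded `ψ`. -/
lemma lagFlux_eq (h : Fields T A b f B P) (hψ : ψ ∈ testSpace T ℝ) (ha : 0 < a) (hc : c < T)
    (i : Fin 3) : lagFlux (Icc a c) ψ b i = fun l =>
      corr (Icc a c) ψ (fun z => b i z * sqn b z) l - corr (Icc a c) (fun z => ψ z * b i z) (sqn b) l
      + -2 * (∑ k, corr (Icc a c) (fun z => ψ z * b k z) (fun z => b i z * b k z) l)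
      + 2 * (∑ k, corr (Icc a c) (fun z => ψ z * (b i z * b k z)) (b k) l)
      + corr (Icc a c) (fun z => ψ z * sqn b z) (b i) l
      - ∫ z, ψ z * (b i z * sqn b z) ∂tcube (Icc a c) := by
  ext l
  have H := h.corrPair_flux hψ ha hc i
  have i1 := (H 0).1.int l
  have i2 := (H 0).2.1.int l
  have i3 := integrable_finsetSum Finset.univ fun k _ => (H k).2.2.1.int l
  have i4 := integrable_finsetSum Finset.univ fun k _ => (H k).2.2.2.1.int l
  have i5 := (H 0).2.2.2.2.int l
  have i6 := ((h.loc_cube i).test_mul hψ).integrable ha hc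
  simp only [corr]
  rw [← integral_finsetSum _ fun k _ => (H k).2.2.1.int l,
    ← integral_finsetSum _ fun k _ => (H k).2.2.2.1.int l, ← integral_comb i1 i2 i3 i4 i5 i6]
  refine integral_congr_ae (Eventually.of_forall fun z => ?_)
  simp only [incrCube, sqn, Fin.sum_univ_three]
  ring

/-- The correlations in the source term. -/
lemma corrPair_source (h : Fields T A b f B P) (hψ : ψ ∈ testSpace T ℝ) (ha : 0 < a) (hc : c < T)
    (k : Fin 3) : CorrPair (Icc a c) (fun z => ψ z * f k z) (b k) ∧
      CorrPair (Icc a c) (fun z => ψ z * b k z) (f k) ∧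
      CorrPair (Icc a c) (fun z => dt ψ z * A k z) (b k) ∧
      CorrPair (Icc a c) (fun z => dx (k + 2) ψ z * A (k + 1) z - dx (k + 1) ψ z * A (k + 2) z)
        (fun z => f k z - tensorDiv b B k z) ∧
      CorrPair (Icc a c) (fun z => dx k ψ z * (P z - smean P z.1)) (b k) ∧
      CorrPair (Icc a c) (dx k ψ) (fun z => smean P z.1 * b k z) ∧
      CorrPair (Icc a c) (dx k ψ) (fun z => b k z * sqn b z) ∧
      CorrPair (Icc a c) (fun z => dx k ψ z * b k z) (sqn b) ∧
      ∀ m, CorrPair (Icc a c) (fun z => dx m ψ z * (b m z * b k z)) (b k) := by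
  have hx : ∀ i, dx i ψ ∈ testSpace T ℝ := mem_testSpace_dx hψ
  have perF : SpacePeriodic fun z => f k z - tensorDiv b B k z := fun t x m => by
    simp only [tensorDiv, h.per_f _ t x m, h.per_b _ t x m, h.per_B _ _ t x m]
  exact ⟨((h.loc_f k).test_mul hψ).corrPair (3 / 2) 3 one_le_three_halves one_le_three (by simp)
      (h.loc_b k) (h.per_b k) ha hc,
    ((h.loc_b k).test_mul hψ).corrPair 3 (3 / 2) one_le_three one_le_three_halves three_halves_ne_top
      (h.loc_f k) (h.per_f k) ha hc,
    ((h.loc_A (3 / 2) k).test_mul (mem_testSpace_dt hψ)).corrPair (3 / 2) 3 one_le_three_halves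
      one_le_three (by simp) (h.loc_b k) (h.per_b k) ha hc,
    (((h.loc_A ⊤ (k + 1)).test_mul (hx (k + 2))).sub ((h.loc_A ⊤ (k + 2)).test_mul (hx (k + 1)))).corrPair
      ⊤ 1 (by simp) le_rfl (by simp) (h.loc_F k) perF ha hc,
    (h.loc_P0.test_mul (hx k)).corrPair (3 / 2) 3 one_le_three_halves one_le_three (by simp)
      (h.loc_b k) (h.per_b k) ha hc,
    (memLpLoc_test ⊤ (hx k)).corrPair ⊤ 1 (by simp) le_rfl (by simp) (h.loc_mean_mul k)
      (fun t x m => by simp only [h.per_b _ t x m]) ha hc,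
    (memLpLoc_test ⊤ (hx k)).corrPair ⊤ 1 (by simp) le_rfl (by simp) (h.loc_cube k)
      (fun t x m => by simp only [h.per_b _ t x m, h.per_sqn t x m]) ha hc,
    ((h.loc_b k).test_mul (hx k)).corrPair 3 (3 / 2) one_le_three one_le_three_halves three_halves_ne_top
      h.loc_sqn h.per_sqn ha hc,
    fun m => ((h.loc_bb m k).test_mul (hx m)).corrPair (3 / 2) 3 one_le_three_halves one_le_three (by simp)
      (h.loc_b k) (h.per_b k) ha hc⟩

lemma continuous_lagFlux (h : Fields T A b f B P) (hψ : ψ ∈ testSpace T ℝ) (ha : 0 < a) (hc : c < T)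
    (i : Fin 3) : Continuous (lagFlux (Icc a c) ψ b i) := by
  rw [h.lagFlux_eq hψ ha hc i]
  have H := h.corrPair_flux hψ ha hc i
  exact (((((H 0).1.cont.sub (H 0).2.1.cont).add ((continuous_finsetSum _ fun k _ =>
    (H k).2.2.1.cont).const_mul _)).add ((continuous_finsetSum _ fun k _ =>
    (H k).2.2.2.1.cont).const_mul _)).add (H 0).2.2.2.2.cont).sub continuous_const

lemma continuous_lagSource (h : Fields T A b f B P) (hψ : ψ ∈ testSpace T ℝ) (ha : 0 < a) (hc : c < T) :
    Continuous (lagSource (Icc a c) A b f B P ψ) := by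
  refine continuous_finsetSum _ fun k _ => ?_
  obtain ⟨h1, h2, h3, h4, h5, h6, h7, h8, h9⟩ := h.corrPair_source hψ ha hc k
  exact ((((((((h1.cont.const_mul _).add (h2.cont.const_mul _)).add (h3.cont.const_mul _)).add
    (h4.cont.const_mul _)).add (h5.cont.const_mul _)).add (h6.cont.const_mul _)).add
    (h7.cont.const_mul _)).add h8.cont).add ((continuous_finsetSum _ fun m _ => (h9 m).cont).const_mul _)

lemma per_lagFlux (h : Fields T A b f B P) (i : Fin 3) : Per (lagFlux (Icc a c) ψ b i) := fun l m => by
  simp only [lagFlux, incrCube, ← add_assoc, h.per_b _ _ _ m]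

lemma per_lagSource (h : Fields T A b f B P) : Per (lagSource (Icc a c) A b f B P ψ) := fun l m => by
  simp only [lagSource, corr, tensorDiv, sqn, ← add_assoc, h.per_b _ _ _ m, h.per_f _ _ _ m,
    h.per_B _ _ _ _ m]

lemma rep_flux (h : Fields T A b f B P) (hψ : ψ ∈ testSpace T ℝ) (ha : 0 < a) (hc : c < T)
    {ι : Type} [Fintype ι] {e : E3 → ℝ} {p r : ι → E3 → ℝ} (hs : Sep e p r) (i : Fin 3) :
    Rep (Icc a c) (pd i e) (lagFlux (Icc a c) ψ b i) fun t =>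
      sep p (fun j => pd i (r j)) (fun x => ψ (t, x)) (fun x => b i (t, x) * sqn b (t, x))
      - sep p (fun j => pd i (r j)) (fun x => ψ (t, x) * b i (t, x)) (fun x => sqn b (t, x))
      + -2 * (∑ k, sep p (fun j => pd i (r j)) (fun x => ψ (t, x) * b k (t, x))
        (fun x => b i (t, x) * b k (t, x)))
      + 2 * (∑ k, sep p (fun j => pd i (r j)) (fun x => ψ (t, x) * (b i (t, x) * b k (t, x)))
        (fun x => b k (t, x)))
      + sep p (fun j => pd i (r j)) (fun x => ψ (t, x) * sqn b (t, x)) (fun x => b i (t, x)) - 0 := by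
  rw [h.lagFlux_eq hψ ha hc i]
  have H := h.corrPair_flux hψ ha hc i
  have hs' := hs.pd i
  -- The lag independent term is invisible to the divergence, since derivatives of `e` have integral
  -- zero.
  have hconst : Rep (Icc a c) (pd i e) (fun _ => ∫ z, ψ z * (b i z * sqn b z) ∂tcube (Icc a c))
      fun _ => 0 := by
    refine ⟨hs'.sp.integrableOn.mul_const _, integrable_zero _ _ _, ?_⟩
    rw [integral_mul_const, integral_pd hs.sp, zero_mul, integral_zero]
  exact ((((((H 0).1.rep hs').sub ((H 0).2.1.rep hs')).add ((Rep.sum _ fun k _ =>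
    (H k).2.2.1.rep hs').const_mul _)).add ((Rep.sum _ fun k _ =>
    (H k).2.2.2.1.rep hs').const_mul _)).add ((H 0).2.2.2.2.rep hs')).sub hconst

lemma rep_source (h : Fields T A b f B P) (hψ : ψ ∈ testSpace T ℝ) (ha : 0 < a) (hc : c < T)
    {ι : Type} [Fintype ι] {e : E3 → ℝ} {p r : ι → E3 → ℝ} (hs : Sep e p r) :
    Rep (Icc a c) e (lagSource (Icc a c) A b f B P ψ) fun t => ∑ k,
      (-2 * sep p r (fun x => ψ (t, x) * f k (t, x)) (fun x => b k (t, x))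
      + -2 * sep p r (fun x => ψ (t, x) * b k (t, x)) (fun x => f k (t, x))
      + -2 * sep p r (fun x => dt ψ (t, x) * A k (t, x)) (fun x => b k (t, x))
      + 2 * sep p r (fun x => dx (k + 2) ψ (t, x) * A (k + 1) (t, x) - dx (k + 1) ψ (t, x) * A (k + 2) (t, x))
        (fun x => f k (t, x) - tensorDiv b B k (t, x))
      + -2 * sep p r (fun x => dx k ψ (t, x) * (P (t, x) - smean P t)) (fun x => b k (t, x))
      + -2 * sep p r (fun x => dx k ψ (t, x)) (fun x => smean P t * b k (t, x))
      + -1 * sep p r (fun x => dx k ψ (t, x)) (fun x => b k (t, x) * sqn b (t, x))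
      + sep p r (fun x => dx k ψ (t, x) * b k (t, x)) (fun x => sqn b (t, x))
      + -2 * ∑ m, sep p r (fun x => dx m ψ (t, x) * (b m (t, x) * b k (t, x))) (fun x => b k (t, x))) := by
  refine Rep.sum _ fun k _ => ?_
  obtain ⟨h1, h2, h3, h4, h5, h6, h7, h8, h9⟩ := h.corrPair_source hψ ha hc k
  exact (((((((((h1.rep hs).const_mul _).add ((h2.rep hs).const_mul _)).add ((h3.rep hs).const_mul _)).add
    ((h4.rep hs).const_mul _)).add ((h5.rep hs).const_mul _)).add ((h6.rep hs).const_mul _)).add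
    ((h7.rep hs).const_mul _)).add (h8.rep hs)).add ((Rep.sum _ fun m _ => (h9 m).rep hs).const_mul _)

/-- The divergence identity for the third-order flux in the lag, tested against trigonometric
polynomials. -/
theorem integral_pd_lagFlux (h : Fields T A b f B P) (hψ : ψ ∈ testSpace T ℝ) {a' c' : ℝ}
    (ha : 0 < a) (haa : a < a') (hac : a' ≤ c') (hcc : c' < c) (hc : c < T)
    (h0 : ∀ t x, t ∉ Icc a' c' → ψ (t, x) = 0) {e : E3 → ℝ} (he : TP e) :
    - ∑ i, ∫ l in cube, pd i e l * lagFlux (Icc a c) ψ b i l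
      = ∫ l in cube, e l * lagSource (Icc a c) A b f B P ψ l := by
  obtain ⟨ι, _, p, r, hs⟩ := he.exists_sep
  have hr : (volume : Measure ℝ).restrict (Icc a c) ≤ volume.restrict (Ioo 0 T) :=
    Measure.restrict_mono (Icc_subset_Ioo' ha hc) le_rfl
  have hψd := testSpace_differentiable hψ
  have R1 := h.rep_flux hψ ha hc hs
  have R2 := h.rep_source hψ ha hc hs
  have ht := h.time_identity hs hψ ha haa hac hcc hc h0
  rw [Finset.sum_congr rfl fun i _ => (R1 i).eq, R2.eq, ← integral_finsetSum _ fun i _ => (R1 i).int_time,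
    neg_eq_iff_add_eq_zero, ← integral_add (integrable_finsetSum _ fun i _ => (R1 i).int_time) R2.int_time]
  -- On each slice the difference between flux and source is `-2` times the integrand of
  -- `time_identity`. The identities `E1` to `E5` move the lag derivatives onto `ψ` or onto `b ⊗ b`,
  -- and the resulting pairings of `ψ G` with `b` and of `ψ b` with `G`, for `G = tensorDiv b B`,
  -- are the ones that cancel.
  refine (integral_congr_ae ?_).trans ((integral_const_mul (-2 : ℝ) _).trans
    ((congrArg (-2 * ·) ht).trans (mul_zero _)))
  filter_upwards [ae_mono hr h.slice,
    ae_mono hr (ae_all_iff.2 fun k => (h.loc_F k).ae_integrableOn_slice),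
    ae_mono hr (ae_all_iff.2 fun k => ((h.loc_f k).mono one_le_three_halves).ae_integrableOn_slice),
    ae_mono hr h.loc_P.ae_integrableOn_slice] with t h1 h2 h3 h4
  have hθ := testSpace_slice_sp hψ t
  have hdx : ∀ i, pd i (fun x => ψ (t, x)) = fun x => dx i ψ (t, x) := fun i =>
    funext fun x => pd_slice hψd i t x
  have E1 : ∀ i, _ := fun i => SliceData.sep_smooth hθ hs i (h1.integrable_cube i)
  have E2 := h1.sep_linear hθ hs h1.integrable_sq
  have E3' := fun k => h1.sep_tensor_right hs k fun x => ψ (t, x) * b k (t, x)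
  have E4 := fun k => h1.sep_tensor_left hθ hs k (h1.integrable_b k)
  have E5 := h1.sep_b hs fun x => ψ (t, x) * sqn b (t, x)
  simp only [hdx] at E1 E2 E4
  have hG : ∀ k, IntegrableOn (fun x => tensorDiv b B k (t, x)) cube := h1.integrable_tensorDiv
  have hdxs : ∀ k, SP fun x => dx k ψ (t, x) := fun k => testSpace_slice_sp (mem_testSpace_dx hψ k) t
  have L1 : ∀ k, sep p r (fun x => ψ (t, x) * (f k (t, x) - tensorDiv b B k (t, x))) (fun x => b k (t, x))
      = sep p r (fun x => ψ (t, x) * f k (t, x)) (fun x => b k (t, x))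
        - sep p r (fun x => ψ (t, x) * tensorDiv b B k (t, x)) (fun x => b k (t, x)) := fun k => by
    simp only [mul_sub]
    exact sep_sub_left hs.left (integrable_sp_mul hθ (h3 k)) (integrable_sp_mul hθ (hG k)) _
  have L2 : ∀ k, sep p r (fun x => ψ (t, x) * b k (t, x)) (fun x => f k (t, x) - tensorDiv b B k (t, x))
      = sep p r (fun x => ψ (t, x) * b k (t, x)) (fun x => f k (t, x))
        - sep p r (fun x => ψ (t, x) * b k (t, x)) (fun x => tensorDiv b B k (t, x)) := fun k =>
    sep_sub_right hs.right _ (h3 k) (hG k)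
  -- The mean of the pressure depends on time only and can be carried over to the factor `b`, where
  -- `loc_mean_mul` makes it integrable.
  have L3 : ∀ k, sep p r (fun x => dx k ψ (t, x) * (P (t, x) - smean P t)) (fun x => b k (t, x))
      = sep p r (fun x => dx k ψ (t, x) * P (t, x)) (fun x => b k (t, x))
        - sep p r (fun x => dx k ψ (t, x)) (fun x => smean P t * b k (t, x)) := fun k => by
    have : sep p r (fun x => dx k ψ (t, x)) (fun x => smean P t * b k (t, x))
        = sep p r (fun x => dx k ψ (t, x) * smean P t) (fun x => b k (t, x)) := by
      simp only [sep, mul_right_comm _ (smean P t), mul_assoc (smean P t), integral_mul_const,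
        integral_const_mul]
      exact Finset.sum_congr rfl fun j _ => by ring
    rw [this]
    simp only [mul_sub]
    exact sep_sub_left hs.left (integrable_sp_mul (hdxs k) h4) ((hdxs k).integrableOn.mul_const _) _
  simp only [L1, L2, L3]
  simp only [Fin.sum_univ_three, sqn, tensorDiv] at E1 E2 E3' E4 E5 ⊢
  have e10 := E1 0
  have e11 := E1 1
  have e12 := E1 2
  have e30 := E3' 0
  have e31 := E3' 1
  have e32 := E3' 2
  have e40 := E4 0
  have e41 := E4 1
  have e42 := E4 2
  clear E1 E3' E4 L1 L2 L3
  linarith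

end Fields

/-! ### From the torus to compactly supported test functions -/

lemma continuous_pd {K : E3 → ℝ} (hK : ContDiff ℝ ∞ K) (i : Fin 3) : Continuous (pd i K) :=
  (hK.continuous_fderiv (by simp)).clm_apply continuous_const

lemma hasCompactSupport_pd {K : E3 → ℝ} (hK : HasCompactSupport K) (i : Fin 3) :
    HasCompactSupport (pd i K) :=
  hK.fderiv_apply ℝ (basisVec i)

lemma integrable_mul_of_hasCompactSupport {K g : E3 → ℝ} (hK : Continuous K) (hc : HasCompactSupport K)
    (hg : Continuous g) : Integrable fun x => K x * g x :=
  (hK.mul hg).integrable_of_hasCompactSupport hc.mul_right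

lemma tendsto_integral_mul_conv_univ {K g : E3 → ℝ} (hK : Continuous K) (hc : HasCompactSupport K)
    (hp : Per g) (hg : Continuous g) :
    Tendsto (fun N => ∫ x, K x * conv N g x) atTop (𝓝 (∫ x, K x * g x)) := by
  obtain ⟨C, -, hC⟩ := hp.exists_bound hg
  have hi : IntegrableOn g cube := hp.integrableOn hg
  refine tendsto_integral_of_dominated_convergence (fun x => ‖K x‖ * C)
    (fun N => (hK.mul (tp_conv hi N).sp.continuous).aestronglyMeasurable)
    ((hK.integrable_of_hasCompactSupport hc).norm.mul_const C)
    (fun N => Eventually.of_forall fun x => ?_)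
    (Eventually.of_forall fun x => (tendsto_conv hp hg x).const_mul _)
  rw [norm_mul]
  exact mul_le_mul_of_nonneg_left (abs_conv_le hp hC N x) (norm_nonneg _)

/-- `div H = q` on the torus, in the weak sense. -/
structure TorusDiv (H : Fin 3 → E3 → ℝ) (q : E3 → ℝ) : Prop where
  per : ∀ i, Per (H i)
  cont : ∀ i, Continuous (H i)
  per_q : Per q
  cont_q : Continuous q
  weak : ∀ e, TP e → - ∑ i, ∫ l in cube, pd i e l * H i l = ∫ l in cube, e l * q l

namespace TorusDiv

variable {H : Fin 3 → E3 → ℝ} {q : E3 → ℝ}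

lemma pd_conv (h : TorusDiv H q) (N : ℕ) (x : E3) : ∑ i, pd i (conv N (H i)) x = conv N q x := by
  have h1 := h.weak _ ((tp_peakKer N).shift_sub x)
  simp only [pd_shift_sub] at h1
  simp only [conv, pd_kerOp (tp_peakKer N) ((h.per _).integrableOn (h.cont _)), Finset.sum_neg_distrib]
  exact h1

/-- The weak divergence identity with compactly supported test functions on `ℝ³`. -/
theorem integral_pd_mul (h : TorusDiv H q) {K : E3 → ℝ} (hK : ContDiff ℝ ∞ K) (hc : HasCompactSupport K) :
    - ∑ i, ∫ x, pd i K x * H i x = ∫ x, K x * q x := by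
  have hsp : ∀ N i, SP (conv N (H i)) := fun N i =>
    (tp_conv ((h.per i).integrableOn (h.cont i)) N).sp
  -- The mollified field satisfies the divergence identity pointwise, so it can be integrated by
  -- parts against `K`; then `N → ∞`.
  have h1 : ∀ N, - ∑ i, ∫ x, pd i K x * conv N (H i) x = ∫ x, K x * conv N q x := fun N => by
    have e1 : ∀ i, ∫ x, pd i K x * conv N (H i) x = - ∫ x, K x * pd i (conv N (H i)) x := fun i => by
      have i1 := integrable_mul_of_hasCompactSupport (continuous_pd hK i) (hasCompactSupport_pd hc i)
        (hsp N i).continuous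
      have i2 := integrable_mul_of_hasCompactSupport hK.continuous hc ((hsp N i).pd i).continuous
      have i3 := integrable_mul_of_hasCompactSupport hK.continuous hc (hsp N i).continuous
      have := integral_mul_fderiv_eq_neg_fderiv_mul_of_integrable (v := basisVec i) i1 i2 i3
        (fun x _ => hK.differentiable (by simp) x) fun x _ => (hsp N i).differentiable x
      exact (neg_eq_iff_eq_neg.2 this).symm
    simp only [e1, Finset.sum_neg_distrib, neg_neg]
    rw [← integral_finsetSum _ fun i _ =>
      integrable_mul_of_hasCompactSupport hK.continuous hc ((hsp N i).pd i).continuous]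
    simp only [← Finset.mul_sum, h.pd_conv N]
  refine tendsto_nhds_unique ?_ (tendsto_integral_mul_conv_univ hK.continuous hc h.per_q h.cont_q)
  simp only [← h1]
  exact (tendsto_finsetSum _ fun i _ => tendsto_integral_mul_conv_univ (continuous_pd hK i)
    (hasCompactSupport_pd hc i) (h.per i) (h.cont i)).neg

end TorusDiv

/-! ### Polar coordinates -/

lemma integral_polar {F : E3 → ℝ} (hF : Integrable F) :
    ∫ x, F x = ∫ r in Ioi (0 : ℝ), r ^ 2 * ∫ ζ : Metric.sphere (0 : E3) 1, F (r • (ζ : E3))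
      ∂(volume : Measure E3).toSphere := by
  have hmp := (volume : Measure E3).measurePreserving_homeomorphUnitSphereProd
  have hme := (homeomorphUnitSphereProd E3).measurableEmbedding
  have hd : Module.finrank ℝ E3 - 1 = 2 := by simp
  rw [hd] at hmp
  set G : Metric.sphere (0 : E3) 1 × Ioi (0 : ℝ) → ℝ := fun w => F ((w.2 : ℝ) • (w.1 : E3)) with hG
  have hGF : ∀ x : ({0}ᶜ : Set E3), G (homeomorphUnitSphereProd E3 x) = F x := fun x => by
    have h0 : ‖(x : E3)‖ ≠ 0 := norm_ne_zero_iff.2 x.2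
    simp [hG, smul_smul, mul_inv_cancel₀ h0]
  have e1 : ∫ x, F x = ∫ x : ({0}ᶜ : Set E3), F x ∂(Measure.comap Subtype.val (volume : Measure E3)) := by
    rw [integral_subtype_comap (measurableSet_singleton _).compl F, restrict_compl_singleton]
  have e2 : ∫ x : ({0}ᶜ : Set E3), F x ∂(Measure.comap Subtype.val (volume : Measure E3))
      = ∫ w, G w ∂(volume : Measure E3).toSphere.prod (.volumeIoiPow 2) := by
    rw [← hmp.integral_comp hme]
    simp only [hGF]
  have hi : Integrable G ((volume : Measure E3).toSphere.prod (.volumeIoiPow 2)) := by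
    rw [← hmp.integrable_comp_emb hme]
    have h1 : Integrable (fun x : ({0}ᶜ : Set E3) => F x) (Measure.comap Subtype.val (volume : Measure E3)) :=
      (integrableOn_iff_comap_subtypeVal (measurableSet_singleton _).compl).1 hF.integrableOn
    exact h1.congr (Eventually.of_forall fun x => (hGF x).symm)
  rw [e1, e2, integral_prod_symm _ hi]
  simp only [Measure.volumeIoiPow, ENNReal.ofReal]
  rw [integral_withDensity_eq_integral_smul (measurable_subtype_coe.pow_const _).real_toNNReal,
    integral_subtype_comap measurableSet_Ioi fun r : ℝ => Real.toNNReal (r ^ 2) •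
      ∫ ζ : Metric.sphere (0 : E3) 1, F (r • (ζ : E3)) ∂(volume : Measure E3).toSphere]
  refine setIntegral_congr_fun measurableSet_Ioi fun r hr => ?_
  beta_reduce
  rw [NNReal.smul_def, Real.coe_toNNReal _ (pow_nonneg (le_of_lt hr) _), smul_eq_mul]

lemma toSphere_real_univ : (volume : Measure E3).toSphere.real univ = 4 * Real.pi := by
  rw [Measure.toSphere_real_apply_univ, Measure.real, EuclideanSpace.volume_ball_fin_three]
  simp only [finrank_euclideanSpace_fin, one_pow, ENNReal.ofReal_one, one_mul]
  rw [ENNReal.toReal_ofReal (by positivity)]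
  push_cast
  ring

/-- The integral of `g` over the sphere of radius `r`, with respect to the angle. -/
def sphereInt (g : E3 → Metric.sphere (0 : E3) 1 → ℝ) (r : ℝ) : ℝ :=
  ∫ ζ, g (r • (ζ : E3)) ζ ∂(volume : Measure E3).toSphere

lemma continuous_sphereInt {g : E3 → Metric.sphere (0 : E3) 1 → ℝ} (hg : Continuous fun w : E3 × _ => g w.1 w.2)
    {C : ℝ} (hC : ∀ x ζ, |g x ζ| ≤ C) : Continuous (sphereInt g) := by
  refine continuous_of_dominated (bound := fun _ => C) (fun r => ?_) (fun r => ?_) (integrable_const _) ?_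
  · have h1 : Continuous fun ζ : Metric.sphere (0 : E3) 1 => (r • (ζ : E3), ζ) :=
      (continuous_subtype_val.const_smul r).prodMk continuous_id
    exact (hg.comp h1).aestronglyMeasurable
  · exact Eventually.of_forall fun ζ => hC _ _
  · exact Eventually.of_forall fun ζ => by
      have h1 : Continuous fun r : ℝ => (r • (ζ : E3), ζ) :=
        (continuous_id.smul continuous_const).prodMk continuous_const
      exact hg.comp h1

/-! ### Radial test functions -/

section Radial

variable {κ : ℝ → ℝ} {R : ℝ}

lemma contDiff_radial (hκ : ContDiff ℝ ∞ κ) (hs : tsupport κ ⊆ Ioo 0 R) :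
    ContDiff ℝ ∞ fun x : E3 => κ ‖x‖ := by
  refine contDiff_iff_contDiffAt.2 fun x => ?_
  rcases eq_or_ne x 0 with rfl | hx
  · have h0 : κ =ᶠ[𝓝 0] 0 := notMem_tsupport_iff_eventuallyEq.1 fun h => lt_irrefl _ (hs h).1
    have h1 : Tendsto (fun x : E3 => ‖x‖) (𝓝 0) (𝓝 0) := tendsto_norm_zero
    exact contDiffAt_const.congr_of_eventuallyEq (h1.eventually h0)
  · exact hκ.contDiffAt.comp x (contDiffAt_norm ℝ hx)

lemma hasCompactSupport_radial (hs : tsupport κ ⊆ Ioo 0 R) : HasCompactSupport fun x : E3 => κ ‖x‖ := by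
  refine HasCompactSupport.intro (isCompact_closedBall (0 : E3) R) fun x hx => ?_
  refine image_eq_zero_of_notMem_tsupport fun h => hx ?_
  rw [mem_closedBall_zero_iff]
  exact (hs h).2.le

lemma pd_radial (hκ : Differentiable ℝ κ) (i : Fin 3) {r : ℝ} (hr : 0 < r)
    (ζ : Metric.sphere (0 : E3) 1) :
    pd i (fun x : E3 => κ ‖x‖) (r • (ζ : E3)) = deriv κ r * (ζ : E3) i := by
  have hn : ‖r • (ζ : E3)‖ = r := by simp [norm_smul, abs_of_pos hr]
  have h1 : HasFDerivAt (fun x : E3 => ‖x‖) ((1 / (2 * r)) • (2 • innerSL ℝ (r • (ζ : E3)))) (r • (ζ : E3)) := by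
    have := (hasStrictFDerivAt_norm_sq (r • (ζ : E3))).hasFDerivAt.sqrt (by rw [hn]; positivity)
    have e : ∀ y : E3, √(‖y‖ ^ 2) = ‖y‖ := fun y => Real.sqrt_sq (norm_nonneg y)
    simp only [e] at this
    simpa only [hn] using this
  have h2 : HasFDerivAt (fun x : E3 => κ ‖x‖) _ (r • (ζ : E3)) :=
    (hκ ‖r • (ζ : E3)‖).hasDerivAt.comp_hasFDerivAt _ h1
  rw [pd, h2.fderiv, hn]
  simp [basisVec, EuclideanSpace.inner_single_right]
  field_simp
  simp

end Radial

namespace TorusDiv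

variable {H : Fin 3 → E3 → ℝ} {q : E3 → ℝ}

/-- The flux of `H` through the sphere of radius `r`, divided by `r²`. -/
def sphereFlux (H : Fin 3 → E3 → ℝ) : ℝ → ℝ := sphereInt fun x ζ => ∑ i, (ζ : E3) i * H i x

lemma abs_sphere_le (ζ : Metric.sphere (0 : E3) 1) (i : Fin 3) : |(ζ : E3) i| ≤ 1 := by
  simpa only [norm_eq_of_mem_sphere ζ, Real.norm_eq_abs] using PiLp.norm_apply_le (ζ : E3) i

lemma continuous_sphereFlux (h : TorusDiv H q) : Continuous (sphereFlux H) := by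
  choose C hC0 hC using fun i => (h.per i).exists_bound (h.cont i)
  refine continuous_sphereInt (C := ∑ i, C i) ?_ fun x ζ => ?_
  · refine continuous_finsetSum _ fun i _ => ?_
    refine Continuous.mul ?_ ((h.cont i).comp continuous_fst)
    exact (EuclideanSpace.proj i).continuous.comp (continuous_subtype_val.comp continuous_snd)
  · refine (Finset.abs_sum_le_sum_abs _ _).trans (Finset.sum_le_sum fun i _ => ?_)
    rw [abs_mul]
    exact (mul_le_of_le_one_left (abs_nonneg _) (abs_sphere_le ζ i)).trans (hC i x)

lemma continuous_sphereInt_source (h : TorusDiv H q) : Continuous (sphereInt fun x _ => q x) := by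
  obtain ⟨C, hC0, hC⟩ := h.per_q.exists_bound h.cont_q
  exact continuous_sphereInt (C := C) (h.cont_q.comp continuous_fst) fun x ζ => hC x

/-- The weak divergence identity for the radial test function `κ(|x|)`, whose gradient at `r ζ` is
`κ'(r) ζ`, in polar coordinates. The support of `κ` avoids `0`, where `|x|` is not smooth. -/
lemma integral_deriv_mul_sphereFlux (h : TorusDiv H q) {κ : ℝ → ℝ} {R : ℝ} (hκ : ContDiff ℝ ∞ κ)
    (hs : tsupport κ ⊆ Ioo 0 R) :
    ∫ r in Ioi (0 : ℝ), r ^ 2 * sphereFlux H r * deriv κ r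
      = - ∫ r in Ioi (0 : ℝ), r ^ 2 * sphereInt (fun x _ => q x) r * κ r := by
  have hK := contDiff_radial hκ hs
  have hc := hasCompactSupport_radial hs
  have h1 := h.integral_pd_mul hK hc
  rw [← integral_finsetSum _ fun i _ => integrable_mul_of_hasCompactSupport (continuous_pd hK i)
      (hasCompactSupport_pd hc i) (h.cont i),
    integral_polar (integrable_finsetSum _ fun i _ => integrable_mul_of_hasCompactSupport
      (continuous_pd hK i) (hasCompactSupport_pd hc i) (h.cont i)),
    integral_polar (integrable_mul_of_hasCompactSupport hK.continuous hc h.cont_q)] at h1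
  rw [neg_eq_iff_eq_neg] at h1
  have e1 : ∀ r ∈ Ioi (0 : ℝ), r ^ 2 * (∫ ζ : Metric.sphere (0 : E3) 1,
      ∑ i, pd i (fun x : E3 => κ ‖x‖) (r • (ζ : E3)) * H i (r • (ζ : E3)) ∂(volume : Measure E3).toSphere)
      = r ^ 2 * sphereFlux H r * deriv κ r := fun r hr => by
    simp only [pd_radial (hκ.differentiable (by simp)) _ hr, mul_assoc, ← Finset.mul_sum, integral_const_mul]
    rw [sphereFlux, sphereInt]
    ring
  have e2 : ∀ r ∈ Ioi (0 : ℝ), r ^ 2 * (∫ ζ : Metric.sphere (0 : E3) 1,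
      κ ‖r • (ζ : E3)‖ * q (r • (ζ : E3)) ∂(volume : Measure E3).toSphere)
      = r ^ 2 * sphereInt (fun x _ => q x) r * κ r := fun r hr => by
    have hn : ∀ ζ : Metric.sphere (0 : E3) 1, ‖r • (ζ : E3)‖ = r := fun ζ => by
      simp [norm_smul, abs_of_pos (mem_Ioi.1 hr)]
    simp only [hn, integral_const_mul]
    rw [sphereInt]
    ring
  rwa [setIntegral_congr_fun measurableSet_Ioi e1, setIntegral_congr_fun measurableSet_Ioi e2] at h1

/-- The divergence theorem on a ball, without derivatives of `H`. The radial identity says that `r²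
sphereFlux` has the weak derivative `r² ∫ q(rζ)`, hence equals a primitive up to a constant. Both
sides are continuous, and the constant is zero by evaluation at `r = 0`. -/
lemma sq_mul_sphereFlux (h : TorusDiv H q) {r : ℝ} (hr : 0 < r) :
    r ^ 2 * sphereFlux H r = ∫ s in 0..r, s ^ 2 * sphereInt (fun x _ => q x) s := by
  have hR : (0 : ℝ) < r + 1 := by linarith
  have c1 : Continuous fun s => s ^ 2 * sphereFlux H s := by
    have := h.continuous_sphereFlux
    fun_prop
  have c2 : Continuous fun s => s ^ 2 * sphereInt (fun x _ => q x) s := by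
    have := h.continuous_sphereInt_source
    fun_prop
  obtain ⟨k, hk⟩ := ae_eq_const_add_primitive hR (c1.intervalIntegrable _ _) (c2.intervalIntegrable _ _)
    fun κ hκ hcs hs => by
      have e : ∀ (g : ℝ → ℝ), (∀ s, s ∉ Ioo 0 (r + 1) → g s = 0) →
          ∫ s in 0..(r + 1), g s = ∫ s in Ioi 0, g s := fun g hg => by
        rw [intervalIntegral.integral_of_le hR.le]
        refine (setIntegral_eq_of_subset_of_forall_sdiff_eq_zero measurableSet_Ioi Ioc_subset_Ioi_self ?_).symm
        exact fun s hs => hg s fun h => hs.2 (Ioo_subset_Ioc_self h)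
      rw [e, e, h.integral_deriv_mul_sphereFlux hκ hs]
      · intro s hs'
        rw [image_eq_zero_of_notMem_tsupport fun h => hs' (hs h), mul_zero]
      · intro s hs'
        rw [image_eq_zero_of_notMem_tsupport fun h => hs' (hs (tsupport_deriv_subset h)), mul_zero]
  have c3 : Continuous fun s => k + ∫ t in 0..s, t ^ 2 * sphereInt (fun x _ => q x) t :=
    continuous_const.add (intervalIntegral.continuous_primitive (fun a b => c2.intervalIntegrable a b) 0)
  have h1 : EqOn (fun s => s ^ 2 * sphereFlux H s)
      (fun s => k + ∫ t in 0..s, t ^ 2 * sphereInt (fun x _ => q x) t) (Ioo 0 (r + 1)) := by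
    refine Measure.eqOn_open_of_ae_eq (μ := volume) ?_ isOpen_Ioo c1.continuousOn c3.continuousOn
    exact (ae_restrict_iff' measurableSet_Ioo).2 hk
  have h2 := h1.closure c1 c3
  rw [closure_Ioo hR.ne] at h2
  have h3 := h2 (left_mem_Icc.2 hR.le)
  have h4 := h2 (⟨hr.le, by linarith⟩ : r ∈ Icc 0 (r + 1))
  simp only [ne_eq, OfNat.ofNat_ne_zero, not_false_eq_true, zero_pow, zero_mul,
    intervalIntegral.integral_same, add_zero] at h3
  beta_reduce at h4
  rw [h4, ← h3, zero_add]

/-- The flux through small spheres. -/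
theorem tendsto_sphereFlux (h : TorusDiv H q) :
    Tendsto (fun r => 1 / r * ((4 * Real.pi)⁻¹ * sphereFlux H r)) (𝓝[>] 0) (𝓝 (q 0 / 3)) := by
  have c := h.continuous_sphereInt_source
  have c1 : Continuous fun r : ℝ => ∫ t in (0:ℝ)..1, t ^ 2 * sphereInt (fun x _ => q x) (r * t) :=
    intervalIntegral.continuous_parametric_intervalIntegral_of_continuous' (by
      simp only [Function.uncurry_def]
      fun_prop) _ _
  have h1 := (c1.tendsto 0).mono_left (nhdsWithin_le_nhds (s := Ioi 0)) |>.const_mul (4 * Real.pi)⁻¹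
  -- The area `4π` of the sphere cancels and `∫ t² = 1/3`; this is the origin of the factor in the
  -- four-thirds law.
  have e0 : (4 * Real.pi)⁻¹ * ∫ t in (0:ℝ)..1, t ^ 2 * sphereInt (fun x _ => q x) (0 * t) = q 0 / 3 := by
    simp only [zero_mul]
    rw [intervalIntegral.integral_mul_const, integral_pow]
    simp only [sphereInt, zero_smul, integral_const, toSphere_real_univ, smul_eq_mul]
    have := Real.pi_pos
    norm_num
    field_simp
  rw [e0] at h1
  refine h1.congr' ?_
  filter_upwards [self_mem_nhdsWithin] with r hr
  have hr : 0 < r := hr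
  have e := h.sq_mul_sphereFlux hr
  have e2 := intervalIntegral.mul_integral_comp_mul_left (a := 0) (b := 1)
    (f := fun s => s ^ 2 * sphereInt (fun x _ => q x) s) (c := r)
  rw [mul_zero, mul_one] at e2
  rw [← e2] at e
  simp only [mul_pow, mul_assoc, intervalIntegral.integral_const_mul] at e
  have e3 : sphereFlux H r = r * ∫ t in (0:ℝ)..1, t ^ 2 * sphereInt (fun x _ => q x) (r * t) := by
    have hr2 : r ^ 2 ≠ 0 := by positivity
    apply mul_left_cancel₀ hr2
    rw [e]
    ring
  rw [e3, one_div, mul_left_comm _ r, inv_mul_cancel_left₀ hr.ne']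

end TorusDiv

/-! ### The mollifier -/

lemma bump_eq : bump = fun x => expNegInvGlue (1 - ‖x‖ ^ 2) := by
  ext x
  rw [bump, expNegInvGlue]
  have h : 1 - ‖x‖ ^ 2 ≤ 0 ↔ ¬ ‖x‖ < 1 := by
    rw [not_lt, sub_nonpos, one_le_sq_iff_one_le_abs, abs_of_nonneg (norm_nonneg x)]
  by_cases hx : ‖x‖ < 1
  · rw [if_pos hx, if_neg (fun h' => h.1 h' hx), one_div]
  · rw [if_neg hx, if_pos (h.2 hx)]

lemma contDiff_bump : ContDiff ℝ ∞ bump := by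
  rw [bump_eq]
  exact expNegInvGlue.contDiff.comp (contDiff_const.sub (contDiff_norm_sq ℝ))

lemma hasCompactSupport_bump : HasCompactSupport bump := by
  refine HasCompactSupport.intro (isCompact_closedBall (0 : E3) 1) fun x hx => ?_
  rw [mem_closedBall_zero_iff, not_le] at hx
  rw [bump, if_neg hx.le.not_gt]

lemma integral_bump_pos : 0 < ∫ x, bump x := by
  refine contDiff_bump.continuous.integral_pos_of_hasCompactSupport_nonneg_nonzero (x := 0)
    hasCompactSupport_bump (fun x => ?_) ?_
  · rw [bump_eq]
    exact expNegInvGlue.nonneg _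
  · rw [bump_eq]
    exact (expNegInvGlue.pos_of_pos (by simp)).ne'

lemma contDiff_mollifier : ContDiff ℝ ∞ mollifier := contDiff_const.mul contDiff_bump

lemma hasCompactSupport_mollifier : HasCompactSupport mollifier := hasCompactSupport_bump.mul_left

lemma integral_mollifier : ∫ x, mollifier x = 1 := by
  simp only [mollifier]
  rw [integral_const_mul, inv_mul_cancel₀ integral_bump_pos.ne']

lemma contDiff_scaledMollifier (ε : ℝ) : ContDiff ℝ ∞ (scaledMollifier ε) :=
  contDiff_const.mul (contDiff_mollifier.comp (contDiff_const_smul _))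

lemma hasCompactSupport_scaledMollifier {ε : ℝ} (hε : 0 < ε) : HasCompactSupport (scaledMollifier ε) :=
  (hasCompactSupport_mollifier.comp_smul (inv_ne_zero hε.ne')).mul_left

lemma inner_gradient (K : E3 → ℝ) (l v : E3) :
    inner ℝ (gradient K l) v = ∑ i, pd i K l * v i := by
  rw [inner_gradient_left]
  have hv : v = ∑ i, v i • basisVec i := by
    ext j
    simp [basisVec, Pi.single_apply]
  conv_lhs => rw [hv]
  rw [map_sum]
  refine Finset.sum_congr rfl fun i _ => ?_
  rw [map_smul, smul_eq_mul, mul_comm, pd]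

/-- The mollifiers converge to the Dirac mass. -/
theorem tendsto_integral_scaledMollifier {q : E3 → ℝ} (hp : Per q) (hq : Continuous q) :
    Tendsto (fun ε => ∫ x, scaledMollifier ε x * q x) (𝓝[>] 0) (𝓝 (q 0)) := by
  obtain ⟨C, -, hC⟩ := hp.exists_bound hq
  have hm := contDiff_mollifier.continuous
  have c : Continuous fun ε : ℝ => ∫ x, mollifier x * q (ε • x) := by
    refine continuous_of_dominated (bound := fun x => ‖mollifier x‖ * C) (fun ε => ?_) (fun ε => ?_)
      ((hm.integrable_of_hasCompactSupport hasCompactSupport_mollifier).norm.mul_const C) ?_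
    · exact (hm.mul (hq.comp (continuous_const_smul ε))).aestronglyMeasurable
    · refine Eventually.of_forall fun x => ?_
      rw [norm_mul]
      exact mul_le_mul_of_nonneg_left (hC _) (norm_nonneg _)
    · refine Eventually.of_forall fun x => ?_
      exact continuous_const.mul (hq.comp (continuous_id.smul continuous_const))
  have h1 := (c.tendsto 0).mono_left (nhdsWithin_le_nhds (s := Ioi 0))
  simp only [zero_smul, integral_mul_const, integral_mollifier, one_mul] at h1
  refine h1.congr' ?_
  filter_upwards [self_mem_nhdsWithin] with ε hε
  have hε : 0 < ε := hε
  have := Measure.integral_comp_inv_smul_of_nonneg (volume : Measure E3)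
    (fun x => (ε ^ 3)⁻¹ * (mollifier x * q (ε • x))) hε.le
  simp only [smul_smul, mul_inv_cancel₀ hε.ne', one_smul, finrank_euclideanSpace_fin, integral_const_mul,
    smul_eq_mul, mul_inv_cancel_left₀ (pow_pos hε 3).ne'] at this
  rw [← this, ← integral_const_mul]
  simp only [scaledMollifier, mul_assoc]

/-! ### Averages of third-order increments over the lag -/

section LagAverage

variable {T : ℝ} {b : Fin 3 → ℝ × E3 → ℝ}

lemma eLpNorm_incr_le {S : Set ℝ} {g : ℝ × E3 → ℝ} (hp : SpacePeriodic g) (hg : MemLp g 3 (tcube S)) (l : E3) :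
    eLpNorm (fun z : ℝ × E3 => g (z.1, z.2 + l) - g z) 3 (tcube S) ≤ 2 * eLpNorm g 3 (tcube S) := by
  have h1 := eLpNorm_sub_le (memLp_tshift hp l (by simp) hg).1 hg.1 one_le_three
  rw [eLpNorm_tshift hp hg.1 l (by simp), ← two_mul] at h1
  exact h1

lemma eLpNorm_incrCube_le {S : Set ℝ} (hp : ∀ k, SpacePeriodic (b k)) (hb : ∀ k, MemLp (b k) 3 (tcube S))
    (i : Fin 3) (l : E3) : eLpNorm (fun z => incrCube b i z l) 1 (tcube S)
      ≤ 2 * eLpNorm (b i) 3 (tcube S) * ∑ k, (2 * eLpNorm (b k) 3 (tcube S)) * (2 * eLpNorm (b k) 3 (tcube S)) := by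
  have hm : ∀ k, AEStronglyMeasurable (fun z : ℝ × E3 => b k (z.1, z.2 + l) - b k z) (tcube S) := fun k =>
    (memLp_tshift (hp k) l (by simp) (hb k)).1.sub (hb k).1
  have h1 := eLpNorm_smul_le_mul_eLpNorm (p := 3) (q := 3 / 2) (r := 1)
    (Finset.aestronglyMeasurable_fun_sum Finset.univ fun k _ => (hm k).pow 2) (hm i)
  refine h1.trans (mul_le_mul' (eLpNorm_incr_le (hp i) (hb i) l) ?_)
  have h3 := eLpNorm_sum_le (μ := tcube S) (s := Finset.univ)
    (f := fun k (z : ℝ × E3) => (b k (z.1, z.2 + l) - b k z) ^ 2) (fun k _ => (hm k).pow 2) one_le_three_halves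
  rw [Finset.sum_fn] at h3
  refine h3.trans (Finset.sum_le_sum fun k _ => ?_)
  have h2 := eLpNorm_smul_le_mul_eLpNorm (p := 3) (q := 3) (r := 3 / 2) (hm k) (hm k)
  refine Eq.trans_le ?_ (h2.trans (mul_le_mul' (eLpNorm_incr_le (hp k) (hb k) l)
    (eLpNorm_incr_le (hp k) (hb k) l)))
  congr 1
  ext z
  exact sq _

variable {Λ : Type*} [MeasurableSpace Λ] {ν : Measure Λ} [SFinite ν] {L : Λ → E3} {w : Fin 3 → Λ → ℝ}

/-- The `L¹` norm of the cubic increment is bounded uniformly in the lag, so any integrable weight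
is allowed. Two cases are needed: lags in `ℝ³` weighted by the gradient of a mollifier, and lags on
a sphere weighted by the coordinates of the normal. -/
lemma integrable_incrCube_prod {S : Set ℝ} (hp : ∀ k, SpacePeriodic (b k))
    (hb : ∀ k, MemLp (b k) 3 (tcube S)) (hL : Measurable L) (hw : ∀ i, Integrable (w i) ν) (i : Fin 3) :
    Integrable (fun q : (ℝ × E3) × Λ => w i q.2 * incrCube b i q.1 (L q.2)) ((tcube S).prod ν) := by
  have hm : ∀ k, AEStronglyMeasurable
      (fun q : (ℝ × E3) × Λ => b k (q.1.1, q.1.2 + L q.2) - b k q.1) ((tcube S).prod ν) := fun k =>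
    (aesm_tshift_prod (hp k) (hb k).1 hL).sub (hb k).1.comp_fst
  refine integrable_prod_of_bound (F := fun q => incrCube b i q.1 (L q.2))
    ((hm i).mul (Finset.aestronglyMeasurable_fun_sum _ fun k _ => (hm k).pow 2)) ?_
    (fun y => eLpNorm_incrCube_le hp hb i (L y)) (hw i)
  have h2 : ∀ k, 2 * eLpNorm (b k) 3 (tcube S) ≠ ⊤ := fun k => ENNReal.mul_ne_top (by simp) (hb k).2.ne
  exact ENNReal.mul_ne_top (h2 i) (ENNReal.sum_ne_top.2 fun k _ => ENNReal.mul_ne_top (h2 k) (h2 k))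

lemma ae_slab_of_Icc {p : ℝ × E3 → Prop} (h : ∀ a c, 0 < a → c < T → ∀ᵐ z ∂tcube (Icc a c), p z) :
    ∀ᵐ z ∂volume.restrict (slab T), p z := by
  rw [slab, Ioo_eq_iUnion_Icc, iUnion_prod_const, ae_restrict_iUnion_iff]
  intro n
  have : (0 : ℝ) < 1 / ((n : ℝ) + 1) := by positivity
  exact h _ _ this (by linarith)

lemma ae_integrable_lagAverage (hp : ∀ k, SpacePeriodic (b k)) (hb : ∀ k, MemLpLoc T 3 (b k))
    (hL : Measurable L) (hw : ∀ i, Integrable (w i) ν) :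
    ∀ᵐ z ∂volume.restrict (slab T), Integrable (fun y => ∑ i, w i y * incrCube b i z (L y)) ν :=
  ae_slab_of_Icc fun a c ha hc => (integrable_finsetSum _ fun i _ =>
    integrable_incrCube_prod hp (fun k => hb k a c ha hc) hL hw i).prod_right_ae

lemma memLpLoc_lagAverage (hp : ∀ k, SpacePeriodic (b k)) (hb : ∀ k, MemLpLoc T 3 (b k))
    (hL : Measurable L) (hw : ∀ i, Integrable (w i) ν) :
    MemLpLoc T 1 fun z => ∫ y, ∑ i, w i y * incrCube b i z (L y) ∂ν := fun a c ha hc =>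
  memLp_one_iff_integrable.2 (integrable_finsetSum _ fun i _ =>
    integrable_incrCube_prod hp (fun k => hb k a c ha hc) hL hw i).integral_prod_left

/-- Averages over the lag of the third-order increments, tested against `ψ`. -/
theorem integral_lagAverage_mul (hp : ∀ k, SpacePeriodic (b k)) (hb : ∀ k, MemLpLoc T 3 (b k))
    (hL : Measurable L) (hw : ∀ i, Integrable (w i) ν) {ψ : ℝ × E3 → ℝ} (hψ : ψ ∈ testSpace T ℝ)
    {a c : ℝ} (ha : 0 < a) (hc : c < T) (h0 : ∀ t x, t ∉ Icc a c → ψ (t, x) = 0) :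
    ∫ z in slab T, (∫ y, ∑ i, w i y * incrCube b i z (L y) ∂ν) * ψ z
      = ∑ i, ∫ y, w i y * lagFlux (Icc a c) ψ b i (L y) ∂ν := by
  obtain ⟨C, -, hC⟩ := testSpace_exists_bound hψ
  have hi : ∀ i, Integrable (fun q : (ℝ × E3) × Λ => w i q.2 * incrCube b i q.1 (L q.2) * ψ q.1)
      ((tcube (Icc a c)).prod ν) := fun i =>
    (integrable_incrCube_prod hp (fun k => hb k a c ha hc) hL hw i).mul_bdd
      hψ.1.continuous.aestronglyMeasurable.comp_fst (Eventually.of_forall fun q => hC q.1)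
  rw [setIntegral_slab_eq ha hc fun t x ht => by rw [h0 t x ht, mul_zero]]
  simp only [← integral_mul_const, Finset.sum_mul]
  rw [← integral_prod (fun q : (ℝ × E3) × Λ => ∑ i, w i q.2 * incrCube b i q.1 (L q.2) * ψ q.1)
    (integrable_finsetSum _ fun i _ => hi i), integral_finsetSum _ fun i _ => hi i]
  refine Finset.sum_congr rfl fun i _ => ?_
  rw [integral_prod_symm _ (hi i)]
  refine integral_congr_ae (Eventually.of_forall fun y => ?_)
  beta_reduce
  rw [lagFlux, ← integral_const_mul]
  refine integral_congr_ae (Eventually.of_forall fun z => ?_)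
  beta_reduce
  ring

end LagAverage

lemma sum_smul_basisVec (v : E3) : ∑ i, v i • basisVec i = v := by
  ext j
  simp [basisVec, Pi.single_apply]

lemma MemLpLoc.of_apply {T : ℝ} {p : ℝ≥0∞} {f : ℝ × E3 → E3} (h : ∀ k, MemLpLoc T p fun z => f z k) :
    MemLpLoc T p f := fun a c ha hc => by
  have h1 := memLp_finsetSum Finset.univ fun k _ =>
    (ContinuousLinearMap.toSpanSingleton ℝ (basisVec k)).comp_memLp' (h k a c ha hc)
  refine h1.ae_eq (Eventually.of_forall fun z => ?_)
  simpa using sum_smul_basisVec (f z)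

lemma fderiv_apply_eq_zero {F : Type*} [NormedAddCommGroup F] [NormedSpace ℝ F] {ψ : ℝ × E3 → F} {a c : ℝ}
    (h0 : ∀ t x, t ∉ Icc a c → ψ (t, x) = 0) (v : ℝ × E3) (t : ℝ) (x : E3) (ht : t ∉ Icc a c) :
    fderiv ℝ ψ (t, x) v = 0 := by
  have : ψ =ᶠ[𝓝 (t, x)] fun _ => 0 := by
    filter_upwards [(isClosed_Icc.isOpen_compl.preimage continuous_fst).mem_nhds ht] with z hz
    exact h0 z.1 z.2 hz
  simp only [this.fderiv_eq]
  simp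

lemma norm_basisVec (i : Fin 3) : ‖basisVec i‖ = 1 := by simp [basisVec]

/-! ### Distributions in divergence form -/

section Distribution

variable {T : ℝ} {g₀ : ℝ × E3 → ℝ} {g : Fin 3 → ℝ × E3 → ℝ}

lemma integrable_div_pairing (h₀ : MemLpLoc T 1 g₀) (h : ∀ k, MemLpLoc T 1 (g k)) {ψ : ℝ × E3 → ℝ}
    (hψ : ψ ∈ testSpace T ℝ) :
    Integrable (fun z => g₀ z * dt ψ z + ∑ k, g k z * dx k ψ z) (volume.restrict (slab T)) :=
  Integrable.add (h₀.integrable_mul (mem_testSpace_dt hψ))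
    (integrable_finsetSum _ fun k _ => (h k).integrable_mul (mem_testSpace_dx hψ k))

/-- The distribution `-∂ₜ g₀ - div g`. -/
def divDistribution (T : ℝ) (g₀ : ℝ × E3 → ℝ) (g : Fin 3 → ℝ × E3 → ℝ) (h₀ : MemLpLoc T 1 g₀)
    (h : ∀ k, MemLpLoc T 1 (g k)) : TorusDistribution T where
  toLinearMap :=
    { toFun := fun ψ => ∫ z in slab T, (g₀ z * dt ψ.1 z + ∑ k, g k z * dx k ψ.1 z)
      map_add' := fun ψ χ => by
        rw [← integral_add (integrable_div_pairing h₀ h ψ.2) (integrable_div_pairing h₀ h χ.2)]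
        refine integral_congr_ae (Eventually.of_forall fun z => ?_)
        have e : fderiv ℝ (ψ + χ).1 z = fderiv ℝ ψ.1 z + fderiv ℝ χ.1 z :=
          fderiv_add (testSpace_differentiable ψ.2 z) (testSpace_differentiable χ.2 z)
        simp only [dt, dx, e, add_apply, mul_add, Finset.sum_add_distrib]
        ring
      map_smul' := fun r ψ => by
        rw [RingHom.id_apply, smul_eq_mul, ← integral_const_mul]
        refine integral_congr_ae (Eventually.of_forall fun z => ?_)
        have e : fderiv ℝ (r • ψ).1 z = r • fderiv ℝ ψ.1 z :=
          fderiv_const_smul (testSpace_differentiable ψ.2 z) r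
        simp only [dt, dx, e, smul_apply, smul_eq_mul, mul_add, Finset.mul_sum,
          mul_left_comm r] }
  bounded a c ha hc := by
    -- Only first derivatives of the test function occur, so order one suffices.
    refine ⟨1, ∫ z, (|g₀ z| + ∑ k, |g k z|) ∂tcube (Icc a c), fun ψ h0 M hM => ?_⟩
    have hi : Integrable (fun z => |g₀ z| + ∑ k, |g k z|) (tcube (Icc a c)) :=
      (h₀.integrable ha hc).abs.add (integrable_finsetSum _ fun k _ => ((h k).integrable ha hc).abs)
    have hf : ∀ z, ‖fderiv ℝ ψ.1 z‖ ≤ M := fun z => by simpa using hM 1 le_rfl z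
    have h1 : ∀ z, |dt ψ.1 z| ≤ M := fun z => by
      simpa [Prod.norm_def, dt] using ((fderiv ℝ ψ.1 z).le_of_opNorm_le (hf z) (1, 0))
    have h2 : ∀ k z, |dx k ψ.1 z| ≤ M := fun k z => by
      simpa [Prod.norm_def, norm_basisVec, dx] using ((fderiv ℝ ψ.1 z).le_of_opNorm_le (hf z) (0, basisVec k))
    change |∫ z in slab T, _| ≤ _
    rw [setIntegral_slab_eq ha hc fun t x ht => by
      simp only [dt, dx, fderiv_apply_eq_zero h0 _ t x ht, mul_zero, Finset.sum_const_zero, add_zero],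
      ← integral_mul_const]
    refine (abs_integral_le_integral_abs).trans (integral_mono_of_nonneg
      (Eventually.of_forall fun z => abs_nonneg _) (hi.mul_const M) (Eventually.of_forall fun z => ?_))
    beta_reduce
    rw [add_mul, Finset.sum_mul]
    refine (abs_add_le _ _).trans (add_le_add ?_ ((Finset.abs_sum_le_sum_abs _ _).trans
      (Finset.sum_le_sum fun k _ => ?_)))
    · rw [abs_mul]
      exact mul_le_mul_of_nonneg_left (h1 z) (abs_nonneg _)
    · rw [abs_mul]
      exact mul_le_mul_of_nonneg_left (h2 k z) (abs_nonneg _)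

/-- Scalar multiples of distributions. -/
def TorusDistribution.constMul {T : ℝ} (r : ℝ) (D : TorusDistribution T) : TorusDistribution T where
  toLinearMap := r • D.toLinearMap
  bounded a c ha hc := by
    obtain ⟨N, C, h⟩ := D.bounded a c ha hc
    refine ⟨N, |r| * C, fun ψ h0 M hM => ?_⟩
    rw [LinearMap.smul_apply, smul_eq_mul, abs_mul, mul_assoc]
    exact mul_le_mul_of_nonneg_left (h ψ h0 M hM) (abs_nonneg _)

end Distribution

/-- `f` is integrable with integral `v`. -/
structure HasInt {α : Type*} [MeasurableSpace α] (μ : Measure α) (f : α → ℝ) (v : ℝ) : Prop where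
  int : Integrable f μ
  eq : ∫ z, f z ∂μ = v

namespace HasInt

variable {α : Type*} [MeasurableSpace α] {μ : Measure α} {f g : α → ℝ} {v w : ℝ}

lemma mk' (h : Integrable f μ) : HasInt μ f (∫ z, f z ∂μ) := ⟨h, rfl⟩

lemma add (h : HasInt μ f v) (h' : HasInt μ g w) : HasInt μ (fun z => f z + g z) (v + w) :=
  ⟨h.int.add h'.int, by rw [integral_add h.int h'.int, h.eq, h'.eq]⟩

lemma const_mul (h : HasInt μ f v) (r : ℝ) : HasInt μ (fun z => r * f z) (r * v) :=
  ⟨h.int.const_mul r, by rw [integral_const_mul, h.eq]⟩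

lemma sum {ι : Type*} {u : Finset ι} {f : ι → α → ℝ} {v : ι → ℝ} (h : ∀ i ∈ u, HasInt μ (f i) (v i)) :
    HasInt μ (fun z => ∑ i ∈ u, f i z) (∑ i ∈ u, v i) :=
  ⟨integrable_finsetSum _ fun i hi => (h i hi).int, by
    rw [integral_finsetSum _ fun i hi => (h i hi).int]
    exact Finset.sum_congr rfl fun i hi => (h i hi).eq⟩

end HasInt

/-! ### The helicity defect as the source at lag zero -/

namespace Fields

variable {T : ℝ} {A b f : Fin 3 → ℝ × E3 → ℝ} {B : Fin 3 → Fin 3 → ℝ × E3 → ℝ}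
  {P : ℝ × E3 → ℝ} {ψ : ℝ × E3 → ℝ} {a c : ℝ}

lemma loc_Ab (h : Fields T A b f B P) (k m : Fin 3) : MemLpLoc T 1 fun z => A k z * b m z :=
  (h.loc_A ⊤ k).mul ⊤ 1 1 (h.loc_b1 m)

lemma loc_Pb (h : Fields T A b f B P) (k : Fin 3) : MemLpLoc T 1 fun z => P z * b k z := by
  have h1 := (h.loc_P0.mul (3 / 2) 3 1 (h.loc_b k)).add (h.loc_mean_mul k)
  simpa only [← add_mul, sub_add_cancel] using h1

lemma loc_fA (h : Fields T A b f B P) (k m : Fin 3) : MemLpLoc T 1 fun z => f k z * A m z :=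
  ((h.loc_f k).mono one_le_three_halves).mul 1 ⊤ 1 (h.loc_A ⊤ m)

lemma loc_GA (h : Fields T A b f B P) (k m : Fin 3) : MemLpLoc T 1 fun z => tensorDiv b B k z * A m z :=
  (h.loc_G k).mul 1 ⊤ 1 (h.loc_A ⊤ m)

/-- The flux of magnetic helicity, with the opposite sign. -/
def helicityFlux (A b f : Fin 3 → ℝ × E3 → ℝ) (B : Fin 3 → Fin 3 → ℝ × E3 → ℝ) (P : ℝ × E3 → ℝ)
    (k : Fin 3) (z : ℝ × E3) : ℝ :=
  (f (k + 1) z * A (k + 2) z - f (k + 2) z * A (k + 1) z)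
    - (tensorDiv b B (k + 1) z * A (k + 2) z - tensorDiv b B (k + 2) z * A (k + 1) z)
    - P z * b k z - b k z * sqn b z

lemma loc_helicityFlux (h : Fields T A b f B P) (k : Fin 3) : MemLpLoc T 1 (helicityFlux A b f B P k) :=
  ((((h.loc_fA _ _).sub (h.loc_fA _ _)).sub ((h.loc_GA _ _).sub (h.loc_GA _ _))).sub (h.loc_Pb k)).sub
    (h.loc_cube k)

lemma loc_helicity (h : Fields T A b f B P) : MemLpLoc T 1 fun z => - ∑ k, A k z * b k z :=
  (MemLpLoc.sum _ fun k _ => h.loc_Ab k k).neg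

/-- The distribution `∂ₜ(A·b) + div(helicity flux)`. -/
def defect (h : Fields T A b f B P) : TorusDistribution T :=
  divDistribution T _ _ h.loc_helicity h.loc_helicityFlux

/-- At lag zero correlations are integrals of products. The two copies of `f · b` vanish by
orthogonality, the cubic terms add up to `-2 |b|² b · ∇ψ`, and the mean of the pressure recombines
with the rest. What is left is twice the weak form of the helicity balance. -/
lemma lagSource_zero (h : Fields T A b f B P) (hfb : ∀ z, ∑ k, f k z * b k z = 0)
    (hψ : ψ ∈ testSpace T ℝ) (ha : 0 < a) (hc : c < T) (h0 : ∀ t x, t ∉ Icc a c → ψ (t, x) = 0) :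
    lagSource (Icc a c) A b f B P ψ 0 = 2 * h.defect.toLinearMap ⟨ψ, hψ⟩ := by
  have hi := fun k => h.corrPair_source hψ ha hc k
  have e : ∀ (f g : ℝ × E3 → ℝ), CorrPair (Icc a c) f g → Integrable (fun z => f z * g z) (tcube (Icc a c)) :=
    fun f g H => by simpa only [add_zero] using H.int 0
  change _ = 2 * ∫ z in slab T, _
  rw [setIntegral_slab_eq ha hc fun t x ht => by
      simp only [dt, dx, fderiv_apply_eq_zero h0 _ t x ht, mul_zero, Finset.sum_const_zero, add_zero],
    ← integral_const_mul]
  simp only [lagSource, corr_zero]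
  have H : HasInt (tcube (Icc a c)) _ _ := HasInt.sum (u := Finset.univ) fun k _ => by
    obtain ⟨h1, h2, h3, h4, h5, h6, h7, h8, h9⟩ := hi k
    exact ((((((((HasInt.mk' (e _ _ h1)).const_mul (-2)).add ((HasInt.mk' (e _ _ h2)).const_mul (-2))).add
      ((HasInt.mk' (e _ _ h3)).const_mul (-2))).add ((HasInt.mk' (e _ _ h4)).const_mul 2)).add
      ((HasInt.mk' (e _ _ h5)).const_mul (-2))).add ((HasInt.mk' (e _ _ h6)).const_mul (-2))).add
      ((HasInt.mk' (e _ _ h7)).const_mul (-1))).add (HasInt.mk' (e _ _ h8)) |>.add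
      ((HasInt.sum (u := Finset.univ) fun m _ => HasInt.mk' (e _ _ (h9 m))).const_mul (-2))
  refine H.eq.symm.trans (integral_congr_ae (Eventually.of_forall fun z => ?_))
  have hz := hfb z
  simp only [Fin.sum_univ_three, helicityFlux, sqn] at hz ⊢
  simp only [Fin.reduceAdd, zero_add]
  -- Two correlations pair `ψ f` with `b` and `ψ b` with `f`, each with the factor `-2`.
  linear_combination (-4 * ψ z) * hz

end Fields

lemma mem_testSpace_component {T : ℝ} {Ψ : ℝ × E3 → E3} (hΨ : Ψ ∈ testSpace T E3) (k : Fin 3) :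
    (fun z => Ψ z k) ∈ testSpace T ℝ := by
  obtain ⟨h1, h2, a, c, ha, hc, h0⟩ := hΨ
  exact ⟨(EuclideanSpace.proj (𝕜 := ℝ) k).contDiff.comp h1, fun t x i => by simp only [h2 t x i], a, c, ha, hc,
    fun t x ht => by simp [h0 t x ht]⟩

lemma dx_component {Ψ : ℝ × E3 → E3} (hΨ : Differentiable ℝ Ψ) (i k : Fin 3) (z : ℝ × E3) :
    dx i (fun z => Ψ z k) z = dx i Ψ z k := by
  have h := (EuclideanSpace.proj (𝕜 := ℝ) k).hasFDerivAt.comp z (hΨ z).hasFDerivAt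
  exact congrArg (· (0, basisVec i)) h.fderiv

/-- The divergence of `b ⊗ b` as a vector field. -/
def tensorField (b : ℝ × E3 → E3) (B : Fin 3 → Fin 3 → ℝ × E3 → ℝ) (z : ℝ × E3) : E3 :=
  WithLp.toLp 2 fun k => tensorDiv (fun k z => b z k) B k z

lemma dissipationIntegrand_eq (b : ℝ × E3 → E3) (ε : ℝ) (z : ℝ × E3) (l : E3) :
    dissipationIntegrand b ε z l
      = ∑ i, pd i (scaledMollifier ε) l * incrCube (fun k z => b z k) i z l := by
  simp only [dissipationIntegrand, inner_gradient, norm_sq_eq_sum, increment, incrCube, Finset.sum_mul,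
    PiLp.sub_apply, mul_assoc]

lemma structureIntegrand_eq (b : ℝ × E3 → E3) (r : ℝ) (z : ℝ × E3) (ζ : Metric.sphere (0 : E3) 1) :
    structureIntegrand b r z ζ
      = ∑ i, (ζ : E3) i * incrCube (fun k z => b z k) i z (r • (ζ : E3)) := by
  simp only [structureIntegrand, inner_eq_sum, norm_sq_eq_sum, increment, incrCube, Finset.sum_mul,
    PiLp.sub_apply, mul_assoc]

lemma integrable_sphere_coord (i : Fin 3) :
    Integrable (fun ζ : Metric.sphere (0 : E3) 1 => (ζ : E3) i) (volume : Measure E3).toSphere :=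
  Integrable.of_bound ((EuclideanSpace.proj (𝕜 := ℝ) i).continuous.comp
    continuous_subtype_val).aestronglyMeasurable 1 (Eventually.of_forall fun ζ => TorusDiv.abs_sphere_le ζ i)

lemma measurable_sphere_smul (r : ℝ) : Measurable fun ζ : Metric.sphere (0 : E3) 1 => r • (ζ : E3) :=
  measurable_subtype_coe.const_smul r

lemma integrable_pd_scaledMollifier {ε : ℝ} (hε : 0 < ε) (i : Fin 3) :
    Integrable (pd i (scaledMollifier ε)) :=
  (continuous_pd (contDiff_scaledMollifier ε) i).integrable_of_hasCompactSupport
    (hasCompactSupport_pd (hasCompactSupport_scaledMollifier hε) i)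

namespace TorusDiv

variable {H : Fin 3 → E3 → ℝ} {q : E3 → ℝ}

lemma sum_integral_sphere (h : TorusDiv H q) (r : ℝ) :
    ∑ i, ∫ ζ : Metric.sphere (0 : E3) 1, (ζ : E3) i * H i (r • (ζ : E3)) ∂(volume : Measure E3).toSphere
      = sphereFlux H r := by
  rw [← integral_finsetSum]
  · rfl
  · intro i _
    obtain ⟨C, -, hC⟩ := (h.per i).exists_bound (h.cont i)
    refine (integrable_sphere_coord i).mul_bdd (c := C) ?_ (Eventually.of_forall fun ζ => hC _)
    exact ((h.cont i).comp (continuous_subtype_val.const_smul r)).aestronglyMeasurable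

end TorusDiv

/-! ### The balance and the two limits -/

section

variable {T : ℝ} {A b f : ℝ × E3 → E3} {B : Fin 3 → Fin 3 → ℝ × E3 → ℝ} {P : ℝ × E3 → ℝ}

namespace Fields

lemma weakDivTensor (h : Fields T (fun k z => A z k) (fun k z => b z k) (fun k z => f z k) B P) :
    WeakDivTensor T b (tensorField b B) := by
  intro Ψ
  have hd := testSpace_differentiable Ψ.2
  have hΨ := mem_testSpace_component Ψ.2
  have i1 : Integrable (fun z => ∑ k, tensorDiv (fun k z => b z k) B k z * Ψ.1 z k) (tcube (Ioo 0 T)) :=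
    integrable_finsetSum _ fun k _ => (h.loc_G k).integrable_mul (hΨ k)
  have i2 : Integrable (fun z => ∑ i, ∑ k, b z i * b z k * dx i Ψ.1 z k) (tcube (Ioo 0 T)) :=
    integrable_finsetSum _ fun i _ => integrable_finsetSum _ fun k _ => by
      have := ((h.loc_bb i k).mono one_le_three_halves).integrable_mul (mem_testSpace_dx (hΨ k) i)
      simp only [dx_component hd] at this
      exact this
  simp only [inner_eq_sum, tensorGrad]
  rw [← sub_eq_zero, sub_neg_eq_add]
  refine (integral_add i1 i2).symm.trans (integral_slab_eq_zero_of_slice (i1.add i2) ?_)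
  filter_upwards [h.slice] with t ht
  have hθ : ∀ k, SP fun x => Ψ.1 (t, x) k := fun k => testSpace_slice_sp (hΨ k) t
  have hp : ∀ i k x, pd i (fun x => Ψ.1 (t, x) k) x = dx i Ψ.1 (t, x) k := fun i k x => by
    rw [pd_slice (testSpace_differentiable (hΨ k)) i t x, dx_component hd]
  have j1 : ∀ k, IntegrableOn (fun x => tensorDiv (fun k z => b z k) B k (t, x) * Ψ.1 (t, x) k) cube := fun k =>
    integrable_mul_sp (hθ k) (ht.integrable_tensorDiv k)
  have j2 : ∀ i k, IntegrableOn (fun x => b (t, x) i * b (t, x) k * dx i Ψ.1 (t, x) k) cube := fun i k => by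
    have := integrable_mul_sp ((hθ k).pd i) (ht.integrable_bb i k)
    simp only [hp] at this
    exact this
  have e := fun k => ht.div_tensor k (hθ k)
  simp only [hp] at e
  beta_reduce
  rw [integral_add (integrable_finsetSum _ fun k _ => j1 k) (integrable_finsetSum _ fun i _ =>
    integrable_finsetSum _ fun k _ => j2 i k), integral_finsetSum _ fun k _ => j1 k,
    integral_finsetSum _ fun i _ => integrable_finsetSum _ fun k _ => j2 i k]
  simp only [integral_finsetSum _ fun k (_ : k ∈ Finset.univ) => j2 _ k]
  rw [Finset.sum_comm (s := Finset.univ) (t := Finset.univ)]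
  simp only [e, tensorDiv, Finset.sum_neg_distrib]
  exact add_neg_cancel _

/-- The defect was defined as the left side of the balance, so besides local integrability this only
compares components. -/
lemma helicityBalance {u : ℝ × E3 → E3} {π : ℝ × E3 → ℝ}
    (h : Fields T (fun k z => A z k) (fun k z => b z k) (fun k z => cross (u z) (b z) k) B
      (fun z => π z - ‖b z‖ ^ 2 / 2)) :
    HelicityBalance T u b A (tensorField b B) π h.defect := by
  have l1 : MemLpLoc T 1 fun z => inner ℝ (A z) (b z) := by
    simp only [inner_eq_sum]
    exact MemLpLoc.sum _ fun k _ => h.loc_Ab k k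
  have l2 : MemLpLoc T 1 fun z => cross (tensorField b B z) (A z) := MemLpLoc.of_apply fun k => by
    simp only [cross_apply]
    exact (h.loc_GA _ _).sub (h.loc_GA _ _)
  have l3 : MemLpLoc T 1 fun z => cross (cross (u z) (b z)) (A z) := MemLpLoc.of_apply fun k => by
    simp only [cross_apply (cross _ _)]
    exact (h.loc_fA _ _).sub (h.loc_fA _ _)
  have l4 : MemLpLoc T 1 fun z => (π z - ‖b z‖ ^ 2 / 2) • b z := MemLpLoc.of_apply fun k => h.loc_Pb k
  have l5 : MemLpLoc T 1 fun z => ‖b z‖ ^ 2 • b z := MemLpLoc.of_apply fun k => by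
    simp only [PiLp.smul_apply, smul_eq_mul, norm_sq_eq_sum]
    simpa only [mul_comm, sqn] using h.loc_cube k
  refine ⟨l1, l2, l3, l4, l5, fun ψ => ?_⟩
  have hg : ∀ {v : ℝ × E3 → E3}, MemLpLoc T 1 v →
      Integrable (fun z => inner ℝ (v z) (grad ψ.1 z)) (tcube (Ioo 0 T)) := fun hv => by
    simp only [inner_grad]
    exact integrable_finsetSum _ fun k _ => (hv.apply k).integrable_mul (mem_testSpace_dx ψ.2 k)
  have H := (((((HasInt.mk' (l1.integrable_mul (mem_testSpace_dt ψ.2))).const_mul (-1)).add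
    ((HasInt.mk' (hg l2)).const_mul (-1))).add (HasInt.mk' (hg l3))).add
    ((HasInt.mk' (hg l4)).const_mul (-1))).add ((HasInt.mk' (hg l5)).const_mul (-1))
  have e : h.defect.toLinearMap ψ = _ := (integral_congr_ae (Eventually.of_forall fun z => ?_)).trans H.eq
  · rw [e]
    change _ = -1 * (∫ z in slab T, _) + -1 * (∫ z in slab T, _) + (∫ z in slab T, _)
      + -1 * (∫ z in slab T, _) + -1 * (∫ z in slab T, _)
    ring
  · simp only [inner_grad]
    simp only [inner_eq_sum, cross_apply, helicityFlux, sqn, norm_sq_eq_sum, Fin.sum_univ_three,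
      PiLp.smul_apply, smul_eq_mul, tensorField]
    simp only [Fin.reduceAdd, zero_add]
    ring

lemma torusDiv (h : Fields T (fun k z => A z k) (fun k z => b z k) (fun k z => f z k) B P)
    {ψ : ℝ × E3 → ℝ} (hψ : ψ ∈ testSpace T ℝ) {a a' c' c : ℝ} (ha : 0 < a) (haa : a < a') (hac : a' ≤ c')
    (hcc : c' < c) (hc : c < T) (h0 : ∀ t x, t ∉ Icc a' c' → ψ (t, x) = 0) :
    TorusDiv (lagFlux (Icc a c) ψ fun k z => b z k)
      (lagSource (Icc a c) (fun k z => A z k) (fun k z => b z k) (fun k z => f z k) B P ψ) :=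
  ⟨h.per_lagFlux, h.continuous_lagFlux hψ ha hc, h.per_lagSource, h.continuous_lagSource hψ ha hc,
    fun _ he => h.integral_pd_lagFlux hψ ha haa hac hcc hc h0 he⟩

/-- The increments of `b` tested against `ψ` form a field of lags whose divergence at zero is twice the
helicity defect. -/
lemma exists_torusDiv (h : Fields T (fun k z => A z k) (fun k z => b z k) (fun k z => f z k) B P)
    (hfb : ∀ z, ∑ k, f z k * b z k = 0) (hT : 0 < T) (ψ : testSpace T ℝ) :
    ∃ a c q, 0 < a ∧ c < T ∧ (∀ t x, t ∉ Icc a c → ψ.1 (t, x) = 0) ∧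
      TorusDiv (lagFlux (Icc a c) ψ.1 fun k z => b z k) q ∧ q 0 = 2 * h.defect.toLinearMap ψ := by
  obtain ⟨-, -, a, c, ha, hc, h0⟩ := id ψ.2
  -- The interval that comes with `ψ` may be empty. Including `T / 2` makes it nonempty, and a
  -- second enlargement below leaves the room at both ends that the product rule in time requires.
  have ha' : 0 < min a (T / 2) := lt_min ha (half_pos hT)
  have hc' : max c (T / 2) < T := max_lt hc (half_lt_self hT)
  have h1 : ∀ t x, t ∉ Icc (min a (T / 2)) (max c (T / 2)) → ψ.1 (t, x) = 0 := fun t x ht =>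
    h0 t x fun h => ht ⟨(min_le_left _ _).trans h.1, h.2.trans (le_max_left _ _)⟩
  have hl := half_lt_self ha'
  have hr : max c (T / 2) < (max c (T / 2) + T) / 2 := by linarith
  have h2 : ∀ t x, t ∉ Icc (min a (T / 2) / 2) ((max c (T / 2) + T) / 2) → ψ.1 (t, x) = 0 := fun t x ht =>
    h1 t x fun h => ht ⟨hl.le.trans h.1, h.2.trans hr.le⟩
  have hcT : (max c (T / 2) + T) / 2 < T := by linarith
  exact ⟨_, _, _, half_pos ha', hcT, h2, h.torusDiv ψ.2 (half_pos ha') hl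
    ((min_le_right _ _).trans (le_max_right _ _)) hr hcT h1, h.lagSource_zero hfb ψ.2 (half_pos ha') hcT h2⟩

/-- Tested against `ψ`, the dissipation term is `-½ ∫ ∇φ_ε · F = ½ ∫ φ_ε q`, which tends to `½
q(0)`. -/
theorem tendsto_dissipation (h : Fields T (fun k z => A z k) (fun k z => b z k) (fun k z => f z k) B P)
    (hfb : ∀ z, ∑ k, f z k * b z k = 0) (hT : 0 < T) :
    TendstoDistribution (dissipation b) h.defect := by
  refine ⟨fun ε hε => ?_, fun ψ => ?_⟩
  · have := memLpLoc_lagAverage h.per_b h.loc_b measurable_id (integrable_pd_scaledMollifier hε)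
    simp only [id, ← dissipationIntegrand_eq] at this
    exact this.const_mul _
  · obtain ⟨a, c, q, ha, hc, h0, hq, hq0⟩ := h.exists_torusDiv hfb hT ψ
    have h1 := (tendsto_integral_scaledMollifier hq.per_q hq.cont_q).const_mul (1 / 2)
    rw [hq0, one_div, inv_mul_cancel_left₀ two_ne_zero] at h1
    refine h1.congr' ?_
    filter_upwards [self_mem_nhdsWithin] with ε hε
    have e := integral_lagAverage_mul h.per_b h.loc_b measurable_id (integrable_pd_scaledMollifier hε)
      ψ.2 ha hc h0
    simp only [id, ← dissipationIntegrand_eq] at e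
    simp only [dissipation, mul_assoc, integral_const_mul]
    rw [e, ← hq.integral_pd_mul (contDiff_scaledMollifier ε) (hasCompactSupport_scaledMollifier hε)]
    ring

/-- Tested against `ψ`, the structure function is the normalised flux of `F` through the sphere of
radius `r` divided by `r`. Its limit is `q(0)/3`, two thirds of the defect. -/
theorem tendsto_structureFunction
    (h : Fields T (fun k z => A z k) (fun k z => b z k) (fun k z => f z k) B P)
    (hfb : ∀ z, ∑ k, f z k * b z k = 0) (hT : 0 < T) :
    TendstoDistribution (fun r z => -structureFunction b r z) (h.defect.constMul (-(2 / 3))) := by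
  refine ⟨fun r _ => ?_, fun ψ => ?_⟩
  · have := memLpLoc_lagAverage h.per_b h.loc_b (measurable_sphere_smul r) integrable_sphere_coord
    simp only [← structureIntegrand_eq] at this
    exact ((this.const_mul _).const_mul _).neg
  · obtain ⟨a, c, q, ha, hc, h0, hq, hq0⟩ := h.exists_torusDiv hfb hT ψ
    have h1 := hq.tendsto_sphereFlux.neg
    have e0 : -(q 0 / 3) = (h.defect.constMul (-(2 / 3))).toLinearMap ψ := by
      rw [hq0]
      change _ = -(2 / 3) * h.defect.toLinearMap ψ
      ring
    rw [e0] at h1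
    refine h1.congr fun r => ?_
    have e := integral_lagAverage_mul h.per_b h.loc_b (measurable_sphere_smul r) integrable_sphere_coord
      ψ.2 ha hc h0
    simp only [← structureIntegrand_eq, hq.sum_integral_sphere] at e
    simp only [structureFunction, neg_mul, mul_assoc, integral_neg, integral_const_mul]
    rw [e]

end Fields

end

lemma sum_cross_mul_eq_zero (u b : E3) : ∑ k, cross u b k * b k = 0 := by
  simp only [cross_apply, Fin.sum_univ_three]
  simp only [Fin.reduceAdd, zero_add]
  ring

end HallMHD

end

theorem theorem1p5 (T : ℝ) (hT : 0 < T)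
    (u b j A : ℝ × HallMHD.E3 → HallMHD.E3) (π : ℝ × HallMHD.E3 → ℝ)
    (hsol : HallMHD.IsWeakSolution T u b j)
    (hpot : HallMHD.IsVectorPotential T u b j A π)
    (hj : HallMHD.MemLpLq T ⊤ (3 / 2) j)
    (hu : HallMHD.MemLpLq T 3 3 u)
    (hA : ContinuousOn A (Ioo 0 T ×ˢ univ)) :
    -- the integrals defining the dissipation term and the structure function converge
    (∀ ε : ℝ, 0 < ε → ∀ᵐ z ∂(volume.restrict (HallMHD.slab T)),
      Integrable (HallMHD.dissipationIntegrand b ε z)) ∧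
    (∀ r : ℝ, 0 < r → ∀ᵐ z ∂(volume.restrict (HallMHD.slab T)),
      Integrable (HallMHD.structureIntegrand b r z)
        ((volume : Measure HallMHD.E3).toSphere)) ∧
    ∃ D : HallMHD.TorusDistribution T,
      -- `D_mh(b,ε) → D_mh(b) = D`
      HallMHD.TendstoDistribution (HallMHD.dissipation b) D ∧
      -- the local balance, with `G = div (b ⊗ b)`
      (∃ G : ℝ × HallMHD.E3 → HallMHD.E3, HallMHD.SpacePeriodic G ∧
        HallMHD.MemLpLoc T 1 G ∧ HallMHD.WeakDivTensor T b G ∧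
        HallMHD.HelicityBalance T u b A G π D) ∧
      -- the law for `S = S(b,b,b) = -lim S(b,b,b;r)`
      (∃ S : HallMHD.TorusDistribution T,
        HallMHD.TendstoDistribution (fun r z => -HallMHD.structureFunction b r z) S ∧
        ∀ ψ : HallMHD.testSpace T ℝ, S.toLinearMap ψ = -(2 / 3) * D.toLinearMap ψ) := by
  obtain ⟨B, h⟩ := HallMHD.exists_fields hsol hpot hj hu hA
  have hfb : ∀ z, ∑ k, HallMHD.cross (u z) (b z) k * b z k = 0 := fun z =>
    HallMHD.sum_cross_mul_eq_zero (u z) (b z)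
  -- The same distribution, the helicity defect, serves as the limit of the dissipation terms and as
  -- the right side of the balance. The structure function has as its limit a multiple of it, so the
  -- final relation holds by definition.
  refine ⟨fun ε hε => ?_, fun r _ => ?_, h.defect, h.tendsto_dissipation hfb hT,
    ⟨HallMHD.tensorField b B, fun t x i => ?_, HallMHD.MemLpLoc.of_apply h.loc_G, h.weakDivTensor,
      h.helicityBalance⟩, _, h.tendsto_structureFunction hfb hT, fun ψ => rfl⟩
  · have := HallMHD.ae_integrable_lagAverage h.per_b h.loc_b measurable_id
      (HallMHD.integrable_pd_scaledMollifier hε)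
    simp only [id, ← HallMHD.dissipationIntegrand_eq] at this
    exact this
  · have := HallMHD.ae_integrable_lagAverage h.per_b h.loc_b (HallMHD.measurable_sphere_smul r)
      HallMHD.integrable_sphere_coord
    simp only [← HallMHD.structureIntegrand_eq] at this
    exact this
  · simp only [HallMHD.tensorField, HallMHD.tensorDiv, hsol.periodic_b t x i, h.per_B _ _ t x i]
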